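/- **Setting.** Let $0\le T<\infty$, let $I=\{0,1,2,\dots\}$ be discrete, and let $\Omega=\mathcal D([0,T],I)$ be the space of right-continuous functions $[0,T]\to I$ with left limits that are left continuous at $T$, with coordinate process $x(t,\omega)=\omega(t)$, $\mathcal F=\sigma(x(s),s\le T)$ and $\mathcal F^0_t=\sigma(x(s),s\le t)$; put $x(0^-)=x(0)$ and $I_i(t)=\mathbf 1_{\{x(t)=i\}}$. Let $G=(g_{ij})$ be a $Q$-matrix: $g_{ij}>0$ for $i\ne j$, $\sum_{j\ne i}g_{ij}<\infty$, $g_{ii}=-\sum_{j\neq i}g_{ij}$. Let $P$ be a probability measure on $(\Omega,\mathcal F)$ under which $x$ is a Markov chain with intensity matrix $G$ and initial law $\xi$, i.e. $P\circ x(0)^{-1}=\xi$ and for every $\varphi:I\to\mathbb R$ with $\sum_j |g_{ij}\varphi(j)|<\infty$ for all $i$ the process $\varphi(x(t))-\varphi(x(0))-\int_0^t\sum_{j\neq x(s)}g_{x(s)j}(\varphi(j)-\varphi(x(s)))\,ds$ is an $(\mathcal F^0_t)$-local martingale. Let $\mathbb F=(\mathcal F_t)$ be the completion of $(\mathcal F^0_t)$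 by the $P$-null sets, and $E$ the expectation under $P$. For $i\ne j$ let $N_{ij}(t)$ be the number of jumps of $x$ from $i$ to $j$ in $(0,t]$ and $M_{ij}(t)=N_{ij}(t)-\int_{(0,t]}I_i(s^-)g_{ij}\,ds$; write $q\,dM=\sum_{i\ne j}q_{ij}\,dM_{ij}$ (a pathwise integral), and $$\langle a,b\rangle_g(t)=\sum_{i\ne j}a_{ij}b_{ij}g_{ij}I_i(t^-),\qquad \|a\|_g^2=\langle a,a\rangle_g .$$ Let $U\subset\mathbb R^d$ and let $\lambda_{ij}(t,x,\bar y,v)$ ($i\neq j$), $f(t,x,\bar y,v)$, $h(k,\bar y)$, $\kappa(k),\kappa_f(k),\kappa_h(k)$ be real functions ($t\in[0,T]$, $x\in\Omega$, $\bar y\in\mathbb R$, $v\in U$, $k\in I$). Put $\ell_{ij}=\lambda_{ij}/g_{ij}-1$ for $i\ne j$ and $\ell_{ii}=0$. Subscripts $\bar y$ denote partial derivatives. Let $\bar u$ be an $\mathbb F$-progressively measurable $U$-valued process such that, for each $\bar y\in\mathbb R$, the processes $\lambda_{ij}(t,x,\bar y,\bar u(t))$, $i\neq j$, are predictable and $f(t,x,\bar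 y,\bar u(t))$ is progressively measurable. Let $L=L^{\bar u}$ be the associated density process: an $\mathbb F$-adapted càdlàg process such that, $P$-a.s. for all $t\in[0,T]$, $$L(t)=1+\int_{(0,t]}L(s^-)\sum_{i\ne j}I_i(s^-)\bar\ell_{ij}(s)\,dM_{ij}(s),\qquad \bar\ell(t)=\ell\big(t,x,E[L(t)\kappa(x(t))],\bar u(t)\big),$$ where $\lambda_{ij}(t,x,E[L(t)\kappa(x(t))],\bar u(t))\ge0$ for $i\neq j$. Write also $\bar\ell_{\bar y}(t)=\ell_{\bar y}(t,x,E[L(t)\kappa(x(t))],\bar u(t))$, $\bar f(t)=f(t,x,E[L(t)\kappa_f(x(t))],\bar u(t))$, $\bar h(T)=h(x(T),E[L(T)\kappa_h(x(T))])$, and similarly $\bar f_{\bar y}(t)$, $\bar h_{\bar y}(T)$. **Proposition.** Assume: * (A1) $\ell$ is differentiable in $\bar y$, and $\|\ell\|_g$ and $\|\ell_{\bar y}\|_g$ are bounded, uniformly in $(t,x,\bar y,v)\in[0,T]\times\Omega\times\mathbb R\times U$. * (A2) $f,h,\kappa_f,\kappa_h$ are bounded, and $f,h$ are differentiable in $\bar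 y$ with bounded derivatives. * $\kappa$ is bounded. Then the linear mean-field BSDE $$dp(t)=-\Big\{\langle\bar\ell(t),q(t)\rangle_g-\bar f(t)+\kappa(x(t))\,E\big[L(t)\langle\bar\ell_{\bar y}(t),q(t)\rangle_g\big]-\kappa_f(x(t))\,E\big[L(t)\bar f_{\bar y}(t)\big]\Big\}dt+q(t)\,dM(t),$$ $$p(T)=-\bar h(T)-\kappa_h(x(T))\,E\big[L(T)\bar h_{\bar y}(T)\big],$$ has a solution $(p,q)$ (all integrals in the equation being convergent) with $p$ real-valued, $\mathbb F$-adapted and càdlàg, and $q=(q_{ij})_{i,j\in I}$ predictable, such that $$E\Big[\sup_{t\in[0,T]}|p(t)|+\int_{(0,T]}\|q(s)\|_g^2\,ds\Big]<\infty .$$ The solution is unique in this class: if $(p,q)$ and $(p',q')$ are two such solutions, then $p$ and $p'$ are indistinguishable, and for all $i\ne j$, $q_{ij}=q'_{ij}$ almost everywhere with respect to $dP\times g_{ij}I_i(s^-)\,ds$. -/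

import Mathlib

open MeasureTheory ProbabilityTheory Filter Topology
open scoped ENNReal

noncomputable section

namespace MFChain

/-- The time interval `[0,T]`. -/
abbrev Time (T : ℝ) : Type := Set.Icc (0 : ℝ) T

/-- Lebesgue measure on `[0,T]`. -/
instance (T : ℝ) : MeasureSpace (Time T) := Measure.Subtype.measureSpace

/-- Control values live in `ℝ^d` with the Euclidean norm. -/
abbrev Ctrl (d : ℕ) : Type := EuclideanSpace ℝ (Fin d)

/-- The path space `D([0,T], I)` with `I = {0,1,2,…}` discrete: functions which are right continuous
with left limits, and left continuous at the final time `T`. -/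
@[ext] structure ChainPath (T : ℝ) where
  /-- the value `x(t)` of the path at time `t` -/
  val : Time T → ℕ
  right_cts : ∀ t, ContinuousWithinAt val (Set.Ici t) t
  left_lim : ∀ t, ∃ k : ℕ, Tendsto val (𝓝[<] t) (𝓝 k)
  left_cts_end : ∀ t : Time T, (t : ℝ) = T → ContinuousWithinAt val (Set.Iic t) t

variable {T : ℝ}

/-- The left limit `x(t⁻)`, with the convention `x(0⁻) = x(0)`. -/
def ChainPath.left (ω : ChainPath T) (t : Time T) : ℕ := Function.leftLim ω.val t

/-- The σ-field `𝓕 = σ(x(s), 0 ≤ s ≤ T)`. -/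
instance : MeasurableSpace (ChainPath T) :=
  ⨆ t : Time T, MeasurableSpace.comap (fun ω : ChainPath T => ω.val t) ⊤

/-- The natural filtration `𝓕⁰_t = σ(x(s), s ≤ t)` of the coordinate process. -/
def rawFiltration (T : ℝ) : Filtration (Time T) (inferInstance : MeasurableSpace (ChainPath T)) where
  seq t := ⨆ s : Time T, ⨆ _ : s ≤ t, MeasurableSpace.comap (fun ω : ChainPath T => ω.val s) ⊤
  mono' _ _ hst := iSup_mono fun _ => iSup_mono' fun h => ⟨h.trans hst, le_rfl⟩
  le' _ := iSup_mono fun _ => iSup_le fun _ => le_rfl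

/-- The `P`-completion of the σ-field `m`: all sets which agree with a set of `m` up to a
subset of a `P`-null set. -/
abbrev completedSigma (P : Measure (ChainPath T)) (m : MeasurableSpace (ChainPath T)) :
    MeasurableSpace (ChainPath T) :=
  eventuallyMeasurableSpace m (ae P)

/-- The filtration `𝔽 = (𝓕_t)`: the completion of `(𝓕⁰_t)` with the `P`-null sets of `Ω`. -/
def completedFiltration (P : Measure (ChainPath T)) :
    Filtration (Time T) (completedSigma P inferInstance) where
  seq t := completedSigma P (rawFiltration T t)
  mono' _ _ hst _ := fun ⟨A, hA, h⟩ => ⟨A, (rawFiltration T).mono hst _ hA, h⟩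
  le' t _ := fun ⟨A, hA, h⟩ => ⟨A, (rawFiltration T).le t _ hA, h⟩

/-- A process all of whose paths are right continuous with left limits. -/
def IsCadlag (p : Time T → ChainPath T → ℝ) : Prop :=
  ∀ ω t, ContinuousWithinAt (fun s => p s ω) (Set.Ici t) t ∧
    ∃ c : ℝ, Tendsto (fun s => p s ω) (𝓝[<] t) (𝓝 c)

/-! ### The reference Markov chain -/

/-- A conservative `Q`-matrix on `I` all of whose off-diagonal entries are positive. -/
structure IsQMatrix (g : ℕ → ℕ → ℝ) : Prop where
  pos : ∀ i j, i ≠ j → 0 < g i j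
  summable : ∀ i, Summable fun j => if j = i then 0 else g i j
  diag : ∀ i, g i i = -∑' j, if j = i then 0 else g i j

/-- `G f (i) = ∑_{j ≠ i} g_{ij} (f(j) - f(i))`. -/
def generator (g : ℕ → ℕ → ℝ) (f : ℕ → ℝ) (i : ℕ) : ℝ :=
  ∑' j, if j = i then 0 else g i j * (f j - f i)

/-- `M^f_t = f(x(t)) - f(x(0)) - ∫_{(0,t]} (G f)(x(s)) ds`. -/
def dynkin [Fact (0 ≤ T)] (g : ℕ → ℕ → ℝ) (f : ℕ → ℝ) (t : Time T) (ω : ChainPath T) : ℝ :=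
  f (ω.val t) - f (ω.val ⊥) - ∫ s in Set.Ioc ⊥ t, generator g f (ω.val s)

/-- Under `P` the coordinate process is a Markov chain with intensity matrix `g` and initial law `ξ`,
expressed by the martingale problem for `g`: for every `f` on `I` for which `G f` is
defined by absolutely convergent series, `M^f` is a local martingale for the natural filtration. -/
structure IsMarkovChain [Fact (0 ≤ T)] (g : ℕ → ℕ → ℝ) (ξ : Measure ℕ) (P : Measure (ChainPath T)) :
    Prop where
  initial : P.map (fun ω : ChainPath T => ω.val ⊥) = ξ
  martingale : ∀ f : ℕ → ℝ, (∀ i, Summable fun j => g i j * f j) →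
    Locally (fun X => Martingale X (rawFiltration T) P) (rawFiltration T) (dynkin g f) P

/-! ### The accompanying martingale and integrals against it -/

/-- The jump times of a path. -/
def jumpTimes (ω : ChainPath T) : Set (Time T) := {s | ω.left s ≠ ω.val s}

/-- A path has only finitely many jumps. -/
theorem finite_jumpTimes (ω : ChainPath T) : (jumpTimes ω).Finite := by
  have key : ∀ t : Time T, ∃ V ∈ 𝓝 t, (jumpTimes ω ∩ V).Finite := by
    intro t
    obtain ⟨k, hk⟩ := ω.left_lim t
    have h1 : ∀ᶠ s in 𝓝[<] t, ω.val s = k := by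
      simpa [nhds_discrete] using hk
    have h2 : ∀ᶠ s in 𝓝[≥] t, ω.val s = ω.val t := by
      simpa [ContinuousWithinAt, nhds_discrete] using ω.right_cts t
    have h1' := eventually_eventually_nhdsWithin.2 h1
    have e1 : ∀ᶠ s in 𝓝[<] t, s ∉ jumpTimes ω := by
      filter_upwards [h1', h1, self_mem_nhdsWithin] with s hs hs1 hst
      have hs' : ∀ᶠ r in 𝓝 s, ω.val r = k := by
        rwa [isOpen_Iio.nhdsWithin_eq hst] at hs
      have hc : ContinuousAt ω.val s := by
        rw [ContinuousAt, nhds_discrete ℕ, tendsto_pure, hs1]; exact hs'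
      simp [jumpTimes, ChainPath.left, hc.continuousWithinAt.leftLim_eq]
    have e2 : ∀ᶠ s in 𝓝[>] t, s ∉ jumpTimes ω := by
      have h3 := h2.filter_mono (nhdsWithin_mono t Set.Ioi_subset_Ici_self)
      filter_upwards [eventually_eventually_nhdsWithin.2 h3, h3, self_mem_nhdsWithin]
        with s hs hs1 hst
      have hs' : ∀ᶠ r in 𝓝 s, ω.val r = ω.val t := by
        rwa [isOpen_Ioi.nhdsWithin_eq hst] at hs
      have hc : ContinuousAt ω.val s := by
        rw [ContinuousAt, nhds_discrete ℕ, tendsto_pure, hs1]; exact hs'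
      simp [jumpTimes, ChainPath.left, hc.continuousWithinAt.leftLim_eq]
    have e3 : ∀ᶠ s in 𝓝[≠] t, s ∉ jumpTimes ω := by
      rw [← Set.Iio_union_Ioi, nhdsWithin_union, eventually_sup]; exact ⟨e1, e2⟩
    refine ⟨{s | s ≠ t → s ∉ jumpTimes ω}, eventually_nhdsWithin_iff.1 e3, ?_⟩
    refine (Set.finite_singleton t).subset fun s hs => ?_
    by_contra hne
    exact hs.2 hne hs.1
  choose V hV hfin using key
  obtain ⟨F, -, hF⟩ := isCompact_univ.elim_nhds_subcover V fun t _ => hV t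
  refine (F.finite_toSet.biUnion fun t _ => hfin t).subset fun s hs => ?_
  obtain ⟨t, ht, hst⟩ := Set.mem_iUnion₂.1 (hF (Set.mem_univ s))
  exact Set.mem_iUnion₂.2 ⟨t, ht, hs, hst⟩

/-- `N_{ij}(t)`, the number of jumps from `i` to `j` during `(0,t]`
(there is no jump at time `0`, as `x(0⁻) = x(0)`). -/
def jumpCount (i j : ℕ) (t : Time T) (ω : ChainPath T) : ℕ :=
  {s : Time T | s ≤ t ∧ s ∈ jumpTimes ω ∧ ω.left s = i ∧ ω.val s = j}.ncard

/-- `M_{ij}(t) = N_{ij}(t) - ∫_{(0,t]} I_i(s⁻) g_{ij} ds`. -/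
def accMart [Fact (0 ≤ T)] (g : ℕ → ℕ → ℝ) (i j : ℕ) (t : Time T) (ω : ChainPath T) : ℝ :=
  jumpCount i j t ω - ∫ s in Set.Ioc ⊥ t, if ω.left s = i then g i j else 0

/-- `‖a‖_g² (t) = ∑_{i ≠ j} |a_{ij}|² g_{ij} 1_{x(t⁻) = i}`, as a function of the state `i = x(t⁻)`. -/
def gNormSq (g a : ℕ → ℕ → ℝ) (i : ℕ) : ℝ≥0∞ :=
  ∑' j, if j = i then 0 else ENNReal.ofReal (a i j ^ 2 * g i j)

/-- `⟨a, b⟩_g (t) = ∑_{i ≠ j} a_{ij} b_{ij} g_{ij} 1_{x(t⁻) = i}`, as a function of `i = x(t⁻)`. -/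
def gInner (g a b : ℕ → ℕ → ℝ) (i : ℕ) : ℝ :=
  ∑' j, if j = i then 0 else a i j * b i j * g i j

/-- The integral `∫_{(0,t]} q dM = ∑_{i ≠ j} ∫_{(0,t]} q_{ij}(s) dM_{ij}(s)` against the accompanying
martingale. As `M_{ij}` has paths of finite variation it is a pathwise Stieltjes integral:
`∑_{i ≠ j} ∫ q_{ij} dN_{ij}` is the finite sum of `q_{x(s⁻) x(s)}(s)` over the jump times
`s ∈ (0,t]`, and `I_i(s⁻) g_{ij} ds` is the compensator of `N_{ij}`. -/
def stochInt [Fact (0 ≤ T)] (g : ℕ → ℕ → ℝ) (q : ℕ → ℕ → Time T → ChainPath T → ℝ)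
    (t : Time T) (ω : ChainPath T) : ℝ :=
  (∑ᶠ (s : Time T) (_ : s ≤ t ∧ s ∈ jumpTimes ω), q (ω.left s) (ω.val s) s ω) -
    ∫ s in Set.Ioc ⊥ t, ∑' j, if j = ω.left s then 0 else q (ω.left s) j s ω * g (ω.left s) j

/-- The integral of the unit matrix `e_{ij}` is `M_{ij}`. -/
theorem stochInt_unit [Fact (0 ≤ T)] (g : ℕ → ℕ → ℝ) {i j : ℕ} (hij : i ≠ j) (t : Time T)
    (ω : ChainPath T) :
    stochInt g (fun k l _ _ => if k = i ∧ l = j then 1 else 0) t ω = accMart g i j t ω := by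
  unfold stochInt accMart
  congr 1
  · have hfin : {s : Time T | s ≤ t ∧ s ∈ jumpTimes ω ∧ ω.left s = i ∧ ω.val s = j}.Finite :=
      (finite_jumpTimes ω).subset fun s hs => hs.2.1
    rw [jumpCount, Set.ncard_eq_toFinset_card _ hfin, Finset.card_eq_sum_ones, Nat.cast_sum,
      ← finsum_mem_eq_finite_toFinset_sum (fun _ => ((1 : ℕ) : ℝ)) hfin]
    refine finsum_congr fun s => ?_
    have e : (s ∈ {s : Time T | s ≤ t ∧ s ∈ jumpTimes ω ∧ ω.left s = i ∧ ω.val s = j}) ↔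
        (s ≤ t ∧ s ∈ jumpTimes ω) ∧ ω.left s = i ∧ ω.val s = j := by
      simp [and_assoc]
    rw [finsum_congr_Prop (propext e) fun _ => rfl]
    by_cases h1 : s ≤ t ∧ s ∈ jumpTimes ω <;> by_cases h2 : ω.left s = i ∧ ω.val s = j <;>
      simp [h1, h2]
  · congr 1
    funext s
    rw [tsum_eq_single j]
    · by_cases h : ω.left s = i
      · simp [h, hij.symm]
      · simp [h]
    · intro l hl
      simp [hl]

/-- The measure `dP × g_{ij} I_i(s⁻) ds` on `[0,T] × Ω`. -/
def jumpMeasure (g : ℕ → ℕ → ℝ) (P : Measure (ChainPath T)) (i j : ℕ) :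
    Measure (Time T × ChainPath T) :=
  ((volume : Measure (Time T)).prod P).withDensity
    fun z => if z.2.left z.1 = i then ENNReal.ofReal (g i j) else 0

/-! ### The control problem -/

/-- The data of the control problem. -/
structure ControlModel (T : ℝ) (d : ℕ) where
  /-- intensity matrix of the reference chain -/
  g : ℕ → ℕ → ℝ
  /-- the set of control values -/
  U : Set (Ctrl d)
  /-- the controlled intensities `λ_{ij}(t, x, ȳ, v)`, functions of the path `x` -/
  lam : ℕ → ℕ → Time T → ChainPath T → ℝ → Ctrl d → ℝ
  /-- the function whose mean enters the intensities -/
  κ : ℕ → ℝ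
  /-- the running cost `f(t, x, ȳ, v)` -/
  f : Time T → ChainPath T → ℝ → Ctrl d → ℝ
  /-- the function whose mean enters the running cost -/
  κf : ℕ → ℝ
  /-- the terminal cost `h(x(T), ȳ)` -/
  h : ℕ → ℝ → ℝ
  /-- the function whose mean enters the terminal cost -/
  κh : ℕ → ℝ

variable {d : ℕ}

namespace ControlModel

/-- `ℓ_{ij}(t, x, ȳ, v) = λ_{ij}(t, x, ȳ, v) / g_{ij} - 1` if `i ≠ j`, and `0` if `i = j`. -/
def ell (D : ControlModel T d) (i j : ℕ) (t : Time T) (ω : ChainPath T) (y : ℝ) (v : Ctrl d) : ℝ :=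
  if i = j then 0 else D.lam i j t ω y v / D.g i j - 1

/-- `∂ℓ_{ij}/∂ȳ`. -/
def ellY (D : ControlModel T d) (i j : ℕ) (t : Time T) (ω : ChainPath T) (y : ℝ) (v : Ctrl d) : ℝ :=
  deriv (fun z => D.ell i j t ω z v) y

/-- `∂f/∂ȳ`. -/
def fY (D : ControlModel T d) (t : Time T) (ω : ChainPath T) (y : ℝ) (v : Ctrl d) : ℝ :=
  deriv (fun z => D.f t ω z v) y

/-- `∂h/∂ȳ`. -/
def hY (D : ControlModel T d) (k : ℕ) (y : ℝ) : ℝ := deriv (fun z => D.h k z) y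

/-- Assumption (A1): `ℓ` is differentiable in `ȳ`, and `‖ℓ‖_g` and `‖ℓ_ȳ‖_g` are bounded. -/
structure A1 (D : ControlModel T d) : Prop where
  diff : ∀ i j t ω, ∀ v ∈ D.U, Differentiable ℝ fun y => D.ell i j t ω y v
  bdd_ell : ∃ C : ℝ, ∀ t (ω : ChainPath T) y, ∀ v ∈ D.U,
    gNormSq D.g (fun i j => D.ell i j t ω y v) (ω.left t) ≤ ENNReal.ofReal C
  bdd_ellY : ∃ C : ℝ, ∀ t (ω : ChainPath T) y, ∀ v ∈ D.U,
    gNormSq D.g (fun i j => D.ellY i j t ω y v) (ω.left t) ≤ ENNReal.ofReal C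

/-- Assumption (A2): `f, h, κ_f, κ_h` are bounded, and `f, h` are differentiable in `ȳ` with bounded
derivatives. -/
structure A2 (D : ControlModel T d) : Prop where
  bdd_f : ∃ C : ℝ, ∀ t ω y, ∀ v ∈ D.U, |D.f t ω y v| ≤ C
  bdd_h : ∃ C : ℝ, ∀ k y, |D.h k y| ≤ C
  bdd_κf : ∃ C : ℝ, ∀ k, |D.κf k| ≤ C
  bdd_κh : ∃ C : ℝ, ∀ k, |D.κh k| ≤ C
  diff_f : ∀ t ω, ∀ v ∈ D.U, Differentiable ℝ fun y => D.f t ω y v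
  bdd_fY : ∃ C : ℝ, ∀ t ω y, ∀ v ∈ D.U, |D.fY t ω y v| ≤ C
  diff_h : ∀ k, Differentiable ℝ fun y => D.h k y
  bdd_hY : ∃ C : ℝ, ∀ k y, |D.hY k y| ≤ C

/-- `E[L(t) k(x(t))]`, the mean of `k(x(t))` under the measure with density process `L`. -/
def mean (P : Measure (ChainPath T)) (L : Time T → ChainPath T → ℝ) (k : ℕ → ℝ) (t : Time T) : ℝ :=
  ∫ ω, L t ω * k (ω.val t) ∂P

variable (D : ControlModel T d) (P : Measure (ChainPath T))
  (u : Time T → ChainPath T → Ctrl d) (L : Time T → ChainPath T → ℝ)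

/-- `ℓ̄_{ij}(t) = ℓ_{ij}(t, x, E[L(t) κ(x(t))], u(t))`. -/
def ellBar (i j : ℕ) (t : Time T) (ω : ChainPath T) : ℝ :=
  D.ell i j t ω (mean P L D.κ t) (u t ω)

/-- `ℓ̄_{ȳ,ij}(t) = (∂ℓ_{ij}/∂ȳ)(t, x, E[L(t) κ(x(t))], u(t))`. -/
def ellYBar (i j : ℕ) (t : Time T) (ω : ChainPath T) : ℝ :=
  D.ellY i j t ω (mean P L D.κ t) (u t ω)

/-- `f̄(t) = f(t, x, E[L(t) κ_f(x(t))], u(t))`. -/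
def fBar (t : Time T) (ω : ChainPath T) : ℝ := D.f t ω (mean P L D.κf t) (u t ω)

/-- `f̄_ȳ(t) = (∂f/∂ȳ)(t, x, E[L(t) κ_f(x(t))], u(t))`. -/
def fYBar (t : Time T) (ω : ChainPath T) : ℝ := D.fY t ω (mean P L D.κf t) (u t ω)

variable [Fact (0 ≤ T)]

/-- `(L, u)` is an admissible pair: `u` is a progressively measurable process with values in `U`
along which the coefficients are non-anticipating, `λ^u` are predictable nonnegative intensities,
and `L` is the associated density process, the adapted càdlàg solution of
`L(t) = 1 + ∫_{(0,t]} L(s⁻) ∑_{i ≠ j} I_i(s⁻) ℓ^u_{ij}(s) dM_{ij}(s)`. -/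
structure IsAdmissiblePair : Prop where
  u_prog : IsStronglyProgressive (completedFiltration P) u
  u_mem : ∀ t ω, u t ω ∈ D.U
  lam_pred : ∀ i j, i ≠ j → ∀ y : ℝ,
    IsStronglyPredictable (completedFiltration P) fun t ω => D.lam i j t ω y (u t ω)
  lam_nonneg : ∀ i j, i ≠ j → ∀ t ω, 0 ≤ D.lam i j t ω (mean P L D.κ t) (u t ω)
  f_prog : ∀ y : ℝ, IsStronglyProgressive (completedFiltration P) fun t ω => D.f t ω y (u t ω)
  L_adapted : StronglyAdapted (completedFiltration P) L
  L_cadlag : IsCadlag L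
  L_eq : ∀ᵐ ω ∂P, ∀ t, L t ω = 1 + stochInt D.g
    (fun i j s ω => Function.leftLim (fun r => L r ω) s * D.ellBar P u L i j s ω) t ω

/-- The driver of the adjoint equation,
`⟨ℓ̄(t), q(t)⟩_g - f̄(t) + κ(x(t)) E[L(t) ⟨ℓ̄_ȳ(t), q(t)⟩_g] - κ_f(x(t)) E[L(t) f̄_ȳ(t)]`. -/
def driver (q : ℕ → ℕ → Time T → ChainPath T → ℝ) (t : Time T) (ω : ChainPath T) : ℝ :=
  gInner D.g (fun i j => D.ellBar P u L i j t ω) (fun i j => q i j t ω) (ω.left t)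
    - D.fBar P u L t ω
    + D.κ (ω.val t) * ∫ η, L t η *
        gInner D.g (fun i j => D.ellYBar P u L i j t η) (fun i j => q i j t η) (η.left t) ∂P
    - D.κf (ω.val t) * ∫ η, L t η * D.fYBar P u L t η ∂P

/-- The final time `T`. -/
def finalTime (T : ℝ) [Fact (0 ≤ T)] : Time T := ⟨T, Fact.out, le_rfl⟩

/-- The terminal value `-h̄(T) - κ_h(x(T)) E[L(T) h̄_ȳ(T)]`, where
`h̄(T) = h(x(T), E[L(T) κ_h(x(T))])`. -/
def terminal (ω : ChainPath T) : ℝ :=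
  -D.h (ω.val (finalTime T)) (mean P L D.κh (finalTime T))
    - D.κh (ω.val (finalTime T)) *
      ∫ η, L (finalTime T) η *
        D.hY (η.val (finalTime T)) (mean P L D.κh (finalTime T)) ∂P

/-- `(p, q)` solves the first-order adjoint equation
`dp(t) = -driver(t) dt + q(t) dM(t)`, `p(T) = terminal`, with `p` adapted and càdlàg, `q`
predictable and `E[sup |p| + ∫ ‖q‖_g² ds] < ∞`. All integrals in the equation converge. -/
structure IsAdjointSolution (p : Time T → ChainPath T → ℝ)
    (q : ℕ → ℕ → Time T → ChainPath T → ℝ) : Prop where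
  p_adapted : StronglyAdapted (completedFiltration P) p
  p_cadlag : IsCadlag p
  q_pred : ∀ i j, IsStronglyPredictable (completedFiltration P) (q i j)
  estimate : ∫⁻ ω, ((⨆ t, ‖p t ω‖ₑ) +
    ∫⁻ s, gNormSq D.g (fun i j => q i j s ω) (ω.left s)) ∂P < ∞
  mean_integrable : ∀ᵐ t : Time T, Integrable (fun η => L t η *
    gInner D.g (fun i j => D.ellYBar P u L i j t η) (fun i j => q i j t η) (η.left t)) P
  driver_integrable : ∀ᵐ ω ∂P, Integrable fun t => D.driver P u L q t ω
  comp_integrable : ∀ᵐ ω ∂P,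
    ∫⁻ s : Time T, ∑' j, (if j = ω.left s then 0 else ‖q (ω.left s) j s ω * D.g (ω.left s) j‖ₑ) < ∞
  equation : ∀ᵐ ω ∂P, ∀ t, p t ω = D.terminal P L ω
    + (∫ s in Set.Ioc t (finalTime T), D.driver P u L q s ω)
    - (stochInt D.g q (finalTime T) ω - stochInt D.g q t ω)

end ControlModel

end MFChain

end

set_option linter.unusedSectionVars false

/-! ### Paths: jumps, telescoping sums, boundedness -/

noncomputable section
namespace MFChain
variable {T : ℝ}

/-! At time `0` the equation reads `∫ q dM = Ξ + ∫ drv(q) ds - Y`. Here `Ξ` is the terminal value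
plus the time integral of the part of the driver free of `q`, `drv` is the linear mean-field part,
and `Y = p(0)` is `𝓕_0`-measurable. If `q` solves this for some `Y`, then `p(t) = Y - ∫_0^t driver
ds + ∫_0^t q dM` solves the backward equation. So everything reduces to a linear fixed point problem
for `q` in `L²`.

Stochastic integration is built from the jump measure `jm` of a path and its compensator `cm`.
Riemann sums of `1 - 1_{x=j}` against the increments of `1_{x=j}` count the jumps into `j`. The
martingale problem for indicators then gives the compensator formula on the sets `(i,T] × A`
(`setLIntegral_jm_Ioi`), and a monotone class argument extends it to nonnegative predictable
integrands (`lintegral_lintegral_jm`). A pathwise integration by parts (`sT_sq`) yields the isometry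
for truncated integrands, and a limit yields it for square integrable ones (`eLpNorm_sT`). The
integral is thus an isometry `J` from an `L²` space of predictable marked processes into `L²(P)`. A
weak type maximal inequality, summed dyadically, gives `E sup |∫ q dM| < ∞`.

Martingale representation (`ae_eq_zero_of_orthogonal`): let `Z` in `L²` be orthogonal to `𝓕_0` and
to all stochastic integrals. Restrict to paths that have not yet jumped above a level `n`. Testing
`Z` against the increments of the indicators of the states `j ≤ n` shows that the numbers `E[Z 1_A
1_{x(t-)=j}]` satisfy a finite system of linear integral inequalities with initial value zero, so
they vanish by Gronwall. Letting `n` grow and adding one time after another, `Z` has mean zero on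
all cylinder events, hence `Z = 0`. Therefore `ζ = E[ζ | 𝓕_0] + J J* ζ` for each `ζ` in `L²`
(`exists_representation`).

Write `Λ q = ∫ drv(q) ds`. The equation for `q` becomes `q = J*(Ξ + Λ q)`. The operator `Λ` is
bounded because `‖ℓ‖_g`, `‖ℓ_ȳ‖_g`, `κ` are bounded and `L` is bounded in `L²`; the latter follows
from its own equation by truncation and Gronwall (`lintegral_density_sq_le`). The increment `∫_t^T r
dM`, with `r = J* Λ q`, is the sum of `∫_t^T drv(q) ds` and an `𝓕_t`-measurable variable to which it
is orthogonal, so its norm is at most that of `∫_t^T drv(q) ds`. Integrated against an exponential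
weight, this makes `J* Λ` a contraction of a weighted norm (`exists_wsq_le`). A Neumann series gives
`q`, and the same contraction applied to a difference of solutions gives uniqueness.

The filtration is completed, so the argument runs on the path space with its completed σ-field and
an abstract `ChainSetup`, and is transported back at the end. In the driver `x(t)` is replaced by
`x(t⁻)`, which changes it at finitely many times of each path only. -/

theorem ChainPath.eventually_left (x : ChainPath T) (t : Time T) :
    ∀ᶠ s in 𝓝[<] t, x.val s = x.left t := by
  obtain ⟨k, hk⟩ := x.left_lim t
  rcases eq_or_neBot (𝓝[<] t) with h | h
  · simp [h]
  · have : x.left t = k := leftLim_eq_of_tendsto hk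
    rw [this]
    simpa [nhds_discrete] using hk

theorem ChainPath.eventually_right (x : ChainPath T) (t : Time T) :
    ∀ᶠ s in 𝓝[≥] t, x.val s = x.val t := by
  simpa [ContinuousWithinAt, nhds_discrete] using x.right_cts t

theorem ChainPath.left_bot [Fact (0 ≤ T)] (x : ChainPath T) : x.left ⊥ = x.val ⊥ :=
  leftLim_eq_of_isBot isBot_bot

/-- The jump times of a path, as a finite set. -/
def jumps (x : ChainPath T) : Finset (Time T) := (finite_jumpTimes x).toFinset

theorem mem_jumps {x : ChainPath T} {s : Time T} : s ∈ jumps x ↔ x.left s ≠ x.val s := by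
  simp [jumps, jumpTimes]

theorem bot_notMem_jumps [Fact (0 ≤ T)] (x : ChainPath T) : ⊥ ∉ jumps x := by
  simp [mem_jumps, x.left_bot]

instance : PreconnectedSpace (Time T) := Subtype.preconnectedSpace isPreconnected_Icc

/-- The difference of the two sides is a locally constant function of `t`, and the time interval is
connected. At time `0` the sum is empty, as there is no jump at `0`. -/
theorem ChainPath.telescope_bot [Fact (0 ≤ T)] (x : ChainPath T) (f : ℕ → ℝ) (t : Time T) :
    f (x.val t) - f (x.val ⊥) = ∑ s ∈ jumps x with s ≤ t, (f (x.val s) - f (x.left s)) := by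
  set V : Time T → ℝ := fun t => f (x.val t) -
    ∑ s ∈ jumps x with s ≤ t, (f (x.val s) - f (x.left s)) with hV
  have hloc : IsLocallyConstant V := by
    rw [IsLocallyConstant.iff_eventually_eq]
    intro t
    have hfin : ∀ᶠ s in 𝓝[≠] t, s ∉ jumps x := by
      have h := ((jumps x).finite_toSet.subset
        (Set.sdiff_subset (t := {t}))).isClosed.isOpen_compl.mem_nhds (x := t) (by simp)
      filter_upwards [nhdsWithin_le_nhds h, self_mem_nhdsWithin] with s hs hst
      simp at hs hst
      tauto
    have hgap : ∀ᶠ s in 𝓝 t, ∀ r ∈ jumps x, r ≠ t → (r ≤ s ↔ r ≤ t) := by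
      rw [Filter.eventually_all_finset]
      intro r hr
      rcases lt_trichotomy r t with h | h | h
      · filter_upwards [lt_mem_nhds h] with s hs _
        simp [hs.le, h.le]
      · simp [h]
      · filter_upwards [gt_mem_nhds h] with s hs _
        simp [hs.not_ge, h.not_ge]
    have hl := x.eventually_left t
    have hr := x.eventually_right t
    rw [eventually_nhdsWithin_iff] at hl hr
    filter_upwards [hgap, hl, hr] with s hs hl hr
    have key : ∀ r ∈ jumps x, r ≠ t → (r ≤ s ↔ r ≤ t) := hs
    -- Just before `t` the path sits at `x.left t` and the sum lacks exactly the term of `t`; the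
    -- two changes cancel. Just after `t` neither the path nor the sum has moved. If `t` is not a
    -- jump time its term is zero.
    rcases lt_or_ge s t with hst | hst
    · have e1 : (∑ r ∈ jumps x with r ≤ s, (f (x.val r) - f (x.left r))) =
          ∑ r ∈ jumps x with r < t, (f (x.val r) - f (x.left r)) := by
        refine Finset.sum_congr (Finset.filter_congr fun r hr => ?_) fun _ _ => rfl
        by_cases h : r = t
        · subst h; simp [hst]
        · rw [key r hr h, lt_iff_le_and_ne]; simp [h]
      have e2 : (∑ r ∈ jumps x with r ≤ t, (f (x.val r) - f (x.left r))) =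
          (∑ r ∈ jumps x with r < t, (f (x.val r) - f (x.left r)))
          + (f (x.val t) - f (x.left t)) := by
        simp only [Finset.sum_filter]
        have : ∀ r ∈ jumps x, (if r ≤ t then f (x.val r) - f (x.left r) else 0) =
          (if r < t then f (x.val r) - f (x.left r) else 0) +
            (if r = t then f (x.val r) - f (x.left r) else 0) := by
          intro r _
          rcases lt_trichotomy r t with h | h | h
          · simp [h, h.le, h.ne]
          · simp [h]
          · simp [h.not_ge, h.not_gt, h.ne']
        rw [Finset.sum_congr rfl this, Finset.sum_add_distrib, Finset.sum_ite_eq']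
        split_ifs with h
        · rfl
        · rw [mem_jumps, not_not] at h; simp [h]
      simp only [hV, e1, e2, hl hst]
      ring
    · have e1 : (∑ r ∈ jumps x with r ≤ s, (f (x.val r) - f (x.left r))) =
          ∑ r ∈ jumps x with r ≤ t, (f (x.val r) - f (x.left r)) := by
        refine Finset.sum_congr (Finset.filter_congr fun r hr => ?_) fun _ _ => rfl
        by_cases h : r = t
        · subst h; simp [hst]
        · rw [key r hr h]
      simp only [hV, e1, hr hst]
  have h := hloc.apply_eq_of_isPreconnected isPreconnected_univ (Set.mem_univ t) (Set.mem_univ ⊥)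
  have h0 : (∑ s ∈ jumps x with s ≤ (⊥ : Time T), (f (x.val s) - f (x.left s))) = 0 := by
    refine Finset.sum_eq_zero fun s hs => ?_
    rw [Finset.mem_filter, le_bot_iff] at hs
    exact absurd (hs.2 ▸ hs.1) (bot_notMem_jumps x)
  simp only [hV, h0] at h
  linarith

theorem ChainPath.telescope [Fact (0 ≤ T)] (x : ChainPath T) (f : ℕ → ℝ) {s t : Time T}
    (hst : s ≤ t) :
    f (x.val t) - f (x.val s) = ∑ r ∈ jumps x with s < r ∧ r ≤ t, (f (x.val r) - f (x.left r)) := by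
  have h1 := x.telescope_bot f t
  have h2 := x.telescope_bot f s
  have : (∑ r ∈ jumps x with r ≤ t, (f (x.val r) - f (x.left r))) =
      (∑ r ∈ jumps x with r ≤ s, (f (x.val r) - f (x.left r))) +
      ∑ r ∈ jumps x with s < r ∧ r ≤ t, (f (x.val r) - f (x.left r)) := by
    simp only [Finset.sum_filter]
    rw [← Finset.sum_add_distrib]
    refine Finset.sum_congr rfl fun r _ => ?_
    rcases le_or_gt r s with h | h
    · simp [h, h.trans hst, h.not_gt]
    · simp [h, h.not_ge]
  linarith

/-! ### Lebesgue measure on `[0,T]` -/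

theorem Time.volume_apply {s : Set (Time T)} (_hs : MeasurableSet s) :
    (volume : Measure (Time T)) s = volume (Subtype.val '' s : Set ℝ) := 
  comap_subtype_coe_apply measurableSet_Icc volume s

instance : NullSingletonClass (volume : Measure (Time T)) :=
  ⟨fun t => by rw [Time.volume_apply (measurableSet_singleton t)]; simp⟩

instance : IsFiniteMeasure (volume : Measure (Time T)) :=
  ⟨by
    rw [Time.volume_apply MeasurableSet.univ, Set.image_univ, Subtype.range_coe]
    exact measure_Icc_lt_top⟩

theorem ChainPath.ae_left_eq (x : ChainPath T) : ∀ᵐ s : Time T, x.left s = x.val s :=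
  measure_mono_null (fun _ hs => mem_jumps.2 hs) ((jumps x).finite_toSet.measure_zero _)

/-- A path visits only finitely many states. -/
theorem ChainPath.bddAbove_range (x : ChainPath T) : ∃ N, ∀ t, x.val t ≤ N := by
  have h : ∀ t : Time T, ∃ V ∈ 𝓝 t, ∃ N, ∀ s ∈ V, x.val s ≤ N := by
    intro t
    have hl := x.eventually_left t
    have hr := x.eventually_right t
    rw [eventually_nhdsWithin_iff] at hl hr
    refine ⟨_, hl.and hr, max (x.left t) (x.val t), fun s hs => ?_⟩
    rcases lt_or_ge s t with hst | hst
    · simp [hs.1 hst]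
    · simp [hs.2 hst]
  choose V hV N hN using h
  obtain ⟨F, -, hF⟩ := isCompact_univ.elim_nhds_subcover V fun t _ => hV t
  refine ⟨F.sup N, fun t => ?_⟩
  obtain ⟨r, hr, htr⟩ := Set.mem_iUnion₂.1 (hF (Set.mem_univ t))
  exact (hN r t htr).trans (Finset.le_sup hr)

theorem ChainPath.left_le {x : ChainPath T} [Fact (0 ≤ T)] {N : ℕ} {t : Time T}
    (h : ∀ s < t, x.val s ≤ N) (h0 : x.val ⊥ ≤ N) : x.left t ≤ N := by
  rcases eq_or_neBot (𝓝[<] t) with hb | hb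
  · have : t = ⊥ := by
      by_contra hne
      have := bot_lt_iff_ne_bot.2 hne
      exact (nhdsLT_neBot_of_exists_lt ⟨_, this⟩).ne hb
    rw [this, x.left_bot]; exact h0
  · obtain ⟨s, hs, hst⟩ := ((x.eventually_left t).and self_mem_nhdsWithin).exists
    rw [← hs]; exact h s hst

end MFChain
end

noncomputable section
namespace MFChain
variable {T : ℝ}

/-! ### Dyadic grids -/

section Grid

variable [hT : Fact (0 ≤ T)]

/-- The grid point `k / 2ⁿ`, capped at `T`. -/
def gridPt (n k : ℕ) : Time T :=
  ⟨min (k / 2 ^ n) T, le_min (by positivity) hT.out, min_le_right _ _⟩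

/-- The index of the last dyadic point of order `n` strictly before `s`. -/
def gridIdx (n : ℕ) (s : Time T) : ℕ := ⌈2 ^ n * (s : ℝ)⌉₊ - 1

/-- The last dyadic point of order `n` strictly before `s` (and `0` if `s = 0`). -/
def gridL (n : ℕ) (s : Time T) : Time T := gridPt n (gridIdx n s)

/-- The first dyadic point of order `n` strictly after `s`, capped at `T`. -/
def gridR (n : ℕ) (s : Time T) : Time T := gridPt n (⌊2 ^ n * (s : ℝ)⌋₊ + 1)

theorem gridPt_zero (n : ℕ) : (gridPt n 0 : Time T) = ⊥ :=
  Subtype.ext (by simp [gridPt, hT.out])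

theorem gridPt_mono (n : ℕ) : Monotone (gridPt n : ℕ → Time T) := fun a b h =>
  Subtype.mk_le_mk.2 (min_le_min_right _ (by gcongr))

theorem exists_gridPt_eq_top (n : ℕ) : ∃ K, (gridPt n K : Time T) = ⊤ := by
  refine ⟨⌈2 ^ n * T⌉₊, Subtype.ext ?_⟩
  change min _ _ = T
  rw [min_eq_right]
  rw [le_div_iff₀ (by positivity), mul_comm]
  exact Nat.le_ceil _

theorem gridIdx_eq {n k : ℕ} {s : Time T} (h1 : gridPt n k < s) (h2 : s ≤ gridPt n (k + 1)) :
    gridIdx n s = k := by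
  have h1' : min ((k : ℝ) / 2 ^ n) T < (s : ℝ) := h1
  have h2' : (s : ℝ) ≤ min (((k + 1 : ℕ) : ℝ) / 2 ^ n) T := h2
  have h3 : (k / 2 ^ n : ℝ) < s := by
    rcases min_lt_iff.1 h1' with h | h
    · exact h
    · exact absurd h s.2.2.not_gt
  have h4 := h2'.trans (min_le_left _ _)
  rw [div_lt_iff₀ (by positivity), mul_comm] at h3
  rw [le_div_iff₀ (by positivity), mul_comm] at h4
  have : ⌈2 ^ n * (s : ℝ)⌉₊ = k + 1 := by
    rw [Nat.ceil_eq_iff (by lia)]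
    exact ⟨by simpa using h3, h4⟩
  simp [gridIdx, this]

theorem gridL_eq {n k : ℕ} {s : Time T} (h1 : gridPt n k < s) (h2 : s ≤ gridPt n (k + 1)) :
    gridL n s = gridPt n k := by
  rw [gridL, gridIdx_eq h1 h2]

theorem gridIdx_add_one {n : ℕ} {s : Time T} (hs : ⊥ < s) :
    gridIdx n s + 1 = ⌈2 ^ n * (s : ℝ)⌉₊ := by
  have hs' : (0 : ℝ) < s := hs
  have : 0 < ⌈2 ^ n * (s : ℝ)⌉₊ := Nat.ceil_pos.2 (by positivity)
  rw [gridIdx]; lia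

theorem gridL_coe {n : ℕ} {s : Time T} (hs : ⊥ < s) :
    (gridIdx n s / 2 ^ n : ℝ) < s ∧ (s : ℝ) ≤ (gridIdx n s + 1) / 2 ^ n := by
  have hs' : (0 : ℝ) < s := hs
  have h := gridIdx_add_one (n := n) hs
  have h1 := (Nat.ceil_eq_iff (n := gridIdx n s + 1) (by lia)).1 h.symm
  rw [div_lt_iff₀ (by positivity), le_div_iff₀ (by positivity), mul_comm (s : ℝ)]
  exact ⟨by simpa using h1.1, by simpa using h1.2⟩

theorem gridL_lt {n : ℕ} {s : Time T} (hs : ⊥ < s) : gridL n s < s :=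
  show min _ _ < (s : ℝ) from (min_le_left _ _).trans_lt (gridL_coe hs).1

theorem le_gridPt_succ {n : ℕ} {s : Time T} (hs : ⊥ < s) : s ≤ gridPt n (gridIdx n s + 1) :=
  show (s : ℝ) ≤ min _ _ from le_min (by simpa using (gridL_coe hs).2) s.2.2

theorem gridL_bot (n : ℕ) : gridL n (⊥ : Time T) = ⊥ := by
  simp [gridL, gridIdx, gridPt_zero]

theorem tendsto_gridL {s : Time T} (hs : ⊥ < s) :
    Tendsto (fun n => gridL n s) atTop (𝓝[<] s) := by
  refine tendsto_nhdsWithin_iff.2 ⟨?_, Eventually.of_forall fun n => gridL_lt hs⟩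
  rw [tendsto_subtype_rng]
  have h0 : Tendsto (fun n : ℕ => (s : ℝ) - (1 / 2) ^ n) atTop (𝓝 s) := by
    simpa using (tendsto_pow_atTop_nhds_zero_of_lt_one (r := (1 / 2 : ℝ)) (by norm_num)
      (by norm_num)).const_sub (s : ℝ)
  refine tendsto_of_tendsto_of_tendsto_of_le_of_le h0 tendsto_const_nhds (fun n => ?_)
    fun n => (gridL_lt (n := n) hs).le
  change _ ≤ min _ _
  refine le_min ?_ ?_
  · have := (gridL_coe (n := n) hs).2
    rw [add_div] at this
    simp only [one_div, inv_pow] at this ⊢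
    linarith
  · have := s.2.2
    have : (0 : ℝ) ≤ (1 / 2) ^ n := by positivity
    linarith

theorem tendsto_gridR (s : Time T) : Tendsto (fun n => gridR n s) atTop (𝓝[≥] s) := by
  have hle : ∀ n, s ≤ gridR n s := fun n => by
    change (s : ℝ) ≤ min _ _
    refine le_min ?_ s.2.2
    rw [le_div_iff₀ (by positivity), mul_comm]
    simpa using (Nat.lt_floor_add_one (2 ^ n * (s : ℝ))).le
  refine tendsto_nhdsWithin_iff.2 ⟨?_, Eventually.of_forall hle⟩
  rw [tendsto_subtype_rng]
  have h0 : Tendsto (fun n : ℕ => (s : ℝ) + (1 / 2) ^ n) atTop (𝓝 s) := by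
    simpa using (tendsto_pow_atTop_nhds_zero_of_lt_one (r := (1 / 2 : ℝ)) (by norm_num)
      (by norm_num)).const_add (s : ℝ)
  refine tendsto_of_tendsto_of_tendsto_of_le_of_le tendsto_const_nhds h0 hle fun n => ?_
  refine (min_le_left _ _).trans ?_
  have := Nat.floor_le (mul_nonneg (pow_nonneg zero_le_two n) s.2.1)
  rw [div_le_iff₀ (by positivity), add_mul, ← mul_pow]
  push_cast
  norm_num
  linarith

/-- Riemann sums along the dyadic grid are integrals of step functions. -/
theorem riemann_sum {μ : Measure (Time T)} {h : Time T → ℝ} {i : Time T}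
    (hh : IntegrableOn h (Set.Ioi i) μ) (c : Time T → ℝ) (n K : ℕ) :
    IntegrableOn (fun r => c (gridL n r) * h r) (Set.Ioc i (max (gridPt n K) i)) μ ∧
    ∑ k ∈ Finset.range K, c (gridPt n k) *
      ∫ r in Set.Ioc (max (gridPt n k) i) (max (gridPt n (k + 1)) i), h r ∂μ =
    ∫ r in Set.Ioc i (max (gridPt n K) i), c (gridL n r) * h r ∂μ := by
  -- Raising the grid points to `i` makes the intervals that end before `i` empty, so the sum only
  -- sees times after `i` while `c` is still sampled at the original grid points.
  induction K with
  | zero => simp [gridPt_zero]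
  | succ K ih =>
    have hle : max (gridPt n K) i ≤ max (gridPt n (K + 1)) i :=
      max_le_max_right _ (gridPt_mono n (Nat.le_succ K))
    have hsub : Set.Ioc (max (gridPt n K) i) (max (gridPt n (K + 1)) i) ⊆ Set.Ioi i :=
      fun r hr => (le_max_right _ _).trans_lt hr.1
    have heq : Set.EqOn (fun r => c (gridL n r) * h r) (fun r => c (gridPt n K) * h r)
        (Set.Ioc (max (gridPt n K) i) (max (gridPt n (K + 1)) i)) := fun r hr => by
      have h1 := max_lt_iff.1 hr.1
      have h2 := (le_max_iff.1 hr.2).resolve_right h1.2.not_ge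
      simp only [gridL_eq h1.1 h2]
    have hint : IntegrableOn (fun r => c (gridL n r) * h r)
        (Set.Ioc (max (gridPt n K) i) (max (gridPt n (K + 1)) i)) μ :=
      IntegrableOn.congr_fun ((hh.mono_set hsub).const_mul _) heq.symm measurableSet_Ioc
    rw [← Set.Ioc_union_Ioc_eq_Ioc (le_max_right _ _) hle]
    refine ⟨ih.1.union hint, ?_⟩
    rw [Finset.sum_range_succ, ih.2, setIntegral_union _ measurableSet_Ioc ih.1 hint,
      setIntegral_congr_fun measurableSet_Ioc heq, integral_const_mul]
    exact Set.disjoint_left.2 fun r h1 h2 => h2.1.not_ge h1.2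

end Grid

/-! ### Jump measure and compensator of a path -/

/-- The rate `g_{ij}`, `j ≠ i`, of a jump from `i` to `j`. -/
def rt (g : ℕ → ℕ → ℝ) (i j : ℕ) : ℝ≥0∞ := if j = i then 0 else ENNReal.ofReal (g i j)

/-- The counting measure of the jumps of `x`, on pairs of a jump time and the state reached. -/
def jm (x : ChainPath T) : Measure (Time T × ℕ) :=
  ∑ s ∈ jumps x, Measure.dirac (s, x.val s)

/-- The counting measure of the jump times. -/
def jt (x : ChainPath T) : Measure (Time T) := ∑ s ∈ jumps x, Measure.dirac s

/-- The compensator of the jump measure. -/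
def cm (g : ℕ → ℕ → ℝ) (x : ChainPath T) : Measure (Time T × ℕ) :=
  (volume.prod Measure.count).withDensity fun z => rt g (x.left z.1) z.2

/-- The jump rates from state `i`, as a measure. -/
def rate (g : ℕ → ℕ → ℝ) (i : ℕ) : Measure ℕ := Measure.count.withDensity (rt g i)

theorem lintegral_jm (x : ChainPath T) (f : Time T × ℕ → ℝ≥0∞) :
    ∫⁻ z, f z ∂jm x = ∑ s ∈ jumps x, f (s, x.val s) := by
  simp [jm]

theorem integrable_jm (x : ChainPath T) (f : Time T × ℕ → ℝ) : Integrable f (jm x) := by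
  rw [jm, integrable_finsetSum_measure]
  exact fun s _ => integrable_dirac (by simp)

theorem integral_jm (x : ChainPath T) (f : Time T × ℕ → ℝ) :
    ∫ z, f z ∂jm x = ∑ s ∈ jumps x, f (s, x.val s) := by
  rw [jm, integral_finsetSum_measure fun s _ => integrable_dirac (by simp)]
  simp

theorem integrable_jt (x : ChainPath T) (f : Time T → ℝ) : Integrable f (jt x) := by
  rw [jt, integrable_finsetSum_measure]
  exact fun s _ => integrable_dirac (by simp)

theorem setIntegral_jt (x : ChainPath T) (f : Time T → ℝ) {A : Set (Time T)}
    [DecidablePred (· ∈ A)] (hA : MeasurableSet A) :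
    ∫ z in A, f z ∂jt x = ∑ s ∈ jumps x with s ∈ A, f s := by
  rw [← integral_indicator hA, jt,
    integral_finsetSum_measure fun s _ => integrable_dirac (by simp)]
  simp [Set.indicator_apply, Finset.sum_filter]

theorem setLIntegral_jm (x : ChainPath T) (f : Time T × ℕ → ℝ≥0∞) {A : Set (Time T)}
    [DecidablePred (· ∈ A)] (hA : MeasurableSet A) :
    ∫⁻ z in A ×ˢ Set.univ, f z ∂jm x = ∑ s ∈ jumps x with s ∈ A, f (s, x.val s) := by
  rw [← lintegral_indicator (hA.prod MeasurableSet.univ), lintegral_jm, Finset.sum_filter]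
  simp [Set.indicator_apply]

theorem setIntegral_jm (x : ChainPath T) (f : Time T × ℕ → ℝ) {A : Set (Time T)}
    [DecidablePred (· ∈ A)] (hA : MeasurableSet A) :
    ∫ z in A ×ˢ Set.univ, f z ∂jm x = ∑ s ∈ jumps x with s ∈ A, f (s, x.val s) := by
  rw [← integral_indicator (hA.prod MeasurableSet.univ), integral_jm, Finset.sum_filter]
  simp [Set.indicator_apply]

instance (x : ChainPath T) : IsFiniteMeasure (jm x) :=
  ⟨by rw [← lintegral_one, lintegral_jm]; simp⟩

theorem lintegral_rate (g : ℕ → ℕ → ℝ) (i : ℕ) (f : ℕ → ℝ≥0∞) :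
    ∫⁻ j, f j ∂rate g i = ∑' j, rt g i j * f j := by
  rw [rate, lintegral_withDensity_eq_lintegral_mul _ .of_discrete .of_discrete, lintegral_count]
  rfl

theorem integral_rate {g : ℕ → ℕ → ℝ} (hg : IsQMatrix g) (i : ℕ) (f : ℕ → ℝ) :
    ∫ j, f j ∂rate g i = ∑' j, if j = i then 0 else f j * g i j := by
  have e : (rt g i) = fun j => ((if j = i then 0 else Real.toNNReal (g i j) : NNReal) : ℝ≥0∞) := by
    ext j; unfold rt; split_ifs <;> rfl
  have e2 : ∀ j, (if j = i then 0 else Real.toNNReal (g i j) : NNReal) • f j =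
      if j = i then 0 else f j * g i j := by
    intro j
    split_ifs with h
    · simp
    · rw [NNReal.smul_def, Real.coe_toNNReal _ (hg.pos i j (Ne.symm h)).le, smul_eq_mul, mul_comm]
  rw [rate, e, integral_withDensity_eq_integral_smul .of_discrete]
  simp only [e2]
  -- For a real series summability is absolute summability, so when it fails both sides take the
  -- default value `0`.
  by_cases hs : Summable fun j => if j = i then 0 else f j * g i j
  · rw [integral_countable (integrable_count_iff.2 hs.norm)]
    simp [Measure.real]
  · rw [tsum_eq_zero_of_not_summable hs, integral_undef]
    rw [integrable_count_iff]
    exact fun h => hs h.of_norm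

section

variable [Fact (0 ≤ T)]

omit [Fact (0 ≤ T)] in
theorem measurable_gridIdx (n : ℕ) : Measurable (gridIdx n : Time T → ℕ) :=
  (Measurable.of_discrete (f := fun k : ℕ => k - 1)).comp
    (Nat.measurable_ceil.comp (measurable_subtype_coe.const_mul _))

theorem ChainPath.tendsto_val_gridL (x : ChainPath T) (s : Time T) :
    ∀ᶠ n in atTop, x.val (gridL n s) = x.left s := by
  rcases eq_bot_or_bot_lt s with rfl | hs
  · simp [gridL_bot, x.left_bot]
  · exact (tendsto_gridL hs).eventually (x.eventually_left s)

theorem ChainPath.measurable_left (x : ChainPath T) : Measurable x.left := by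
  refine measurable_of_tendsto_metrizable (f := fun n s => x.val (gridL n s))
    (fun n => Measurable.comp (g := fun k => x.val (gridPt n k)) .of_discrete
      (measurable_gridIdx n)) (tendsto_pi_nhds.2 fun s => ?_)
  exact tendsto_const_nhds.congr' ((x.tendsto_val_gridL s).mono fun _ h => h.symm)

theorem measurable_rt_left (g : ℕ → ℕ → ℝ) (x : ChainPath T) :
    Measurable fun z : Time T × ℕ => rt g (x.left z.1) z.2 :=
  (Measurable.of_discrete (f := fun p : ℕ × ℕ => rt g p.1 p.2)).comp
    ((x.measurable_left.comp measurable_fst).prodMk measurable_snd)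

theorem rate_univ_lt_top {g : ℕ → ℕ → ℝ} (hg : IsQMatrix g) (i : ℕ) : rate g i Set.univ < ∞ := by
  rw [← lintegral_one, lintegral_rate]
  have e : ∀ j, rt g i j * 1 = ENNReal.ofReal (if j = i then 0 else g i j) := by
    intro j; unfold rt; split_ifs <;> simp
  simp only [e]
  rw [← ENNReal.ofReal_tsum_of_nonneg _ (hg.summable i)]
  · exact ENNReal.ofReal_lt_top
  · intro j
    split_ifs with h
    · exact le_rfl
    · exact (hg.pos i j (Ne.symm h)).le

theorem lintegral_cm (g : ℕ → ℕ → ℝ) (x : ChainPath T)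
    {f : Time T × ℕ → ℝ≥0∞} (hf : Measurable f) :
    ∫⁻ z, f z ∂cm g x = ∫⁻ s, ∫⁻ j, f (s, j) ∂rate g (x.left s) := by
  have hr := measurable_rt_left g x
  rw [cm, lintegral_withDensity_eq_lintegral_mul _ hr hf, lintegral_prod _ (hr.mul hf).aemeasurable]
  simp only [Pi.mul_apply, lintegral_count, lintegral_rate]

theorem setLIntegral_cm (g : ℕ → ℕ → ℝ) (x : ChainPath T)
    {f : Time T × ℕ → ℝ≥0∞} (hf : Measurable f) {A : Set (Time T)} (hA : MeasurableSet A) :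
    ∫⁻ z in A ×ˢ Set.univ, f z ∂cm g x = ∫⁻ s in A, ∫⁻ j, f (s, j) ∂rate g (x.left s) := by
  rw [← lintegral_indicator (hA.prod MeasurableSet.univ), lintegral_cm _ _
    (hf.indicator (hA.prod MeasurableSet.univ)), ← lintegral_indicator hA]
  refine lintegral_congr fun s => ?_
  by_cases h : s ∈ A <;> simp [Set.indicator, h]

theorem rate_le {g : ℕ → ℕ → ℝ} (hg : IsQMatrix g) (N : ℕ) :
    ∃ C : NNReal, ∀ i ≤ N, rate g i Set.univ ≤ C := by
  refine ⟨∑ i ∈ Finset.range (N + 1), (rate g i Set.univ).toNNReal, fun i hi => ?_⟩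
  rw [← ENNReal.coe_toNNReal (rate_univ_lt_top hg i).ne, ENNReal.coe_le_coe]
  exact Finset.single_le_sum (f := fun i => (rate g i Set.univ).toNNReal)
    (fun _ _ => zero_le) (Finset.mem_range.2 (by lia))

/-- A path visits finitely many states, so the total rates are bounded along it. The bound depends
on the path; the rates need not be bounded over all states. -/
theorem isFiniteMeasure_cm {g : ℕ → ℕ → ℝ} (hg : IsQMatrix g) (x : ChainPath T) :
    IsFiniteMeasure (cm g x) := by
  obtain ⟨N, hN⟩ := x.bddAbove_range
  obtain ⟨C, hC⟩ := rate_le hg N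
  constructor
  rw [← lintegral_one, lintegral_cm g x measurable_const]
  simp only [lintegral_one]
  calc _ ≤ ∫⁻ _ : Time T, (C : ℝ≥0∞) :=
        lintegral_mono fun s => hC _ (ChainPath.left_le (fun r _ => hN r) (hN _))
    _ < ∞ := by rw [lintegral_const]; exact ENNReal.mul_lt_top (by simp) (measure_lt_top _ _)

/-- The compensator has no mass on `{t} × ℕ`. -/
theorem cm_singleton_prod (g : ℕ → ℕ → ℝ) (x : ChainPath T) (t : Time T) :
    cm g x ({t} ×ˢ Set.univ) = 0 := by
  rw [← setLIntegral_one, setLIntegral_cm g x measurable_const (measurableSet_singleton t)]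
  simp

/-- Integration against the compensator, for an integrable function. -/
theorem integral_cm {g : ℕ → ℕ → ℝ} (x : ChainPath T) {φ : Time T × ℕ → ℝ}
    (hφ : Integrable φ (cm g x)) :
    Integrable (fun s => ∫ j, φ (s, j) ∂rate g (x.left s)) ∧
    (∀ᵐ s, Integrable (fun j => φ (s, j)) (rate g (x.left s))) ∧
    ∀ A, MeasurableSet A →
      ∫ z in A ×ˢ Set.univ, φ z ∂cm g x = ∫ s in A, ∫ j, φ (s, j) ∂rate g (x.left s) := by
  -- The rates are finite, and with values in `NNReal` a density acts on Bochner integrals by scalar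
  -- multiplication. This reduces the claim to Fubini for `ds` times counting measure.
  set w : Time T × ℕ → NNReal := fun z => (rt g (x.left z.1) z.2).toNNReal with hw
  have hne : ∀ i j, rt g i j ≠ ∞ := fun i j => by unfold rt; split_ifs <;> simp
  have hwm : Measurable w := (measurable_rt_left g x).ennreal_toNNReal
  have hcm : cm g x = (volume.prod Measure.count).withDensity fun z => (w z : ℝ≥0∞) := by
    rw [cm]; congr 1; ext z; exact (ENNReal.coe_toNNReal (hne _ _)).symm
  have hrate : ∀ s, rate g (x.left s) =
      Measure.count.withDensity fun j => (w (s, j) : ℝ≥0∞) := fun s => by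
    rw [rate]; congr 1; ext j; exact (ENNReal.coe_toNNReal (hne _ _)).symm
  have hi : Integrable (fun z => w z • φ z) (volume.prod Measure.count) := by
    rw [hcm, integrable_withDensity_iff_integrable_smul hwm] at hφ
    exact hφ
  have hin : ∀ s, ∫ j, φ (s, j) ∂rate g (x.left s) = ∫ j, w (s, j) • φ (s, j) ∂Measure.count :=
    fun s => by rw [hrate, integral_withDensity_eq_integral_smul .of_discrete]
  refine ⟨?_, ?_, fun A hA => ?_⟩
  · simp only [hin]; exact hi.integral_prod_left
  · filter_upwards [hi.prod_right_ae] with s hs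
    rw [hrate, integrable_withDensity_iff_integrable_smul .of_discrete]
    exact hs
  · simp only [hin]
    rw [hcm, setIntegral_withDensity_eq_setIntegral_smul hwm _ (hA.prod MeasurableSet.univ),
      setIntegral_prod _ hi.integrableOn]
    simp

end

end MFChain
end

noncomputable section
namespace MFChain
variable {T : ℝ} [Fact (0 ≤ T)] {Ω : Type*} [mΩ : MeasurableSpace Ω]

/-! ### Chains on a filtered probability space -/

/-- The indicator function of the state `j`. -/
def ind (j i : ℕ) : ℝ := if i = j then 1 else 0

/-- `X` is a Markov chain with intensities `g` under `Pm`, adapted to a filtration `𝔽` which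
contains the null sets, and every event is determined by `X` up to a null set. -/
structure ChainSetup (g : ℕ → ℕ → ℝ) (Pm : Measure Ω) (𝔽 : Filtration (Time T) mΩ)
    (X : Ω → ChainPath T) : Prop where
  qmat : IsQMatrix g
  adapted : ∀ t, Measurable[𝔽 t] fun ω => (X ω).val t
  null : ∀ A, Pm A = 0 → MeasurableSet[𝔽 ⊥] A
  occ : ∀ j, ∫⁻ ω, (∫⁻ s, ‖g ((X ω).left s) j‖ₑ) ∂Pm ≠ ∞
  -- The martingale problem for the single function `ind j`: its generator at `i` equals `g i j`,
  -- for `i = j` as well, where the rate is negative. The field `occ` makes the right side a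
  -- convergent integral.
  mart : ∀ j s t, s ≤ t → ∀ A, MeasurableSet[𝔽 s] A →
    ∫ ω in A, (ind j ((X ω).val t) - ind j ((X ω).val s)) ∂Pm =
      ∫ ω in A, (∫ r in Set.Ioc s t, g ((X ω).left r) j) ∂Pm
  gen : ∀ A, MeasurableSet A →
    ∃ B, MeasurableSet[MeasurableSpace.comap X inferInstance] B ∧ A =ᵐ[Pm] B

/-! ### The predictable σ-algebra -/

section Predictable

variable {𝔽 : Filtration (Time T) mΩ}

theorem predictable_le : 𝔽.predictable ≤ Prod.instMeasurableSpace :=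
  measurableSpace_le_predictable_of_measurableSet
    (fun A hA => (measurableSet_singleton _).prod (𝔽.le _ A hA))
    fun _ A hA => measurableSet_Ioi.prod (𝔽.le _ A hA)

theorem measurable_fst_predictable :
    Measurable[𝔽.predictable] (Prod.fst : Time T × Ω → Time T) := by
  have : (Subtype.instMeasurableSpace : MeasurableSpace (Time T)) = .generateFrom (Set.range Set.Ioi) := by
    rw [← borel_eq_generateFrom_Ioi]; exact BorelSpace.measurable_eq
  rw [this]
  refine @measurable_generateFrom _ _ 𝔽.predictable _ _ ?_
  rintro _ ⟨i, rfl⟩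
  have := measurableSet_predictable_Ioi_prod (𝓕 := 𝔽) (i := i) (@MeasurableSet.univ _ (𝔽 i))
  rwa [Set.prod_univ] at this

/-- Stopping the time variable at `t` keeps only the information of `𝔽 t`. Composition with this map
shows that predictable processes are progressive. -/
theorem measurable_min_predictable (t : Time T) :
    Measurable[(inferInstance : MeasurableSpace (Time T)).prod (𝔽 t), 𝔽.predictable]
      fun z : Time T × Ω => (min z.1 t, z.2) := by
  refine @measurable_generateFrom _ _ (_) _ _ ?_
  have hfst : Measurable[(inferInstance : MeasurableSpace (Time T)).prod (𝔽 t)]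
    (fun z : Time T × Ω => min z.1 t) := (measurable_id.min measurable_const).comp
      (@measurable_fst _ _ _ (𝔽 t))
  rintro _ (⟨A, hA, rfl⟩ | ⟨i, A, hA, rfl⟩)
  · have h1 := @measurable_snd (Time T) Ω Subtype.instMeasurableSpace (𝔽 t) _ (𝔽.mono bot_le _ hA)
    exact @MeasurableSet.inter _ (_) _ _ (hfst (measurableSet_singleton ⊥)) h1
  · by_cases h : i < t
    · have h1 := @measurable_snd (Time T) Ω Subtype.instMeasurableSpace (𝔽 t) _ (𝔽.mono h.le _ hA)
      exact @MeasurableSet.inter _ (_) _ _ (hfst measurableSet_Ioi) h1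
    · have : (fun z : Time T × Ω => (min z.1 t, z.2)) ⁻¹' (Set.Ioi i ×ˢ A) = ∅ := by
        ext z; simp [h]
      rw [this]
      exact @MeasurableSet.empty _ (_)

/-- The sampled process is constant on each interval between consecutive grid points, open on the
left, with a value known at the left end. As `gridL n s` tends to `s` strictly from the left, limits
of such processes show that left limits are predictable. -/
theorem measurable_gridL_predictable {E : Type*} [MeasurableSpace E] {Z : Time T → Ω → E}
    (hZ : ∀ t, Measurable[𝔽 t] (Z t)) (n : ℕ) :
    Measurable[𝔽.predictable] fun z : Time T × Ω => Z (gridL n z.1) z.2 := by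
  intro B hB
  have : (fun z : Time T × Ω => Z (gridL n z.1) z.2) ⁻¹' B =
      ({⊥} ×ˢ (Z ⊥ ⁻¹' B)) ∪ ⋃ k, Set.Ioc (gridPt n k) (gridPt n (k + 1)) ×ˢ
        (Z (gridPt n k) ⁻¹' B) := by
    ext ⟨s, ω⟩
    simp only [Set.mem_preimage, Set.mem_union, Set.mem_prod, Set.mem_singleton_iff,
      Set.mem_iUnion, Set.mem_Ioc]
    constructor
    · intro h
      rcases eq_bot_or_bot_lt s with rfl | hs
      · left; rw [gridL_bot] at h; exact ⟨rfl, h⟩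
      · right; exact ⟨gridIdx n s, ⟨gridL_lt hs, le_gridPt_succ hs⟩, h⟩
    · rintro (⟨rfl, h⟩ | ⟨k, ⟨h1, h2⟩, h⟩)
      · rwa [gridL_bot]
      · rwa [gridL_eq h1 h2]
  rw [this]
  refine @MeasurableSet.union _ 𝔽.predictable _ _
    (measurableSet_predictable_singleton_bot_prod (hZ ⊥ hB))
    (@MeasurableSet.iUnion _ _ 𝔽.predictable _ _ fun k =>
      measurableSet_predictable_Ioc_prod _ _ (hZ _ hB))

/-- An adapted process, taken after the time `t` at which it is known, is predictable. -/
theorem measurable_Ioi_predictable {E : Type*} [MeasurableSpace E] [Zero E] {t : Time T} {Y : Ω → E}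
    (hY : Measurable[𝔽 t] Y) :
    Measurable[𝔽.predictable] fun z : Time T × Ω => if t < z.1 then Y z.2 else 0 := by
  classical
  intro B hB
  have : (fun z : Time T × Ω => if t < z.1 then Y z.2 else 0) ⁻¹' B =
      (Set.Ioi t ×ˢ (Y ⁻¹' B)) ∪ ((Set.Ioi t ×ˢ Set.univ)ᶜ ∩ if (0 : E) ∈ B then Set.univ else ∅) := by
    ext ⟨s, ω⟩
    by_cases h : t < s <;> by_cases h0 : (0 : E) ∈ B <;> simp [h, h0]
  rw [this]
  refine @MeasurableSet.union _ 𝔽.predictable _ _ (measurableSet_predictable_Ioi_prod (hY hB))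
    (@MeasurableSet.inter _ 𝔽.predictable _ _ (@MeasurableSet.compl _ _ 𝔽.predictable
      (measurableSet_predictable_Ioi_prod (@MeasurableSet.univ _ (𝔽 t)))) ?_)
  split_ifs
  · exact @MeasurableSet.univ _ 𝔽.predictable
  · exact @MeasurableSet.empty _ 𝔽.predictable

end Predictable

namespace ChainSetup

variable {g : ℕ → ℕ → ℝ} {Pm : Measure Ω} {𝔽 : Filtration (Time T) mΩ} {X : Ω → ChainPath T}
  (S : ChainSetup g Pm 𝔽 X)
include S

theorem measurable_left :
    Measurable[𝔽.predictable] fun z : Time T × Ω => (X z.2).left z.1 := by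
  let _ : MeasurableSpace (Time T × Ω) := 𝔽.predictable
  refine measurable_of_tendsto_metrizable (f := fun n z => (X z.2).val (gridL n z.1))
    (fun n => measurable_gridL_predictable S.adapted n) (tendsto_pi_nhds.2 fun z => ?_)
  exact tendsto_const_nhds.congr' (((X z.2).tendsto_val_gridL z.1).mono fun _ h => h.symm)

end ChainSetup
end MFChain
end

noncomputable section

namespace MFChain
variable {T : ℝ} [Fact (0 ≤ T)]

/-! ### Counting the jumps into a state by Riemann sums -/

/-- The jump of the indicator of the state `j`. -/
def dind (x : ChainPath T) (j : ℕ) (s : Time T) : ℝ := ind j (x.val s) - ind j (x.left s)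

theorem ind_nonneg (j i : ℕ) : 0 ≤ ind j i := by unfold ind; split_ifs <;> norm_num
theorem ind_le_one (j i : ℕ) : ind j i ≤ 1 := by unfold ind; split_ifs <;> norm_num

theorem integral_dind (x : ChainPath T) (j : ℕ) {s t : Time T} (hst : s ≤ t) :
    ∫ r in Set.Ioc s t, dind x j r ∂jt x = ind j (x.val t) - ind j (x.val s) := by
  classical
  rw [setIntegral_jt x _ measurableSet_Ioc, x.telescope (ind j) hst]
  rfl

/-- The number of jumps into `j` after time `i`, as a real number. -/
def jcount (x : ChainPath T) (j : ℕ) (i : Time T) : ℝ :=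
  ∑ s ∈ jumps x with i < s, ind j (x.val s)

/-- Riemann sums for the number of jumps into `j` after time `i`. -/
def rsum (x : ChainPath T) (j : ℕ) (i : Time T) (n : ℕ) : ℝ :=
  ∫ r in Set.Ioi i, (1 - ind j (x.val (gridL n r))) * dind x j r ∂jt x

theorem rsum_eq (x : ChainPath T) (j : ℕ) (i : Time T) {n K : ℕ} (hK : (gridPt n K : Time T) = ⊤) :
    rsum x j i n = ∑ k ∈ Finset.range K, (1 - ind j (x.val (gridPt n k))) *
      (ind j (x.val (max (gridPt n (k + 1)) i)) - ind j (x.val (max (gridPt n k) i))) := by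
  have h := (riemann_sum (μ := jt x) (h := dind x j) (i := i) (integrable_jt x _).integrableOn
    (fun r => 1 - ind j (x.val r)) n K).2
  rw [hK, max_eq_left le_top, Set.Ioc_top] at h
  rw [rsum, ← h]
  refine Finset.sum_congr rfl fun k _ => ?_
  rw [integral_dind x j (max_le_max_right _ (gridPt_mono n (Nat.le_succ k)))]

/-- Nothing is clamped when `i = ⊥`, so every term is `(1 - a)(b - a)` with `a, b` in `{0, 1}`. This
sign makes Fatou's lemma available before integrability is known. -/
theorem rsum_bot_nonneg (x : ChainPath T) (j n : ℕ) : 0 ≤ rsum x j ⊥ n := by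
  obtain ⟨K, hK⟩ := exists_gridPt_eq_top (T := T) n
  rw [rsum_eq x j ⊥ hK]
  refine Finset.sum_nonneg fun k _ => ?_
  simp only [bot_le, max_eq_left]
  unfold ind
  split_ifs <;> norm_num

/-- In the limit the factor is `1 - ind j (x.left s)`: it removes the jumps out of `j` and leaves
the jumps into `j` with weight one. -/
theorem tendsto_rsum (x : ChainPath T) (j : ℕ) (i : Time T) :
    Tendsto (rsum x j i) atTop (𝓝 (jcount x j i)) := by
  classical
  have h1 : ∀ n, rsum x j i n = ∑ s ∈ jumps x with i < s,
      (1 - ind j (x.val (gridL n s))) * dind x j s := fun n =>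
    setIntegral_jt x _ measurableSet_Ioi
  simp only [jcount]
  rw [tendsto_congr h1]
  refine tendsto_finsetSum _ fun s hs => ?_
  have hs' : x.left s ≠ x.val s := mem_jumps.1 (Finset.mem_filter.1 hs).1
  refine tendsto_const_nhds.congr' ((x.tendsto_val_gridL s).mono fun n hn => ?_)
  simp only [hn, dind]
  unfold ind
  split_ifs <;> simp_all

/-- The terms are bounded by the entries into `j` plus the exits from `j`, and telescoping `ind j`
over the whole path shows that the exits exceed the entries by at most one. This is the dominating
function, uniform in `n`, for the passage to the limit. -/
theorem abs_rsum_le (x : ChainPath T) (j : ℕ) (i : Time T) (n : ℕ) :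
    |rsum x j i n| ≤ 2 * jcount x j ⊥ + 1 := by
  classical
  have h1 : rsum x j i n = ∑ s ∈ jumps x with i < s,
      (1 - ind j (x.val (gridL n s))) * dind x j s := setIntegral_jt x _ measurableSet_Ioi
  have h2 := x.telescope (ind j) (bot_le (a := (⊤ : Time T)))
  have h3 : ∀ s ∈ jumps x, ⊥ < s := fun s hs =>
    bot_lt_iff_ne_bot.2 fun h => bot_notMem_jumps x (h ▸ hs)
  have h4 : jcount x j ⊥ = ∑ s ∈ jumps x, ind j (x.val s) := by
    rw [jcount, Finset.filter_true_of_mem h3]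
  rw [Finset.filter_true_of_mem fun s hs => ⟨h3 s hs, le_top⟩, Finset.sum_sub_distrib, ← h4] at h2
  calc |rsum x j i n| ≤ ∑ s ∈ jumps x with i < s, |(1 - ind j (x.val (gridL n s))) * dind x j s| :=
        h1 ▸ Finset.abs_sum_le_sum_abs _ _
    _ ≤ ∑ s ∈ jumps x, |(1 - ind j (x.val (gridL n s))) * dind x j s| :=
        Finset.sum_le_sum_of_subset_of_nonneg (Finset.filter_subset _ _) fun _ _ _ => abs_nonneg _
    _ ≤ ∑ s ∈ jumps x, (ind j (x.val s) + ind j (x.left s)) := by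
        refine Finset.sum_le_sum fun s _ => ?_
        rw [dind]; unfold ind
        split_ifs <;> norm_num
    _ ≤ _ := by
        rw [Finset.sum_add_distrib, ← h4]
        have := ind_le_one j (x.val ⊥)
        have := ind_nonneg j (x.val ⊤)
        linarith

omit [Fact (0 ≤ T)] in
theorem ofReal_jcount (x : ChainPath T) (j : ℕ) (i : Time T) :
    ENNReal.ofReal (jcount x j i) = jm x (Set.Ioi i ×ˢ {j}) := by
  classical
  rw [jcount, ENNReal.ofReal_sum_of_nonneg fun _ _ => ind_nonneg _ _, jm,
    Measure.finsetSum_apply, Finset.sum_filter]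
  refine Finset.sum_congr rfl fun s _ => ?_
  rw [Measure.dirac_apply' _ (measurableSet_Ioi.prod (measurableSet_singleton j))]
  unfold ind Set.indicator
  by_cases h1 : i < s <;> by_cases h2 : x.val s = j <;> simp [h1, h2]

theorem cm_prod_singleton (g : ℕ → ℕ → ℝ) (x : ChainPath T) (j : ℕ) {A : Set (Time T)}
    (hA : MeasurableSet A) : cm g x (A ×ˢ {j}) = ∫⁻ s in A, rt g (x.left s) j := by
  have hm : MeasurableSet ((Set.univ : Set (Time T)) ×ˢ {j}) :=
    MeasurableSet.univ.prod (measurableSet_singleton j)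
  have := setLIntegral_cm g x (measurable_one.indicator hm) hA
  rw [setLIntegral_indicator hm, Set.prod_inter_prod, Set.univ_inter, Set.inter_univ] at this
  simp only [Pi.one_apply, setLIntegral_one] at this
  rw [this]
  refine lintegral_congr fun s => ?_
  rw [lintegral_rate, tsum_eq_single j]
  · simp
  · intro k hk; simp [hk]

/-- The jumps of a path, up to time `t`, into the state `j`. -/
theorem measurable_jm_Iic_prod {Ω : Type*} {m : MeasurableSpace Ω} {X : Ω → ChainPath T} {t : Time T}
    (hX : ∀ s ≤ t, Measurable fun ω => (X ω).val s) (j : ℕ) :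
    Measurable fun ω => jm (X ω) (Set.Iic t ×ˢ {j}) := by
  classical
  -- Riemann sums for the process stopped at `t`
  have hlim : ∀ ω, Tendsto (fun n => ∫ r in Set.Ioi ⊥, (1 - ind j ((X ω).val (gridL n r))) *
      (Set.Iic t).indicator (dind (X ω) j) r ∂jt (X ω)) atTop
      (𝓝 (∑ s ∈ jumps (X ω) with s ≤ t, ind j ((X ω).val s))) := fun ω => by
    set x := X ω
    have h1 : ∀ n, ∫ r in Set.Ioi ⊥, (1 - ind j (x.val (gridL n r))) *
        (Set.Iic t).indicator (dind x j) r ∂jt x = ∑ s ∈ jumps x with s ≤ t,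
      (1 - ind j (x.val (gridL n s))) * dind x j s := fun n => by
      rw [setIntegral_jt x _ measurableSet_Ioi, Finset.sum_filter, Finset.sum_filter]
      refine Finset.sum_congr rfl fun s hs => ?_
      have : ⊥ < s := bot_lt_iff_ne_bot.2 fun h => bot_notMem_jumps x (h ▸ hs)
      by_cases hst : s ≤ t <;> simp [hst, this]
    rw [tendsto_congr h1]
    refine tendsto_finsetSum _ fun s hs => ?_
    have hs' : x.left s ≠ x.val s := mem_jumps.1 (Finset.mem_filter.1 hs).1
    refine tendsto_const_nhds.congr' ((x.tendsto_val_gridL s).mono fun n hn => ?_)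
    simp only [hn, dind]
    unfold ind
    split_ifs <;> simp_all
  have heq : ∀ ω, jm (X ω) (Set.Iic t ×ˢ {j}) =
      ENNReal.ofReal (∑ s ∈ jumps (X ω) with s ≤ t, ind j ((X ω).val s)) := fun ω => by
    rw [ENNReal.ofReal_sum_of_nonneg fun _ _ => ind_nonneg _ _, jm,
      Measure.finsetSum_apply, Finset.sum_filter]
    refine Finset.sum_congr rfl fun s _ => ?_
    rw [Measure.dirac_apply' _ (measurableSet_Iic.prod (measurableSet_singleton j))]
    unfold ind Set.indicator
    by_cases h1 : s ≤ t <;> by_cases h2 : (X ω).val s = j <;> simp [h1, h2]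
  simp only [heq]
  refine ENNReal.measurable_ofReal.comp
    (measurable_of_tendsto_metrizable (fun n => ?_) (tendsto_pi_nhds.2 hlim))
  obtain ⟨K, hK⟩ := exists_gridPt_eq_top (T := T) n
  -- Stopping the increments at `t` leaves only sample times up to `t`, so the measurability
  -- hypothesis covers the whole sum.
  have hrs : ∀ ω, ∫ r in Set.Ioi ⊥, (1 - ind j ((X ω).val (gridL n r))) *
      (Set.Iic t).indicator (dind (X ω) j) r ∂jt (X ω) =
      ∑ k ∈ Finset.range K, if gridPt n k ≤ t then (1 - ind j ((X ω).val (gridPt n k))) *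
        (ind j ((X ω).val (min (gridPt n (k + 1)) t)) - ind j ((X ω).val (gridPt n k))) else 0 :=
      fun ω => by
    have h := (riemann_sum (μ := jt (X ω)) (h := (Set.Iic t).indicator (dind (X ω) j)) (i := ⊥)
      (integrable_jt _ _).integrableOn (fun r => 1 - ind j ((X ω).val r)) n K).2
    rw [hK, max_eq_left le_top, Set.Ioc_top] at h
    rw [← h]
    refine Finset.sum_congr rfl fun k _ => ?_
    rw [max_eq_left bot_le, max_eq_left bot_le, setIntegral_indicator measurableSet_Iic,
      Set.Ioc_inter_Iic]
    split_ifs with hk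
    · rw [integral_dind _ _ (le_min (gridPt_mono n (Nat.le_succ k)) hk)]
    · rw [Set.Ioc_eq_empty]
      · simp
      · simp only [not_lt]; exact (min_le_right _ _).trans (not_le.1 hk).le
  simp only [hrs]
  have hi : Measurable (ind j) := .of_discrete
  refine Finset.measurable_sum _ fun k _ => ?_
  split_ifs with hk
  · exact (measurable_const.sub (hi.comp (hX _ hk))).mul
      ((hi.comp (hX _ (min_le_right _ _))).sub (hi.comp (hX _ hk)))
  · exact measurable_const

namespace ChainSetup

variable {Ω : Type*} [mΩ : MeasurableSpace Ω]
  {g : ℕ → ℕ → ℝ} {Pm : Measure Ω} {𝔽 : Filtration (Time T) mΩ} {X : Ω → ChainPath T}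
  (S : ChainSetup g Pm 𝔽 X)
include S

theorem measurable_left_joint : Measurable fun z : Time T × Ω => (X z.2).left z.1 :=
  S.measurable_left.mono predictable_le le_rfl

theorem measurable_val (t : Time T) : Measurable fun ω => (X ω).val t :=
  (S.adapted t).mono (𝔽.le t) le_rfl

variable [IsProbabilityMeasure Pm]

theorem integrable_occ (j : ℕ) :
    Integrable (fun p : Ω × Time T => g ((X p.1).left p.2) j) (Pm.prod volume) := by
  have hm : Measurable (fun p : Ω × Time T => g ((X p.1).left p.2) j) :=
    (Measurable.of_discrete (f := fun i => g i j)).comp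
      (S.measurable_left_joint.comp measurable_swap)
  refine ⟨hm.aestronglyMeasurable, ?_⟩
  rw [hasFiniteIntegral_iff_enorm, lintegral_prod _ hm.enorm.aemeasurable]
  exact (S.occ j).lt_top

theorem integrable_integral_occ (j : ℕ) (A : Set (Time T)) :
    Integrable (fun ω => ∫ r in A, g ((X ω).left r) j) Pm := by
  have h : Integrable (fun p : Ω × Time T => g ((X p.1).left p.2) j)
      (Pm.prod (volume.restrict A)) :=
    (S.integrable_occ j).mono_measure (Measure.prod_mono le_rfl Measure.restrict_le_self)
  exact h.integral_prod_left

theorem ae_integrable_occ (j : ℕ) : ∀ᵐ ω ∂Pm, Integrable fun r => g ((X ω).left r) j :=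
  (S.integrable_occ j).prod_right_ae

theorem measurable_rsum (j : ℕ) (i : Time T) (n : ℕ) : Measurable fun ω => rsum (X ω) j i n := by
  obtain ⟨K, hK⟩ := exists_gridPt_eq_top (T := T) n
  simp only [rsum_eq _ j i hK]
  have hi : Measurable (ind j) := .of_discrete
  exact Finset.measurable_sum _ fun k _ =>
    (measurable_const.sub (hi.comp (S.measurable_val _))).mul
      ((hi.comp (S.measurable_val _)).sub (hi.comp (S.measurable_val _)))

/-- The martingale property is applied to each term. The factor `1 - ind j` at a grid point is the
indicator of an event known at the start of the clamped interval, and so is `A`; on their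
intersection the increment of `ind j` has the same mean as its compensator. -/
theorem setIntegral_rsum (j n : ℕ) {i : Time T} {A : Set Ω} (hA : MeasurableSet[𝔽 i] A) :
    ∫ ω in A, rsum (X ω) j i n ∂Pm = ∫ ω in A, (∫ r in Set.Ioi i,
      (1 - ind j ((X ω).val (gridL n r))) * g ((X ω).left r) j) ∂Pm := by
  obtain ⟨K, hK⟩ := exists_gridPt_eq_top (T := T) n
  have hi : Measurable (ind j) := .of_discrete
  have hR : ∀ᵐ ω ∂Pm, ∫ r in Set.Ioi i,
      (1 - ind j ((X ω).val (gridL n r))) * g ((X ω).left r) j =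
      ∑ k ∈ Finset.range K, (1 - ind j ((X ω).val (gridPt n k))) *
      ∫ r in Set.Ioc (max (gridPt n k) i) (max (gridPt n (k + 1)) i), g ((X ω).left r) j := by
    filter_upwards [S.ae_integrable_occ j] with ω hω
    have h := (riemann_sum (μ := volume) (h := fun r => g ((X ω).left r) j) (i := i)
      hω.integrableOn (fun r => 1 - ind j ((X ω).val r)) n K).2
    rw [hK, max_eq_left le_top, Set.Ioc_top] at h
    exact h.symm
  rw [integral_congr_ae (ae_restrict_of_ae hR)]
  simp only [rsum_eq _ j i hK]
  have hmc : ∀ t, Measurable fun ω => (1 - ind j ((X ω).val t)) := fun t =>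
    measurable_const.sub (hi.comp (S.measurable_val t))
  have hbd : ∀ t ω, ‖1 - ind j ((X ω).val t)‖ ≤ 1 := fun t ω => by
    unfold ind; split_ifs <;> norm_num
  have hdI : ∀ s t, Integrable (fun ω => ind j ((X ω).val t) - ind j ((X ω).val s)) Pm :=
    fun s t => Integrable.of_bound
      ((hi.comp (S.measurable_val t)).sub (hi.comp (S.measurable_val s))).aestronglyMeasurable 1
      (Eventually.of_forall fun ω => by unfold ind; split_ifs <;> norm_num)
  rw [integral_finsetSum, integral_finsetSum]
  · refine Finset.sum_congr rfl fun k _ => ?_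
    set t0 := gridPt (T := T) n k
    set t1 := gridPt (T := T) n (k + 1)
    have ht : t0 ≤ t1 := gridPt_mono n (Nat.le_succ k)
    set B : Set Ω := {ω | (X ω).val t0 ≠ j} with hB
    have hBm : MeasurableSet[𝔽 (max t0 i)] B :=
      (𝔽.mono (le_max_left t0 i) _ ((S.adapted t0) (measurableSet_singleton j))).compl
    have hc : ∀ (F : Ω → ℝ), (fun ω => (1 - ind j ((X ω).val t0)) * F ω) = B.indicator F := by
      intro F; ext ω
      unfold ind Set.indicator
      by_cases h : (X ω).val t0 = j <;> simp [B, h]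
    rw [hc, hc, setIntegral_indicator (𝔽.le _ _ hBm), setIntegral_indicator (𝔽.le _ _ hBm)]
    exact S.mart j _ _ (max_le_max_right _ ht) _
      (MeasurableSet.inter (𝔽.mono (le_max_right t0 i) _ hA) hBm)
  · exact fun k _ => ((S.integrable_integral_occ j _).bdd_mul (hmc _).aestronglyMeasurable
      (Eventually.of_forall (hbd _))).integrableOn
  · exact fun k _ => ((hdI _ _).bdd_mul (hmc _).aestronglyMeasurable
      (Eventually.of_forall (hbd _))).integrableOn

theorem measurable_jcount (j : ℕ) (i : Time T) : Measurable fun ω => jcount (X ω) j i :=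
  measurable_of_tendsto_metrizable (S.measurable_rsum j i)
    (tendsto_pi_nhds.2 fun ω => tendsto_rsum (X ω) j i)

/-- Fatou's lemma for the nonnegative Riemann sums, whose means are bounded by the expected total
rate in the field `occ`. -/
theorem integrable_jcount (j : ℕ) : Integrable (fun ω => jcount (X ω) j ⊥) Pm := by
  have hnn : ∀ ω, 0 ≤ jcount (X ω) j ⊥ := fun ω => Finset.sum_nonneg fun _ _ => ind_nonneg _ _
  refine ⟨(S.measurable_jcount j ⊥).aestronglyMeasurable, ?_⟩
  have hb : ∀ n, ∫⁻ ω, ENNReal.ofReal (rsum (X ω) j ⊥ n) ∂Pm ≤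
      ∫⁻ ω, (∫⁻ s, ‖g ((X ω).left s) j‖ₑ) ∂Pm := fun n => by
    have hint : Integrable (fun ω => rsum (X ω) j ⊥ n) Pm := by
      obtain ⟨K, hK⟩ := exists_gridPt_eq_top (T := T) n
      refine Integrable.of_bound (S.measurable_rsum j ⊥ n).aestronglyMeasurable (K : ℝ)
        (Eventually.of_forall fun ω => ?_)
      rw [rsum_eq _ j ⊥ hK]
      refine (norm_sum_le _ _).trans ((Finset.sum_le_card_nsmul _ _ 1 fun k _ => ?_).trans (by simp))
      unfold ind; split_ifs <;> norm_num
    rw [← ofReal_integral_eq_lintegral_ofReal hint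
      (Eventually.of_forall fun ω => rsum_bot_nonneg _ _ _)]
    have h := S.setIntegral_rsum j n (i := ⊥) (A := Set.univ) MeasurableSet.univ
    rw [setIntegral_univ, setIntegral_univ] at h
    rw [h]
    refine (ENNReal.ofReal_le_ofReal (le_abs_self _)).trans ?_
    rw [← Real.norm_eq_abs, ofReal_norm]
    refine (enorm_integral_le_lintegral_enorm _).trans (lintegral_mono fun ω => ?_)
    refine (enorm_integral_le_lintegral_enorm _).trans ((setLIntegral_le_lintegral _ _).trans
      (lintegral_mono fun s => ?_))
    dsimp only
    unfold ind
    split_ifs <;> simp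
  rw [hasFiniteIntegral_iff_ofReal (Eventually.of_forall hnn)]
  refine lt_of_le_of_lt ?_ (S.occ j).lt_top
  calc ∫⁻ ω, ENNReal.ofReal (jcount (X ω) j ⊥) ∂Pm
      = ∫⁻ ω, liminf (fun n => ENNReal.ofReal (rsum (X ω) j ⊥ n)) atTop ∂Pm :=
        lintegral_congr fun ω =>
          ((ENNReal.continuous_ofReal.tendsto _).comp (tendsto_rsum (X ω) j ⊥)).liminf_eq.symm
    _ ≤ liminf (fun n => ∫⁻ ω, ENNReal.ofReal (rsum (X ω) j ⊥ n) ∂Pm) atTop :=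
        lintegral_liminf_le fun n => (S.measurable_rsum j ⊥ n).ennreal_ofReal
    _ ≤ _ := liminf_le_of_le (by isBoundedDefault) fun b hb' => by
        obtain ⟨n, hn⟩ := hb'.exists
        exact hn.trans (hb n)

/-- The limit of `setIntegral_rsum`: on the left the number of entries into `j` dominates, on the
right the absolute rate into `j` along the path. -/
theorem setIntegral_jcount (j : ℕ) {i : Time T} {A : Set Ω} (hA : MeasurableSet[𝔽 i] A) :
    ∫ ω in A, jcount (X ω) j i ∂Pm = ∫ ω in A, (∫ r in Set.Ioi i,
      (1 - ind j ((X ω).left r)) * g ((X ω).left r) j) ∂Pm := by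
  have h1 : Tendsto (fun n => ∫ ω in A, rsum (X ω) j i n ∂Pm) atTop
      (𝓝 (∫ ω in A, jcount (X ω) j i ∂Pm)) := by
    refine tendsto_integral_of_dominated_convergence (fun ω => 2 * jcount (X ω) j ⊥ + 1)
      (fun n => (S.measurable_rsum j i n).aestronglyMeasurable)
      (((S.integrable_jcount j).const_mul 2).add (integrable_const 1)).integrableOn
      (fun n => Eventually.of_forall fun ω => abs_rsum_le _ _ _ _)
      (Eventually.of_forall fun ω => tendsto_rsum _ _ _)
  refine tendsto_nhds_unique h1 ?_
  simp only [S.setIntegral_rsum j _ hA]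
  have hi : Measurable (ind j) := .of_discrete
  have hgm : Measurable (fun k => g k j) := .of_discrete
  have hbd : ∀ k, ‖1 - ind j k‖ ≤ 1 := fun k => by unfold ind; split_ifs <;> norm_num
  refine tendsto_integral_of_dominated_convergence (fun ω => ∫ r, ‖g ((X ω).left r) j‖)
    (fun n => ?_) (S.integrable_occ j).norm.integral_prod_left.integrableOn
      (fun n => ae_restrict_of_ae ?_) (ae_restrict_of_ae ?_)
  · have hm : Measurable fun p : Ω × Time T =>
        (1 - ind j ((X p.1).val (gridL n p.2))) * g ((X p.1).left p.2) j :=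
      (measurable_const.sub (hi.comp (((measurable_gridL_predictable S.adapted n).mono
        predictable_le le_rfl).comp measurable_swap))).mul
        (hgm.comp (S.measurable_left_joint.comp measurable_swap))
    exact (hm.stronglyMeasurable.integral_prod_right (ν := volume.restrict (Set.Ioi i))).aestronglyMeasurable
  · filter_upwards [S.ae_integrable_occ j] with ω hω
    refine (norm_integral_le_integral_norm _).trans ?_
    refine (integral_mono_of_nonneg (Eventually.of_forall fun _ => norm_nonneg _)
      hω.norm.integrableOn (Eventually.of_forall fun r => ?_)).trans
      (setIntegral_le_integral hω.norm (Eventually.of_forall fun _ => norm_nonneg _))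
    dsimp only
    rw [norm_mul]
    exact mul_le_of_le_one_left (norm_nonneg _) (hbd _)
  · filter_upwards [S.ae_integrable_occ j] with ω hω
    refine tendsto_integral_of_dominated_convergence (fun r => ‖g ((X ω).left r) j‖)
      (fun n => ?_) hω.norm.integrableOn (fun n => Eventually.of_forall fun r => ?_)
      (Eventually.of_forall fun r => ?_)
    · exact ((measurable_const.sub (Measurable.comp (g := fun k => ind j ((X ω).val (gridPt n k)))
        .of_discrete (measurable_gridIdx n))).mul
          (hgm.comp (X ω).measurable_left)).aestronglyMeasurable
    · rw [norm_mul]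
      exact mul_le_of_le_one_left (norm_nonneg _) (hbd _)
    · exact tendsto_const_nhds.congr' (((X ω).tendsto_val_gridL r).mono fun n hn => by
        simp only [hn])

/-- The compensator formula on the sets which generate the predictable σ-algebra. -/
theorem setLIntegral_jm_Ioi (j : ℕ) {i : Time T} {A : Set Ω} (hA : MeasurableSet[𝔽 i] A) :
    ∫⁻ ω in A, jm (X ω) (Set.Ioi i ×ˢ {j}) ∂Pm = ∫⁻ ω in A, cm g (X ω) (Set.Ioi i ×ˢ {j}) ∂Pm := by
  have hi : Measurable (ind j) := .of_discrete
  have hgm : Measurable (fun k => g k j) := .of_discrete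
  have hnn : ∀ k, 0 ≤ (1 - ind j k) * g k j := fun k => by
    unfold ind
    split_ifs with h
    · simp
    · simpa using (S.qmat.pos k j h).le
  have hle : ∀ ω, jcount (X ω) j i ≤ jcount (X ω) j ⊥ := fun ω =>
    Finset.sum_le_sum_of_subset_of_nonneg
      (Finset.monotone_filter_right _ fun s _ h => bot_le.trans_lt h)
      fun _ _ _ => ind_nonneg _ _
  have hnj : ∀ ω, 0 ≤ jcount (X ω) j i := fun ω => Finset.sum_nonneg fun _ _ => ind_nonneg _ _
  have hrt : ∀ k, ENNReal.ofReal ((1 - ind j k) * g k j) = rt g k j := fun k => by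
    unfold ind rt
    by_cases h : k = j
    · simp [h]
    · simp [h, Ne.symm h]
  have hbd : ∀ k, ‖1 - ind j k‖ ≤ 1 := fun k => by unfold ind; split_ifs <;> norm_num
  have hI : Integrable (fun p : Ω × Time T => (1 - ind j ((X p.1).left p.2)) *
      g ((X p.1).left p.2) j) (Pm.prod (volume.restrict (Set.Ioi i))) := by
    refine Integrable.bdd_mul (c := 1) ((S.integrable_occ j).mono_measure
      (Measure.prod_mono le_rfl Measure.restrict_le_self)) ?_ (Eventually.of_forall fun _ => hbd _)
    exact (measurable_const.sub (hi.comp (S.measurable_left_joint.comp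
      measurable_swap))).aestronglyMeasurable
  simp only [← ofReal_jcount]
  rw [← ofReal_integral_eq_lintegral_ofReal _ (Eventually.of_forall hnj), S.setIntegral_jcount j hA,
    ofReal_integral_eq_lintegral_ofReal hI.integral_prod_left.integrableOn
      (Eventually.of_forall fun ω => integral_nonneg fun r => hnn _)]
  · refine lintegral_congr_ae (ae_restrict_of_ae ?_)
    filter_upwards [hI.prod_right_ae] with ω hω
    rw [ofReal_integral_eq_lintegral_ofReal hω (Eventually.of_forall fun r => hnn _), cm_prod_singleton _ _ _ measurableSet_Ioi]
    simp only [hrt]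
  · refine ((S.integrable_jcount j).mono' (S.measurable_jcount j i).aestronglyMeasurable
      (Eventually.of_forall fun ω => ?_)).integrableOn
    rw [Real.norm_of_nonneg (hnj ω)]
    exact hle ω

end ChainSetup
end MFChain
end

/-! ### The compensator formula for predictable integrands -/

noncomputable section

namespace MFChain
variable {T : ℝ} [Fact (0 ≤ T)] {Ω : Type*} [mΩ : MeasurableSpace Ω]

theorem measurable_tsum_ennreal {α : Type*} {_ : MeasurableSpace α} {f : ℕ → α → ℝ≥0∞}
    (hf : ∀ n, Measurable (f n)) : Measurable fun a => ∑' n, f n a := .tsum hf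

theorem jm_bot_prod (x : ChainPath T) (B : Set ℕ) : jm x ({⊥} ×ˢ B) = 0 := by
  classical
  rw [jm, Measure.finsetSum_apply]
  refine Finset.sum_eq_zero fun s hs => ?_
  have : s ≠ ⊥ := fun h => bot_notMem_jumps x (h ▸ hs)
  simp [this]

theorem isPiSystem_predictable (𝔽 : Filtration (Time T) mΩ) :
    IsPiSystem ({s : Set (Time T × Ω) | ∃ A, MeasurableSet[𝔽 ⊥] A ∧ s = {⊥} ×ˢ A} ∪
    {s | ∃ i A, MeasurableSet[𝔽 i] A ∧ s = Set.Ioi i ×ˢ A}) := by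
  rintro _ (⟨A, hA, rfl⟩ | ⟨i, A, hA, rfl⟩) _ (⟨B, hB, rfl⟩ | ⟨k, B, hB, rfl⟩) hne
  · exact Or.inl ⟨A ∩ B, hA.inter hB, by rw [Set.prod_inter_prod, Set.inter_self]⟩
  · obtain ⟨z, h1, h2⟩ := hne
    have e1 : z.1 = ⊥ := h1.1
    have e2 : k < z.1 := h2.1
    simp [e1] at e2
  · obtain ⟨z, h1, h2⟩ := hne
    have e1 : z.1 = ⊥ := h2.1
    have e2 : i < z.1 := h1.1
    simp [e1] at e2
  · refine Or.inr ⟨max i k, A ∩ B, (𝔽.mono (le_max_left _ _) _ hA).inter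
      (𝔽.mono (le_max_right _ _) _ hB), ?_⟩
    rw [Set.prod_inter_prod, Set.Ioi_inter_Ioi]

theorem setLIntegral_prod_univ_eq_tsum {μ : Measure (Time T × ℕ)} {A : Set (Time T)}
    (hA : MeasurableSet A) (f : Time T × ℕ → ℝ≥0∞) :
    ∫⁻ z in A ×ˢ Set.univ, f z ∂μ = ∑' j, ∫⁻ z in A ×ˢ {j}, f (z.1, j) ∂μ := by
  have : A ×ˢ (Set.univ : Set ℕ) = ⋃ j, A ×ˢ {j} := by ext; simp
  rw [this, lintegral_iUnion (fun j => hA.prod (measurableSet_singleton j))]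
  · refine tsum_congr fun j => setLIntegral_congr_fun (hA.prod (measurableSet_singleton j)) ?_
    rintro ⟨s, k⟩ ⟨-, hk⟩
    simp only [Set.mem_singleton_iff] at hk
    simp [hk]
  · intro i j hij
    rw [Function.onFun, Set.disjoint_prod]
    right; simpa using hij

theorem setLIntegral_section (μ : Measure (Time T × ℕ)) (j : ℕ) (t : Set (Time T)) (c : ℝ≥0∞)
    {𝔽 : Filtration (Time T) mΩ}
    {B : Set (Time T × Ω)} (hB : MeasurableSet[𝔽.predictable] B) (ω : Ω) :
    ∫⁻ z in t ×ˢ {j}, B.indicator (fun _ => c) (z.1, ω) ∂μ =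
      c * μ ((t ∩ {s | (s, ω) ∈ B}) ×ˢ {j}) := by
  have hs : MeasurableSet {s | (s, ω) ∈ B} := measurable_prodMk_right (predictable_le _ hB)
  have e : (fun z : Time T × ℕ => B.indicator (fun _ => c) (z.1, ω)) =
    ({s | (s, ω) ∈ B} ×ˢ Set.univ).indicator fun _ => c := by
    classical
    ext z; simp [Set.indicator_apply]
  rw [e, setLIntegral_indicator (hs.prod MeasurableSet.univ), setLIntegral_const,
    Set.prod_inter_prod, Set.univ_inter, Set.inter_comm]

namespace ChainSetup

variable {g : ℕ → ℕ → ℝ} {Pm : Measure Ω} {𝔽 : Filtration (Time T) mΩ} {X : Ω → ChainPath T}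
  (S : ChainSetup g Pm 𝔽 X)
include S

theorem measurable_jm_Iic (j : ℕ) (t : Time T) :
    Measurable[𝔽 t] fun ω => jm (X ω) (Set.Iic t ×ˢ {j}) :=
  measurable_jm_Iic_prod (m := 𝔽 t) (fun s hs => (S.adapted s).mono (𝔽.mono hs) le_rfl) j

/-- A monotone class argument over the generators of the predictable σ-algebra. The jump measure of
each path is finite, so complements are handled by subtraction. -/
theorem measurable_jm_section (j : ℕ) (t : Time T) {B : Set (Time T × Ω)}
    (hB : MeasurableSet[𝔽.predictable] B) :
    Measurable[𝔽 t] fun ω => jm (X ω) ((Set.Iic t ∩ {s | (s, ω) ∈ B}) ×ˢ {j}) := by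
  have hsec : ∀ (B : Set (Time T × Ω)), MeasurableSet[𝔽.predictable] B → ∀ ω,
      MeasurableSet ((Set.Iic t ∩ {s | (s, ω) ∈ B}) ×ˢ ({j} : Set ℕ)) := fun B hB ω =>
    (measurableSet_Iic.inter (measurable_prodMk_right (predictable_le _ hB))).prod
      (measurableSet_singleton j)
  refine MeasurableSpace.induction_on_inter (m := 𝔽.predictable)
    (C := fun B _ => Measurable[𝔽 t] fun ω =>
      jm (X ω) ((Set.Iic t ∩ {s | (s, ω) ∈ B}) ×ˢ ({j} : Set ℕ)))
    rfl (isPiSystem_predictable 𝔽) ?_ ?_ ?_ ?_ B hB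
  · simp
  · rintro _ (⟨A, hA, rfl⟩ | ⟨i, A, hA, rfl⟩)
    · have : ∀ ω, jm (X ω) ((Set.Iic t ∩ {s | (s, ω) ∈ ({⊥} : Set (Time T)) ×ˢ A}) ×ˢ {j}) = 0 :=
        fun ω => measure_mono_null (by rintro ⟨s, k⟩ ⟨⟨-, h, -⟩, h2⟩; exact ⟨h, h2⟩)
          (jm_bot_prod (X ω) {j})
      simp only [this]
      exact measurable_const
    · by_cases hit : i ≤ t
      · have : ∀ ω, jm (X ω) ((Set.Iic t ∩ {s | (s, ω) ∈ Set.Ioi i ×ˢ A}) ×ˢ {j}) =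
            A.indicator (fun ω => jm (X ω) (Set.Iic t ×ˢ {j}) - jm (X ω) (Set.Iic i ×ˢ {j})) ω := by
          intro ω
          by_cases hω : ω ∈ A
          · rw [Set.indicator_of_mem hω, ← measure_sdiff (Set.prod_mono (Set.Iic_subset_Iic.2 hit)
              le_rfl) (measurableSet_Iic.prod (measurableSet_singleton j)).nullMeasurableSet
              (measure_ne_top _ _)]
            congr 1
            ext ⟨s, k⟩
            simp only [Set.mem_prod, Set.mem_inter_iff, Set.mem_Iic, Set.mem_ofPred_eq, Set.mem_Ioi,
              hω, and_true, Set.mem_singleton_iff, Set.mem_sdiff, not_and]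
            constructor
            · exact fun h => ⟨⟨h.1.1, h.2⟩, fun h' => absurd h.1.2 h'.not_gt⟩
            · exact fun h => ⟨⟨h.1.1, not_le.1 fun h' => h.2 h' h.1.2⟩, h.1.2⟩
          · simp [hω]
        simp only [this]
        exact Measurable.indicator ((S.measurable_jm_Iic j t).sub
          ((S.measurable_jm_Iic j i).mono (𝔽.mono hit) le_rfl)) (𝔽.mono hit _ hA)
      · have : ∀ ω, Set.Iic t ∩ {s | (s, ω) ∈ Set.Ioi i ×ˢ A} = ∅ := by
          intro ω; ext s
          simp only [Set.mem_inter_iff, Set.mem_Iic, Set.mem_ofPred_eq, Set.mem_prod, Set.mem_Ioi,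
            Set.mem_empty_iff_false, iff_false]
          exact fun h => hit (h.2.1.le.trans h.1)
        simp only [this, Set.empty_prod, measure_empty]
        exact measurable_const
  · intro B hB ih
    have : ∀ ω, jm (X ω) ((Set.Iic t ∩ {s | (s, ω) ∈ Bᶜ}) ×ˢ {j}) =
        jm (X ω) (Set.Iic t ×ˢ {j}) - jm (X ω) ((Set.Iic t ∩ {s | (s, ω) ∈ B}) ×ˢ {j}) := by
      intro ω
      rw [← measure_sdiff (Set.prod_mono Set.inter_subset_left le_rfl)
        (hsec B hB ω).nullMeasurableSet (measure_ne_top _ _)]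
      congr 1
      ext ⟨s, k⟩
      simp
      tauto
    simp only [this]
    exact (S.measurable_jm_Iic j t).sub ih
  · intro B hd hB ih
    have : ∀ ω, jm (X ω) ((Set.Iic t ∩ {s | (s, ω) ∈ ⋃ n, B n}) ×ˢ {j}) =
        ∑' n, jm (X ω) ((Set.Iic t ∩ {s | (s, ω) ∈ B n}) ×ˢ {j}) := by
      intro ω
      rw [← measure_iUnion _ fun n => hsec _ (hB n) ω]
      · congr 1
        ext ⟨s, k⟩
        simp
      · intro n m hnm
        refine Set.disjoint_left.2 ?_
        rintro ⟨s, k⟩ ⟨⟨-, h1⟩, -⟩ ⟨⟨-, h2⟩, -⟩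
        exact Set.disjoint_left.1 (hd hnm) h1 h2
    simp only [this]
    exact measurable_tsum_ennreal ih

/-- Integrals of predictable processes against the jump measure are adapted. -/
theorem measurable_setLIntegral_jm {f : Time T → Ω → ℕ → ℝ≥0∞}
    (hf : ∀ j, Measurable[𝔽.predictable] fun z : Time T × Ω => f z.1 z.2 j) (t : Time T) :
    Measurable[𝔽 t] fun ω => ∫⁻ z in Set.Iic t ×ˢ Set.univ, f z.1 ω z.2 ∂jm (X ω) := by
  simp only [setLIntegral_prod_univ_eq_tsum measurableSet_Iic]
  refine measurable_tsum_ennreal fun j => ?_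
  refine Measurable.ennreal_induction (mα := 𝔽.predictable) (motive := fun h =>
    Measurable[𝔽 t] fun ω => ∫⁻ z in Set.Iic t ×ˢ {j}, h (z.1, ω) ∂jm (X ω)) ?_ ?_ ?_ (hf j)
  · intro c B hB
    simp only [setLIntegral_section _ j _ c hB]
    exact (S.measurable_jm_section j t hB).const_mul c
  · intro f1 f2 _ h1 h2 ih1 ih2
    have : ∀ ω, ∫⁻ z in Set.Iic t ×ˢ {j}, (f1 + f2) (z.1, ω) ∂jm (X ω) =
      ∫⁻ z in Set.Iic t ×ˢ {j}, f1 (z.1, ω) ∂jm (X ω) +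
      ∫⁻ z in Set.Iic t ×ˢ {j}, f2 (z.1, ω) ∂jm (X ω) := fun ω =>
      lintegral_add_left ((h1.mono predictable_le le_rfl).comp
        (measurable_fst.prodMk measurable_const)) _
    simp only [this]
    exact ih1.add ih2
  · intro F hF hmono ih
    have : ∀ ω, ∫⁻ z in Set.Iic t ×ˢ {j}, (fun z => ⨆ n, F n z) (z.1, ω) ∂jm (X ω) =
        ⨆ n, ∫⁻ z in Set.Iic t ×ˢ {j}, F n (z.1, ω) ∂jm (X ω) := fun ω =>
      lintegral_iSup (fun n => ((hF n).mono predictable_le le_rfl).comp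
        (measurable_fst.prodMk measurable_const)) fun n m h z => hmono h _
    simp only [this]
    exact Measurable.iSup ih

theorem measurable_rate_integral {f : Time T → Ω → ℕ → ℝ≥0∞}
    (hf : ∀ j, Measurable[𝔽.predictable] fun z : Time T × Ω => f z.1 z.2 j) :
    Measurable[𝔽.predictable]
      fun z : Time T × Ω => ∫⁻ j, f z.1 z.2 j ∂rate g ((X z.2).left z.1) := by
  simp only [lintegral_rate]
  exact measurable_tsum_ennreal fun j => ((Measurable.of_discrete (f := fun i => rt g i j)).comp
    S.measurable_left).mul (hf j)

theorem measurable_mark {E : Type*} [MeasurableSpace E] {f : Time T → Ω → ℕ → E}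
    (hf : ∀ j, Measurable[𝔽.predictable] fun z : Time T × Ω => f z.1 z.2 j) (ω : Ω) :
    Measurable fun z : Time T × ℕ => f z.1 ω z.2 :=
  measurable_from_prod_countable_left fun j => ((hf j).mono predictable_le le_rfl).comp
    measurable_prodMk_right

/-- Integrals of predictable processes against the compensator are adapted. -/
theorem measurable_setLIntegral_cm {f : Time T → Ω → ℕ → ℝ≥0∞}
    (hf : ∀ j, Measurable[𝔽.predictable] fun z : Time T × Ω => f z.1 z.2 j) (t : Time T) :
    Measurable[𝔽 t] fun ω => ∫⁻ z in Set.Iic t ×ˢ Set.univ, f z.1 ω z.2 ∂cm g (X ω) := by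
  have h := (S.measurable_rate_integral hf).comp (measurable_min_predictable (𝔽 := 𝔽) t)
  have h2 := @Measurable.lintegral_prod_left' _ _ _ (𝔽 t) (volume.restrict (Set.Iic t)) _ _ h
  convert h2 using 2 with ω
  rw [setLIntegral_cm g (X ω) (S.measurable_mark hf ω) measurableSet_Iic]
  refine setLIntegral_congr_fun measurableSet_Iic fun s hs => ?_
  simp [min_eq_left (Set.mem_Iic.1 hs)]

theorem measurable_cm_section (j : ℕ) {B : Set (Time T × Ω)}
    (hB : MeasurableSet[𝔽.predictable] B) :
    Measurable fun ω => cm g (X ω) ({s | (s, ω) ∈ B} ×ˢ {j}) := by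
  have h1 : ∀ ω, cm g (X ω) ({s | (s, ω) ∈ B} ×ˢ {j}) =
      ∫⁻ s, B.indicator (fun z => rt g ((X z.2).left z.1) j) (s, ω) := fun ω => by
    have hs : MeasurableSet {s | (s, ω) ∈ B} := measurable_prodMk_right (predictable_le _ hB)
    rw [cm_prod_singleton _ _ _ hs, ← lintegral_indicator hs]
    classical
    simp [Set.indicator_apply]
  simp only [h1]
  refine Measurable.lintegral_prod_left' (f := B.indicator
    (fun z : Time T × Ω => rt g ((X z.2).left z.1) j)) ?_
  exact ((Measurable.of_discrete (f := fun i => rt g i j)).comp S.measurable_left_joint).indicator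
    (predictable_le _ hB)

variable [IsProbabilityMeasure Pm]

theorem jm_eq_Ioi (x : ChainPath T) (B : Set ℕ) : jm x (Set.univ ×ˢ B) = jm x (Set.Ioi ⊥ ×ˢ B) := by
  refine le_antisymm ?_ (measure_mono (Set.prod_mono (Set.subset_univ _) le_rfl))
  have : (Set.univ : Set (Time T)) ×ˢ B ⊆ Set.Ioi ⊥ ×ˢ B ∪ {⊥} ×ˢ B := by
    rintro ⟨s, k⟩ ⟨-, hk⟩
    rcases eq_bot_or_bot_lt s with h | h
    · right; exact ⟨h, hk⟩
    · left; exact ⟨h, hk⟩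
  refine (measure_mono this).trans ((measure_union_le _ _).trans ?_)
  rw [jm_bot_prod, add_zero]

theorem lintegral_jm_univ_ne_top (j : ℕ) : ∫⁻ ω, jm (X ω) (Set.univ ×ˢ {j}) ∂Pm ≠ ∞ := by
  simp only [jm_eq_Ioi S, ← ofReal_jcount]
  have := (S.integrable_jcount j).lintegral_lt_top
  exact this.ne

/-- A monotone class argument started from `setLIntegral_jm_Ioi`; sets over time `0` have no mass on
either side. Subtraction for complements is legitimate because the expected number of jumps into a
fixed state is finite. -/
theorem lintegral_jm_section (j : ℕ) {B : Set (Time T × Ω)}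
    (hB : MeasurableSet[𝔽.predictable] B) :
    ∫⁻ ω, jm (X ω) ({s | (s, ω) ∈ B} ×ˢ {j}) ∂Pm =
      ∫⁻ ω, cm g (X ω) ({s | (s, ω) ∈ B} ×ˢ {j}) ∂Pm := by
  have hsec : ∀ (B : Set (Time T × Ω)), MeasurableSet[𝔽.predictable] B → ∀ ω,
      MeasurableSet ({s | (s, ω) ∈ B} ×ˢ ({j} : Set ℕ)) := fun B hB ω =>
    (measurable_prodMk_right (predictable_le _ hB)).prod (measurableSet_singleton j)
  have hmj : ∀ (B : Set (Time T × Ω)), MeasurableSet[𝔽.predictable] B →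
      Measurable fun ω => jm (X ω) ({s | (s, ω) ∈ B} ×ˢ {j}) := fun B hB => by
    have := (S.measurable_jm_section j ⊤ hB).mono (𝔽.le _) le_rfl
    simpa using this
  have hcuniv : ∀ ω, cm g (X ω) (Set.univ ×ˢ {j}) = cm g (X ω) (Set.Ioi ⊥ ×ˢ {j}) := fun ω => by
    rw [cm_prod_singleton _ _ _ MeasurableSet.univ, cm_prod_singleton _ _ _ measurableSet_Ioi,
      restrict_Ioi_eq_restrict_Ici, Set.Ici_bot]
  have huniv : ∫⁻ ω, jm (X ω) (Set.univ ×ˢ {j}) ∂Pm = ∫⁻ ω, cm g (X ω) (Set.univ ×ˢ {j}) ∂Pm := by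
    have := S.setLIntegral_jm_Ioi j (i := ⊥) (A := Set.univ) MeasurableSet.univ
    simpa only [jm_eq_Ioi S, hcuniv, Measure.restrict_univ] using this
  have hfin := S.lintegral_jm_univ_ne_top j
  have hcfin : ∀ ω, IsFiniteMeasure (cm g (X ω)) := fun ω => isFiniteMeasure_cm S.qmat _
  refine MeasurableSpace.induction_on_inter (m := 𝔽.predictable)
    (C := fun B _ => ∫⁻ ω, jm (X ω) ({s | (s, ω) ∈ B} ×ˢ {j}) ∂Pm =
      ∫⁻ ω, cm g (X ω) ({s | (s, ω) ∈ B} ×ˢ {j}) ∂Pm)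
    rfl (isPiSystem_predictable 𝔽) ?_ ?_ ?_ ?_ B hB
  · simp
  · rintro _ (⟨A, hA, rfl⟩ | ⟨i, A, hA, rfl⟩)
    · have h1 : ∀ ω, jm (X ω) ({s | (s, ω) ∈ ({⊥} : Set (Time T)) ×ˢ A} ×ˢ {j}) = 0 :=
        fun ω => measure_mono_null (by rintro ⟨s, k⟩ ⟨⟨h, -⟩, h2⟩; exact ⟨h, h2⟩)
          (jm_bot_prod (X ω) {j})
      have h2 : ∀ ω, cm g (X ω) ({s | (s, ω) ∈ ({⊥} : Set (Time T)) ×ˢ A} ×ˢ {j}) = 0 :=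
        fun ω => measure_mono_null (by rintro ⟨s, k⟩ ⟨⟨h, -⟩, h2⟩; exact ⟨h, trivial⟩)
          (cm_singleton_prod g (X ω) ⊥)
      simp only [h1, h2]
    · classical
      have h : ∀ ω, ({s | (s, ω) ∈ Set.Ioi i ×ˢ A} ×ˢ {j} : Set (Time T × ℕ)) =
          if ω ∈ A then Set.Ioi i ×ˢ {j} else ∅ := fun ω => by
        ext ⟨s, k⟩; by_cases hω : ω ∈ A <;> simp [hω]
      have h1 : ∀ (μ : Ω → Measure (Time T × ℕ)) ω,
          μ ω ({s | (s, ω) ∈ Set.Ioi i ×ˢ A} ×ˢ {j}) =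
            A.indicator (fun ω => μ ω (Set.Ioi i ×ˢ {j})) ω := fun μ ω => by
        rw [h]; by_cases hω : ω ∈ A <;> simp [hω]
      simp only [h1 fun ω => jm (X ω), h1 fun ω => cm g (X ω)]
      rw [lintegral_indicator (𝔽.le _ _ hA), lintegral_indicator (𝔽.le _ _ hA)]
      exact S.setLIntegral_jm_Ioi j hA
  · intro B hB ih
    have h1 : ∀ (μ : Ω → Measure (Time T × ℕ)) (_ : ∀ ω, IsFiniteMeasure (μ ω)) ω,
        μ ω ({s | (s, ω) ∈ Bᶜ} ×ˢ {j}) =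
        μ ω (Set.univ ×ˢ {j}) - μ ω ({s | (s, ω) ∈ B} ×ˢ {j}) := fun μ _ ω => by
      rw [← measure_sdiff (Set.prod_mono (Set.subset_univ _) le_rfl)
        (hsec B hB ω).nullMeasurableSet (measure_ne_top _ _)]
      congr 1
      ext ⟨s, k⟩
      simp
      tauto
    simp only [h1 (fun ω => jm (X ω)) fun _ => inferInstance, h1 (fun ω => cm g (X ω)) hcfin]
    rw [lintegral_sub (hmj B hB), lintegral_sub (S.measurable_cm_section j hB), ih, huniv]
    · rw [← ih]
      refine ne_top_of_le_ne_top hfin (lintegral_mono fun ω => ?_)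
      exact measure_mono (Set.prod_mono (Set.subset_univ _) le_rfl)
    · exact Eventually.of_forall fun ω => measure_mono (Set.prod_mono (Set.subset_univ _) le_rfl)
    · refine ne_top_of_le_ne_top hfin (lintegral_mono fun ω => ?_)
      exact measure_mono (Set.prod_mono (Set.subset_univ _) le_rfl)
    · exact Eventually.of_forall fun ω => measure_mono (Set.prod_mono (Set.subset_univ _) le_rfl)
  · intro B hd hB ih
    have h1 : ∀ (μ : Ω → Measure (Time T × ℕ)) ω, μ ω ({s | (s, ω) ∈ ⋃ n, B n} ×ˢ {j}) =
        ∑' n, μ ω ({s | (s, ω) ∈ B n} ×ˢ {j}) := by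
      intro μ ω
      rw [← measure_iUnion _ fun n => hsec _ (hB n) ω]
      · congr 1
        ext ⟨s, k⟩
        simp
      · intro n m hnm
        refine Set.disjoint_left.2 ?_
        rintro ⟨s, k⟩ ⟨h1, -⟩ ⟨h2, -⟩
        exact Set.disjoint_left.1 (hd hnm) h1 h2
    simp only [h1 fun ω => jm (X ω), h1 fun ω => cm g (X ω)]
    rw [lintegral_tsum fun n => (hmj _ (hB n)).aemeasurable,
      lintegral_tsum fun n => (S.measurable_cm_section j (hB n)).aemeasurable]
    exact tsum_congr ih

/-- The compensator formula: the integrals of a nonnegative predictable process against the jump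
measure and against the compensator have the same mean. -/
theorem lintegral_lintegral_jm {f : Time T → Ω → ℕ → ℝ≥0∞}
    (hf : ∀ j, Measurable[𝔽.predictable] fun z : Time T × Ω => f z.1 z.2 j) :
    ∫⁻ ω, (∫⁻ z, f z.1 ω z.2 ∂jm (X ω)) ∂Pm = ∫⁻ ω, (∫⁻ z, f z.1 ω z.2 ∂cm g (X ω)) ∂Pm := by
  -- Measurability of both sides is carried along in the induction, since additivity and monotone
  -- convergence of the outer integral use it.
  have key : ∀ h : Time T × Ω → ℝ≥0∞, Measurable[𝔽.predictable] h → ∀ j,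
      (Measurable fun ω => ∫⁻ z in Set.univ ×ˢ {j}, h (z.1, ω) ∂jm (X ω)) ∧
      (Measurable fun ω => ∫⁻ z in Set.univ ×ˢ {j}, h (z.1, ω) ∂cm g (X ω)) ∧
      ∫⁻ ω, (∫⁻ z in Set.univ ×ˢ {j}, h (z.1, ω) ∂jm (X ω)) ∂Pm =
      ∫⁻ ω, (∫⁻ z in Set.univ ×ˢ {j}, h (z.1, ω) ∂cm g (X ω)) ∂Pm := by
    intro h hh j
    refine Measurable.ennreal_induction (mα := 𝔽.predictable) (motive := fun h =>
      (Measurable fun ω => ∫⁻ z in Set.univ ×ˢ {j}, h (z.1, ω) ∂jm (X ω)) ∧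
      (Measurable fun ω => ∫⁻ z in Set.univ ×ˢ {j}, h (z.1, ω) ∂cm g (X ω)) ∧
      ∫⁻ ω, (∫⁻ z in Set.univ ×ˢ {j}, h (z.1, ω) ∂jm (X ω)) ∂Pm =
      ∫⁻ ω, (∫⁻ z in Set.univ ×ˢ {j}, h (z.1, ω) ∂cm g (X ω)) ∂Pm) ?_ ?_ ?_ hh
    · intro c B hB
      have hmj : Measurable fun ω => jm (X ω) ({s | (s, ω) ∈ B} ×ˢ {j}) := by
        have := (S.measurable_jm_section j ⊤ hB).mono (𝔽.le _) le_rfl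
        simpa using this
      have hmc := S.measurable_cm_section j hB
      simp only [setLIntegral_section _ j _ c hB, Set.univ_inter]
      refine ⟨hmj.const_mul c, hmc.const_mul c, ?_⟩
      rw [lintegral_const_mul _ hmj, lintegral_const_mul _ hmc, S.lintegral_jm_section j hB]
    · intro f1 f2 _ h1 h2 ih1 ih2
      have : ∀ (μ : Measure (Time T × ℕ)) ω, ∫⁻ z in Set.univ ×ˢ {j}, (f1 + f2) (z.1, ω) ∂μ =
        ∫⁻ z in Set.univ ×ˢ {j}, f1 (z.1, ω) ∂μ +
        ∫⁻ z in Set.univ ×ˢ {j}, f2 (z.1, ω) ∂μ := fun μ ω =>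
        lintegral_add_left ((h1.mono predictable_le le_rfl).comp
          (measurable_fst.prodMk measurable_const)) _
      simp only [this]
      refine ⟨ih1.1.add ih2.1, ih1.2.1.add ih2.2.1, ?_⟩
      rw [lintegral_add_left ih1.1, lintegral_add_left ih1.2.1, ih1.2.2, ih2.2.2]
    · intro F hF hmono ih
      have : ∀ (μ : Measure (Time T × ℕ)) ω,
          ∫⁻ z in Set.univ ×ˢ {j}, (fun z => ⨆ n, F n z) (z.1, ω) ∂μ =
          ⨆ n, ∫⁻ z in Set.univ ×ˢ {j}, F n (z.1, ω) ∂μ := fun μ ω =>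
        lintegral_iSup (fun n => ((hF n).mono predictable_le le_rfl).comp
          (measurable_fst.prodMk measurable_const)) fun n m h z => hmono h _
      simp only [this]
      refine ⟨.iSup fun n => (ih n).1, .iSup fun n => (ih n).2.1, ?_⟩
      rw [lintegral_iSup (fun n => (ih n).1) fun n m h ω => lintegral_mono fun z => hmono h _,
        lintegral_iSup (fun n => (ih n).2.1) fun n m h ω => lintegral_mono fun z => hmono h _]
      exact iSup_congr fun n => (ih n).2.2
  have e : ∀ (μ : Measure (Time T × ℕ)) ω, ∫⁻ z, f z.1 ω z.2 ∂μ =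
      ∑' j, ∫⁻ z in Set.univ ×ˢ {j}, f z.1 ω j ∂μ := fun μ ω => by
    rw [← setLIntegral_prod_univ_eq_tsum MeasurableSet.univ fun z : Time T × ℕ => f z.1 ω z.2,
      Set.univ_prod_univ, Measure.restrict_univ]
  simp only [e]
  rw [lintegral_tsum fun j => (key _ (hf j) j).1.aemeasurable,
    lintegral_tsum fun j => (key _ (hf j) j).2.1.aemeasurable]
  exact tsum_congr fun j => (key _ (hf j) j).2.2

theorem iUnion_Iic_gridL {s : Time T} (hs : ⊥ < s) : ⋃ n, Set.Iic (gridL n s) = Set.Iio s := by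
  ext r
  simp only [Set.mem_iUnion, Set.mem_Iic, Set.mem_Iio]
  constructor
  · rintro ⟨n, hn⟩; exact hn.trans_lt (gridL_lt hs)
  · intro h
    have := (tendsto_nhdsWithin_iff.1 (tendsto_gridL hs)).1.eventually (lt_mem_nhds h)
    exact (this.exists).imp fun _ h => h.le

/-- If the integrals over `[0, t]` are adapted, those over `[0, s)` are predictable. -/
theorem measurable_setLIntegral_Iio {μ : Ω → Measure (Time T × ℕ)} {f : Time T → Ω → ℕ → ℝ≥0∞}
    (h0 : ∀ ω, μ ω ({⊥} ×ˢ Set.univ) = 0)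
    (h : ∀ t, Measurable[𝔽 t] fun ω => ∫⁻ z in Set.Iic t ×ˢ Set.univ, f z.1 ω z.2 ∂μ ω) :
    Measurable[𝔽.predictable]
      fun z : Time T × Ω => ∫⁻ w in Set.Iio z.1 ×ˢ Set.univ, f w.1 z.2 w.2 ∂μ z.2 := by
  -- For `s > 0` the interval `[0, s)` is the union of the nested intervals `[0, gridL n s]`. At `s
  -- = 0` the sampled interval is `{0}`, which has no mass by `h0`.
  have e : ∀ z : Time T × Ω, ∫⁻ w in Set.Iio z.1 ×ˢ Set.univ, f w.1 z.2 w.2 ∂μ z.2 =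
      ⨆ n, ∫⁻ w in Set.Iic (gridL n z.1) ×ˢ Set.univ, f w.1 z.2 w.2 ∂μ z.2 := by
    rintro ⟨s, ω⟩
    rcases eq_bot_or_bot_lt s with rfl | hs
    · simp [gridL_bot, Measure.restrict_eq_zero.2 (h0 ω)]
    · have : Set.Iio s ×ˢ (Set.univ : Set ℕ) = ⋃ n, Set.Iic (gridL n s) ×ˢ Set.univ := by
        rw [← iUnion_Iic_gridL S hs, Set.iUnion_prod_const]
      dsimp only
      rw [this, setLIntegral_iUnion_of_directed]
      intro n m
      rcases le_total (gridL n s) (gridL m s) with h | h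
      · exact ⟨m, Set.prod_mono (Set.Iic_subset_Iic.2 h) le_rfl, le_rfl⟩
      · exact ⟨n, le_rfl, Set.prod_mono (Set.Iic_subset_Iic.2 h) le_rfl⟩
  simp only [e]
  exact Measurable.iSup fun n => measurable_gridL_predictable h n

end ChainSetup
end MFChain
end

noncomputable section

namespace MFChain
variable {T : ℝ} [Fact (0 ≤ T)] {Ω : Type*} [mΩ : MeasurableSpace Ω]

/-! ### Stochastic integrals -/

instance {μ : Measure (Time T × ℕ)} [IsFiniteMeasure μ] : SFinite μ :=
  @instSFiniteOfSigmaFinite _ _ _ (IsFiniteMeasure.toSigmaFinite μ)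

/-- A family of predictable processes indexed by the states. -/
def Pred {E : Type*} [MeasurableSpace E] (𝔽 : Filtration (Time T) mΩ) (q : Time T → Ω → ℕ → E) :
    Prop :=
  ∀ j, Measurable[𝔽.predictable] fun z : Time T × Ω => q z.1 z.2 j

/-- The integral of `φ` over `[0,T]` against the jump measure minus its compensator. -/
def sT (g : ℕ → ℕ → ℝ) (x : ChainPath T) (φ : Time T × ℕ → ℝ) : ℝ :=
  ∫ z, φ z ∂jm x - ∫ z, φ z ∂cm g x

/-- Here the measure depends on the parameter and is only known through its lower integrals. The
integral is a difference of two of them where the absolute integral is finite, and the default value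
`0` elsewhere. -/
theorem measurable_integral_of_lintegral {α β : Type*} [MeasurableSpace α] {m : MeasurableSpace β}
    {μ : β → Measure α} {φ : β → α → ℝ} (hφ : ∀ b, AEStronglyMeasurable (φ b) (μ b))
    (h1 : Measurable fun b => ∫⁻ a, ENNReal.ofReal (φ b a) ∂μ b)
    (h2 : Measurable fun b => ∫⁻ a, ENNReal.ofReal (-φ b a) ∂μ b)
    (h3 : Measurable fun b => ∫⁻ a, ‖φ b a‖ₑ ∂μ b) :
    Measurable fun b => ∫ a, φ b a ∂μ b := by
  classical
  have e : (fun b => ∫ a, φ b a ∂μ b) = fun b => if ∫⁻ a, ‖φ b a‖ₑ ∂μ b < ∞ then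
      (∫⁻ a, ENNReal.ofReal (φ b a) ∂μ b).toReal - (∫⁻ a, ENNReal.ofReal (-φ b a) ∂μ b).toReal
      else 0 := by
    ext b
    split_ifs with h
    · exact integral_eq_lintegral_pos_part_sub_lintegral_neg_part ⟨hφ b, h⟩
    · exact integral_undef fun hi => h hi.2
  rw [e]
  exact Measurable.ite (measurableSet_lt h3 measurable_const)
    (h1.ennreal_toReal.sub h2.ennreal_toReal) measurable_const

theorem ae_integrable_of_lintegral {α β : Type*} [MeasurableSpace α] [MeasurableSpace β]
    {P : Measure β} {μ : β → Measure α} {φ : β → α → ℝ}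
    (hφ : ∀ b, AEStronglyMeasurable (φ b) (μ b))
    (hm : Measurable fun b => ∫⁻ a, ‖φ b a‖ₑ ∂μ b)
    (h : ∫⁻ b, (∫⁻ a, ‖φ b a‖ₑ ∂μ b) ∂P ≠ ∞) : ∀ᵐ b ∂P, Integrable (φ b) (μ b) := by
  filter_upwards [ae_lt_top hm h] with b hb
  exact ⟨hφ b, hb⟩

theorem integrable_integral_of_lintegral {α β : Type*} [MeasurableSpace α] [MeasurableSpace β]
    {P : Measure β} {μ : β → Measure α} {φ : β → α → ℝ}
    (hm : Measurable fun b => ∫ a, φ b a ∂μ b)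
    (h : ∫⁻ b, (∫⁻ a, ‖φ b a‖ₑ ∂μ b) ∂P ≠ ∞) : Integrable (fun b => ∫ a, φ b a ∂μ b) P :=
  ⟨hm.aestronglyMeasurable, (lintegral_mono fun _ =>
    enorm_integral_le_lintegral_enorm _).trans_lt h.lt_top⟩

theorem integral_integral_eq_toReal_sub {α β : Type*} [MeasurableSpace α] [MeasurableSpace β]
    {P : Measure β} {μ : β → Measure α} {φ : β → α → ℝ}
    (hφ : ∀ b, AEStronglyMeasurable (φ b) (μ b))
    (h1 : Measurable fun b => ∫⁻ a, ENNReal.ofReal (φ b a) ∂μ b)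
    (h2 : Measurable fun b => ∫⁻ a, ENNReal.ofReal (-φ b a) ∂μ b)
    (h3 : Measurable fun b => ∫⁻ a, ‖φ b a‖ₑ ∂μ b)
    (h : ∫⁻ b, (∫⁻ a, ‖φ b a‖ₑ ∂μ b) ∂P ≠ ∞) :
    ∫ b, (∫ a, φ b a ∂μ b) ∂P = (∫⁻ b, (∫⁻ a, ENNReal.ofReal (φ b a) ∂μ b) ∂P).toReal -
      (∫⁻ b, (∫⁻ a, ENNReal.ofReal (-φ b a) ∂μ b) ∂P).toReal := by
  have hle1 : ∫⁻ b, (∫⁻ a, ENNReal.ofReal (φ b a) ∂μ b) ∂P ≠ ∞ :=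
    ne_top_of_le_ne_top h (lintegral_mono fun b => lintegral_mono fun a => by
      rw [← ofReal_norm]; exact ENNReal.ofReal_le_ofReal (le_abs_self _))
  have hle2 : ∫⁻ b, (∫⁻ a, ENNReal.ofReal (-φ b a) ∂μ b) ∂P ≠ ∞ :=
    ne_top_of_le_ne_top h (lintegral_mono fun b => lintegral_mono fun a => by
      rw [← ofReal_norm]; exact ENNReal.ofReal_le_ofReal (neg_le_abs _))
  have e : ∀ᵐ b ∂P, ∫ a, φ b a ∂μ b = (∫⁻ a, ENNReal.ofReal (φ b a) ∂μ b).toReal -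
      (∫⁻ a, ENNReal.ofReal (-φ b a) ∂μ b).toReal := by
    filter_upwards [ae_integrable_of_lintegral hφ h3 h] with b hb
    exact integral_eq_lintegral_pos_part_sub_lintegral_neg_part hb
  rw [integral_congr_ae e, integral_sub
    (integrable_toReal_of_lintegral_ne_top h1.aemeasurable hle1)
    (integrable_toReal_of_lintegral_ne_top h2.aemeasurable hle2),
    integral_toReal h1.aemeasurable (ae_lt_top h1 hle1),
    integral_toReal h2.aemeasurable (ae_lt_top h2 hle2)]

/-- The product of two integrals, split according to the order of the times. -/
theorem integral_mul_integral_split {α β : Measure (Time T × ℕ)} [SFinite α] [SFinite β]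
    {φ : Time T × ℕ → ℝ} (hα : Integrable φ α) (hβ : Integrable φ β) :
    (∫ z, φ z ∂α) * ∫ w, φ w ∂β =
      ∫ w, φ w * (∫ z in Set.Iio w.1 ×ˢ Set.univ, φ z ∂α) ∂β +
      ∫ z, φ z * (∫ w in Set.Iio z.1 ×ˢ Set.univ, φ w ∂β) ∂α +
      ∫ w, φ w * (∫ z in {w.1} ×ˢ Set.univ, φ z ∂α) ∂β := by
  have hi : Integrable (fun p : (Time T × ℕ) × (Time T × ℕ) => φ p.1 * φ p.2) (α.prod β) :=
    hα.mul_prod hβ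
  rw [← integral_prod_mul]
  have m1 : MeasurableSet {p : (Time T × ℕ) × (Time T × ℕ) | p.1.1 < p.2.1} :=
    measurableSet_lt (measurable_fst.comp measurable_fst) (measurable_fst.comp measurable_snd)
  have m2 : MeasurableSet {p : (Time T × ℕ) × (Time T × ℕ) | p.2.1 < p.1.1} :=
    measurableSet_lt (measurable_fst.comp measurable_snd) (measurable_fst.comp measurable_fst)
  have m3 : MeasurableSet {p : (Time T × ℕ) × (Time T × ℕ) | p.1.1 = p.2.1} :=
    measurableSet_eq_fun (measurable_fst.comp measurable_fst) (measurable_fst.comp measurable_snd)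
  set F := fun p : (Time T × ℕ) × (Time T × ℕ) => φ p.1 * φ p.2
  have hsplit : ∀ p, F p = Set.indicator {p | p.1.1 < p.2.1} F p
      + Set.indicator {p | p.2.1 < p.1.1} F p + Set.indicator {p | p.1.1 = p.2.1} F p := by
    intro p
    rcases lt_trichotomy p.1.1 p.2.1 with h | h | h
    · simp [h, h.not_gt, h.ne]
    · simp [h]
    · simp [h, h.not_gt, h.ne']
  have e1 : ∫ p, Set.indicator {p | p.1.1 < p.2.1} F p ∂(α.prod β) =
      ∫ w, φ w * (∫ z in Set.Iio w.1 ×ˢ Set.univ, φ z ∂α) ∂β := by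
    rw [integral_prod_symm _ (hi.indicator m1)]
    refine integral_congr_ae (Eventually.of_forall fun w => ?_)
    dsimp only
    rw [← integral_const_mul, ← integral_indicator (measurableSet_Iio.prod MeasurableSet.univ)]
    refine integral_congr_ae (Eventually.of_forall fun z => ?_)
    by_cases h : z.1 < w.1 <;> simp [h, F, mul_comm]
  have e2 : ∫ p, Set.indicator {p | p.2.1 < p.1.1} F p ∂(α.prod β) =
      ∫ z, φ z * (∫ w in Set.Iio z.1 ×ˢ Set.univ, φ w ∂β) ∂α := by
    rw [integral_prod _ (hi.indicator m2)]
    refine integral_congr_ae (Eventually.of_forall fun z => ?_)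
    dsimp only
    rw [← integral_const_mul, ← integral_indicator (measurableSet_Iio.prod MeasurableSet.univ)]
    refine integral_congr_ae (Eventually.of_forall fun w => ?_)
    by_cases h : w.1 < z.1 <;> simp [h, F]
  have e3 : ∫ p, Set.indicator {p | p.1.1 = p.2.1} F p ∂(α.prod β) =
      ∫ w, φ w * (∫ z in {w.1} ×ˢ Set.univ, φ z ∂α) ∂β := by
    rw [integral_prod_symm _ (hi.indicator m3)]
    refine integral_congr_ae (Eventually.of_forall fun w => ?_)
    dsimp only
    rw [← integral_const_mul,
      ← integral_indicator ((measurableSet_singleton w.1).prod MeasurableSet.univ)]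
    refine integral_congr_ae (Eventually.of_forall fun z => ?_)
    by_cases h : z.1 = w.1 <;> simp [h, F, mul_comm]
  rw [integral_congr_ae (Eventually.of_forall hsplit), integral_add _ (hi.indicator m3),
    integral_add (hi.indicator m1) (hi.indicator m2), e1, e2, e3]
  exact (hi.indicator m1).add (hi.indicator m2)

/-- The left limit of the stochastic integral of `φ`. -/
def sLeft (g : ℕ → ℕ → ℝ) (x : ChainPath T) (φ : Time T × ℕ → ℝ) (s : Time T) : ℝ :=
  ∫ z in Set.Iio s ×ˢ Set.univ, φ z ∂jm x - ∫ z in Set.Iio s ×ˢ Set.univ, φ z ∂cm g x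

/-- Integration by parts for the square of a stochastic integral. -/
theorem sT_sq {g : ℕ → ℕ → ℝ} (hg : IsQMatrix g) (x : ChainPath T) {φ : Time T × ℕ → ℝ}
    (hφ : Measurable φ) {c : ℝ} (hc : ∀ z, |φ z| ≤ c)  :
    sT g x φ ^ 2 = 2 * sT g x (fun z => φ z * sLeft g x φ z.1) + ∫ z, φ z ^ 2 ∂jm x := by
  classical
  have := isFiniteMeasure_cm hg x
  have hbd : ∀ {μ : Measure (Time T × ℕ)} [IsFiniteMeasure μ], Integrable φ μ := fun {μ} _ =>
    Integrable.of_bound hφ.aestronglyMeasurable c (Eventually.of_forall hc)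
  have hmI : ∀ {μ : Measure (Time T × ℕ)} [IsFiniteMeasure μ], Measurable fun w : Time T × ℕ =>
      ∫ z in Set.Iio w.1 ×ˢ Set.univ, φ z ∂μ := fun {μ} _ => by
    have h1 : Measurable fun p : (Time T × ℕ) × (Time T × ℕ) =>
        Set.indicator {p | p.2.1 < p.1.1} (fun p => φ p.2) p :=
      (hφ.comp measurable_snd).indicator (measurableSet_lt (measurable_fst.comp measurable_snd)
        (measurable_fst.comp measurable_fst))
    have h2 := (h1.stronglyMeasurable.integral_prod_right' (ν := μ)).measurable
    convert h2 using 2 with w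
    rw [← integral_indicator (measurableSet_Iio.prod MeasurableSet.univ)]
    refine integral_congr_ae (Eventually.of_forall fun z => ?_)
    by_cases h : z.1 < w.1 <;> simp [h]
  have hII : ∀ {μ ν : Measure (Time T × ℕ)} [IsFiniteMeasure μ] [IsFiniteMeasure ν],
      Integrable (fun w => φ w * ∫ z in Set.Iio w.1 ×ˢ Set.univ, φ z ∂μ) ν := fun {μ ν} _ _ => by
    refine (hbd (μ := ν)).mul_bdd (c := c * μ.real Set.univ) hmI.aestronglyMeasurable
      (Eventually.of_forall fun w => ?_)
    refine (norm_setIntegral_le_of_norm_le_const (C := c) (measure_lt_top _ _)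
      fun z _ => hc z).trans ?_
    have h0 : 0 ≤ c := (abs_nonneg _).trans (hc w)
    exact mul_le_mul_of_nonneg_left (measureReal_mono (Set.subset_univ _)) h0
  -- With `J` and `C` the integrals against jumps and compensator, `(J - C)² = J² - 2CJ + C²`, and
  -- each product is split by the order of the two times. The compensator has no atoms in time, so a
  -- diagonal survives in `J²` only, where it is the sum of the squared jumps.
  have hJJ := integral_mul_integral_split (α := jm x) (β := jm x) (φ := φ) hbd hbd
  have hJC := integral_mul_integral_split (α := cm g x) (β := jm x) (φ := φ) hbd hbd
  have hCC := integral_mul_integral_split (α := cm g x) (β := cm g x) (φ := φ) hbd hbd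
  have hz : ∀ t : Time T, ∫ z in {t} ×ˢ Set.univ, φ z ∂cm g x = 0 := fun t => by
    rw [Measure.restrict_eq_zero.2 (cm_singleton_prod g x t), integral_zero_measure]
  have hd : ∫ w, φ w * (∫ z in {w.1} ×ˢ Set.univ, φ z ∂jm x) ∂jm x = ∫ z, φ z ^ 2 ∂jm x := by
    rw [integral_jm, integral_jm]
    refine Finset.sum_congr rfl fun s hs => ?_
    rw [setIntegral_jm _ _ (measurableSet_singleton _), Finset.sum_filter]
    simp [hs, sq]
  simp only [hz, mul_zero, integral_zero, add_zero] at hJC hCC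
  rw [hd] at hJJ
  have e : ∀ {ν : Measure (Time T × ℕ)} [IsFiniteMeasure ν],
      ∫ z, φ z * sLeft g x φ z.1 ∂ν = ∫ w, φ w * (∫ z in Set.Iio w.1 ×ˢ Set.univ, φ z ∂jm x) ∂ν -
        ∫ w, φ w * (∫ z in Set.Iio w.1 ×ˢ Set.univ, φ z ∂cm g x) ∂ν := fun {ν} _ => by
    rw [← integral_sub hII hII]
    simp only [sLeft, mul_sub]
  rw [sT, sT, e, e]
  linear_combination hJJ - 2 * hJC + hCC

end MFChain
end

/-! ### The isometry for bounded integrands -/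

noncomputable section

namespace MFChain
variable {T : ℝ} [Fact (0 ≤ T)] {Ω : Type*} [mΩ : MeasurableSpace Ω]

/-- The squared norm `E ∫ ‖q‖²` of an integrand. -/
def nsq (g : ℕ → ℕ → ℝ) (Pm : Measure Ω) (X : Ω → ChainPath T) (q : Time T → Ω → ℕ → ℝ) : ℝ≥0∞ :=
  ∫⁻ ω, (∫⁻ z, ‖q z.1 ω z.2‖ₑ ^ 2 ∂cm g (X ω)) ∂Pm

section
variable {𝔽 : Filtration (Time T) mΩ} {q : Time T → Ω → ℕ → ℝ}

theorem Pred.neg (hq : Pred 𝔽 q) : Pred 𝔽 fun s ω j => -q s ω j :=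
  fun j => measurable_neg.comp (hq j)

theorem Pred.enorm (hq : Pred 𝔽 q) : Pred 𝔽 fun s ω j => ‖q s ω j‖ₑ :=
  fun j => measurable_enorm.comp (hq j)

theorem Pred.ofReal (hq : Pred 𝔽 q) : Pred 𝔽 fun s ω j => ENNReal.ofReal (q s ω j) :=
  fun j => ENNReal.measurable_ofReal.comp (hq j)

theorem Pred.sq (hq : Pred 𝔽 q) : Pred 𝔽 fun s ω j => q s ω j ^ 2 :=
  fun j => (measurable_id.pow_const 2).comp (hq j)

theorem Pred.enorm_sq (hq : Pred 𝔽 q) : Pred 𝔽 fun s ω j => ‖q s ω j‖ₑ ^ 2 :=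
  fun j => (measurable_enorm.pow_const 2).comp (hq j)

end

theorem eLpNorm_two_eq {α : Type*} {m : MeasurableSpace α} {μ : Measure α} (f : α → ℝ) :
    eLpNorm f 2 μ = (∫⁻ a, ‖f a‖ₑ ^ 2 ∂μ) ^ (1 / 2 : ℝ) := by
  rw [eLpNorm_eq_lintegral_rpow_enorm_toReal (by simp) (by simp)]
  simp

/-- At most `n + 1` jumps are preceded by at most `n` jumps. -/
theorem jm_few (x : ChainPath T) (n : ℕ) :
    jm x {z | jm x (Set.Iio z.1 ×ˢ Set.univ) ≤ n} ≤ n + 1 := by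
  classical
  have hI : ∀ s, jm x (Set.Iio s ×ˢ Set.univ) = ((jumps x).filter (· < s)).card := fun s => by
    rw [← setLIntegral_one, setLIntegral_jm x _ measurableSet_Iio]
    simp
  simp only [hI, Nat.cast_le]
  set F := (jumps x).filter fun s => ((jumps x).filter (· < s)).card ≤ n with hF
  have h1 : jm x {z | ((jumps x).filter (· < z.1)).card ≤ n} = F.card := by
    rw [jm, Measure.finsetSum_apply, hF, Finset.card_filter, Nat.cast_sum]
    refine Finset.sum_congr rfl fun s _ => ?_
    rw [Measure.dirac_apply]
    by_cases h : ((jumps x).filter (· < s)).card ≤ n <;> simp [h]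
  rw [h1]
  have : F.card ≤ n + 1 := by
    rcases F.eq_empty_or_nonempty with h | h
    · simp [h]
    -- Every other jump in `F` precedes the last one, `m`, and `m` itself is preceded by at most `n`
    -- jumps.
    · set m := F.max' h
      have hm : m ∈ F := F.max'_mem h
      have hsub : F ⊆ insert m ((jumps x).filter (· < m)) := fun s hs => by
        rcases (F.le_max' s hs).eq_or_lt with h | h
        · exact Finset.mem_insert.2 (Or.inl h)
        · exact Finset.mem_insert_of_mem (Finset.mem_filter.2 ⟨(Finset.mem_filter.1 hs).1, h⟩)
      exact (Finset.card_le_card hsub).trans ((Finset.card_insert_le _ _).trans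
        (Nat.succ_le_succ (Finset.mem_filter.1 hm).2))
  exact_mod_cast this

namespace ChainSetup

variable {g : ℕ → ℕ → ℝ} {Pm : Measure Ω} {𝔽 : Filtration (Time T) mΩ} {X : Ω → ChainPath T}
  (S : ChainSetup g Pm 𝔽 X)
include S

theorem finite_cm (ω : Ω) : IsFiniteMeasure (cm g (X ω)) := isFiniteMeasure_cm S.qmat _

theorem measurable_lintegral_jm {f : Time T → Ω → ℕ → ℝ≥0∞} (hf : Pred 𝔽 f) :
    Measurable fun ω => ∫⁻ z, f z.1 ω z.2 ∂jm (X ω) := by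
  simpa using (S.measurable_setLIntegral_jm hf ⊤).mono (𝔽.le _) le_rfl

theorem measurable_lintegral_cm {f : Time T → Ω → ℕ → ℝ≥0∞} (hf : Pred 𝔽 f) :
    Measurable fun ω => ∫⁻ z, f z.1 ω z.2 ∂cm g (X ω) := by
  simpa using (S.measurable_setLIntegral_cm hf ⊤).mono (𝔽.le _) le_rfl

variable {q : Time T → Ω → ℕ → ℝ}

theorem measurable_setIntegral_jm (hq : Pred 𝔽 q) (t : Time T) :
    Measurable[𝔽 t] fun ω => ∫ z in Set.Iic t ×ˢ Set.univ, q z.1 ω z.2 ∂jm (X ω) :=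
  measurable_integral_of_lintegral (fun ω => (S.measurable_mark hq ω).aestronglyMeasurable)
    (S.measurable_setLIntegral_jm (f := fun s ω j => ENNReal.ofReal (q s ω j)) hq.ofReal t)
    (S.measurable_setLIntegral_jm (f := fun s ω j => ENNReal.ofReal (-q s ω j)) hq.neg.ofReal t)
    (S.measurable_setLIntegral_jm (f := fun s ω j => ‖q s ω j‖ₑ) hq.enorm t)

theorem measurable_setIntegral_cm (hq : Pred 𝔽 q) (t : Time T) :
    Measurable[𝔽 t] fun ω => ∫ z in Set.Iic t ×ˢ Set.univ, q z.1 ω z.2 ∂cm g (X ω) :=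
  measurable_integral_of_lintegral (fun ω => (S.measurable_mark hq ω).aestronglyMeasurable)
    (S.measurable_setLIntegral_cm (f := fun s ω j => ENNReal.ofReal (q s ω j)) hq.ofReal t)
    (S.measurable_setLIntegral_cm (f := fun s ω j => ENNReal.ofReal (-q s ω j)) hq.neg.ofReal t)
    (S.measurable_setLIntegral_cm (f := fun s ω j => ‖q s ω j‖ₑ) hq.enorm t)

theorem measurable_integral_jm (hq : Pred 𝔽 q) :
    Measurable fun ω => ∫ z, q z.1 ω z.2 ∂jm (X ω) := by
  simpa using (S.measurable_setIntegral_jm hq ⊤).mono (𝔽.le _) le_rfl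

theorem measurable_integral_cm (hq : Pred 𝔽 q) :
    Measurable fun ω => ∫ z, q z.1 ω z.2 ∂cm g (X ω) := by
  simpa using (S.measurable_setIntegral_cm hq ⊤).mono (𝔽.le _) le_rfl

theorem measurable_sT (hq : Pred 𝔽 q) : Measurable fun ω => sT g (X ω) fun z => q z.1 ω z.2 :=
  (S.measurable_integral_jm hq).sub (S.measurable_integral_cm hq)

variable [IsProbabilityMeasure Pm]

theorem measurable_setLIntegral_Iio_jm {f : Time T → Ω → ℕ → ℝ≥0∞} (hf : Pred 𝔽 f) :
    Measurable[𝔽.predictable]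
      fun z : Time T × Ω => ∫⁻ w in Set.Iio z.1 ×ˢ Set.univ, f w.1 z.2 w.2 ∂jm (X z.2) :=
  S.measurable_setLIntegral_Iio (fun _ => jm_bot_prod _ _) (S.measurable_setLIntegral_jm hf)

theorem measurable_setLIntegral_Iio_cm {f : Time T → Ω → ℕ → ℝ≥0∞} (hf : Pred 𝔽 f) :
    Measurable[𝔽.predictable]
      fun z : Time T × Ω => ∫⁻ w in Set.Iio z.1 ×ˢ Set.univ, f w.1 z.2 w.2 ∂cm g (X z.2) :=
  S.measurable_setLIntegral_Iio (fun _ => cm_singleton_prod _ _ _)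
    (S.measurable_setLIntegral_cm hf)

theorem measurable_sLeft (hq : Pred 𝔽 q) : Measurable[𝔽.predictable]
    fun z : Time T × Ω => sLeft g (X z.2) (fun w => q w.1 z.2 w.2) z.1 := by
  refine Measurable.sub (m := 𝔽.predictable) ?_ ?_
  · exact measurable_integral_of_lintegral
      (fun z => (S.measurable_mark hq z.2).aestronglyMeasurable)
      (S.measurable_setLIntegral_Iio_jm (f := fun s ω j => ENNReal.ofReal (q s ω j)) hq.ofReal)
      (S.measurable_setLIntegral_Iio_jm (f := fun s ω j => ENNReal.ofReal (-q s ω j)) hq.neg.ofReal)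
      (S.measurable_setLIntegral_Iio_jm (f := fun s ω j => ‖q s ω j‖ₑ) hq.enorm)
  · exact measurable_integral_of_lintegral
      (fun z => (S.measurable_mark hq z.2).aestronglyMeasurable)
      (S.measurable_setLIntegral_Iio_cm (f := fun s ω j => ENNReal.ofReal (q s ω j)) hq.ofReal)
      (S.measurable_setLIntegral_Iio_cm (f := fun s ω j => ENNReal.ofReal (-q s ω j)) hq.neg.ofReal)
      (S.measurable_setLIntegral_Iio_cm (f := fun s ω j => ‖q s ω j‖ₑ) hq.enorm)

/-- The compensator formula for integrable real integrands. -/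
theorem integral_jm_eq (hq : Pred 𝔽 q)
    (h : ∫⁻ ω, (∫⁻ z, ‖q z.1 ω z.2‖ₑ ∂cm g (X ω)) ∂Pm ≠ ∞) :
    Integrable (fun ω => ∫ z, q z.1 ω z.2 ∂jm (X ω)) Pm ∧
    Integrable (fun ω => ∫ z, q z.1 ω z.2 ∂cm g (X ω)) Pm ∧
    ∫ ω, (∫ z, q z.1 ω z.2 ∂jm (X ω)) ∂Pm = ∫ ω, (∫ z, q z.1 ω z.2 ∂cm g (X ω)) ∂Pm := by
  have hj : ∫⁻ ω, (∫⁻ z, ‖q z.1 ω z.2‖ₑ ∂jm (X ω)) ∂Pm ≠ ∞ := by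
    rwa [S.lintegral_lintegral_jm (f := fun s ω j => ‖q s ω j‖ₑ) hq.enorm]
  refine ⟨integrable_integral_of_lintegral (S.measurable_integral_jm hq) hj,
    integrable_integral_of_lintegral (S.measurable_integral_cm hq) h, ?_⟩
  rw [integral_integral_eq_toReal_sub
      (fun ω => (S.measurable_mark hq ω).aestronglyMeasurable)
      (S.measurable_lintegral_jm (f := fun s ω j => ENNReal.ofReal (q s ω j)) hq.ofReal)
      (S.measurable_lintegral_jm (f := fun s ω j => ENNReal.ofReal (-q s ω j)) hq.neg.ofReal)
      (S.measurable_lintegral_jm (f := fun s ω j => ‖q s ω j‖ₑ) hq.enorm) hj,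
    integral_integral_eq_toReal_sub
      (fun ω => (S.measurable_mark hq ω).aestronglyMeasurable)
      (S.measurable_lintegral_cm (f := fun s ω j => ENNReal.ofReal (q s ω j)) hq.ofReal)
      (S.measurable_lintegral_cm (f := fun s ω j => ENNReal.ofReal (-q s ω j)) hq.neg.ofReal)
      (S.measurable_lintegral_cm (f := fun s ω j => ‖q s ω j‖ₑ) hq.enorm) h,
    S.lintegral_lintegral_jm (f := fun s ω j => ENNReal.ofReal (q s ω j)) hq.ofReal,
    S.lintegral_lintegral_jm (f := fun s ω j => ENNReal.ofReal (-q s ω j)) hq.neg.ofReal]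

theorem integral_sT_of_lintegral (hq : Pred 𝔽 q)
    (h : ∫⁻ ω, (∫⁻ z, ‖q z.1 ω z.2‖ₑ ∂cm g (X ω)) ∂Pm ≠ ∞) :
    Integrable (fun ω => sT g (X ω) fun z => q z.1 ω z.2) Pm ∧
    ∫ ω, sT g (X ω) (fun z => q z.1 ω z.2) ∂Pm = 0 := by
  obtain ⟨h1, h2, h3⟩ := S.integral_jm_eq hq h
  refine ⟨h1.sub h2, ?_⟩
  simp only [sT]
  rw [integral_sub h1 h2, h3, sub_self]

/-- The isometry for bounded integrands supported on boundedly many jumps. -/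
theorem lintegral_sT_sq_of_bdd (hq : Pred 𝔽 q) {c : ℝ} {M : NNReal} (hc : ∀ s ω j, |q s ω j| ≤ c)
    (hj : ∀ ω, ∫⁻ z, ‖q z.1 ω z.2‖ₑ ∂jm (X ω) ≤ M)
    (hM : ∀ ω, ∫⁻ z, ‖q z.1 ω z.2‖ₑ ∂cm g (X ω) ≤ M) :
    ∫⁻ ω, ‖sT g (X ω) fun z => q z.1 ω z.2‖ₑ ^ 2 ∂Pm = nsq g Pm X q := by
  -- The integral of `|q|` is at most `M` against either measure, so the left limit of the
  -- stochastic integral is at most `2M`. Hence `q * sLeft` is an integrable predictable integrand,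
  -- its stochastic integral has mean zero, and taking means in `sT_sq` leaves only the integral of
  -- `q²` against the jump measure.
  have hbd : ∀ ω s, |sLeft g (X ω) (fun z => q z.1 ω z.2) s| ≤ 2 * M := fun ω s => by
    have key : ∀ μ : Measure (Time T × ℕ), ∫⁻ z, ‖q z.1 ω z.2‖ₑ ∂μ ≤ M →
        |∫ z in Set.Iio s ×ˢ Set.univ, q z.1 ω z.2 ∂μ| ≤ M := fun μ hμ => by
      have h1 := (enorm_integral_le_lintegral_enorm
        (μ := μ.restrict (Set.Iio s ×ˢ Set.univ)) fun z => q z.1 ω z.2).trans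
        ((setLIntegral_le_lintegral _ _).trans hμ)
      rw [← ofReal_norm, ENNReal.ofReal_le_coe] at h1
      exact h1
    refine (abs_sub _ _).trans ?_
    rw [two_mul]
    exact add_le_add (key _ (hj ω)) (key _ (hM ω))
  have hn1 : ∫⁻ ω, (∫⁻ z, ‖q z.1 ω z.2‖ₑ ∂cm g (X ω)) ∂Pm ≤ M :=
    (lintegral_mono hM).trans (by simp)
  have hqX : Pred 𝔽 fun s ω j => q s ω j * sLeft g (X ω) (fun z => q z.1 ω z.2) s := fun j =>
    (hq j).mul (S.measurable_sLeft hq)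
  have hq2 : Pred 𝔽 fun s ω j => q s ω j ^ 2 := hq.sq
  have hfin : ∀ (r : Time T → Ω → ℕ → ℝ) (C : ℝ), (∀ s ω j, |r s ω j| ≤ C * |q s ω j|) →
      ∫⁻ ω, (∫⁻ z, ‖r z.1 ω z.2‖ₑ ∂cm g (X ω)) ∂Pm ≠ ∞ := fun r C hr => by
    refine ne_top_of_le_ne_top (b := ENNReal.ofReal C * M) (by finiteness) ?_
    calc _ ≤ ∫⁻ ω, (∫⁻ z, ENNReal.ofReal C * ‖q z.1 ω z.2‖ₑ ∂cm g (X ω)) ∂Pm := by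
          refine lintegral_mono fun ω => lintegral_mono fun z => ?_
          rcases le_or_gt 0 C with h0 | h0
          · rw [← ofReal_norm, ← ofReal_norm, ← ENNReal.ofReal_mul h0]
            exact ENNReal.ofReal_le_ofReal (hr _ _ _)
          · have h2 := hr z.1 ω z.2
            have h3 : |r z.1 ω z.2| = 0 := le_antisymm
              (h2.trans (mul_nonpos_of_nonpos_of_nonneg h0.le (abs_nonneg _))) (abs_nonneg _)
            simp [abs_eq_zero.1 h3]
      _ = ENNReal.ofReal C * ∫⁻ ω, (∫⁻ z, ‖q z.1 ω z.2‖ₑ ∂cm g (X ω)) ∂Pm := by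
          rw [← lintegral_const_mul' _ _ ENNReal.ofReal_ne_top]
          exact lintegral_congr fun ω => lintegral_const_mul' _ _ ENNReal.ofReal_ne_top
      _ ≤ _ := by gcongr
  obtain ⟨i1, i2⟩ := S.integral_sT_of_lintegral hqX (hfin _ (2 * M) fun s ω j => by
    rw [abs_mul, mul_comm]; exact mul_le_mul_of_nonneg_right (hbd ω s) (abs_nonneg _))
  have hsq : ∀ s ω j, |q s ω j ^ 2| ≤ c * |q s ω j| := fun s ω j => by
    rw [abs_pow, sq]; exact mul_le_mul_of_nonneg_right (hc _ _ _) (abs_nonneg _)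
  obtain ⟨j1, j2, j3⟩ := S.integral_jm_eq hq2 (hfin _ c hsq)
  have hpt : ∀ ω, sT g (X ω) (fun z => q z.1 ω z.2) ^ 2 = 2 * sT g (X ω)
      (fun z => q z.1 ω z.2 * sLeft g (X ω) (fun w => q w.1 ω w.2) z.1) +
      ∫ z, q z.1 ω z.2 ^ 2 ∂jm (X ω) := fun ω =>
    sT_sq S.qmat (X ω) (S.measurable_mark hq ω) (c := c) fun z => hc _ _ _
  have hsqI : Integrable (fun ω => sT g (X ω) (fun z => q z.1 ω z.2) ^ 2) Pm := by
    simp only [hpt]; exact (i1.const_mul 2).add j1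
  have e1 : ∫ ω, sT g (X ω) (fun z => q z.1 ω z.2) ^ 2 ∂Pm =
      ∫ ω, (∫ z, q z.1 ω z.2 ^ 2 ∂jm (X ω)) ∂Pm := by
    simp only [hpt]
    rw [integral_add (i1.const_mul 2) j1, integral_const_mul, i2, mul_zero, zero_add]
  have hen : ∀ r : ℝ, ‖r‖ₑ ^ 2 = ENNReal.ofReal (r ^ 2) := fun r => by
    rw [← ofReal_norm, ← ENNReal.ofReal_pow (norm_nonneg _), Real.norm_eq_abs, sq_abs]
  rw [nsq, ← S.lintegral_lintegral_jm (f := fun s ω j => ‖q s ω j‖ₑ ^ 2) hq.enorm_sq]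
  simp only [hen]
  rw [← ofReal_integral_eq_lintegral_ofReal hsqI (Eventually.of_forall fun ω => sq_nonneg _), e1,
    ofReal_integral_eq_lintegral_ofReal j1
      (Eventually.of_forall fun ω => integral_nonneg fun z => sq_nonneg _)]
  exact lintegral_congr fun ω => ofReal_integral_eq_lintegral_ofReal (integrable_jm _ _)
    (Eventually.of_forall fun z => sq_nonneg _)

end ChainSetup
end MFChain
end

/-! ### Truncation and the isometry for square integrable integrands -/

noncomputable section

namespace MFChain
variable {T : ℝ} [Fact (0 ≤ T)] {Ω : Type*} [mΩ : MeasurableSpace Ω]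

section Linear
variable {g : ℕ → ℕ → ℝ} {x : ChainPath T} {φ ψ : Time T × ℕ → ℝ}

theorem sT_add (h1 : Integrable φ (cm g x)) (h2 : Integrable ψ (cm g x)) :
    sT g x (fun z => φ z + ψ z) = sT g x φ + sT g x ψ := by
  simp only [sT, integral_add h1 h2, integral_add (integrable_jm x φ) (integrable_jm x ψ)]
  ring

theorem sT_sub (h1 : Integrable φ (cm g x)) (h2 : Integrable ψ (cm g x)) :
    sT g x (fun z => φ z - ψ z) = sT g x φ - sT g x ψ := by
  simp only [sT, integral_sub h1 h2, integral_sub (integrable_jm x φ) (integrable_jm x ψ)]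
  ring

theorem sT_const_mul (c : ℝ) : sT g x (fun z => c * φ z) = c * sT g x φ := by
  simp only [sT, integral_const_mul]
  ring

end Linear

/-- The integrand `q` switched off when the state, the number of jumps so far or `q` exceed `n`. -/
def trunc (X : Ω → ChainPath T) (n : ℕ) (q : Time T → Ω → ℕ → ℝ) (s : Time T) (ω : Ω) (j : ℕ) : ℝ :=
  open Classical in
  if ((X ω).left s ≤ n ∧ jm (X ω) (Set.Iio s ×ˢ Set.univ) ≤ n) ∧ |q s ω j| ≤ n then q s ω j else 0

section Trunc
variable {X : Ω → ChainPath T} {q : Time T → Ω → ℕ → ℝ}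

theorem abs_trunc_le (n : ℕ) (s : Time T) (ω : Ω) (j : ℕ) : |trunc X n q s ω j| ≤ |q s ω j| := by
  unfold trunc; split_ifs <;> simp

theorem abs_trunc_le_nat (n : ℕ) (s : Time T) (ω : Ω) (j : ℕ) : |trunc X n q s ω j| ≤ n := by
  unfold trunc; split_ifs with h
  · exact h.2
  · simp

theorem eventually_trunc_eq (s : Time T) (ω : Ω) (j : ℕ) :
    ∀ᶠ n in atTop, trunc X n q s ω j = q s ω j := by
  obtain ⟨m, hm⟩ := ENNReal.exists_nat_gt (measure_ne_top (jm (X ω)) (Set.Iio s ×ˢ Set.univ))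
  filter_upwards [eventually_ge_atTop ((X ω).left s), eventually_ge_atTop m,
    eventually_ge_atTop ⌈|q s ω j|⌉₊] with n h1 h2 h3
  exact if_pos ⟨⟨h1, hm.le.trans (by exact_mod_cast h2)⟩, Nat.ceil_le.1 h3⟩

theorem tendsto_trunc (s : Time T) (ω : Ω) (j : ℕ) :
    Tendsto (fun n => trunc X n q s ω j) atTop (𝓝 (q s ω j)) :=
  tendsto_const_nhds.congr' ((eventually_trunc_eq s ω j).mono fun _ h => h.symm)

end Trunc

namespace ChainSetup

variable {g : ℕ → ℕ → ℝ} {Pm : Measure Ω} {𝔽 : Filtration (Time T) mΩ} {X : Ω → ChainPath T}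
  (S : ChainSetup g Pm 𝔽 X) {q r : Time T → Ω → ℕ → ℝ}
include S

variable [IsProbabilityMeasure Pm]

theorem pred_trunc (hq : Pred 𝔽 q) (n : ℕ) : Pred 𝔽 (trunc X n q) := fun j => by
  classical
  have h1 := S.measurable_left (measurableSet_Iic : MeasurableSet (Set.Iic n))
  have h2 := (S.measurable_setLIntegral_Iio_jm (f := fun _ _ _ => 1) fun j =>
    @measurable_const _ _ _ 𝔽.predictable _) (measurableSet_Iic : MeasurableSet (Set.Iic (n : ℝ≥0∞)))
  have h3 := (measurable_norm.comp (hq j)) (measurableSet_Iic : MeasurableSet (Set.Iic (n : ℝ)))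
  have h4 := @MeasurableSet.inter _ 𝔽.predictable _ _
    (@MeasurableSet.inter _ 𝔽.predictable _ _ h1 h2) h3
  have h5 := Measurable.indicator (hq j) h4
  convert h5 using 2 with z
  simp [trunc, Set.indicator_apply]

/-- At most `n + 1` jumps are preceded by at most `n` jumps, and each contributes at most `n`. The
bound on the state in `trunc` plays no part here: it serves the compensator, whose rates are bounded
over the states up to `n`. -/
theorem lintegral_trunc_jm_le (n : ℕ) (ω : Ω) :
    ∫⁻ z, ‖trunc X n q z.1 ω z.2‖ₑ ∂jm (X ω) ≤ ((n * (n + 1) : ℕ) : NNReal) := by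
  classical
  have hm : MeasurableSet {z : Time T × ℕ | jm (X ω) (Set.Iio z.1 ×ˢ Set.univ) ≤ n} := by
    have : Monotone fun s : Time T => jm (X ω) (Set.Iio s ×ˢ Set.univ) := fun s t h =>
      measure_mono (Set.prod_mono (Set.Iio_subset_Iio h) le_rfl)
    exact (this.measurable.comp measurable_fst) measurableSet_Iic
  calc _ ≤ ∫⁻ z, {z : Time T × ℕ | jm (X ω) (Set.Iio z.1 ×ˢ Set.univ) ≤ n}.indicator
        (fun _ => (n : ℝ≥0∞)) z ∂jm (X ω) := by
        refine lintegral_mono fun z => ?_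
        rw [Set.indicator_apply]
        split_ifs with h
        · rw [← ofReal_norm]
          exact ENNReal.ofReal_le_of_le_toReal (by simpa using abs_trunc_le_nat n z.1 ω z.2)
        · have h' : ¬ jm (X ω) (Set.Iio z.1 ×ˢ Set.univ) ≤ n := h
          simp [trunc, h']
    _ = n * jm (X ω) {z : Time T × ℕ | jm (X ω) (Set.Iio z.1 ×ˢ Set.univ) ≤ n} := by
        rw [lintegral_indicator hm]; simp
    _ ≤ n * (n + 1) := by gcongr; exact jm_few _ _
    _ = _ := by push_cast; rfl

theorem lintegral_trunc_cm_le (n : ℕ) : ∃ M : NNReal, ∀ ω,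
    ∫⁻ z, ‖trunc X n q z.1 ω z.2‖ₑ ∂cm g (X ω) ≤ M := by
  classical
  obtain ⟨C, hC⟩ := rate_le S.qmat n
  refine ⟨n * C * (volume (Set.univ : Set (Time T))).toNNReal, fun ω => ?_⟩
  have hm : MeasurableSet {s : Time T | (X ω).left s ≤ n} :=
    (X ω).measurable_left measurableSet_Iic
  calc _ ≤ ∫⁻ z, {z : Time T × ℕ | (X ω).left z.1 ≤ n}.indicator
        (fun _ => (n : ℝ≥0∞)) z ∂cm g (X ω) := by
        refine lintegral_mono fun z => ?_
        rw [Set.indicator_apply]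
        split_ifs with h
        · rw [← ofReal_norm]
          exact ENNReal.ofReal_le_of_le_toReal (by simpa using abs_trunc_le_nat n z.1 ω z.2)
        · have h' : ¬ (X ω).left z.1 ≤ n := h
          simp [trunc, h']
    _ ≤ ∫⁻ s : Time T, (n * C : NNReal) := by
        rw [lintegral_cm g (X ω) (f := {z : Time T × ℕ | (X ω).left z.1 ≤ n}.indicator fun _ => (n : ℝ≥0∞))
          (measurable_const.indicator (measurable_fst hm))]
        refine lintegral_mono fun s => ?_
        by_cases h : (X ω).left s ≤ n
        · have : ∀ j : ℕ, {z : Time T × ℕ | (X ω).left z.1 ≤ n}.indicator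
            (fun _ => (n : ℝ≥0∞)) (s, j) = n := fun j => Set.indicator_of_mem (by exact h) _
          simp only [this, lintegral_const]
          push_cast
          gcongr
          exact hC _ h
        · have : ∀ j : ℕ, {z : Time T × ℕ | (X ω).left z.1 ≤ n}.indicator
            (fun _ => (n : ℝ≥0∞)) (s, j) = 0 := fun j => Set.indicator_of_notMem (by exact h) _
          simp [this]
    _ = _ := by
        rw [lintegral_const]
        push_cast
        rw [ENNReal.coe_toNNReal (measure_ne_top _ _)]

theorem lintegral_sT_sq_trunc (hq : Pred 𝔽 q) (n : ℕ) :
    ∫⁻ ω, ‖sT g (X ω) fun z => trunc X n q z.1 ω z.2‖ₑ ^ 2 ∂Pm = nsq g Pm X (trunc X n q) := by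
  obtain ⟨M, hM⟩ := S.lintegral_trunc_cm_le (q := q) n
  refine S.lintegral_sT_sq_of_bdd (c := n) (M := (n * (n + 1) : ℕ) + M) (S.pred_trunc hq n)
    (fun _ _ _ => abs_trunc_le_nat _ _ _ _) (fun ω => ?_) fun ω => ?_
  · exact (S.lintegral_trunc_jm_le n ω).trans (by simp)
  · exact (hM ω).trans (by simp)

theorem integral_sT_trunc (hq : Pred 𝔽 q) (n : ℕ) :
    ∫ ω, sT g (X ω) (fun z => trunc X n q z.1 ω z.2) ∂Pm = 0 := by
  obtain ⟨M, hM⟩ := S.lintegral_trunc_cm_le (q := q) n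
  refine (S.integral_sT_of_lintegral (S.pred_trunc hq n) (ne_top_of_le_ne_top (b := (M : ℝ≥0∞))
    (by simp) ?_)).2
  exact (lintegral_mono hM).trans (by simp)

theorem memLp_cm (hq : Pred 𝔽 q) (hn : nsq g Pm X q ≠ ∞) :
    ∀ᵐ ω ∂Pm, MemLp (fun z : Time T × ℕ => q z.1 ω z.2) 2 (cm g (X ω)) := by
  filter_upwards [ae_lt_top (S.measurable_lintegral_cm hq.enorm_sq) hn] with ω hω
  refine ⟨(S.measurable_mark hq ω).aestronglyMeasurable, ?_⟩
  rw [eLpNorm_two_eq]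
  exact ENNReal.rpow_lt_top_of_nonneg (by norm_num) hω.ne

theorem ae_integrable_cm (hq : Pred 𝔽 q) (hn : nsq g Pm X q ≠ ∞) :
    ∀ᵐ ω ∂Pm, Integrable (fun z : Time T × ℕ => q z.1 ω z.2) (cm g (X ω)) := by
  filter_upwards [S.memLp_cm hq hn] with ω hω
  have := S.finite_cm ω
  exact hω.integrable (by norm_num)

theorem tendsto_nsq {f : ℕ → Time T → Ω → ℕ → ℝ} (hf : ∀ n, Pred 𝔽 (f n)) (hq : Pred 𝔽 q)
    (hn : nsq g Pm X q ≠ ∞) (hle : ∀ n s ω j, |f n s ω j| ≤ |q s ω j|)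
    (hlim : ∀ s ω j, Tendsto (fun n => f n s ω j) atTop (𝓝 (r s ω j))) :
    Tendsto (fun n => nsq g Pm X (f n)) atTop (𝓝 (nsq g Pm X r)) := by
  have hle' : ∀ n s ω j, ‖f n s ω j‖ₑ ^ 2 ≤ ‖q s ω j‖ₑ ^ 2 := fun n s ω j => by
    gcongr
    rw [← ofReal_norm, ← ofReal_norm]
    exact ENNReal.ofReal_le_ofReal (hle n s ω j)
  refine tendsto_lintegral_of_dominated_convergence
    (fun ω => ∫⁻ z, ‖q z.1 ω z.2‖ₑ ^ 2 ∂cm g (X ω))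
    (fun n => S.measurable_lintegral_cm (hf n).enorm_sq)
    (fun n => Eventually.of_forall fun ω => lintegral_mono fun z => hle' n _ _ _) hn ?_
  filter_upwards [ae_lt_top (S.measurable_lintegral_cm hq.enorm_sq) hn] with ω hω
  refine tendsto_lintegral_of_dominated_convergence (fun z => ‖q z.1 ω z.2‖ₑ ^ 2)
    (fun n => S.measurable_mark (f := fun s ω j => ‖f n s ω j‖ₑ ^ 2) (hf n).enorm_sq ω)
    (fun n => Eventually.of_forall fun z => hle' n _ _ _) hω.ne ?_
  refine Eventually.of_forall fun z => ?_
  exact ((ENNReal.continuous_pow 2).tendsto _).comp ((hlim z.1 ω z.2).enorm)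

omit [IsProbabilityMeasure Pm] in
theorem tendsto_sT {f : ℕ → Time T → Ω → ℕ → ℝ} (hf : ∀ n, Pred 𝔽 (f n)) {ω : Ω}
    (hi : Integrable (fun z : Time T × ℕ => q z.1 ω z.2) (cm g (X ω)))
    (hle : ∀ n s ω j, |f n s ω j| ≤ |q s ω j|)
    (hlim : ∀ s ω j, Tendsto (fun n => f n s ω j) atTop (𝓝 (r s ω j))) :
    Tendsto (fun n => sT g (X ω) fun z => f n z.1 ω z.2) atTop
      (𝓝 (sT g (X ω) fun z => r z.1 ω z.2)) := by
  refine Tendsto.sub ?_ ?_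
  · exact tendsto_integral_of_dominated_convergence (fun z => |q z.1 ω z.2|)
      (fun n => (S.measurable_mark (hf n) ω).aestronglyMeasurable) (integrable_jm _ _)
      (fun n => Eventually.of_forall fun z => hle n _ _ _)
      (Eventually.of_forall fun z => hlim _ _ _)
  · exact tendsto_integral_of_dominated_convergence (fun z => |q z.1 ω z.2|)
      (fun n => (S.measurable_mark (hf n) ω).aestronglyMeasurable) hi.abs
      (fun n => Eventually.of_forall fun z => hle n _ _ _)
      (Eventually.of_forall fun z => hlim _ _ _)

/-- Fatou's lemma along the truncations, for which the isometry is known and whose norms converge by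
dominated convergence. -/
theorem lintegral_sT_sq_le (hq : Pred 𝔽 q) (hn : nsq g Pm X q ≠ ∞) :
    ∫⁻ ω, ‖sT g (X ω) fun z => q z.1 ω z.2‖ₑ ^ 2 ∂Pm ≤ nsq g Pm X q := by
  calc _ ≤ ∫⁻ ω, liminf (fun n => ‖sT g (X ω) fun z => trunc X n q z.1 ω z.2‖ₑ ^ 2) atTop ∂Pm := by
        refine lintegral_mono_ae ?_
        filter_upwards [S.ae_integrable_cm hq hn] with ω hω
        refine (Tendsto.liminf_eq ?_).ge
        exact ((ENNReal.continuous_pow 2).tendsto _).comp (S.tendsto_sT (S.pred_trunc hq) hω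
          (fun n => abs_trunc_le n) tendsto_trunc).enorm
    _ ≤ liminf (fun n => ∫⁻ ω, ‖sT g (X ω) fun z => trunc X n q z.1 ω z.2‖ₑ ^ 2 ∂Pm) atTop :=
        lintegral_liminf_le fun n =>
          (measurable_enorm.pow_const 2).comp (S.measurable_sT (S.pred_trunc hq n))
    _ = nsq g Pm X q := by
        simp only [S.lintegral_sT_sq_trunc hq]
        exact (S.tendsto_nsq (S.pred_trunc hq) hq hn (fun n => abs_trunc_le n)
          tendsto_trunc).liminf_eq

theorem eLpNorm_sT_le (hq : Pred 𝔽 q) (hn : nsq g Pm X q ≠ ∞) :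
    eLpNorm (fun ω => sT g (X ω) fun z => q z.1 ω z.2) 2 Pm ≤ nsq g Pm X q ^ (1 / 2 : ℝ) := by
  rw [eLpNorm_two_eq]
  exact ENNReal.rpow_le_rpow (S.lintegral_sT_sq_le hq hn) (by norm_num)

theorem memLp_sT (hq : Pred 𝔽 q) (hn : nsq g Pm X q ≠ ∞) :
    MemLp (fun ω => sT g (X ω) fun z => q z.1 ω z.2) 2 Pm :=
  ⟨(S.measurable_sT hq).aestronglyMeasurable, (S.eLpNorm_sT_le hq hn).trans_lt
    (ENNReal.rpow_lt_top_of_nonneg (by norm_num) hn)⟩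

omit [IsProbabilityMeasure Pm] S in
theorem nsq_mono (h : ∀ s ω j, |r s ω j| ≤ |q s ω j|) : nsq g Pm X r ≤ nsq g Pm X q :=
  lintegral_mono fun ω => lintegral_mono fun z => by
    simp only [← ofReal_norm]
    gcongr
    exact h _ _ _

omit [IsProbabilityMeasure Pm] S in
theorem nsq_const_mul_ne_top (c : ℝ) (hn : nsq g Pm X q ≠ ∞) :
    nsq g Pm X (fun s ω j => c * q s ω j) ≠ ∞ := by
  have : nsq g Pm X (fun s ω j => c * q s ω j) = ‖c‖ₑ ^ 2 * nsq g Pm X q := by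
    simp only [nsq, enorm_mul, mul_pow]
    rw [← lintegral_const_mul' _ _ (by simp)]
    exact lintegral_congr fun ω => lintegral_const_mul' _ _ (by simp)
  rw [this]
  exact ENNReal.mul_ne_top (by simp) hn

theorem tendsto_nsq_sub_trunc (hq : Pred 𝔽 q) (hn : nsq g Pm X q ≠ ∞) :
    Tendsto (fun n => nsq g Pm X fun s ω j => q s ω j - trunc X n q s ω j) atTop (𝓝 0) := by
  have h0 : nsq g Pm X (fun _ _ _ => 0) = 0 := by simp [nsq]
  rw [← h0]
  refine S.tendsto_nsq (q := fun s ω j => 2 * q s ω j) (fun n j => (hq j).sub (S.pred_trunc hq n j))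
    (fun j => (measurable_const_mul 2).comp (hq j)) (nsq_const_mul_ne_top 2 hn)
    (fun n s ω j => ?_) fun s ω j => ?_
  · refine (abs_sub _ _).trans ?_
    rw [abs_mul, abs_two, two_mul]
    exact add_le_add le_rfl (abs_trunc_le n s ω j)
  · simpa using (tendsto_trunc (X := X) (q := q) s ω j).const_sub (q s ω j)

theorem tendsto_eLpNorm_sT_sub (hq : Pred 𝔽 q) (hn : nsq g Pm X q ≠ ∞) :
    Tendsto (fun n => eLpNorm (fun ω => (sT g (X ω) fun z => q z.1 ω z.2) -
      sT g (X ω) fun z => trunc X n q z.1 ω z.2) 2 Pm) atTop (𝓝 0) := by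
  have h1 := (ENNReal.continuous_rpow_const (y := 1 / 2)).tendsto 0 |>.comp
    (S.tendsto_nsq_sub_trunc hq hn)
  rw [ENNReal.zero_rpow_of_pos (by norm_num)] at h1
  refine tendsto_of_tendsto_of_tendsto_of_le_of_le tendsto_const_nhds h1
    (fun _ => zero_le) fun n => ?_
  have hn' : nsq g Pm X (trunc X n q) ≠ ∞ := ne_top_of_le_ne_top hn (nsq_mono (abs_trunc_le n))
  have hn2 : nsq g Pm X (fun s ω j => q s ω j - trunc X n q s ω j) ≠ ∞ :=
    ne_top_of_le_ne_top (nsq_const_mul_ne_top 2 hn) (nsq_mono fun s ω j => by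
      refine (abs_sub _ _).trans ?_
      rw [abs_mul, abs_two, two_mul]
      exact add_le_add le_rfl (abs_trunc_le n s ω j))
  refine le_trans (le_of_eq ?_) (S.eLpNorm_sT_le (fun j => (hq j).sub (S.pred_trunc hq n j)) hn2)
  refine eLpNorm_congr_ae ?_
  filter_upwards [S.ae_integrable_cm hq hn, S.ae_integrable_cm (S.pred_trunc hq n) hn'] with ω h h'
  exact (sT_sub h h').symm

/-- The isometry of the stochastic integral. -/
theorem eLpNorm_sT (hq : Pred 𝔽 q) (hn : nsq g Pm X q ≠ ∞) :
    eLpNorm (fun ω => sT g (X ω) fun z => q z.1 ω z.2) 2 Pm = nsq g Pm X q ^ (1 / 2 : ℝ) := by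
  refine le_antisymm (S.eLpNorm_sT_le hq hn) ?_
  have h1 := (ENNReal.continuous_rpow_const (y := 1 / 2)).tendsto _ |>.comp
    (S.tendsto_nsq (S.pred_trunc hq) hq hn (fun n => abs_trunc_le n) tendsto_trunc)
  -- The reverse inequality: the norm of the truncated integral is at most the norm of the full
  -- integral plus that of the difference, and the latter tends to zero.
  have h2 := (S.tendsto_eLpNorm_sT_sub hq hn).const_add
    (eLpNorm (fun ω => sT g (X ω) fun z => q z.1 ω z.2) 2 Pm)
  rw [add_zero] at h2
  refine le_of_tendsto_of_tendsto' h1 h2 fun n => ?_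
  simp only [Function.comp, ← S.lintegral_sT_sq_trunc hq, ← eLpNorm_two_eq]
  have m1 := (S.measurable_sT hq).aestronglyMeasurable (μ := Pm)
  have m2 := (S.measurable_sT (S.pred_trunc hq n)).aestronglyMeasurable (μ := Pm)
  have h3 := eLpNorm_sub_le (p := 2) m1 (m1.sub m2) (by norm_num)
  rw [sub_sub_cancel] at h3
  exact h3

theorem integral_sT (hq : Pred 𝔽 q) (hn : nsq g Pm X q ≠ ∞) :
    ∫ ω, sT g (X ω) (fun z => q z.1 ω z.2) ∂Pm = 0 := by
  have hn' : ∀ n, nsq g Pm X (trunc X n q) ≠ ∞ := fun n =>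
    ne_top_of_le_ne_top hn (nsq_mono (abs_trunc_le n))
  have h1 := tendsto_integral_of_L1' (fun ω => sT g (X ω) fun z => q z.1 ω z.2)
    (S.measurable_sT hq).aestronglyMeasurable
    (F := fun n ω => sT g (X ω) fun z => trunc X n q z.1 ω z.2) (l := atTop) (μ := Pm)
    (Eventually.of_forall fun n => (S.memLp_sT (S.pred_trunc hq n) (hn' n)).integrable (by norm_num))
    ?_
  · simp only [S.integral_sT_trunc hq] at h1
    exact (tendsto_nhds_unique h1 tendsto_const_nhds)
  · refine tendsto_of_tendsto_of_tendsto_of_le_of_le tendsto_const_nhds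
      (S.tendsto_eLpNorm_sT_sub hq hn) (fun _ => zero_le) fun n => ?_
    rw [eLpNorm_sub_comm]
    exact eLpNorm_le_eLpNorm_of_exponent_le (by norm_num)
      ((S.measurable_sT hq).sub (S.measurable_sT (S.pred_trunc hq n))).aestronglyMeasurable

end ChainSetup
end MFChain
end

/-! ### The stochastic integral as a càdlàg martingale -/

noncomputable section

namespace MFChain
variable {T : ℝ} [Fact (0 ≤ T)] {Ω : Type*} [mΩ : MeasurableSpace Ω]

section Path

theorem continuousWithinAt_setIntegral {α : Type*} [MeasurableSpace α] {μ : Measure α}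
    {τ : α → Time T} (hτ : Measurable τ) {φ : α → ℝ} (hφ : Integrable φ μ) (t : Time T) :
    ContinuousWithinAt (fun s => ∫ z in τ ⁻¹' Set.Iic s, φ z ∂μ) (Set.Ici t) t := by
  classical
  simp only [ContinuousWithinAt, ← integral_indicator (hτ measurableSet_Iic)]
  refine tendsto_integral_filter_of_dominated_convergence (fun z => |φ z|)
    (Eventually.of_forall fun s => hφ.aestronglyMeasurable.indicator (hτ measurableSet_Iic))
    (Eventually.of_forall fun s => Eventually.of_forall fun z => ?_) hφ.abs
    (Eventually.of_forall fun z => ?_)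
  · rw [Set.indicator_apply]; split_ifs <;> simp
  · refine tendsto_const_nhds.congr' ?_
    by_cases h : τ z ≤ t
    · filter_upwards [self_mem_nhdsWithin] with s hs
      have h2 : τ z ≤ s := h.trans hs
      simp [h, h2]
    · filter_upwards [mem_nhdsWithin_of_mem_nhds (Iio_mem_nhds (not_le.1 h))] with s hs
      have h2 : ¬ τ z ≤ s := not_le.2 hs
      simp [h, h2]

theorem tendsto_setIntegral_left {α : Type*} [MeasurableSpace α] {μ : Measure α}
    {τ : α → Time T} (hτ : Measurable τ) {φ : α → ℝ} (hφ : Integrable φ μ) (t : Time T) :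
    Tendsto (fun s => ∫ z in τ ⁻¹' Set.Iic s, φ z ∂μ) (𝓝[<] t)
      (𝓝 (∫ z in τ ⁻¹' Set.Iio t, φ z ∂μ)) := by
  classical
  simp only [← integral_indicator (hτ measurableSet_Iic), ← integral_indicator (hτ measurableSet_Iio)]
  refine tendsto_integral_filter_of_dominated_convergence (fun z => |φ z|)
    (Eventually.of_forall fun s => hφ.aestronglyMeasurable.indicator (hτ measurableSet_Iic))
    (Eventually.of_forall fun s => Eventually.of_forall fun z => ?_) hφ.abs
    (Eventually.of_forall fun z => ?_)
  · rw [Set.indicator_apply]; split_ifs <;> simp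
  · refine tendsto_const_nhds.congr' ?_
    by_cases h : τ z < t
    · filter_upwards [mem_nhdsWithin_of_mem_nhds (Ioi_mem_nhds h)] with s hs
      have h2 : τ z ≤ s := hs.le
      simp [h, h2]
    · filter_upwards [self_mem_nhdsWithin] with s hs
      have h2 : ¬ τ z ≤ s := not_le.2 (lt_of_lt_of_le hs (not_lt.1 h))
      simp [h, h2]

variable {g : ℕ → ℕ → ℝ} {x : ChainPath T} {φ : Time T × ℕ → ℝ}

/-- The stochastic integral of `φ` over `[0,t]`. -/
def sI (g : ℕ → ℕ → ℝ) (x : ChainPath T) (φ : Time T × ℕ → ℝ) (t : Time T) : ℝ :=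
  ∫ z in Set.Iic t ×ˢ Set.univ, φ z ∂jm x - ∫ z in Set.Iic t ×ˢ Set.univ, φ z ∂cm g x

theorem sI_eq : sI g x φ = fun t => ∫ z in Prod.fst ⁻¹' Set.Iic t, φ z ∂jm x -
    ∫ z in Prod.fst ⁻¹' Set.Iic t, φ z ∂cm g x := by
  ext t
  rw [sI, Set.prod_univ]

theorem sI_top : sI g x φ ⊤ = sT g x φ := by simp [sI, sT]

theorem sI_bot : sI g x φ ⊥ = 0 := by
  rw [sI, Set.Iic_bot, Measure.restrict_eq_zero.2 (cm_singleton_prod g x _),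
    Measure.restrict_eq_zero.2 (jm_bot_prod x _)]
  simp

theorem continuousWithinAt_sI (hφ : Integrable φ (cm g x)) (t : Time T) :
    ContinuousWithinAt (sI g x φ) (Set.Ici t) t := by
  rw [sI_eq]
  exact (continuousWithinAt_setIntegral measurable_fst (integrable_jm x φ) t).sub
    (continuousWithinAt_setIntegral measurable_fst hφ t)

theorem tendsto_sI_left (hφ : Integrable φ (cm g x)) (t : Time T) :
    Tendsto (sI g x φ) (𝓝[<] t) (𝓝 (sLeft g x φ t)) := by
  have h1 := (tendsto_setIntegral_left measurable_fst (integrable_jm x φ) t).sub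
    (tendsto_setIntegral_left measurable_fst hφ t)
  rw [sI_eq, sLeft, Set.prod_univ]
  exact h1

theorem sT_Iic (t : Time T) : sT g x (fun z => if z.1 ≤ t then φ z else 0) = sI g x φ t := by
  classical
  have hm : MeasurableSet (Set.Iic t ×ˢ (Set.univ : Set ℕ)) := measurableSet_Iic.prod .univ
  rw [sT, sI, ← integral_indicator hm, ← integral_indicator hm]
  simp [Set.indicator_apply]

theorem sT_Ioi (hφ : Integrable φ (cm g x)) (t : Time T) :
    sT g x (fun z => if t < z.1 then φ z else 0) = sT g x φ - sI g x φ t := by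
  classical
  have hm : MeasurableSet (Set.Iic t ×ˢ (Set.univ : Set ℕ)) := measurableSet_Iic.prod .univ
  rw [← sT_Iic]
  rw [← sT_sub hφ]
  · congr 1
    ext z
    by_cases h : z.1 ≤ t
    · simp [h]
    · simp [h, not_le.1 h]
  · refine (hφ.indicator hm).congr (Eventually.of_forall fun z => ?_)
    simp [Set.indicator_apply]

end Path

/-! ### Maximal inequality -/

section Maximal

variable {Pm : Measure Ω} [IsProbabilityMeasure Pm] {𝔽 : Filtration (Time T) mΩ}
  {Y : Time T → Ω → ℝ}

/-- The submartingale property of `|Y|`: split `A` by the sign of `Y t`, an event of `𝔽 t`, and use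
the martingale property on each piece. -/
theorem setIntegral_abs_le (hY : ∀ t, Measurable[𝔽 t] (Y t)) (hI : ∀ t, Integrable (Y t) Pm)
    (hM : ∀ t A, MeasurableSet[𝔽 t] A → ∫ ω in A, Y t ω ∂Pm = ∫ ω in A, Y ⊤ ω ∂Pm)
    {t : Time T} {A : Set Ω} (hA : MeasurableSet[𝔽 t] A) :
    ∫ ω in A, |Y t ω| ∂Pm ≤ ∫ ω in A, |Y ⊤ ω| ∂Pm := by
  set B : Set Ω := Y t ⁻¹' Set.Ici 0
  have hB : MeasurableSet[𝔽 t] B := hY t measurableSet_Ici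
  have hB' := 𝔽.le _ _ hB
  have hA' := 𝔽.le _ _ hA
  have h1 := hM t _ (hA.inter hB)
  have h2 := hM t _ (hA.diff hB)
  have e1 : ∫ ω in A ∩ B, |Y t ω| ∂Pm = ∫ ω in A ∩ B, Y t ω ∂Pm :=
    setIntegral_congr_fun (hA'.inter hB') fun ω hω => abs_of_nonneg hω.2
  have e2 : ∫ ω in A \ B, |Y t ω| ∂Pm = - ∫ ω in A \ B, Y t ω ∂Pm := by
    rw [← integral_neg]
    exact setIntegral_congr_fun (hA'.diff hB') fun ω hω => abs_of_nonpos (not_le.1 hω.2).le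
  rw [← integral_inter_add_sdiff hB' (hI t).abs.integrableOn, e1, e2, h1, h2,
    ← integral_inter_add_sdiff hB' (hI ⊤).abs.integrableOn]
  refine add_le_add ((le_abs_self _).trans (abs_integral_le_integral_abs))
    ((neg_le_abs _).trans (abs_integral_le_integral_abs))

/-- The weak type maximal inequality on a finite set of times. -/
theorem maximal_finset (hY : ∀ t, Measurable[𝔽 t] (Y t)) (hI : ∀ t, Integrable (Y t) Pm)
    (hM : ∀ t A, MeasurableSet[𝔽 t] A → ∫ ω in A, Y t ω ∂Pm = ∫ ω in A, Y ⊤ ω ∂Pm)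
    (hL : MemLp (Y ⊤) 2 Pm) {c : ℝ} (hc : 0 < c) (F : Finset (Time T)) :
    c ^ 2 * Pm.real {ω | ∃ t ∈ F, c ≤ |Y t ω|} ≤ ∫ ω, Y ⊤ ω ^ 2 ∂Pm := by
  classical
  -- `B t` is the event that `t` is the first time in `F` at which `|Y|` reaches `c`. It belongs to
  -- `𝔽 t`, and these events partition the exceedance event.
  set B : Time T → Set Ω := fun t => {ω | c ≤ |Y t ω| ∧ ∀ s ∈ F, s < t → |Y s ω| < c} with hBdef
  have hB : ∀ t, MeasurableSet[𝔽 t] (B t) := fun t => by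
    have e : B t = (fun ω => |Y t ω|) ⁻¹' Set.Ici c ∩
        ⋂ s ∈ F, ⋂ _ : s < t, (fun ω => |Y s ω|) ⁻¹' Set.Iio c := by
      ext ω; simp [hBdef]
    rw [e]
    have h1 : MeasurableSet[𝔽 t] ((fun ω => |Y t ω|) ⁻¹' Set.Ici c) :=
      (measurable_norm.comp (hY t)) measurableSet_Ici
    have h2 : ∀ s, s < t → MeasurableSet[𝔽 t] ((fun ω => |Y s ω|) ⁻¹' Set.Iio c) := fun s h =>
      𝔽.mono h.le _ ((measurable_norm.comp (hY s)) measurableSet_Iio)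
    exact @MeasurableSet.inter _ (𝔽 t) _ _ h1
      (@MeasurableSet.biInter _ _ (𝔽 t) _ _ F.countable_toSet fun s _ =>
        @MeasurableSet.iInter _ _ (𝔽 t) _ _ fun h => h2 s h)
  have hU : {ω | ∃ t ∈ F, c ≤ |Y t ω|} = ⋃ t ∈ F, B t := by
    ext ω
    simp only [Set.mem_ofPred_eq, Set.mem_iUnion, exists_prop, hBdef]
    constructor
    · rintro ⟨t, ht, h⟩
      have hne : (F.filter fun t => c ≤ |Y t ω|).Nonempty := ⟨t, Finset.mem_filter.2 ⟨ht, h⟩⟩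
      obtain ⟨m, hm, hmin⟩ := Finset.exists_min_image _ id hne
      have hmem := Finset.mem_filter.1 hm
      refine ⟨m, hmem.1, hmem.2, fun s hs hlt => ?_⟩
      by_contra hcon
      have h2 := hmin s (Finset.mem_filter.2 ⟨hs, not_lt.1 hcon⟩)
      exact absurd hlt (not_lt.2 h2)
    · rintro ⟨t, ht, h, -⟩; exact ⟨t, ht, h⟩
  have hd : Set.PairwiseDisjoint (F : Set (Time T)) B := fun s hs t ht hst => by
    refine Set.disjoint_left.2 fun ω h1 h2 => ?_
    rcases lt_or_gt_of_ne hst with h | h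
    · exact absurd (h2.2 s hs h) (not_lt.2 h1.1)
    · exact absurd (h1.2 t ht h) (not_lt.2 h2.1)
  have key : c * Pm.real (⋃ t ∈ F, B t) ≤ ∫ ω in ⋃ t ∈ F, B t, |Y ⊤ ω| ∂Pm := by
    rw [measureReal_biUnion_finset hd fun t _ => 𝔽.le _ _ (hB t),
      integral_biUnion_finset F (fun t _ => 𝔽.le _ _ (hB t)) hd fun t _ => (hI ⊤).abs.integrableOn,
      Finset.mul_sum]
    refine Finset.sum_le_sum fun t _ => ?_
    refine le_trans ?_ (setIntegral_abs_le hY hI hM (hB t))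
    have := setIntegral_mono_on (μ := Pm) (s := B t) (f := fun _ => c) (g := fun ω => |Y t ω|)
      (integrable_const c).integrableOn (hI t).abs.integrableOn (𝔽.le _ _ (hB t)) fun ω hω => hω.1
    rw [setIntegral_const, smul_eq_mul] at this
    linarith
  rw [hU]
  set A := ⋃ t ∈ F, B t
  have hA : MeasurableSet A := MeasurableSet.biUnion F.countable_toSet fun t _ => 𝔽.le _ _ (hB t)
  -- The elementary inequality `|Y| ≤ c/2 + Y²/(2c)` turns `c P(A) ≤ ∫_A |Y|` into `c² P(A) ≤ ∫ Y²`.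
  have h2 : ∫ ω in A, |Y ⊤ ω| ∂Pm ≤ ∫ ω in A, (c / 2 + (1 / (2 * c)) * Y ⊤ ω ^ 2) ∂Pm := by
    refine integral_mono (hI ⊤).abs.integrableOn
      ((integrable_const _).add (hL.integrable_sq.const_mul _)).integrableOn fun ω => ?_
    have : c / 2 + (1 / (2 * c)) * Y ⊤ ω ^ 2 - |Y ⊤ ω| = (c - |Y ⊤ ω|) ^ 2 / (2 * c) := by
      field_simp
      rw [← sq_abs (Y ⊤ ω)]
      ring
    have h3 : 0 ≤ (c - |Y ⊤ ω|) ^ 2 / (2 * c) := by positivity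
    simp only
    linarith
  rw [integral_add (integrable_const _).integrableOn (hL.integrable_sq.const_mul _).integrableOn,
    setIntegral_const, smul_eq_mul, integral_const_mul] at h2
  have h4 : ∫ ω in A, Y ⊤ ω ^ 2 ∂Pm ≤ ∫ ω, Y ⊤ ω ^ 2 ∂Pm :=
    setIntegral_le_integral hL.integrable_sq (Eventually.of_forall fun ω => sq_nonneg _)
  have h5 : c * Pm.real A ≤ Pm.real A * (c / 2) + 1 / (2 * c) * ∫ ω, Y ⊤ ω ^ 2 ∂Pm :=
    (key.trans h2).trans (by gcongr)
  have h6 := mul_le_mul_of_nonneg_left h5 (by positivity : (0 : ℝ) ≤ 2 * c)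
  have h7 : 2 * c * (Pm.real A * (c / 2) + 1 / (2 * c) * ∫ ω, Y ⊤ ω ^ 2 ∂Pm) =
      c ^ 2 * Pm.real A + ∫ ω, Y ⊤ ω ^ 2 ∂Pm := by field_simp
  rw [h7] at h6
  nlinarith

/-- If `m + 1` is the least exponent with `x ≤ 2^(m+1)`, then `2^m < x` and the term `m` alone
dominates `x`. For `x = ∞` all terms are present and the series diverges. -/
theorem le_dyadic (x : ℝ≥0∞) :
    x ≤ 1 + ∑' m : ℕ, 2 ^ (m + 1) * (if 2 ^ m < x then 1 else 0) := by
  classical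
  rcases eq_or_ne x ∞ with rfl | hx
  · have h1 : ∑' m : ℕ, (2 : ℝ≥0∞) ^ (m + 1) * (if 2 ^ m < ∞ then 1 else 0) = ∞ := by
      refine top_unique ((ENNReal.tsum_const_eq_top_of_ne_zero (α := ℕ) one_ne_zero).ge.trans
        (ENNReal.tsum_le_tsum fun m => ?_))
      rw [if_pos (ENNReal.pow_lt_top (by norm_num)), mul_one]
      exact one_le_pow₀ (by norm_num)
    rw [h1]; simp
  · have hex : ∃ n : ℕ, x ≤ 2 ^ n := by
      obtain ⟨n, hn⟩ := ENNReal.exists_nat_gt hx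
      refine ⟨n, hn.le.trans ?_⟩
      exact_mod_cast n.lt_two_pow_self.le
    rcases h : Nat.find hex with _ | m
    · have := Nat.find_spec hex
      rw [h, pow_zero] at this
      exact this.trans le_self_add
    · have h1 := Nat.find_spec hex
      rw [h] at h1
      have h2 : 2 ^ m < x := not_le.1 (Nat.find_min hex (by omega))
      refine h1.trans (le_trans ?_ le_add_self)
      refine le_trans ?_ (ENNReal.le_tsum m)
      simp [h2]

/-- The weak type inequality at the levels `2^m` bounds the exceedance probabilities by `V / 4^m`,
and the sum of `2^(m+1) V / 4^m` converges. Only the first moment of the supremum is wanted, so the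
strong `L²` inequality is not used. -/
theorem lintegral_iSup_lt_top (hY : ∀ t, Measurable[𝔽 t] (Y t)) (hI : ∀ t, Integrable (Y t) Pm)
    (hM : ∀ t A, MeasurableSet[𝔽 t] A → ∫ ω in A, Y t ω ∂Pm = ∫ ω in A, Y ⊤ ω ∂Pm)
    (hL : MemLp (Y ⊤) 2 Pm) (tt : ℕ → Time T) :
    ∫⁻ ω, (⨆ i, ‖Y (tt i) ω‖ₑ) ∂Pm < ∞ := by
  classical
  have hYm : ∀ t, Measurable (Y t) := fun t => (hY t).mono (𝔽.le _) le_rfl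
  set V := ∫ ω, Y ⊤ ω ^ 2 ∂Pm
  set D : ℕ → Set Ω := fun m => ⋃ N : ℕ, {ω | ∃ t ∈ (Finset.range N).image tt, (2 : ℝ) ^ m ≤ |Y t ω|}
  have hDm : ∀ m, MeasurableSet (D m) := fun m => by
    refine MeasurableSet.iUnion fun N => ?_
    have : {ω | ∃ t ∈ (Finset.range N).image tt, (2 : ℝ) ^ m ≤ |Y t ω|} =
        ⋃ t ∈ (Finset.range N).image tt, (fun ω => |Y t ω|) ⁻¹' Set.Ici (2 ^ m) := by
      ext ω; simp
    rw [this]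
    exact MeasurableSet.biUnion (Finset.countable_toSet _) fun t _ =>
      measurable_norm.comp (hYm t) measurableSet_Ici
  have hD : ∀ m, Pm (D m) ≤ ENNReal.ofReal (V / 4 ^ m) := fun m => by
    rw [Monotone.measure_iUnion]
    · refine iSup_le fun N => ?_
      have := maximal_finset hY hI hM hL (c := 2 ^ m) (by positivity) ((Finset.range N).image tt)
      rw [← ofReal_measureReal]
      refine ENNReal.ofReal_le_ofReal ?_
      rw [le_div_iff₀ (by positivity), mul_comm]
      refine le_trans (le_of_eq ?_) this
      rw [← pow_mul, mul_comm m 2, pow_mul]; norm_num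
    · intro a b hab ω
      rintro ⟨t, ht, h⟩
      exact ⟨t, Finset.image_subset_image (Finset.range_mono hab) ht, h⟩
  calc _ ≤ ∫⁻ ω, (1 + ∑' m : ℕ, 2 ^ (m + 1) * (D m).indicator (fun _ => 1) ω) ∂Pm := by
        refine lintegral_mono fun ω => (le_dyadic _).trans ?_
        gcongr with m
        split_ifs with h
        · obtain ⟨i, hi⟩ := lt_iSup_iff.1 h
          have : ω ∈ D m := by
            refine Set.mem_iUnion.2 ⟨i + 1, tt i, Finset.mem_image_of_mem _ (by simp), ?_⟩
            have h2 : (2 : ℝ≥0∞) ^ m = ENNReal.ofReal (2 ^ m) := by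
              rw [ENNReal.ofReal_pow (by norm_num)]; simp
            rw [← ofReal_norm, h2] at hi
            exact (ENNReal.ofReal_lt_ofReal_iff'.1 hi).1.le
          simp [this]
        · exact zero_le
    _ = 1 + ∑' m : ℕ, 2 ^ (m + 1) * Pm (D m) := by
        have hmm : ∀ m : ℕ, Measurable fun ω => (2 : ℝ≥0∞) ^ (m + 1) * (D m).indicator (fun _ => 1) ω :=
          fun m => (measurable_const.indicator (hDm m)).const_mul _
        rw [lintegral_add_left measurable_const, lintegral_tsum fun m => (hmm m).aemeasurable]
        simp only [lintegral_const, measure_univ, mul_one]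
        congr 1
        refine tsum_congr fun m => ?_
        rw [lintegral_const_mul _ (measurable_const.indicator (hDm m)),
          lintegral_indicator (hDm m)]
        simp
    _ ≤ 1 + ∑' m : ℕ, ENNReal.ofReal (2 * V) * (1 / 2) ^ m := by
        refine add_le_add le_rfl (ENNReal.tsum_le_tsum fun m => ?_)
        calc _ ≤ (2 : ℝ≥0∞) ^ (m + 1) * ENNReal.ofReal (V / 4 ^ m) := by exact mul_le_mul' le_rfl (hD m)
          _ = ENNReal.ofReal (2 * V * (1 / 2) ^ m) := by
            have h2 : (2 : ℝ≥0∞) ^ (m + 1) = ENNReal.ofReal (2 ^ (m + 1)) := by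
              rw [ENNReal.ofReal_pow (by norm_num)]; simp
            rw [h2, ← ENNReal.ofReal_mul (by positivity)]
            congr 1
            rw [show (4 : ℝ) = 2 * 2 by norm_num, mul_pow, pow_succ, div_pow, one_pow]
            field_simp
          _ = _ := by
            rw [ENNReal.ofReal_mul' (by positivity), ENNReal.ofReal_pow (by norm_num)]
            rw [ENNReal.ofReal_div_of_pos (by norm_num)]; simp
    _ < ∞ := by
        rw [ENNReal.tsum_mul_left, one_div, ENNReal.tsum_geometric]
        refine ENNReal.add_lt_top.2 ⟨by simp, ENNReal.mul_lt_top ENNReal.ofReal_lt_top ?_⟩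
        rw [ENNReal.one_sub_inv_two, inv_inv]; simp

end Maximal

namespace ChainSetup

variable {g : ℕ → ℕ → ℝ} {Pm : Measure Ω} {𝔽 : Filtration (Time T) mΩ} {X : Ω → ChainPath T}
  (S : ChainSetup g Pm 𝔽 X) {q : Time T → Ω → ℕ → ℝ}
include S

theorem measurable_sI (hq : Pred 𝔽 q) (t : Time T) :
    Measurable[𝔽 t] fun ω => sI g (X ω) (fun z => q z.1 ω z.2) t :=
  (S.measurable_setIntegral_jm hq t).sub (S.measurable_setIntegral_cm hq t)

variable [IsProbabilityMeasure Pm]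

omit [IsProbabilityMeasure Pm] S in
theorem Pred.Iic (hq : Pred 𝔽 q) (t : Time T) : Pred 𝔽 fun s ω j => if s ≤ t then q s ω j else 0 :=
  fun j => Measurable.ite (measurable_fst_predictable (𝔽 := 𝔽) measurableSet_Iic) (hq j)
    (@measurable_const _ _ _ 𝔽.predictable 0)

theorem memLp_sI (hq : Pred 𝔽 q) (hn : nsq g Pm X q ≠ ∞) (t : Time T) :
    MemLp (fun ω => sI g (X ω) (fun z => q z.1 ω z.2) t) 2 Pm := by
  have h := S.memLp_sT (Pred.Iic hq t) (ne_top_of_le_ne_top hn (nsq_mono fun s ω j => by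
    split_ifs <;> simp))
  simpa only [sT_Iic (φ := fun z : Time T × ℕ => q z.1 _ z.2)] using h

/-- The martingale property of the stochastic integral. -/
theorem setIntegral_sI (hq : Pred 𝔽 q) (hn : nsq g Pm X q ≠ ∞) (t : Time T) {A : Set Ω}
    (hA : MeasurableSet[𝔽 t] A) :
    ∫ ω in A, sI g (X ω) (fun z => q z.1 ω z.2) t ∂Pm =
      ∫ ω in A, sT g (X ω) (fun z => q z.1 ω z.2) ∂Pm := by
  classical
  set Y : Ω → ℝ := A.indicator fun _ => 1
  have hY : Measurable[𝔽 t] Y := measurable_const.indicator hA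
  have hr : Pred 𝔽 fun s ω j => (if t < s then Y ω else 0) * q s ω j := fun j =>
    Measurable.mul (measurable_Ioi_predictable hY) (hq j)
  have h0 := S.integral_sT hr (ne_top_of_le_ne_top hn (nsq_mono fun s ω j => by
    rw [abs_mul]
    refine mul_le_of_le_one_left (abs_nonneg _) ?_
    split_ifs
    · by_cases h : ω ∈ A <;> simp [Y, h]
    · simp))
  have e : ∀ᵐ ω ∂Pm, sT g (X ω) (fun z => (if t < z.1 then Y ω else 0) * q z.1 ω z.2) =
      A.indicator (fun ω => sT g (X ω) (fun z => q z.1 ω z.2) -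
        sI g (X ω) (fun z => q z.1 ω z.2) t) ω := by
    filter_upwards [S.ae_integrable_cm hq hn] with ω hω
    have : (fun z : Time T × ℕ => (if t < z.1 then Y ω else 0) * q z.1 ω z.2) =
        fun z => Y ω * (if t < z.1 then q z.1 ω z.2 else 0) := by
      ext z; split_ifs <;> simp
    rw [this, sT_const_mul, sT_Ioi hω]
    by_cases h : ω ∈ A <;> simp [Y, h]
  rw [integral_congr_ae e, integral_indicator (𝔽.le _ _ hA), integral_sub] at h0
  · linarith
  · exact ((S.memLp_sT hq hn).integrable (by norm_num)).integrableOn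
  · exact ((S.memLp_sI hq hn t).integrable (by norm_num)).integrableOn

/-- By right continuity the value at `t` is a limit of values at the grid points `gridR n t`, so a
supremum over the countable set of grid points, enumerated by pairing, suffices. -/
theorem lintegral_iSup_sI (hq : Pred 𝔽 q) (hn : nsq g Pm X q ≠ ∞) :
    ∫⁻ ω, (⨆ t, ‖sI g (X ω) (fun z => q z.1 ω z.2) t‖ₑ) ∂Pm < ∞ := by
  have h := lintegral_iSup_lt_top (Pm := Pm) (𝔽 := 𝔽)
    (Y := fun t ω => sI g (X ω) (fun z => q z.1 ω z.2) t) (S.measurable_sI hq)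
    (fun t => (S.memLp_sI hq hn t).integrable (by norm_num))
    (fun t A hA => by simp only [sI_top]; exact S.setIntegral_sI hq hn t hA)
    (S.memLp_sI hq hn ⊤) fun i => gridPt i.unpair.1 i.unpair.2
  refine (lintegral_mono_ae ?_).trans_lt h
  filter_upwards [S.ae_integrable_cm hq hn] with ω hω
  refine iSup_le fun t => ?_
  have h1 := ((continuousWithinAt_sI hω t).tendsto.comp (tendsto_gridR t)).enorm
  refine le_of_tendsto h1 (Eventually.of_forall fun n => ?_)
  refine le_iSup_of_le (Nat.pair n (⌊2 ^ n * (t : ℝ)⌋₊ + 1)) ?_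
  simp [gridR]

end ChainSetup
end MFChain
end

/-! ### Gronwall's inequality -/

noncomputable section

namespace MFChain
variable {T : ℝ} [Fact (0 ≤ T)] {Ω : Type*} [mΩ : MeasurableSpace Ω]

section Gronwall

theorem lintegral_exp_Iic_le {β : ℝ} (hβ : 0 < β) (t : Time T) :
    ∫⁻ s in Set.Iic t, ENNReal.ofReal (Real.exp (β * s)) ≤ ENNReal.ofReal (Real.exp (β * t) / β) := by
  classical
  rw [← lintegral_indicator measurableSet_Iic]
  set F : ℝ → ℝ≥0∞ := (Set.Iic (t : ℝ)).indicator fun s => ENNReal.ofReal (Real.exp (β * s))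
  calc _ = ∫⁻ s : Time T, F s := by
        refine lintegral_congr fun s => ?_
        simp [F, Set.indicator_apply]
    _ = ∫⁻ s in Set.Icc 0 T, F s := lintegral_subtype_comap measurableSet_Icc F
    _ ≤ ∫⁻ s, F s := setLIntegral_le_lintegral _ _
    _ = ENNReal.ofReal (∫ s in Set.Iic (t : ℝ), Real.exp (β * s)) := by
        rw [lintegral_indicator measurableSet_Iic, ofReal_integral_eq_lintegral_ofReal
          (integrableOn_exp_mul_Iic hβ _) (Eventually.of_forall fun s => (Real.exp_pos _).le)]
    _ = _ := by rw [integral_exp_mul_Iic hβ]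

/-- The supremum `M` of `exp(-2Ct) y(t)` satisfies `M ≤ A + M/2`, because the weight integrates to
at most `exp(2Ct)/(2C)`. The crude bound `B` serves only to make `M` finite, so that `M/2` may be
subtracted. No measurability of `y` is used. -/
theorem gronwall {y : Time T → ℝ≥0∞} {A B : ℝ≥0∞} (hB : B ≠ ∞) (hy : ∀ t, y t ≤ B) {C : ℝ}
    (hC : 0 < C) (h : ∀ t, y t ≤ A + ENNReal.ofReal C * ∫⁻ r in Set.Iic t, y r) (t : Time T) :
    y t ≤ ENNReal.ofReal (Real.exp (2 * C * T)) * (2 * A) := by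
  set e : ℝ → ℝ≥0∞ := fun r => ENNReal.ofReal (Real.exp r)
  have hmul : ∀ a b, e a * e b = e (a + b) := fun a b => by
    simp only [e]; rw [← ENNReal.ofReal_mul (Real.exp_pos _).le, Real.exp_add]
  have he0 : e 0 = 1 := by simp [e]
  set M : ℝ≥0∞ := ⨆ t : Time T, e (-(2 * C * t)) * y t with hM
  have hle : ∀ t : Time T, e (-(2 * C * t)) ≤ 1 := fun t => by
    rw [← he0]
    refine ENNReal.ofReal_le_ofReal (Real.exp_le_exp.2 ?_)
    have := mul_nonneg hC.le t.2.1
    linarith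
  have hMB : M ≠ ∞ := ne_top_of_le_ne_top hB (iSup_le fun t =>
    (mul_le_mul' (hle t) (hy t)).trans (by simp))
  have hyM : ∀ r : Time T, y r ≤ e (2 * C * r) * M := fun r => by
    calc y r = e (2 * C * r) * (e (-(2 * C * r)) * y r) := by
          rw [← mul_assoc, hmul, add_neg_cancel, he0, one_mul]
      _ ≤ _ := by gcongr; exact le_iSup (fun t : Time T => e (-(2 * C * t)) * y t) r
  have hM2 : M ≤ A + M / 2 := by
    refine iSup_le fun t => ?_
    calc e (-(2 * C * t)) * y t ≤ e (-(2 * C * t)) *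
          (A + ENNReal.ofReal C * ∫⁻ r in Set.Iic t, e (2 * C * r) * M) := by
          refine mul_le_mul' le_rfl ((h t).trans ?_)
          gcongr with r
          exact hyM r
      _ ≤ e (-(2 * C * t)) *
          (A + ENNReal.ofReal C * (ENNReal.ofReal (Real.exp (2 * C * t) / (2 * C)) * M)) := by
          rw [lintegral_mul_const' _ _ hMB]
          gcongr
          exact lintegral_exp_Iic_le (by positivity) t
      _ = e (-(2 * C * t)) * A + M / 2 := by
          rw [mul_add]
          congr 1
          have : ENNReal.ofReal (Real.exp (2 * C * t) / (2 * C)) =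
              e (2 * C * t) * ENNReal.ofReal (1 / (2 * C)) := by
            rw [← ENNReal.ofReal_mul (Real.exp_pos _).le]; congr 1; ring
          rw [this]
          calc _ = (e (-(2 * C * t)) * e (2 * C * t)) *
                (ENNReal.ofReal C * ENNReal.ofReal (1 / (2 * C))) * M := by ring
            _ = M / 2 := by
              rw [hmul, neg_add_cancel, he0, one_mul, ← ENNReal.ofReal_mul hC.le,
                show C * (1 / (2 * C)) = 2⁻¹ by field_simp, mul_comm, div_eq_mul_inv,
                ENNReal.ofReal_inv_of_pos (by norm_num)]
              simp
      _ ≤ _ := by gcongr; exact (mul_le_mul' (hle t) le_rfl).trans (by simp)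
  have hMA : M ≤ 2 * A := by
    have h1 : M / 2 + M / 2 ≤ A + M / 2 := by rwa [ENNReal.add_halves]
    have h2 : M / 2 ≤ A := (ENNReal.add_le_add_iff_right (ENNReal.div_ne_top hMB (by simp))).1 h1
    calc M = M / 2 + M / 2 := (ENNReal.add_halves _).symm
      _ ≤ A + A := add_le_add h2 h2
      _ = 2 * A := (two_mul A).symm
  refine (hyM t).trans (mul_le_mul' (ENNReal.ofReal_le_ofReal (Real.exp_le_exp.2 ?_)) hMA)
  exact mul_le_mul_of_nonneg_left t.2.2 (by positivity)

end Gronwall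

/-! ### Paths up to their first jump above a level -/

section Path

/-- Between `s` and `r`, exclusively, the path does not jump to a state above `n`. -/
def lowUntil (x : ChainPath T) (n : ℕ) (s r : Time T) : Prop :=
  ∀ σ ∈ jumps x, s < σ → σ < r → x.val σ ≤ n

/-- The time `r` lies so close to `t` that no jump falls strictly between them. Statements on the
open interval up to `t` thereby reduce to the half-open interval up to `r`. -/
theorem exists_lt_val_eq_left (x : ChainPath T) {s t : Time T} (hst : s < t) :
    ∃ r, s ≤ r ∧ r < t ∧ x.val r = x.left t ∧ ∀ σ ∈ jumps x, σ < t → σ ≤ r := by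
  have hb : (𝓝[<] t).NeBot := nhdsLT_neBot_of_exists_lt ⟨s, hst⟩
  have h1 := x.eventually_left t
  have h2 : ∀ᶠ r in 𝓝[<] t, s ≤ r := by
    filter_upwards [mem_nhdsWithin_of_mem_nhds (Ioi_mem_nhds hst)] with r hr using hr.le
  have h3 : ∀ᶠ r in 𝓝[<] t, ∀ σ ∈ jumps x, σ < t → σ ≤ r := by
    rw [Filter.eventually_all_finset]
    intro σ _
    by_cases h : σ < t
    · filter_upwards [mem_nhdsWithin_of_mem_nhds (Ioi_mem_nhds h)] with r hr _ using hr.le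
    · exact Eventually.of_forall fun r h' => absurd h' h
  obtain ⟨r, h1, h2, h3, h4⟩ := (h1.and (h2.and (h3.and self_mem_nhdsWithin))).exists
  exact ⟨r, h2, h4, h1, h3⟩

/-- Telescoping the indicator of the states above `n`: a jump to a state at most `n` never increases
it. -/
theorem val_le_of_low {x : ChainPath T} {n : ℕ} {s t : Time T} (hst : s ≤ t) (hs : x.val s ≤ n)
    (h : ∀ σ ∈ jumps x, s < σ → σ ≤ t → x.val σ ≤ n) : x.val t ≤ n := by
  by_contra hcon
  have h1 := x.telescope (fun i => if n < i then 1 else 0) hst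
  have h2 : ∑ r ∈ jumps x with s < r ∧ r ≤ t, ((if n < x.val r then (1 : ℝ) else 0) -
      (if n < x.left r then 1 else 0)) ≤ 0 := by
    refine Finset.sum_nonpos fun r hr => ?_
    obtain ⟨hr1, hr2, hr3⟩ := Finset.mem_filter.1 hr
    rw [if_neg (not_lt.2 (h r hr1 hr2 hr3))]
    split_ifs <;> norm_num
  rw [← h1, if_pos (not_le.1 hcon), if_neg (not_lt.2 hs)] at h2
  norm_num at h2

theorem left_le_of_low {x : ChainPath T} {n : ℕ} {s t : Time T} (hst : s < t) (hs : x.val s ≤ n)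
    (h : lowUntil x n s t) : x.left t ≤ n := by
  obtain ⟨r, h1, h2, h3, -⟩ := exists_lt_val_eq_left x hst
  rw [← h3]
  exact val_le_of_low h1 hs fun σ hσ hs' hr => h σ hσ hs' (hr.trans_lt h2)

open Classical in
-- Telescoping for the path followed up to and including its first jump `τ` above `n`. If there is
-- such a jump, then after it the indicator of `j` is zero, because `j ≤ n < x(τ)`; this is why the
-- killed chain appears on the right.
theorem sum_dind_Ioc (x : ChainPath T) {n j : ℕ} (hj : j ≤ n) {s t : Time T} (hst : s ≤ t) :
    ∑ σ ∈ jumps x with (s < σ ∧ σ ≤ t) ∧ lowUntil x n s σ, dind x j σ =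
      (if x.val t = j ∧ ∀ σ ∈ jumps x, s < σ → σ ≤ t → x.val σ ≤ n then 1 else 0) -
        ind j (x.val s) := by
  by_cases h : ∀ σ ∈ jumps x, s < σ → σ ≤ t → x.val σ ≤ n
  · have e : (jumps x).filter (fun σ => (s < σ ∧ σ ≤ t) ∧ lowUntil x n s σ) =
        (jumps x).filter fun σ => s < σ ∧ σ ≤ t := by
      refine Finset.filter_congr fun σ hσ => and_iff_left_of_imp fun hh => ?_
      exact fun ρ hρ h1 h2 => h ρ hρ h1 (h2.le.trans hh.2)
    rw [e]
    have h2 := x.telescope (ind j) hst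
    rw [if_congr (and_iff_left h) rfl rfl]
    unfold dind
    rw [← h2]
    rfl
  · push Not at h
    obtain ⟨σ₀, hσ₀⟩ := h
    have hne : ((jumps x).filter fun σ => (s < σ ∧ σ ≤ t) ∧ n < x.val σ).Nonempty :=
      ⟨σ₀, Finset.mem_filter.2 ⟨hσ₀.1, ⟨hσ₀.2.1, hσ₀.2.2.1⟩, hσ₀.2.2.2⟩⟩
    obtain ⟨τ, hτ, hmin⟩ := Finset.exists_min_image _ id hne
    obtain ⟨hτ1, ⟨hτ2, hτ3⟩, hτ4⟩ := Finset.mem_filter.1 hτ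
    have hno : ¬ ∀ σ ∈ jumps x, s < σ → σ ≤ t → x.val σ ≤ n := fun h =>
      absurd (h τ hτ1 hτ2 hτ3) (not_le.2 hτ4)
    have e : (jumps x).filter (fun σ => (s < σ ∧ σ ≤ t) ∧ lowUntil x n s σ) =
        (jumps x).filter fun σ => s < σ ∧ σ ≤ τ := by
      refine Finset.filter_congr fun σ hσ => ⟨fun hh => ⟨hh.1.1, ?_⟩, fun hh =>
        ⟨⟨hh.1, hh.2.trans hτ3⟩, fun ρ hρ h1 h2 => ?_⟩⟩
      · by_contra hcon
        exact absurd (hh.2 τ hτ1 hτ2 (not_le.1 hcon)) (not_le.2 hτ4)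
      · by_contra hcon
        have h3 := hmin ρ (Finset.mem_filter.2 ⟨hρ, ⟨h1, (h2.le.trans hh.2).trans hτ3⟩,
          not_le.1 hcon⟩)
        exact absurd (lt_of_lt_of_le h2 hh.2) (not_lt.2 h3)
    rw [e]
    have h2 := x.telescope (ind j) hτ2.le
    simp only [hno, and_false, if_false]
    unfold dind
    rw [← h2]
    congr 1
    exact if_neg (by omega)

open Classical in
theorem sum_dind_Ioo (x : ChainPath T) {n j : ℕ} (hj : j ≤ n) {s t : Time T} (hst : s < t) :
    ∑ σ ∈ jumps x with (s < σ ∧ σ < t) ∧ lowUntil x n s σ, dind x j σ =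
      (if x.left t = j ∧ lowUntil x n s t then 1 else 0) - ind j (x.val s) := by
  obtain ⟨r, h1, h2, h3, h4⟩ := exists_lt_val_eq_left x hst
  have h5 := sum_dind_Ioc x hj h1
  have e : (jumps x).filter (fun σ => (s < σ ∧ σ ≤ r) ∧ lowUntil x n s σ) =
      (jumps x).filter fun σ => (s < σ ∧ σ < t) ∧ lowUntil x n s σ := by
    refine Finset.filter_congr fun σ hσ => ?_
    have : σ ≤ r ↔ σ < t := ⟨fun h => h.trans_lt h2, h4 σ hσ⟩
    rw [this]
  have e2 : (∀ σ ∈ jumps x, s < σ → σ ≤ r → x.val σ ≤ n) ↔ lowUntil x n s t :=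
    forall₂_congr fun σ hσ => by
      have : σ ≤ r ↔ σ < t := ⟨fun h => h.trans_lt h2, h4 σ hσ⟩
      rw [this]
  rw [e, if_congr (and_congr (by rw [h3]) e2) rfl rfl] at h5
  exact h5

open Classical in
-- The condition at the time `t` itself may be dropped, since `x(t) = j ≤ n` is part of the event.
theorem sum_dind_Ioc_of_lowUntil (x : ChainPath T) {n j : ℕ} (hj : j ≤ n) {s t : Time T}
    (hst : s ≤ t) :
    ∑ σ ∈ jumps x with (s < σ ∧ σ ≤ t) ∧ lowUntil x n s σ, dind x j σ =
      (if x.val t = j ∧ lowUntil x n s t then 1 else 0) - ind j (x.val s) := by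
  rw [sum_dind_Ioc x hj hst]
  congr 1
  refine if_congr (and_congr_right fun h => ?_) rfl rfl
  refine ⟨fun h' σ hσ h1 h2 => h' σ hσ h1 h2.le, fun h' σ hσ h1 h2 => ?_⟩
  rcases h2.lt_or_eq with h3 | rfl
  · exact h' σ hσ h1 h3
  · omega

theorem integral_rate_ind {g : ℕ → ℕ → ℝ} (hg : IsQMatrix g) (i j : ℕ) :
    ∫ k, (ind j k - ind j i) ∂rate g i = g i j := by
  rw [integral_rate hg]
  by_cases hij : i = j
  · subst hij
    rw [hg.diag i, ← tsum_neg]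
    refine tsum_congr fun k => ?_
    by_cases h : k = i <;> simp [ind, h]
  · rw [tsum_eq_single j]
    · simp [ind, hij, Ne.symm hij]
    · intro k hk
      simp [ind, hij, hk]

end Path

/-! ### Martingale representation -/

namespace ChainSetup

variable {g : ℕ → ℕ → ℝ} {Pm : Measure Ω} {𝔽 : Filtration (Time T) mΩ} {X : Ω → ChainPath T}
  (S : ChainSetup g Pm 𝔽 X) {Z : Ω → ℝ}
include S
variable [IsProbabilityMeasure Pm]

/-- The event says that the jump measure on the open interval gives no mass to states above `n`
after `s`, so it is the zero set of a predictable integral over `[0, r)`. -/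
theorem measurableSet_lowUntil (n : ℕ) (s : Time T) :
    MeasurableSet[𝔽.predictable] {z : Time T × Ω | lowUntil (X z.2) n s z.1} := by
  classical
  have h := S.measurable_setLIntegral_Iio_jm (f := fun r _ j => if s < r ∧ n < j then 1 else 0)
    fun j => Measurable.ite (p := fun z : Time T × Ω => s < z.1 ∧ n < j) (by
      by_cases hj : n < j
      · simp only [hj, and_true]
        exact measurable_fst_predictable (𝔽 := 𝔽) measurableSet_Ioi
      · simp [hj]) (@measurable_const _ _ _ 𝔽.predictable _) (@measurable_const _ _ _ 𝔽.predictable _)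
  have h2 := h (measurableSet_singleton 0)
  convert h2 using 1
  ext z
  rw [Set.mem_preimage, setLIntegral_jm _ _ measurableSet_Iio, Set.mem_singleton_iff,
    Finset.sum_eq_zero_iff]
  simp only [Finset.mem_filter, Set.mem_Iio, ite_eq_right_iff, one_ne_zero, imp_false, not_and,
    not_lt, lowUntil, Set.mem_ofPred_eq]
  exact forall_congr' fun σ => by tauto

theorem measurableSet_lowUntil_time (n : ℕ) (s r : Time T) :
    MeasurableSet {ω : Ω | lowUntil (X ω) n s r} :=
  measurable_prodMk_left (predictable_le _ (S.measurableSet_lowUntil n s))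

open Classical in
-- Orthogonality is applied to the increment of the indicator of `j`, restricted to `A`, to times in
-- `B`, and to paths that have stayed low. Its integral against the jumps is the sum on the left,
-- and its compensator is the integral of the rate `g (x(r⁻)) j`. Staying low keeps `x(r⁻)` at most
-- `n`, so the rates are bounded, the integrand is square integrable, and only finitely many states
-- enter the bound.
theorem enorm_setIntegral_sum_dind_le (hZ : MemLp Z 2 Pm)
    (hJ : ∀ q, Pred 𝔽 q → nsq g Pm X q ≠ ∞ →
      ∫ ω, Z ω * sT g (X ω) (fun z => q z.1 ω z.2) ∂Pm = 0)
    {s : Time T} {A : Set Ω} (hA : MeasurableSet[𝔽 s] A) {n : ℕ} (hAn : ∀ ω ∈ A, (X ω).val s ≤ n)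
    (j : ℕ) {B : Set (Time T)} (hB : MeasurableSet B) (hBs : B ⊆ Set.Ioi s) :
    ‖∫ ω in A, Z ω * ∑ σ ∈ jumps (X ω) with σ ∈ B ∧ lowUntil (X ω) n s σ, dind (X ω) j σ ∂Pm‖ₑ ≤
      ∫⁻ r in B, ∑ i ∈ Finset.range (n + 1), ‖g i j‖ₑ *
        ‖∫ ω in A, Z ω * (if (X ω).left r = i ∧ lowUntil (X ω) n s r then 1 else 0) ∂Pm‖ₑ := by
  have hA' := 𝔽.le _ _ hA
  have hZi : Integrable Z Pm := hZ.integrable (by norm_num)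
  set Y : Ω → ℝ := A.indicator fun _ => 1
  set o : Time T → Ω → ℝ := fun r ω => if lowUntil (X ω) n s r then 1 else 0
  set b : Time T → ℝ := B.indicator fun _ => 1
  have hbs : ∀ r, b r * (if s < r then (1 : ℝ) else 0) = b r := fun r => by
    by_cases h : r ∈ B
    · have : s < r := hBs h
      simp [this]
    · simp [b, h]
  set q : Time T → Ω → ℕ → ℝ := fun r ω k => b r * (if s < r then Y ω else 0) * o r ω *
    (ind j k - ind j ((X ω).left r)) with hq
  have ho : Measurable[𝔽.predictable] fun z : Time T × Ω => o z.1 z.2 :=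
    Measurable.ite (S.measurableSet_lowUntil n s) (@measurable_const _ _ _ 𝔽.predictable _)
      (@measurable_const _ _ _ 𝔽.predictable _)
  have hb : Measurable b := measurable_const.indicator hB
  have hqp : Pred 𝔽 q := fun k =>
    (((hb.comp measurable_fst_predictable).mul (measurable_Ioi_predictable
      (measurable_const.indicator hA))).mul ho).mul
      (((Measurable.of_discrete (f := fun i => ind j k - ind j i)).comp S.measurable_left))
  have hb1 : ∀ r, |b r| ≤ 1 := fun r => by by_cases h : r ∈ B <;> simp [b, h]
  have ho1 : ∀ r ω, |o r ω| ≤ 1 := fun r ω => by simp only [o]; split_ifs <;> simp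
  have hi1 : ∀ k i, |ind j k - ind j i| ≤ 1 := fun k i => by
    rw [abs_le]
    constructor <;> linarith [ind_nonneg j k, ind_le_one j k, ind_nonneg j i, ind_le_one j i]
  have hq1 : ∀ r ω k, |q r ω k| ≤ if (X ω).left r ≤ n then 1 else 0 := fun r ω k => by
    by_cases h : s < r ∧ ω ∈ A ∧ lowUntil (X ω) n s r
    · rw [if_pos (left_le_of_low h.1 (hAn ω h.2.1) h.2.2)]
      simp only [hq, abs_mul, h.1, if_true, Y, Set.indicator_of_mem h.2.1, mul_one]
      exact mul_le_one₀ (mul_le_one₀ (hb1 r) (abs_nonneg _) (ho1 r ω)) (abs_nonneg _) (hi1 _ _)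
    · have : q r ω k = 0 := by
        simp only [hq, Y, o, Set.indicator_apply]
        by_cases h1 : s < r <;> by_cases h2 : ω ∈ A <;> by_cases h3 : lowUntil (X ω) n s r <;>
          simp_all
      rw [this, abs_zero]
      split_ifs <;> norm_num
  obtain ⟨C, hC⟩ := rate_le S.qmat n
  have hcm1 : ∀ ω, ∫⁻ z, ‖q z.1 ω z.2‖ₑ ∂cm g (X ω) ≤ C * volume (Set.univ : Set (Time T)) ∧
      ∫⁻ z, ‖q z.1 ω z.2‖ₑ ^ 2 ∂cm g (X ω) ≤ C * volume (Set.univ : Set (Time T)) := fun ω => by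
    have hbd : ∀ z : Time T × ℕ, ‖q z.1 ω z.2‖ₑ ≤ if (X ω).left z.1 ≤ n then 1 else 0 := fun z => by
      have h1 := hq1 z.1 ω z.2
      rw [← ofReal_norm, Real.norm_eq_abs]
      split_ifs at h1 ⊢
      · exact ENNReal.ofReal_le_one.2 h1
      · rw [ENNReal.ofReal_eq_zero.2 h1]
    have hmain : ∫⁻ z : Time T × ℕ, (if (X ω).left z.1 ≤ n then (1 : ℝ≥0∞) else 0) ∂cm g (X ω) ≤
        C * volume (Set.univ : Set (Time T)) := by
      have hm : Measurable fun z : Time T × ℕ => if (X ω).left z.1 ≤ n then (1 : ℝ≥0∞) else 0 :=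
        Measurable.ite ((X ω).measurable_left.comp measurable_fst measurableSet_Iic)
          measurable_const measurable_const
      rw [lintegral_cm g (X ω) hm, ← lintegral_const]
      refine lintegral_mono fun r => ?_
      by_cases h : (X ω).left r ≤ n
      · simpa [h] using hC _ h
      · simp [h]
    refine ⟨(lintegral_mono hbd).trans hmain, (lintegral_mono fun z => ?_).trans hmain⟩
    refine (pow_le_pow_left₀ zero_le (hbd z) 2).trans ?_
    split_ifs <;> simp
  have hfin : (C : ℝ≥0∞) * volume (Set.univ : Set (Time T)) ≠ ∞ :=
    ENNReal.mul_ne_top (by simp) (measure_ne_top _ _)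
  have hn : nsq g Pm X q ≠ ∞ := ne_top_of_le_ne_top hfin
    ((lintegral_mono fun ω => (hcm1 ω).2).trans (by simp))
  have hI : ∀ ω, Integrable (fun z : Time T × ℕ => q z.1 ω z.2) (cm g (X ω)) := fun ω =>
    ⟨(S.measurable_mark hqp ω).aestronglyMeasurable, (hcm1 ω).1.trans_lt hfin.lt_top⟩
  set W : Ω → ℝ := fun ω => ∑ σ ∈ jumps (X ω) with σ ∈ B ∧ lowUntil (X ω) n s σ, dind (X ω) j σ
  have hjm : ∀ ω, ∫ z, q z.1 ω z.2 ∂jm (X ω) = Y ω * W ω := fun ω => by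
    rw [integral_jm, Finset.mul_sum, Finset.sum_filter]
    refine Finset.sum_congr rfl fun σ hσ => ?_
    by_cases h1 : σ ∈ B
    · have h2 : s < σ := hBs h1
      by_cases h3 : lowUntil (X ω) n s σ <;> simp [hq, b, o, h1, h2, h3, dind]
    · simp [hq, b, h1]
  have hcm : ∀ ω, ∫ z, q z.1 ω z.2 ∂cm g (X ω) =
      Y ω * ∫ r in B, ∑ i ∈ Finset.range (n + 1), g i j *
        (if (X ω).left r = i ∧ lowUntil (X ω) n s r then 1 else 0) := fun ω => by
    have h1 := (integral_cm (X ω) (hI ω)).2.2 _ MeasurableSet.univ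
    rw [Set.univ_prod_univ, setIntegral_univ, setIntegral_univ] at h1
    rw [h1, ← integral_const_mul, ← integral_indicator hB]
    refine integral_congr_ae (Eventually.of_forall fun r => ?_)
    simp only [hq]
    rw [integral_const_mul, integral_rate_ind S.qmat, Set.indicator_apply]
    by_cases h1 : r ∈ B
    · have h2 : s < r := hBs h1
      by_cases h3 : ω ∈ A
      · by_cases h4 : lowUntil (X ω) n s r
        · have h5 := left_le_of_low h2 (hAn ω h3) h4
          simp [b, o, h1, h2, h4, Nat.lt_succ_of_le h5]
        · simp [o, h4]
      · simp [Y, h3]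
    · simp [b, h1]
  have h0 := hJ q hqp hn
  have hsT : ∀ ω, Z ω * sT g (X ω) (fun z => q z.1 ω z.2) =
      Z ω * (Y ω * W ω) - Z ω * (Y ω * ∫ r in B, ∑ i ∈ Finset.range (n + 1), g i j *
        (if (X ω).left r = i ∧ lowUntil (X ω) n s r then 1 else 0)) := fun ω => by
    rw [sT, hjm, hcm, mul_sub]
  set c : ℝ := ∑ i ∈ Finset.range (n + 1), |g i j|
  have hsumle : ∀ r ω, |∑ i ∈ Finset.range (n + 1), g i j *
        (if (X ω).left r = i ∧ lowUntil (X ω) n s r then (1 : ℝ) else 0)| ≤ c := fun r ω => by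
    refine (Finset.abs_sum_le_sum_abs _ _).trans (Finset.sum_le_sum fun i _ => ?_)
    rw [abs_mul]
    refine mul_le_of_le_one_right (abs_nonneg _) ?_
    split_ifs <;> simp
  have hmeas1 : ∀ i, Measurable fun z : Time T × Ω =>
      (if (X z.2).left z.1 = i ∧ lowUntil (X z.2) n s z.1 then (1 : ℝ) else 0) := fun i =>
    Measurable.ite ((S.measurable_left_joint (measurableSet_singleton i)).inter
      (predictable_le _ (S.measurableSet_lowUntil n s))) measurable_const measurable_const
  have hmeas : Measurable fun z : Time T × Ω => ∑ i ∈ Finset.range (n + 1), g i j *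
        (if (X z.2).left z.1 = i ∧ lowUntil (X z.2) n s z.1 then (1 : ℝ) else 0) :=
    Finset.measurable_sum _ fun i _ => (hmeas1 i).const_mul _
  have hprod : Integrable (fun z : Time T × Ω => Z z.2 * ∑ i ∈ Finset.range (n + 1), g i j *
        (if (X z.2).left z.1 = i ∧ lowUntil (X z.2) n s z.1 then (1 : ℝ) else 0))
      ((volume.restrict B).prod (Pm.restrict A)) :=
    (hZi.integrableOn.comp_snd (volume.restrict B)).mul_bdd (c := c) hmeas.aestronglyMeasurable
      (Eventually.of_forall fun z => hsumle _ _)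
  have hI2 : Integrable (fun ω => Z ω * (Y ω * ∫ r in B, ∑ i ∈ Finset.range (n + 1), g i j *
        (if (X ω).left r = i ∧ lowUntil (X ω) n s r then 1 else 0))) Pm := by
    refine hZi.mul_bdd (c := (C * volume (Set.univ : Set (Time T))).toReal) ?_
      (Eventually.of_forall fun ω => ?_)
    · simp only [← hcm]; exact (S.measurable_integral_cm hqp).aestronglyMeasurable
    · rw [← hcm]
      refine (norm_integral_le_lintegral_norm _).trans (ENNReal.toReal_mono hfin ?_)
      simp only [ofReal_norm]
      exact (hcm1 ω).1
  have hI1 : Integrable (fun ω => Z ω * (Y ω * W ω)) Pm := by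
    have := (hZ.integrable_mul (S.memLp_sT hqp hn)).add hI2
    refine this.congr (Eventually.of_forall fun ω => ?_)
    simp only [Pi.add_apply, Pi.mul_apply, hsT]
    ring
  have hY : ∀ V : Ω → ℝ, ∫ ω, Z ω * (Y ω * V ω) ∂Pm = ∫ ω in A, Z ω * V ω ∂Pm := fun V => by
    rw [← integral_indicator hA']
    refine integral_congr_ae (Eventually.of_forall fun ω => ?_)
    by_cases h : ω ∈ A <;> simp [Y, h]
  rw [integral_congr_ae (Eventually.of_forall hsT), integral_sub hI1 hI2, hY, hY, sub_eq_zero] at h0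
  rw [h0]
  simp only [← integral_const_mul]
  rw [← integral_integral_swap (f := fun r ω => Z ω * ∑ i ∈ Finset.range (n + 1), g i j *
        (if (X ω).left r = i ∧ lowUntil (X ω) n s r then (1 : ℝ) else 0)) hprod]
  refine (enorm_integral_le_lintegral_enorm _).trans (lintegral_mono fun r => ?_)
  simp only [Finset.mul_sum]
  rw [integral_finsetSum]
  · refine (enorm_sum_le _ _).trans (Finset.sum_le_sum fun i _ => ?_)
    rw [← enorm_mul, ← integral_const_mul]
    refine le_of_eq ?_
    congr 2
    ext ω; ring
  · intro i _
    have h2 : Measurable fun ω => g i j *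
        (if (X ω).left r = i ∧ lowUntil (X ω) n s r then (1 : ℝ) else 0) :=
      ((hmeas1 i).comp measurable_prodMk_left).const_mul _
    refine hZi.integrableOn.mul_bdd (c := |g i j|) h2.aestronglyMeasurable
      (Eventually.of_forall fun ω => ?_)
    rw [Real.norm_eq_abs, abs_mul]
    refine mul_le_of_le_one_right (abs_nonneg _) ?_
    split_ifs <;> simp

open Classical in
-- For `i ≤ n` the means of `Z` over `A` on the events where the path has stayed low and `x(r⁻) = i`
-- satisfy a closed finite system of linear integral inequalities. The initial values vanish by
-- `hgood`, so Gronwall's inequality with constant term zero applies.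
theorem setIntegral_low_eq_zero (hZ : MemLp Z 2 Pm)
    (hJ : ∀ q, Pred 𝔽 q → nsq g Pm X q ≠ ∞ →
      ∫ ω, Z ω * sT g (X ω) (fun z => q z.1 ω z.2) ∂Pm = 0)
    {s : Time T} {A : Set Ω} (hA : MeasurableSet[𝔽 s] A) {n : ℕ} (hAn : ∀ ω ∈ A, (X ω).val s ≤ n)
    (hgood : ∀ j, ∫ ω in A, Z ω * ind j ((X ω).val s) ∂Pm = 0) {t : Time T} (hst : s ≤ t) {j : ℕ}
    (hj : j ≤ n) :
    ∫ ω in A, Z ω * (if (X ω).val t = j ∧ lowUntil (X ω) n s t then 1 else 0) ∂Pm = 0 := by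
  have hA' := 𝔽.le _ _ hA
  have hZi : Integrable Z Pm := hZ.integrable (by norm_num)
  set w : ℕ → Time T → ℝ := fun i r =>
    ∫ ω in A, Z ω * (if (X ω).left r = i ∧ lowUntil (X ω) n s r then 1 else 0) ∂Pm with hw
  set y : Time T → ℝ≥0∞ := fun r => if s < r then ∑ i ∈ Finset.range (n + 1), ‖w i r‖ₑ else 0
  have hZind : ∀ i, IntegrableOn (fun ω => Z ω * ind i ((X ω).val s)) A Pm := fun i => by
    refine hZi.integrableOn.mul_bdd (c := 1)
      ((Measurable.of_discrete (f := ind i)).comp (S.measurable_val s)).aestronglyMeasurable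
      (Eventually.of_forall fun ω => ?_)
    rw [Real.norm_eq_abs, abs_of_nonneg (ind_nonneg _ _)]
    exact ind_le_one _ _
  have hZp : ∀ (r : Time T) (p : Ω → Prop) [DecidablePred p], MeasurableSet {ω | p ω} → IntegrableOn (fun ω => Z ω *
      (if p ω ∧ lowUntil (X ω) n s r then 1 else 0)) A Pm := fun r p _ hp => by
    refine hZi.integrableOn.mul_bdd (c := 1) (Measurable.ite (hp.inter
      (S.measurableSet_lowUntil_time n s r)) measurable_const measurable_const).aestronglyMeasurable
      (Eventually.of_forall fun ω => ?_)
    split_ifs <;> simp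
  have hp1 : ∀ (r : Time T) i, MeasurableSet {ω : Ω | (X ω).left r = i} := fun r i =>
    (S.measurable_left_joint.comp measurable_prodMk_left) (measurableSet_singleton i)
  have hp2 : ∀ (r : Time T) i, MeasurableSet {ω : Ω | (X ω).val r = i} := fun r i =>
    S.measurable_val r (measurableSet_singleton i)
  set K : ℝ := ∑ i ∈ Finset.range (n + 1), ∑ k ∈ Finset.range (n + 1), |g i k| + 1
  have hK : 0 < K := by positivity
  have hgK : ∀ i ∈ Finset.range (n + 1), ∀ k ∈ Finset.range (n + 1), ‖g i k‖ₑ ≤ ENNReal.ofReal K := by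
    intro i hi k hk
    rw [← ofReal_norm, Real.norm_eq_abs]
    refine ENNReal.ofReal_le_ofReal ?_
    have h1 : |g i k| ≤ ∑ k ∈ Finset.range (n + 1), |g i k| :=
      Finset.single_le_sum (f := fun k => |g i k|) (fun _ _ => abs_nonneg _) hk
    have h2 : ∑ k ∈ Finset.range (n + 1), |g i k| ≤
        ∑ i ∈ Finset.range (n + 1), ∑ k ∈ Finset.range (n + 1), |g i k| :=
      Finset.single_le_sum (f := fun i => ∑ k ∈ Finset.range (n + 1), |g i k|)
        (fun _ _ => Finset.sum_nonneg fun _ _ => abs_nonneg _) hi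
    linarith
  -- Used twice: on `(s, r)` for left limits, which closes the system for `y`, and on `(s, t]` for
  -- the value at `t`, once `y` is known to vanish.
  have hstep : ∀ k ∈ Finset.range (n + 1), ∀ B : Set (Time T), MeasurableSet B → B ⊆ Set.Ioi s →
      ∀ V : Ω → ℝ, IntegrableOn (fun ω => Z ω * V ω) A Pm → (∀ ω ∈ A, ∑ σ ∈ jumps (X ω) with
        σ ∈ B ∧ lowUntil (X ω) n s σ, dind (X ω) k σ = V ω - ind k ((X ω).val s)) →
      ‖∫ ω in A, Z ω * V ω ∂Pm‖ₑ ≤ ENNReal.ofReal K * ∫⁻ r in B, y r := fun k hk B hB hBs V hV e => by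
    have h1 := integral_sub hV (hZind k)
    rw [hgood k, sub_zero] at h1
    rw [← h1]
    have h2 : ∫ ω in A, (Z ω * V ω - Z ω * ind k ((X ω).val s)) ∂Pm = ∫ ω in A, Z ω *
        ∑ σ ∈ jumps (X ω) with σ ∈ B ∧ lowUntil (X ω) n s σ, dind (X ω) k σ ∂Pm :=
      setIntegral_congr_fun hA' fun ω hω => by simp only [e ω hω, mul_sub]
    rw [h2]
    refine (S.enorm_setIntegral_sum_dind_le hZ hJ hA hAn k hB hBs).trans ?_
    rw [← lintegral_const_mul' _ _ ENNReal.ofReal_ne_top]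
    refine setLIntegral_mono' hB fun r hr => ?_
    have : s < r := hBs hr
    simp only [y, this, if_true, Finset.mul_sum]
    exact Finset.sum_le_sum fun i hi => mul_le_mul' (hgK i hi k hk) le_rfl
  have hyB : ∀ r, y r ≤ (n + 1 : ℕ) * ∫⁻ ω, ‖Z ω‖ₑ ∂Pm := fun r => by
    simp only [y]
    split_ifs
    · refine (Finset.sum_le_card_nsmul _ _ (∫⁻ ω, ‖Z ω‖ₑ ∂Pm) fun i _ => ?_).trans (by simp)
      refine (enorm_integral_le_lintegral_enorm _).trans
        ((lintegral_mono fun ω => ?_).trans (setLIntegral_le_lintegral A _))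
      rw [enorm_mul]
      refine mul_le_of_le_one_right zero_le ?_
      split_ifs <;> simp
    · exact zero_le
  have hyle : ∀ r, y r ≤ 0 + ENNReal.ofReal ((n + 1 : ℕ) * K) * ∫⁻ u in Set.Iic r, y u := fun r => by
    rw [zero_add]
    by_cases h : s < r
    · have e : ∀ k ∈ Finset.range (n + 1), ‖w k r‖ₑ ≤ ENNReal.ofReal K * ∫⁻ u in Set.Iic r, y u :=
        fun k hk => by
        refine (hstep k hk (Set.Ioo s r) measurableSet_Ioo (fun u hu => hu.1) _ (hZp r _ (hp1 r k))
          fun ω hω => ?_).trans (mul_le_mul' le_rfl (lintegral_mono_set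
            (Set.Ioo_subset_Iio_self.trans Set.Iio_subset_Iic_self)))
        refine (Finset.sum_congr (Finset.ext fun σ => by simp) fun _ _ => rfl).trans
          ((sum_dind_Ioo (X ω) (by simpa [Nat.lt_succ_iff] using hk) h).trans rfl)
      simp only [y, h, if_true]
      refine (Finset.sum_le_card_nsmul _ _ _ e).trans (le_of_eq ?_)
      rw [Finset.card_range, nsmul_eq_mul, ENNReal.ofReal_mul (by positivity),
        ENNReal.ofReal_natCast, mul_assoc]
    · simp [y, h]
  have hy0 : ∀ r, y r = 0 := fun r => by
    have h1 := gronwall (ENNReal.mul_ne_top (by simp) (by simpa using hZi.2.ne)) hyB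
      (by positivity) hyle r
    simpa using h1
  have h1 := hstep j (by simpa [Nat.lt_succ_iff] using hj) (Set.Ioc s t) measurableSet_Ioc
    (fun u hu => hu.1) _ (hZp t _ (hp2 t j)) fun ω hω => by
      refine (Finset.sum_congr (Finset.ext fun σ => by simp) fun _ _ => rfl).trans
        ((sum_dind_Ioc_of_lowUntil (X ω) hj hst).trans rfl)
  simp only [hy0, lintegral_zero, mul_zero] at h1
  simpa using h1

/-- The level `n` tends to infinity: each path is bounded, so it is eventually low. A set `B` of
states is then split into its points. The conclusion has the form of `hgood` at the later time,
which allows iteration. -/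
theorem setIntegral_val_eq_zero (hZ : MemLp Z 2 Pm)
    (hJ : ∀ q, Pred 𝔽 q → nsq g Pm X q ≠ ∞ →
      ∫ ω, Z ω * sT g (X ω) (fun z => q z.1 ω z.2) ∂Pm = 0)
    {s : Time T} {A : Set Ω} (hA : MeasurableSet[𝔽 s] A)
    (hgood : ∀ B : Set ℕ, ∫ ω in A ∩ (fun ω => (X ω).val s) ⁻¹' B, Z ω ∂Pm = 0) {t : Time T}
    (hst : s ≤ t) (B : Set ℕ) : ∫ ω in A ∩ (fun ω => (X ω).val t) ⁻¹' B, Z ω ∂Pm = 0 := by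
  classical
  have hA' := 𝔽.le _ _ hA
  have hZi : Integrable Z Pm := hZ.integrable (by norm_num)
  have hsing : ∀ j, ∫ ω in A ∩ (fun ω => (X ω).val t) ⁻¹' {j}, Z ω ∂Pm = 0 := fun j => by
    have hn : ∀ n, j ≤ n → ∫ ω in A ∩ (fun ω => (X ω).val s) ⁻¹' Set.Iic n,
        Z ω * (if (X ω).val t = j ∧ lowUntil (X ω) n s t then 1 else 0) ∂Pm = 0 := fun n hjn => by
      refine S.setIntegral_low_eq_zero hZ hJ (hA.inter (S.adapted s measurableSet_Iic))
        (fun ω hω => hω.2) (fun k => ?_) hst hjn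
      rw [← hgood (Set.Iic n ∩ {k}), Set.preimage_inter, ← Set.inter_assoc,
        ← setIntegral_indicator (S.measurable_val s (measurableSet_singleton k))]
      refine integral_congr_ae (Eventually.of_forall fun ω => ?_)
      by_cases h : (X ω).val s = k <;> simp [ind, h]
    set F : ℕ → Ω → ℝ := fun n => (A ∩ (fun ω => (X ω).val s) ⁻¹' Set.Iic n).indicator fun ω =>
      Z ω * (if (X ω).val t = j ∧ lowUntil (X ω) n s t then 1 else 0) with hF
    have hsm : ∀ n, MeasurableSet (A ∩ (fun ω => (X ω).val s) ⁻¹' Set.Iic n) := fun n =>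
      hA'.inter (S.measurable_val s measurableSet_Iic)
    have hm2 : MeasurableSet ((fun ω => (X ω).val t) ⁻¹' {j}) :=
      S.measurable_val t (measurableSet_singleton j)
    have hlim := tendsto_integral_of_dominated_convergence (μ := Pm) (F := F)
      (f := (A ∩ (fun ω => (X ω).val t) ⁻¹' {j}).indicator Z) (fun ω => |Z ω|) (fun n => ?_) hZi.abs
      (fun n => Eventually.of_forall fun ω => ?_) (Eventually.of_forall fun ω => ?_)
    · rw [integral_indicator (hA'.inter hm2)] at hlim
      refine tendsto_nhds_unique hlim (tendsto_const_nhds.congr' ?_)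
      filter_upwards [eventually_ge_atTop j] with n hjn
      rw [hF]
      dsimp only
      rw [integral_indicator (hsm n), hn n hjn]
    · refine (hZi.aestronglyMeasurable.mul ?_).indicator (hsm n)
      exact (Measurable.ite ((S.measurable_val t (measurableSet_singleton j)).inter
        (S.measurableSet_lowUntil_time n s t)) measurable_const measurable_const).aestronglyMeasurable
    · simp only [hF, Set.indicator_apply]
      split_ifs <;> simp
    · obtain ⟨N, hN⟩ := (X ω).bddAbove_range
      refine tendsto_const_nhds.congr' ?_
      filter_upwards [eventually_ge_atTop N] with n hnN
      have h1 : lowUntil (X ω) n s t := fun σ _ _ _ => (hN σ).trans hnN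
      have h2 : (X ω).val s ≤ n := (hN s).trans hnN
      by_cases h3 : ω ∈ A <;> by_cases h4 : (X ω).val t = j <;> simp [hF, h1, h2, h3, h4]
  have hU : A ∩ (fun ω => (X ω).val t) ⁻¹' B =
      ⋃ j : ℕ, A ∩ (fun ω => (X ω).val t) ⁻¹' (B ∩ {j}) := by
    ext ω; simp
  rw [hU, integral_iUnion (fun j => hA'.inter (S.measurable_val t .of_discrete)) ?_ hZi.integrableOn]
  · refine (tsum_congr fun j => ?_).trans tsum_zero
    by_cases h : j ∈ B
    · rw [Set.inter_eq_right.2 (Set.singleton_subset_iff.2 h), hsing j]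
    · have : B ∩ {j} = ∅ := by ext k; simp; rintro h1 rfl; exact h h1
      simp [this]
  · intro i j hij
    refine Set.disjoint_left.2 fun ω h1 h2 => hij ?_
    have e1 : (X ω).val t = i := h1.2.2
    have e2 : (X ω).val t = j := h2.2.2
    omega

theorem measurable_path : Measurable X := by
  refine measurable_iff_comap_le.2 ?_
  rw [show (instMeasurableSpaceChainPath : MeasurableSpace (ChainPath T)) =
    ⨆ t : Time T, MeasurableSpace.comap (fun ω : ChainPath T => ω.val t) ⊤ from rfl,
    MeasurableSpace.comap_iSup]
  refine iSup_le fun t => ?_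
  rw [MeasurableSpace.comap_comp]
  exact measurable_iff_comap_le.1 (S.measurable_val t)

/-- The martingale representation property: a square integrable variable orthogonal to `𝔽 ⊥` and to
all stochastic integrals vanishes. -/
theorem ae_eq_zero_of_orthogonal (hZ : MemLp Z 2 Pm)
    (h0 : ∀ A, MeasurableSet[𝔽 ⊥] A → ∫ ω in A, Z ω ∂Pm = 0)
    (hJ : ∀ q, Pred 𝔽 q → nsq g Pm X q ≠ ∞ →
      ∫ ω, Z ω * sT g (X ω) (fun z => q z.1 ω z.2) ∂Pm = 0) : Z =ᵐ[Pm] 0 := by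
  classical
  have hZi : Integrable Z Pm := hZ.integrable (by norm_num)
  have hX := S.measurable_path
  -- Induction over the times of a cylinder in increasing order. The claim leaves one further event
  -- of `x(t)` free, and this is the input `setIntegral_val_eq_zero` asks for when the next time is
  -- added. The start is the orthogonality to `𝔽 ⊥`.
  have hcyl : ∀ (F : Finset (Time T)) (b : Time T → Set ℕ),
      MeasurableSet[𝔽 (F.sup id)] (⋂ r ∈ F, (fun ω => (X ω).val r) ⁻¹' b r) ∧
      ∀ t, (∀ r ∈ F, r ≤ t) → ∀ B : Set ℕ,
      ∫ ω in (⋂ r ∈ F, (fun ω => (X ω).val r) ⁻¹' b r) ∩ (fun ω => (X ω).val t) ⁻¹' B, Z ω ∂Pm = 0 := by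
    intro F b
    induction F using Finset.induction_on_max with
    | empty =>
      have hu : (⋂ r ∈ (∅ : Finset (Time T)), (fun ω => (X ω).val r) ⁻¹' b r) = Set.univ := by simp
      rw [hu]
      refine ⟨@MeasurableSet.univ _ _, fun t _ B => ?_⟩
      refine S.setIntegral_val_eq_zero hZ hJ (s := ⊥) (@MeasurableSet.univ _ _) (fun C => ?_) bot_le B
      rw [Set.univ_inter]
      exact h0 _ (S.adapted ⊥ .of_discrete)
    | insert a F ha ih =>
      have e : (⋂ r ∈ insert a F, (fun ω => (X ω).val r) ⁻¹' b r) =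
          (⋂ r ∈ F, (fun ω => (X ω).val r) ⁻¹' b r) ∩ (fun ω => (X ω).val a) ⁻¹' b a := by
        rw [Finset.set_biInter_insert, Set.inter_comm]
      have hsup : F.sup id ≤ a := Finset.sup_le fun r hr => (ha r hr).le
      have hm : MeasurableSet[𝔽 a] ((⋂ r ∈ F, (fun ω => (X ω).val r) ⁻¹' b r) ∩
          (fun ω => (X ω).val a) ⁻¹' b a) :=
        (𝔽.mono hsup _ ih.1).inter (S.adapted a .of_discrete)
      rw [e]
      refine ⟨𝔽.mono ?_ _ hm, fun t ht B => ?_⟩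
      · rw [Finset.sup_insert]; exact le_sup_left
      · refine S.setIntegral_val_eq_zero hZ hJ hm (fun C => ?_) (ht a (Finset.mem_insert_self _ _)) B
        rw [Set.inter_assoc, ← Set.preimage_inter]
        exact ih.2 a (fun r hr => (ha r hr).le) _
  -- Cylinders form a π-system that generates the σ-field of the path space; the field `gen` then
  -- reaches every event up to a null set.
  have hall : ∀ C : Set (ChainPath T), MeasurableSet C → ∫ ω in X ⁻¹' C, Z ω ∂Pm = 0 := by
    have hgen : (inferInstance : MeasurableSpace (ChainPath T)) = MeasurableSpace.generateFrom
        (piiUnionInter (fun t : Time T => {C | MeasurableSet[MeasurableSpace.comap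
          (fun ω : ChainPath T => ω.val t) ⊤] C}) Set.univ) := by
      refine Eq.trans ?_ (generateFrom_piiUnionInter_measurableSet (fun t : Time T =>
        MeasurableSpace.comap (fun ω : ChainPath T => ω.val t) ⊤) Set.univ).symm
      simp only [Set.mem_univ, iSup_pos]
      rfl
    have hpi := isPiSystem_piiUnionInter (fun t : Time T => {C | MeasurableSet[MeasurableSpace.comap
          (fun ω : ChainPath T => ω.val t) ⊤] C})
      (fun t => @MeasurableSpace.isPiSystem_measurableSet _ (MeasurableSpace.comap
          (fun ω : ChainPath T => ω.val t) ⊤)) Set.univ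
    have hcyl' : ∀ C ∈ piiUnionInter (fun t : Time T => {C | MeasurableSet[MeasurableSpace.comap
          (fun ω : ChainPath T => ω.val t) ⊤] C}) Set.univ, ∫ ω in X ⁻¹' C, Z ω ∂Pm = 0 := by
      rintro _ ⟨F, -, f, hf, rfl⟩
      have hf' : ∀ r, ∃ b : Set ℕ, r ∈ F → (fun ω : ChainPath T => ω.val r) ⁻¹' b = f r := fun r => by
        by_cases hr : r ∈ F
        · obtain ⟨b, -, hb⟩ := hf r hr
          exact ⟨b, fun _ => hb⟩
        · exact ⟨∅, fun h => absurd h hr⟩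
      choose b hb using hf'
      have h1 := (hcyl F b).2 ⊤ (fun _ _ => le_top) Set.univ
      rw [Set.preimage_univ, Set.inter_univ] at h1
      rw [← h1]
      congr 2
      ext ω
      simp only [Set.mem_preimage, Set.mem_iInter]
      refine forall₂_congr fun r hr => ?_
      rw [← hb r hr]
      rfl
    have huniv : ∫ ω, Z ω ∂Pm = 0 := by simpa using h0 _ (@MeasurableSet.univ _ _)
    intro C hC
    induction C, hC using MeasurableSpace.induction_on_inter hgen hpi with
    | empty => simp
    | basic C hC => exact hcyl' C hC
    | compl C hC ih =>
      have := integral_add_compl (hX hC) hZi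
      rw [ih, huniv, zero_add] at this
      rwa [Set.preimage_compl]
    | iUnion f hd hm ih =>
      rw [Set.preimage_iUnion, integral_iUnion (fun i => hX (hm i))
        (fun i j hij => (hd hij).preimage X) hZi.integrableOn]
      simp [ih]
  refine hZi.ae_eq_zero_of_forall_setIntegral_eq_zero fun A hA _ => ?_
  obtain ⟨_, ⟨C, hC, rfl⟩, hAC⟩ := S.gen A hA
  rw [setIntegral_congr_set hAC]
  exact hall C hC

end ChainSetup
end MFChain
end

/-! ### `L²` estimates for the linear mean-field driver -/

noncomputable section

namespace MFChain
variable {T : ℝ} [Fact (0 ≤ T)] {Ω : Type*} [mΩ : MeasurableSpace Ω]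

theorem lintegral_mul_sq_le {α : Type*} {m : MeasurableSpace α} {μ : Measure α} {f h : α → ℝ≥0∞}
    (hf : AEMeasurable f μ) (hh : AEMeasurable h μ) :
    (∫⁻ a, f a * h a ∂μ) ^ 2 ≤ (∫⁻ a, f a ^ 2 ∂μ) * ∫⁻ a, h a ^ 2 ∂μ := by
  have h1 := ENNReal.lintegral_mul_le_Lp_mul_Lq μ Real.HolderConjugate.two_two hf hh
  have h2 := pow_le_pow_left₀ zero_le h1 2
  simp only [Pi.mul_apply, ENNReal.rpow_two] at h2
  have e : ∀ x : ℝ≥0∞, (x ^ (1 / 2 : ℝ)) ^ 2 = x := fun x => by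
    rw [← ENNReal.rpow_natCast, ← ENNReal.rpow_mul]; norm_num
  rwa [mul_pow, e, e] at h2

theorem lintegral_sq_le {α : Type*} {m : MeasurableSpace α} {μ : Measure α} {f : α → ℝ≥0∞}
    (hf : AEMeasurable f μ) : (∫⁻ a, f a ∂μ) ^ 2 ≤ μ Set.univ * ∫⁻ a, f a ^ 2 ∂μ := by
  simpa using lintegral_mul_sq_le (f := fun _ => 1) (μ := μ) aemeasurable_const hf

theorem enorm_add_sq_le (a b : ℝ) : ‖a + b‖ₑ ^ 2 ≤ 2 * ‖a‖ₑ ^ 2 + 2 * ‖b‖ₑ ^ 2 := by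
  have hen : ∀ r : ℝ, ‖r‖ₑ ^ 2 = ENNReal.ofReal (r ^ 2) := fun r => by
    rw [← ofReal_norm, ← ENNReal.ofReal_pow (norm_nonneg _), Real.norm_eq_abs, sq_abs]
  have h2 : (2 : ℝ≥0∞) = ENNReal.ofReal 2 := by simp
  rw [hen, hen, hen, h2, ← ENNReal.ofReal_mul (by norm_num), ← ENNReal.ofReal_mul (by norm_num),
    ← ENNReal.ofReal_add (by positivity) (by positivity)]
  exact ENNReal.ofReal_le_ofReal (by nlinarith [sq_nonneg (a - b)])

theorem enorm_integral_mul_sq_le {μ : Measure ℕ} {a b : ℕ → ℝ} {c : ℝ≥0∞}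
    (h : ∫⁻ j, ‖a j‖ₑ ^ 2 ∂μ ≤ c) :
    ‖∫ j, a j * b j ∂μ‖ₑ ^ 2 ≤ c * ∫⁻ j, ‖b j‖ₑ ^ 2 ∂μ := by
  refine (pow_le_pow_left₀ zero_le (enorm_integral_le_lintegral_enorm _) 2).trans ?_
  simp only [enorm_mul]
  exact (lintegral_mul_sq_le .of_discrete .of_discrete).trans (mul_le_mul' h le_rfl)

/-- A process whose restriction to `[0, t]` is measurable with respect to `𝔽 t`. -/
def Prog (𝔽 : Filtration (Time T) mΩ) (a : Time T → Ω → ℝ) : Prop :=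
  ∀ t, Measurable[(inferInstance : MeasurableSpace (Time T)).prod (𝔽 t)]
    fun z : Time T × Ω => a (min z.1 t) z.2

section Prog
variable {𝔽 : Filtration (Time T) mΩ} {a b : Time T → Ω → ℝ}

theorem Prog.of_predictable (ha : Measurable[𝔽.predictable] fun z : Time T × Ω => a z.1 z.2) :
    Prog 𝔽 a := fun t => ha.comp (measurable_min_predictable t)

theorem Prog.measurable (ha : Prog 𝔽 a) : Measurable fun z : Time T × Ω => a z.1 z.2 := by
  have h := (ha ⊤).mono (sup_le_sup le_rfl (MeasurableSpace.comap_mono (𝔽.le ⊤))) le_rfl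
  simpa using h

theorem Prog.measurable_setIntegral (ha : Prog 𝔽 a) (t : Time T) :
    Measurable[𝔽 t] fun ω => ∫ s in Set.Iic t, a s ω := by
  have h := @StronglyMeasurable.integral_prod_left' _ _ _ _ (𝔽 t) (volume.restrict (Set.Iic t)) _ _ _ _
    (@Measurable.stronglyMeasurable _ _ (_) _ _ _ _ _ _ (ha t))
  convert h.measurable using 2 with ω
  refine setIntegral_congr_fun measurableSet_Iic fun s hs => ?_
  simp [min_eq_left (Set.mem_Iic.1 hs)]

end Prog

/-- The integral of `‖q_s‖²` over `Ω`. -/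
def msq (g : ℕ → ℕ → ℝ) (Pm : Measure Ω) (X : Ω → ChainPath T) (q : Time T → Ω → ℕ → ℝ)
    (s : Time T) : ℝ≥0∞ :=
  ∫⁻ ω, (∫⁻ j, ‖q s ω j‖ₑ ^ 2 ∂rate g ((X ω).left s)) ∂Pm

/-- The coefficients of the linear mean-field driver. -/
structure Coeffs (T : ℝ) (Ω : Type*) where
  ℓ : Time T → Ω → ℕ → ℝ
  ℓy : Time T → Ω → ℕ → ℝ
  L : Time T → Ω → ℝ
  κ : ℕ → ℝ

namespace Coeffs

/-- The mean-field term `E[L ⟨ℓy, q⟩]`. -/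
def mf (D : Coeffs T Ω) (g : ℕ → ℕ → ℝ) (Pm : Measure Ω) (X : Ω → ChainPath T)
    (q : Time T → Ω → ℕ → ℝ) (s : Time T) : ℝ :=
  ∫ η, D.L s η * (∫ j, D.ℓy s η j * q s η j ∂rate g ((X η).left s)) ∂Pm

/-- The linear driver `⟨ℓ, q⟩ + κ E[L ⟨ℓy, q⟩]`. -/
def drv (D : Coeffs T Ω) (g : ℕ → ℕ → ℝ) (Pm : Measure Ω) (X : Ω → ChainPath T)
    (q : Time T → Ω → ℕ → ℝ) (s : Time T) (ω : Ω) : ℝ :=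
  -- The left limit inside `κ` makes the driver predictable. It differs from the state only at the
  -- jump times, which are Lebesgue null.
  (∫ j, D.ℓ s ω j * q s ω j ∂rate g ((X ω).left s)) + D.κ ((X ω).left s) * D.mf g Pm X q s

/-- One constant serves for all bounds. The density enters only through its `L²` norm, which
suffices for Cauchy-Schwarz in the mean-field term; that term is deterministic, so joint
measurability of `L` is enough. -/
structure Bounded (D : Coeffs T Ω) (g : ℕ → ℕ → ℝ) (Pm : Measure Ω) (𝔽 : Filtration (Time T) mΩ)
    (X : Ω → ChainPath T) (c : NNReal) : Prop where
  ℓ_pred : Pred 𝔽 D.ℓ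
  ℓy_pred : Pred 𝔽 D.ℓy
  ℓ_le : ∀ s ω, ∫⁻ j, ‖D.ℓ s ω j‖ₑ ^ 2 ∂rate g ((X ω).left s) ≤ c
  ℓy_le : ∀ s ω, ∫⁻ j, ‖D.ℓy s ω j‖ₑ ^ 2 ∂rate g ((X ω).left s) ≤ c
  L_meas : Measurable fun z : Time T × Ω => D.L z.1 z.2
  L_le : ∀ s, ∫⁻ ω, ‖D.L s ω‖ₑ ^ 2 ∂Pm ≤ c
  κ_le : ∀ k, ‖D.κ k‖ₑ ≤ c

end Coeffs

theorem measurable_section {F : Time T × Ω → ℝ} (hF : Measurable F) (s : Time T) :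
    Measurable fun ω => F (s, ω) := hF.comp measurable_prodMk_left

theorem Pred.mul {𝔽 : Filtration (Time T) mΩ} {q r : Time T → Ω → ℕ → ℝ} (hq : Pred 𝔽 q)
    (hr : Pred 𝔽 r) : Pred 𝔽 fun s ω j => q s ω j * r s ω j :=
  fun j => Measurable.mul (hq j) (hr j)

theorem Pred.add {𝔽 : Filtration (Time T) mΩ} {q r : Time T → Ω → ℕ → ℝ} (hq : Pred 𝔽 q)
    (hr : Pred 𝔽 r) : Pred 𝔽 fun s ω j => q s ω j + r s ω j :=
  fun j => Measurable.add (hq j) (hr j)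

theorem Pred.sub {𝔽 : Filtration (Time T) mΩ} {q r : Time T → Ω → ℕ → ℝ} (hq : Pred 𝔽 q)
    (hr : Pred 𝔽 r) : Pred 𝔽 fun s ω j => q s ω j - r s ω j :=
  fun j => Measurable.sub (hq j) (hr j)

theorem Pred.const_mul {𝔽 : Filtration (Time T) mΩ} {q : Time T → Ω → ℕ → ℝ} (hq : Pred 𝔽 q)
    (c : ℝ) : Pred 𝔽 fun s ω j => c * q s ω j :=
  fun j => (measurable_const_mul c).comp (hq j)

namespace ChainSetup

variable {g : ℕ → ℕ → ℝ} {Pm : Measure Ω} {𝔽 : Filtration (Time T) mΩ} {X : Ω → ChainPath T}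
  (S : ChainSetup g Pm 𝔽 X) {q r : Time T → Ω → ℕ → ℝ}
include S

theorem measurable_rate_integral_real (hq : Pred 𝔽 q) : Measurable[𝔽.predictable]
    fun z : Time T × Ω => ∫ j, q z.1 z.2 j ∂rate g ((X z.2).left z.1) :=
  measurable_integral_of_lintegral (fun _ => .of_discrete)
    (S.measurable_rate_integral (f := fun s ω j => ENNReal.ofReal (q s ω j)) hq.ofReal)
    (S.measurable_rate_integral (f := fun s ω j => ENNReal.ofReal (-q s ω j)) hq.neg.ofReal)
    (S.measurable_rate_integral (f := fun s ω j => ‖q s ω j‖ₑ) hq.enorm)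

theorem measurable_rate_sq (hq : Pred 𝔽 q) : Measurable
    fun z : Time T × Ω => ∫⁻ j, ‖q z.1 z.2 j‖ₑ ^ 2 ∂rate g ((X z.2).left z.1) :=
  (S.measurable_rate_integral (f := fun s ω j => ‖q s ω j‖ₑ ^ 2) hq.enorm_sq).mono
    predictable_le le_rfl

variable [IsProbabilityMeasure Pm]

theorem measurable_msq (hq : Pred 𝔽 q) : Measurable (msq g Pm X q) :=
  (S.measurable_rate_sq hq).lintegral_prod_right'

theorem nsq_eq (hq : Pred 𝔽 q) : nsq g Pm X q = ∫⁻ s, msq g Pm X q s := by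
  have h1 : ∀ ω, ∫⁻ z, ‖q z.1 ω z.2‖ₑ ^ 2 ∂cm g (X ω) =
      ∫⁻ s, (∫⁻ j, ‖q s ω j‖ₑ ^ 2 ∂rate g ((X ω).left s)) := fun ω =>
    lintegral_cm g (X ω) (S.measurable_mark (f := fun s ω j => ‖q s ω j‖ₑ ^ 2) hq.enorm_sq ω)
  simp only [nsq, h1, msq]
  exact lintegral_lintegral_swap
    (f := fun ω s => ∫⁻ j, ‖q s ω j‖ₑ ^ 2 ∂rate g ((X ω).left s))
    ((S.measurable_rate_sq hq).comp measurable_swap).aemeasurable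

theorem msq_lt_top (hq : Pred 𝔽 q) (hn : nsq g Pm X q ≠ ∞) : ∀ᵐ s, msq g Pm X q s < ∞ := by
  rw [S.nsq_eq hq] at hn
  exact ae_lt_top (S.measurable_msq hq) hn

variable {D : Coeffs T Ω} {c : NNReal} (B : D.Bounded g Pm 𝔽 X c)
include B

theorem measurable_mf (hq : Pred 𝔽 q) : Measurable (D.mf g Pm X q) := by
  have h : Measurable fun z : Time T × Ω => D.L z.1 z.2 *
      (∫ j, D.ℓy z.1 z.2 j * q z.1 z.2 j ∂rate g ((X z.2).left z.1)) :=
    B.L_meas.mul ((S.measurable_rate_integral_real (B.ℓy_pred.mul hq)).mono predictable_le le_rfl)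
  exact (h.stronglyMeasurable.integral_prod_right' (ν := Pm)).measurable

theorem measurable_drv (hq : Pred 𝔽 q) : Measurable[𝔽.predictable]
    fun z : Time T × Ω => D.drv g Pm X q z.1 z.2 :=
  Measurable.add (S.measurable_rate_integral_real (B.ℓ_pred.mul hq))
    (Measurable.mul ((Measurable.of_discrete (f := D.κ)).comp S.measurable_left)
      ((S.measurable_mf B hq).comp measurable_fst_predictable))

/-- Cauchy-Schwarz twice: over `Ω` against the density, then over the target states against `ℓy`.
Each gives one factor `c`. -/
theorem enorm_mf_sq_le (hq : Pred 𝔽 q) (s : Time T) :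
    ‖D.mf g Pm X q s‖ₑ ^ 2 ≤ (c : ℝ≥0∞) ^ 2 * msq g Pm X q s := by
  have hm0 : Measurable fun z : Time T × Ω =>
      ∫ j, D.ℓy z.1 z.2 j * q z.1 z.2 j ∂rate g ((X z.2).left z.1) :=
    (S.measurable_rate_integral_real (q := fun s ω j => D.ℓy s ω j * q s ω j)
      (B.ℓy_pred.mul hq)).mono predictable_le le_rfl
  have hm : Measurable fun ω => ∫ j, D.ℓy s ω j * q s ω j ∂rate g ((X ω).left s) :=
    measurable_section hm0 s
  have hL : Measurable fun ω => D.L s ω := B.L_meas.comp (measurable_prodMk_left (x := s))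
  have h1 : ‖D.mf g Pm X q s‖ₑ ≤
      ∫⁻ ω, ‖D.L s ω‖ₑ * ‖∫ j, D.ℓy s ω j * q s ω j ∂rate g ((X ω).left s)‖ₑ ∂Pm := by
    simp only [← enorm_mul]
    exact enorm_integral_le_lintegral_enorm _
  have h2 : ∫⁻ ω, ‖∫ j, D.ℓy s ω j * q s ω j ∂rate g ((X ω).left s)‖ₑ ^ 2 ∂Pm ≤
      c * msq g Pm X q s := by
    rw [msq, ← lintegral_const_mul' _ _ ENNReal.coe_ne_top]
    exact lintegral_mono fun ω => enorm_integral_mul_sq_le (B.ℓy_le s ω)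
  calc _ ≤ _ := pow_le_pow_left₀ zero_le h1 2
    _ ≤ _ := lintegral_mul_sq_le hL.enorm.aemeasurable hm.enorm.aemeasurable
    _ ≤ c * (c * msq g Pm X q s) := mul_le_mul' (B.L_le s) h2
    _ = _ := by ring

/-- From `(a + b)² ≤ 2a² + 2b²`. The term with `ℓ` contributes `2c`; the mean-field term contributes
`2c⁴`, a factor `c²` from `κ` and a factor `c²` from `enorm_mf_sq_le`. -/
theorem lintegral_drv_sq_le (hq : Pred 𝔽 q) (s : Time T) :
    ∫⁻ ω, ‖D.drv g Pm X q s ω‖ₑ ^ 2 ∂Pm ≤ (2 * c + 2 * c ^ 4 : NNReal) * msq g Pm X q s := by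
  have hm2 := (S.measurable_rate_sq hq).comp (measurable_prodMk_left (x := s))
  calc _ ≤ ∫⁻ ω, (2 * (c * ∫⁻ j, ‖q s ω j‖ₑ ^ 2 ∂rate g ((X ω).left s)) +
        2 * (c ^ 2 * (c ^ 2 * msq g Pm X q s))) ∂Pm := by
        refine lintegral_mono fun ω => (enorm_add_sq_le _ _).trans ?_
        refine add_le_add (mul_le_mul' le_rfl (enorm_integral_mul_sq_le (B.ℓ_le s ω)))
          (mul_le_mul' le_rfl ?_)
        rw [enorm_mul, mul_pow]
        exact mul_le_mul' (pow_le_pow_left₀ zero_le (B.κ_le _) 2) (S.enorm_mf_sq_le B hq s)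
    _ = 2 * (c * msq g Pm X q s) + 2 * (c ^ 2 * (c ^ 2 * msq g Pm X q s)) := by
        rw [lintegral_add_right _ measurable_const, lintegral_const, measure_univ, mul_one,
          lintegral_const_mul' _ _ (by simp), lintegral_const_mul' _ _ (by simp)]
        rfl
    _ = _ := by push_cast; ring

theorem integrable_mf (hq : Pred 𝔽 q) {s : Time T} (hqs : msq g Pm X q s < ∞) :
    Integrable (fun ω => D.L s ω * ∫ j, D.ℓy s ω j * q s ω j ∂rate g ((X ω).left s)) Pm := by
  have hL : MemLp (D.L s) 2 Pm := by
    refine ⟨(B.L_meas.comp measurable_prodMk_left).aestronglyMeasurable, ?_⟩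
    rw [eLpNorm_two_eq]
    exact ENNReal.rpow_lt_top_of_nonneg (by norm_num) (ne_top_of_le_ne_top (by simp) (B.L_le s))
  have hm2 := (S.measurable_rate_sq hq).comp (measurable_prodMk_left (x := s))
  refine MemLp.integrable_mul (p := 2) (q := 2) hL ⟨(((S.measurable_rate_integral_real
    (B.ℓy_pred.mul hq)).mono predictable_le le_rfl).comp measurable_prodMk_left).aestronglyMeasurable, ?_⟩
  rw [eLpNorm_two_eq]
  refine ENNReal.rpow_lt_top_of_nonneg (by norm_num) (ne_top_of_le_ne_top
    (b := c * msq g Pm X q s) (ENNReal.mul_ne_top (by simp) hqs.ne) ?_)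
  rw [msq, ← lintegral_const_mul' _ _ ENNReal.coe_ne_top]
  exact lintegral_mono fun ω => enorm_integral_mul_sq_le (B.ℓy_le s ω)

/-- Finiteness of `msq` at the time `s` makes the integrals involved converge outside a null set.
Elsewhere default values could break additivity, so the statement is only almost sure. -/
theorem drv_add (hq : Pred 𝔽 q) (hr : Pred 𝔽 r) {s : Time T} (hqs : msq g Pm X q s < ∞)
    (hrs : msq g Pm X r s < ∞) : ∀ᵐ ω ∂Pm, D.drv g Pm X (fun s ω j => q s ω j + r s ω j) s ω =
      D.drv g Pm X q s ω + D.drv g Pm X r s ω := by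
  have hI : ∀ {p : Time T → Ω → ℕ → ℝ}, Pred 𝔽 p → msq g Pm X p s < ∞ → ∀ᵐ ω ∂Pm,
      ∀ ℓ : ℕ → ℝ, ∫⁻ j, ‖ℓ j‖ₑ ^ 2 ∂rate g ((X ω).left s) ≤ c →
      Integrable (fun j => ℓ j * p s ω j) (rate g ((X ω).left s)) := by
    intro p hp hps
    have hm2 := (S.measurable_rate_sq hp).comp (measurable_prodMk_left (x := s))
    filter_upwards [ae_lt_top hm2 hps.ne] with ω hω ℓ hℓ
    have hM : ∀ {f : ℕ → ℝ}, ∫⁻ j, ‖f j‖ₑ ^ 2 ∂rate g ((X ω).left s) ≠ ∞ →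
        MemLp f 2 (rate g ((X ω).left s)) := fun {f} hf => by
      refine ⟨.of_discrete, ?_⟩
      rw [eLpNorm_two_eq]
      exact ENNReal.rpow_lt_top_of_nonneg (by norm_num) hf
    exact MemLp.integrable_mul (p := 2) (q := 2) (hM (ne_top_of_le_ne_top (by simp) hℓ)) (hM hω.ne)
  have hmf : D.mf g Pm X (fun s ω j => q s ω j + r s ω j) s = D.mf g Pm X q s + D.mf g Pm X r s := by
    rw [Coeffs.mf, Coeffs.mf, Coeffs.mf, ← integral_add (S.integrable_mf B hq hqs) (S.integrable_mf B hr hrs)]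
    refine integral_congr_ae ?_
    filter_upwards [hI hq hqs, hI hr hrs] with ω h1 h2
    simp only [mul_add]
    rw [integral_add (h1 _ (B.ℓy_le s ω)) (h2 _ (B.ℓy_le s ω)), mul_add]
  filter_upwards [hI hq hqs, hI hr hrs] with ω h1 h2
  simp only [Coeffs.drv, hmf, mul_add]
  rw [integral_add (h1 _ (B.ℓ_le s ω)) (h2 _ (B.ℓ_le s ω))]
  ring

omit B S [IsProbabilityMeasure Pm] in
theorem drv_const_mul (a : ℝ) (s : Time T) (ω : Ω) :
    D.drv g Pm X (fun s ω j => a * q s ω j) s ω = a * D.drv g Pm X q s ω := by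
  have h : ∀ x y : ℝ, x * (a * y) = a * (x * y) := fun x y => by ring
  simp only [Coeffs.drv, Coeffs.mf, h, integral_const_mul]
  ring

theorem lintegral_lintegral_drv_sq_le (hq : Pred 𝔽 q) :
    ∫⁻ ω, (∫⁻ s, ‖D.drv g Pm X q s ω‖ₑ ^ 2) ∂Pm ≤ (2 * c + 2 * c ^ 4 : NNReal) * nsq g Pm X q := by
  have hm := (S.measurable_drv B hq).mono predictable_le le_rfl
  rw [lintegral_lintegral_swap (f := fun ω s => ‖D.drv g Pm X q s ω‖ₑ ^ 2)
    ((hm.comp measurable_swap).enorm.pow_const 2).aemeasurable, S.nsq_eq hq,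
    ← lintegral_const_mul' _ _ ENNReal.coe_ne_top]
  exact lintegral_mono fun s => S.lintegral_drv_sq_le B hq s

theorem integrable_drv (hq : Pred 𝔽 q) (hn : nsq g Pm X q ≠ ∞) :
    ∀ᵐ ω ∂Pm, Integrable fun s => D.drv g Pm X q s ω := by
  have hm := (S.measurable_drv B hq).mono predictable_le le_rfl
  have h1 : ∫⁻ ω, (∫⁻ s, ‖D.drv g Pm X q s ω‖ₑ ^ 2) ∂Pm ≠ ∞ :=
    ne_top_of_le_ne_top (ENNReal.mul_ne_top ENNReal.coe_ne_top hn) (S.lintegral_lintegral_drv_sq_le B hq)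
  filter_upwards [ae_lt_top (hm.enorm.pow_const 2).lintegral_prod_left' h1] with ω hω
  have : MemLp (fun s => D.drv g Pm X q s ω) 2 := by
    refine ⟨(hm.comp measurable_prodMk_right).aestronglyMeasurable, ?_⟩
    rw [eLpNorm_two_eq]
    exact ENNReal.rpow_lt_top_of_nonneg (by norm_num) hω.ne
  exact this.integrable (by norm_num)

theorem integral_drv_add (hq : Pred 𝔽 q) (hr : Pred 𝔽 r) (hqn : nsq g Pm X q ≠ ∞)
    (hrn : nsq g Pm X r ≠ ∞) : ∀ᵐ ω ∂Pm,
      ∫ s, D.drv g Pm X (fun s ω j => q s ω j + r s ω j) s ω =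
        (∫ s, D.drv g Pm X q s ω) + ∫ s, D.drv g Pm X r s ω := by
  have hmq := (S.measurable_drv B hq).mono predictable_le le_rfl
  have hmr := (S.measurable_drv B hr).mono predictable_le le_rfl
  have hms := (S.measurable_drv B (hq.add hr)).mono predictable_le le_rfl
  have h1 : ∀ᵐ s, ∀ᵐ ω ∂Pm, D.drv g Pm X (fun s ω j => q s ω j + r s ω j) s ω =
      D.drv g Pm X q s ω + D.drv g Pm X r s ω := by
    filter_upwards [S.msq_lt_top hq hqn, S.msq_lt_top hr hrn] with s h1 h2
    exact S.drv_add B hq hr h1 h2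
  -- The identity is known for almost every time almost surely; for joint measurable processes the
  -- two quantifiers may be exchanged, and the time integral taken path by path.
  replace h1 := (Measure.ae_ae_comm (p := fun s ω => D.drv g Pm X (fun s ω j => q s ω j + r s ω j) s ω =
      D.drv g Pm X q s ω + D.drv g Pm X r s ω) (measurableSet_eq_fun hms (hmq.add hmr))).1 h1
  filter_upwards [h1, S.integrable_drv B hq hqn, S.integrable_drv B hr hrn] with ω h1 h2 h3
  rw [integral_congr_ae h1, integral_add h2 h3]

theorem lintegral_integral_drv_sq_le (hq : Pred 𝔽 q) :
    ∫⁻ ω, ‖∫ s, D.drv g Pm X q s ω‖ₑ ^ 2 ∂Pm ≤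
      volume (Set.univ : Set (Time T)) * ((2 * c + 2 * c ^ 4 : NNReal) * nsq g Pm X q) := by
  have hm := (S.measurable_drv B hq).mono predictable_le le_rfl
  refine le_trans ?_ (mul_le_mul' le_rfl (S.lintegral_lintegral_drv_sq_le B hq))
  rw [← lintegral_const_mul' _ _ (measure_ne_top _ _)]
  refine lintegral_mono fun ω => ?_
  refine (pow_le_pow_left₀ zero_le (enorm_integral_le_lintegral_enorm _) 2).trans ?_
  exact lintegral_sq_le (hm.comp measurable_prodMk_right).enorm.aemeasurable

end ChainSetup
end MFChain
end

/-! ### Weighted norms and the contraction estimate -/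

noncomputable section

namespace MFChain
variable {T : ℝ} [Fact (0 ≤ T)] {Ω : Type*} [mΩ : MeasurableSpace Ω]

theorem measurable_section_left {F : Time T × Ω → ℝ} (hF : Measurable F) (ω : Ω) :
    Measurable fun s => F (s, ω) := hF.comp measurable_prodMk_right

theorem lintegral_exp_neg_Ioi_le {β : ℝ} (hβ : 0 < β) (t : Time T) :
    ∫⁻ s in Set.Ioi t, ENNReal.ofReal (Real.exp (-(β * s))) ≤
      ENNReal.ofReal (Real.exp (-(β * t)) / β) := by
  classical
  rw [← lintegral_indicator measurableSet_Ioi]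
  set F : ℝ → ℝ≥0∞ := (Set.Ioi (t : ℝ)).indicator fun s => ENNReal.ofReal (Real.exp (-β * s))
  have hi : ∫ s in Set.Ioi (t : ℝ), Real.exp (-β * s) = Real.exp (-(β * t)) / β := by
    rw [integral_exp_mul_Ioi (by linarith)]
    rw [neg_mul, neg_div_neg_eq]
  calc _ = ∫⁻ s : Time T, F s := by
        refine lintegral_congr fun s => ?_
        simp [F, Set.indicator_apply]
    _ = ∫⁻ s in Set.Icc 0 T, F s := lintegral_subtype_comap measurableSet_Icc F
    _ ≤ ∫⁻ s, F s := setLIntegral_le_lintegral _ _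
    _ = ENNReal.ofReal (∫ s in Set.Ioi (t : ℝ), Real.exp (-β * s)) := by
        rw [lintegral_indicator measurableSet_Ioi, ofReal_integral_eq_lintegral_ofReal
          (integrableOn_exp_mul_Ioi (by linarith) _) (Eventually.of_forall fun s => (Real.exp_pos _).le)]
    _ = _ := by rw [hi]

theorem exp_le_one_add_lintegral {β : ℝ} (hβ : 0 < β) (s : Time T) :
    ENNReal.ofReal (Real.exp (β * s)) ≤
      1 + ∫⁻ t in Set.Iio s, ENNReal.ofReal (β * Real.exp (β * t)) := by
  classical
  set F : ℝ → ℝ≥0∞ := (Set.Iio (s : ℝ)).indicator fun t => ENNReal.ofReal (β * Real.exp (β * t))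
  have h1 : ∫⁻ t in Set.Iio s, ENNReal.ofReal (β * Real.exp (β * t)) =
      ∫⁻ t in Set.Ico (0 : ℝ) s, ENNReal.ofReal (β * Real.exp (β * t)) := by
    rw [← lintegral_indicator measurableSet_Iio]
    calc _ = ∫⁻ t : Time T, F t := by
          refine lintegral_congr fun t => ?_
          simp [F, Set.indicator_apply]
      _ = ∫⁻ t in Set.Icc 0 T, F t := lintegral_subtype_comap measurableSet_Icc F
      _ = _ := by
          rw [← lintegral_indicator measurableSet_Icc, ← lintegral_indicator measurableSet_Ico]
          refine lintegral_congr fun t => ?_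
          have := s.2.2
          by_cases h : 0 ≤ t ∧ t < s
          · have h2 : t ∈ Set.Icc 0 T := ⟨h.1, by linarith [h.2]⟩
            have h3 : t ∈ Set.Ico 0 (s : ℝ) := h
            simp [F, h2, h3, h.2]
          · have h3 : t ∉ Set.Ico 0 (s : ℝ) := h
            simp only [Set.indicator_of_notMem h3]
            by_cases h4 : t ∈ Set.Icc 0 T
            · have : ¬ t < s := fun h5 => h ⟨h4.1, h5⟩
              simp [F, h4, this]
            · simp [h4]
  have hd : ∀ t : ℝ, HasDerivAt (fun t => Real.exp (β * t)) (β * Real.exp (β * t)) t := fun t => by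
    have := ((hasDerivAt_id t).const_mul β).exp
    simpa [mul_comm] using this
  have hc : Continuous fun t => β * Real.exp (β * t) := by fun_prop
  have h2 : ∫ t in (0 : ℝ)..s, β * Real.exp (β * t) = Real.exp (β * s) - 1 := by
    rw [intervalIntegral.integral_eq_sub_of_hasDerivAt (fun t _ => hd t) (hc.intervalIntegrable _ _)]
    simp
  rw [h1, ← ofReal_integral_eq_lintegral_ofReal ((hc.integrableOn_Icc).mono_set Set.Ico_subset_Icc_self)
    (Eventually.of_forall fun t => by positivity), integral_Ico_eq_integral_Ioc,
    ← intervalIntegral.integral_of_le s.2.1, h2]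
  rw [← ENNReal.ofReal_one, ← ENNReal.ofReal_add (by norm_num)]
  · simp
  · have : (1 : ℝ) ≤ Real.exp (β * s) := Real.one_le_exp (mul_nonneg hβ.le s.2.1)
    linarith

/-- The tail inequality is integrated against `2γ exp(2γt) dt`, using `exp(2γs) = 1 + ∫_0^s 2γ
exp(2γt) dt`. On the right the product of this weight with `exp(-γt)/γ` is `2 exp(γt)`; after
exchanging the integrals, `∫_0^s exp(γt) dt ≤ exp(γs)/γ` restores the weight `exp(2γs)` and gains
`1/γ`. The constant `3` is `1` from the hypothesis at `t = 0` plus `2` from the integrated part. -/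
theorem weighted_le {m m' : Time T → ℝ≥0∞} (hm : Measurable m) (hm' : Measurable m') {γ : ℝ}
    (hγ : 0 < γ) {K : ℝ≥0∞}
    (h : ∀ t, ∫⁻ s in Set.Ioi t, m' s ≤ ENNReal.ofReal (Real.exp (-(γ * t)) / γ) *
      (K * ∫⁻ s : Time T in Set.Ioi t, ENNReal.ofReal (Real.exp (γ * s)) * m s)) :
    ∫⁻ s : Time T, ENNReal.ofReal (Real.exp (2 * γ * s)) * m' s ≤
      3 * K * ENNReal.ofReal γ⁻¹ * ∫⁻ s : Time T, ENNReal.ofReal (Real.exp (2 * γ * s)) * m s := by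
  classical
  set N := ∫⁻ s : Time T, ENNReal.ofReal (Real.exp (2 * γ * s)) * m s
  have hexp : ∀ β : ℝ, Measurable fun s : Time T => ENNReal.ofReal (Real.exp (β * s)) := fun β => by
    fun_prop
  have ea : ∀ a b : ℝ, ENNReal.ofReal (Real.exp a) * ENNReal.ofReal (Real.exp b) =
      ENNReal.ofReal (Real.exp (a + b)) := fun a b => by
    rw [← ENNReal.ofReal_mul (Real.exp_pos _).le, Real.exp_add]
  have hN1 : ∫⁻ s : Time T, ENNReal.ofReal (Real.exp (γ * s)) * m s ≤ N := by
    refine lintegral_mono fun s => mul_le_mul' (ENNReal.ofReal_le_ofReal (Real.exp_le_exp.2 ?_)) le_rfl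
    have := mul_nonneg hγ.le s.2.1
    linarith
  have hms : MeasurableSet {z : Time T × Time T | z.2 < z.1} :=
    measurableSet_lt measurable_snd measurable_fst
  have h0 : ∫⁻ s, m' s ≤ K * ENNReal.ofReal γ⁻¹ * N := by
    have e : ∫⁻ s, m' s = ∫⁻ s : Time T in Set.Ioi (⊥ : Time T), m' s := by
      rw [← setLIntegral_univ]
      refine setLIntegral_congr ?_
      rw [← Set.Ici_bot]
      exact Ioi_ae_eq_Ici.symm
    have hb : ((⊥ : Time T) : ℝ) = 0 := rfl
    refine e.le.trans ((h ⊥).trans ?_)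
    rw [hb, mul_zero, neg_zero, Real.exp_zero, one_div, ← mul_assoc, mul_comm _ K]
    exact mul_le_mul' le_rfl ((setLIntegral_le_lintegral _ _).trans hN1)
  have h1 : ∫⁻ s : Time T, (∫⁻ t : Time T in Set.Iio s, ENNReal.ofReal (2 * γ * Real.exp (2 * γ * t))) * m' s ≤
      2 * K * ENNReal.ofReal γ⁻¹ * N := by
    calc _ = ∫⁻ s, ∫⁻ t, {z : Time T × Time T | z.2 < z.1}.indicator (fun z =>
          ENNReal.ofReal (2 * γ * Real.exp (2 * γ * z.2)) * m' z.1) (s, t) := by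
          refine lintegral_congr fun s => ?_
          rw [← lintegral_indicator measurableSet_Iio, ← lintegral_mul_const]
          · refine lintegral_congr fun t => ?_
            by_cases ht : t < s <;> simp [ht]
          · exact Measurable.indicator (by fun_prop) measurableSet_Iio
      _ = ∫⁻ t, ∫⁻ s, {z : Time T × Time T | z.2 < z.1}.indicator (fun z =>
          ENNReal.ofReal (2 * γ * Real.exp (2 * γ * z.2)) * m' z.1) (s, t) := by
          refine lintegral_lintegral_swap (f := fun s t => {z : Time T × Time T | z.2 < z.1}.indicator
            (fun z => ENNReal.ofReal (2 * γ * Real.exp (2 * γ * z.2)) * m' z.1) (s, t)) ?_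
          refine (Measurable.indicator ?_ hms).aemeasurable
          exact Measurable.mul (by fun_prop) (hm'.comp measurable_fst)
      _ = ∫⁻ t : Time T, ENNReal.ofReal (2 * γ * Real.exp (2 * γ * t)) * ∫⁻ s in Set.Ioi t, m' s := by
          refine lintegral_congr fun t => ?_
          rw [← lintegral_indicator measurableSet_Ioi, ← lintegral_const_mul]
          · refine lintegral_congr fun s => ?_
            by_cases ht : t < s <;> simp [ht]
          · exact hm'.indicator measurableSet_Ioi
      _ ≤ ∫⁻ t : Time T, 2 * K * (ENNReal.ofReal (Real.exp (γ * t)) *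
            ∫⁻ s : Time T in Set.Ioi t, ENNReal.ofReal (Real.exp (γ * s)) * m s) := by
          refine lintegral_mono fun t => (mul_le_mul' le_rfl (h t)).trans (le_of_eq ?_)
          have : ENNReal.ofReal (2 * γ * Real.exp (2 * γ * t)) *
              ENNReal.ofReal (Real.exp (-(γ * t)) / γ) = 2 * ENNReal.ofReal (Real.exp (γ * t)) := by
            rw [← ENNReal.ofReal_mul (by positivity), show (2 : ℝ≥0∞) = ENNReal.ofReal 2 by simp,
              ← ENNReal.ofReal_mul (by norm_num)]
            congr 1
            rw [show γ * (t : ℝ) = 2 * γ * t + -(γ * t) by ring, Real.exp_add]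
            ring_nf
            field_simp
          rw [← mul_assoc, this]
          ring
      _ = 2 * K * ∫⁻ t, ∫⁻ s, {z : Time T × Time T | z.2 < z.1}.indicator (fun z =>
          ENNReal.ofReal (Real.exp (γ * z.2)) * (ENNReal.ofReal (Real.exp (γ * z.1)) * m z.1)) (s, t) := by
          rw [← lintegral_const_mul]
          · refine lintegral_congr fun t => ?_
            rw [← lintegral_indicator measurableSet_Ioi, ← lintegral_const_mul]
            · congr 1
              refine lintegral_congr fun s => ?_
              by_cases ht : t < s <;> simp [ht]
            · exact Measurable.indicator ((hexp γ).mul hm) measurableSet_Ioi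
          · refine Measurable.lintegral_prod_left' (f := {z : Time T × Time T | z.2 < z.1}.indicator (fun z =>
              ENNReal.ofReal (Real.exp (γ * z.2)) * (ENNReal.ofReal (Real.exp (γ * z.1)) * m z.1))) ?_
            refine Measurable.indicator ?_ hms
            exact Measurable.mul (by fun_prop) (Measurable.mul (by fun_prop) (hm.comp measurable_fst))
      _ = 2 * K * ∫⁻ s, ∫⁻ t, {z : Time T × Time T | z.2 < z.1}.indicator (fun z =>
          ENNReal.ofReal (Real.exp (γ * z.2)) * (ENNReal.ofReal (Real.exp (γ * z.1)) * m z.1)) (s, t) := by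
          congr 1
          refine lintegral_lintegral_swap (f := fun t s => {z : Time T × Time T | z.2 < z.1}.indicator
            (fun z => ENNReal.ofReal (Real.exp (γ * z.2)) *
              (ENNReal.ofReal (Real.exp (γ * z.1)) * m z.1)) (s, t)) ?_
          refine Measurable.aemeasurable ?_
          refine Measurable.comp (g := {z : Time T × Time T | z.2 < z.1}.indicator (fun z =>
              ENNReal.ofReal (Real.exp (γ * z.2)) * (ENNReal.ofReal (Real.exp (γ * z.1)) * m z.1))) ?_
              measurable_swap
          refine Measurable.indicator ?_ hms
          exact Measurable.mul (by fun_prop) (Measurable.mul (by fun_prop) (hm.comp measurable_fst))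
      _ = 2 * K * ∫⁻ s : Time T, (∫⁻ t : Time T in Set.Iio s, ENNReal.ofReal (Real.exp (γ * t))) *
            (ENNReal.ofReal (Real.exp (γ * s)) * m s) := by
          congr 1
          refine lintegral_congr fun s => ?_
          rw [← lintegral_indicator measurableSet_Iio, ← lintegral_mul_const]
          · refine lintegral_congr fun t => ?_
            by_cases ht : t < s <;> simp [ht]
          · exact Measurable.indicator (by fun_prop) measurableSet_Iio
      _ ≤ 2 * K * ∫⁻ s : Time T, ENNReal.ofReal γ⁻¹ * (ENNReal.ofReal (Real.exp (2 * γ * s)) * m s) := by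
          refine mul_le_mul' le_rfl (lintegral_mono fun s => ?_)
          refine (mul_le_mul' ((lintegral_mono_set Set.Iio_subset_Iic_self).trans
            (lintegral_exp_Iic_le hγ s)) le_rfl).trans (le_of_eq ?_)
          rw [div_eq_mul_inv, ENNReal.ofReal_mul (Real.exp_pos _).le,
            show 2 * γ * (s : ℝ) = γ * s + γ * s by ring, ← ea]
          ring
      _ = _ := by
          rw [lintegral_const_mul' _ _ ENNReal.ofReal_ne_top]
          ring
  calc _ ≤ ∫⁻ s, (m' s + (∫⁻ t : Time T in Set.Iio s, ENNReal.ofReal (2 * γ * Real.exp (2 * γ * t))) * m' s) := by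
        refine lintegral_mono fun s => ?_
        rw [← one_add_mul]
        exact mul_le_mul' (exp_le_one_add_lintegral (by positivity) s) le_rfl
    _ ≤ K * ENNReal.ofReal γ⁻¹ * N + 2 * K * ENNReal.ofReal γ⁻¹ * N := by
        rw [lintegral_add_left hm']
        exact add_le_add h0 h1
    _ = _ := by ring

/-- Pythagoras: `V = D - G` with `D` and `G` orthogonal, so the squared norm of `V` is the sum of
those of `D` and `G`. -/
theorem lintegral_sq_le_of_orthogonal {μ : Measure Ω} {V G D : Ω → ℝ} (hV : MemLp V 2 μ)
    (hD : MemLp D 2 μ) (hG : MemLp G 2 μ) (h : D =ᵐ[μ] V + G) (h0 : ∫ ω, D ω * G ω ∂μ = 0) :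
    ∫⁻ ω, ‖D ω‖ₑ ^ 2 ∂μ ≤ ∫⁻ ω, ‖V ω‖ₑ ^ 2 ∂μ := by
  have hen : ∀ r : ℝ, ‖r‖ₑ ^ 2 = ENNReal.ofReal (r ^ 2) := fun r => by
    rw [← ofReal_norm, ← ENNReal.ofReal_pow (norm_nonneg _), Real.norm_eq_abs, sq_abs]
  simp only [hen]
  rw [← ofReal_integral_eq_lintegral_ofReal hV.integrable_sq (Eventually.of_forall fun _ => sq_nonneg _),
    ← ofReal_integral_eq_lintegral_ofReal hD.integrable_sq (Eventually.of_forall fun _ => sq_nonneg _)]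
  refine ENNReal.ofReal_le_ofReal ?_
  have hDG : Integrable (fun ω => D ω * G ω) μ := MemLp.integrable_mul (p := 2) (q := 2) hD hG
  have e : ∫ ω, V ω ^ 2 ∂μ = ∫ ω, (D ω ^ 2 + G ω ^ 2 - 2 * (D ω * G ω)) ∂μ := by
    refine integral_congr_ae ?_
    filter_upwards [h] with ω hω
    rw [Pi.add_apply] at hω
    rw [hω]; ring
  rw [e, integral_sub (f := fun ω => D ω ^ 2 + G ω ^ 2) (hD.integrable_sq.add hG.integrable_sq)
    (hDG.const_mul 2), integral_add hD.integrable_sq hG.integrable_sq, integral_const_mul, h0]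
  have : 0 ≤ ∫ ω, G ω ^ 2 ∂μ := integral_nonneg fun _ => sq_nonneg _
  linarith

/-- The weighted norm `∫ e^{2γs} E‖q_s‖² ds`. -/
def wsq (g : ℕ → ℕ → ℝ) (Pm : Measure Ω) (X : Ω → ChainPath T) (γ : ℝ) (q : Time T → Ω → ℕ → ℝ) :
    ℝ≥0∞ :=
  ∫⁻ s : Time T, ENNReal.ofReal (Real.exp (2 * γ * s)) * msq g Pm X q s

namespace ChainSetup

variable {g : ℕ → ℕ → ℝ} {Pm : Measure Ω} {𝔽 : Filtration (Time T) mΩ} {X : Ω → ChainPath T}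
  (S : ChainSetup g Pm 𝔽 X) {q r : Time T → Ω → ℕ → ℝ}
include S
variable [IsProbabilityMeasure Pm]

theorem lintegral_sT_sq (hq : Pred 𝔽 q) (hn : nsq g Pm X q ≠ ∞) :
    ∫⁻ ω, ‖sT g (X ω) fun z => q z.1 ω z.2‖ₑ ^ 2 ∂Pm = nsq g Pm X q := by
  have h := S.eLpNorm_sT hq hn
  rw [eLpNorm_two_eq] at h
  exact (ENNReal.rpow_left_injective (by norm_num : (1 / 2 : ℝ) ≠ 0)) h

theorem nsq_le_wsq (hq : Pred 𝔽 q) {γ : ℝ} (hγ : 0 ≤ γ) : nsq g Pm X q ≤ wsq g Pm X γ q := by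
  rw [S.nsq_eq hq]
  refine lintegral_mono fun s => ?_
  refine le_mul_of_one_le_left zero_le ?_
  rw [← ENNReal.ofReal_one]
  refine ENNReal.ofReal_le_ofReal (Real.one_le_exp ?_)
  have := s.2.1
  positivity

theorem wsq_le_nsq (hq : Pred 𝔽 q) {γ : ℝ} (hγ : 0 ≤ γ) :
    wsq g Pm X γ q ≤ ENNReal.ofReal (Real.exp (2 * γ * T)) * nsq g Pm X q := by
  rw [S.nsq_eq hq, ← lintegral_const_mul' _ _ ENNReal.ofReal_ne_top]
  refine lintegral_mono fun s => mul_le_mul' (ENNReal.ofReal_le_ofReal (Real.exp_le_exp.2 ?_)) le_rfl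
  exact mul_le_mul_of_nonneg_left s.2.2 (by positivity)

/-- The increments of a stochastic integral are orthogonal to the past. -/
theorem integral_sT_sub_sI_mul (hq : Pred 𝔽 q) (hn : nsq g Pm X q ≠ ∞) (t : Time T) {G : Ω → ℝ}
    (hG : Measurable[𝔽 t] G) (hG2 : MemLp G 2 Pm) :
    ∫ ω, (sT g (X ω) (fun z => q z.1 ω z.2) - sI g (X ω) (fun z => q z.1 ω z.2) t) * G ω ∂Pm = 0 := by
  set F : Ω → ℝ := fun ω => sT g (X ω) (fun z => q z.1 ω z.2) - sI g (X ω) (fun z => q z.1 ω z.2) t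
  have h1 : MemLp (fun ω => sT g (X ω) (fun z => q z.1 ω z.2)) 2 Pm := S.memLp_sT hq hn
  have h2 : MemLp (fun ω => sI g (X ω) (fun z => q z.1 ω z.2) t) 2 Pm := S.memLp_sI hq hn t
  have hF : MemLp F 2 Pm := h1.sub h2
  have hFi : Integrable F Pm := hF.integrable (by norm_num)
  have hc : Pm[F|𝔽 t] =ᵐ[Pm] 0 := by
    symm
    refine ae_eq_condExp_of_forall_setIntegral_eq (𝔽.le t) hFi (fun A _ _ => integrableOn_zero)
      (fun A hA _ => ?_) stronglyMeasurable_zero.aestronglyMeasurable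
    have e : ∫ ω in A, F ω ∂Pm = 0 := by
      rw [integral_sub (h1.integrable (by norm_num)).integrableOn
        (h2.integrable (by norm_num)).integrableOn, S.setIntegral_sI hq hn t hA, sub_self]
    simpa using e.symm
  have hi : Integrable (F * G) Pm := MemLp.integrable_mul (p := 2) (q := 2) hF hG2
  have h3 := condExp_mul_of_stronglyMeasurable_right (m := 𝔽 t) (μ := Pm) (f := F) (g := G)
    hG.stronglyMeasurable hi hFi
  calc _ = ∫ ω, (F * G) ω ∂Pm := rfl
    _ = ∫ ω, (Pm[F * G|𝔽 t]) ω ∂Pm := (integral_condExp (𝔽.le t)).symm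
    _ = ∫ ω, (0 : ℝ) ∂Pm := by
        refine integral_congr_ae ?_
        filter_upwards [h3, hc] with ω h3 h4
        rw [h3, Pi.mul_apply, h4]; simp
    _ = 0 := by simp

variable {D : Coeffs T Ω} {c : NNReal} (B : D.Bounded g Pm 𝔽 X c)
include B

/-- The increment `F` of the integral of `r` after `t` equals `V + G`, where `V` is the integral of
the driver after `t` and `G` is `𝔽 t`-measurable. As `F` is orthogonal to `G`, its norm is at most
that of `V`, and by the isometry the squared norm of `F` is the left side. Cauchy-Schwarz with the
splitting `1 = exp(-γs/2) exp(γs/2)` bounds `V`. This replaces Itô's formula for `|p|²`, and the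
unknown `Y` disappears into `G`. -/
theorem lintegral_Ioi_msq_le (hq : Pred 𝔽 q) (hn : nsq g Pm X q ≠ ∞) (hr : Pred 𝔽 r)
    (hrn : nsq g Pm X r ≠ ∞) {Y : Ω → ℝ} (hY : Measurable[𝔽 ⊥] Y)
    (h : ∀ᵐ ω ∂Pm, sT g (X ω) (fun z => r z.1 ω z.2) = (∫ s, D.drv g Pm X q s ω) - Y ω) {γ : ℝ}
    (hγ : 0 < γ) (t : Time T) :
    ∫⁻ s in Set.Ioi t, msq g Pm X r s ≤ ENNReal.ofReal (Real.exp (-(γ * t)) / γ) *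
      ((2 * c + 2 * c ^ 4 : NNReal) *
        ∫⁻ s : Time T in Set.Ioi t, ENNReal.ofReal (Real.exp (γ * s)) * msq g Pm X q s) := by
  classical
  have hmp := S.measurable_drv B hq
  have hm : Measurable fun z : Time T × Ω => D.drv g Pm X q z.1 z.2 := hmp.mono predictable_le le_rfl
  set V : Ω → ℝ := fun ω => ∫ s in Set.Ioi t, D.drv g Pm X q s ω
  set U : Ω → ℝ := fun ω => ∫ s in Set.Iic t, D.drv g Pm X q s ω
  set G : Ω → ℝ := fun ω => U ω - Y ω - sI g (X ω) (fun z => r z.1 ω z.2) t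
  set F : Ω → ℝ := fun ω => sT g (X ω) (fun z => r z.1 ω z.2) - sI g (X ω) (fun z => r z.1 ω z.2) t
  have hUm : Measurable[𝔽 t] U := (Prog.of_predictable hmp).measurable_setIntegral t
  have hGm : Measurable[𝔽 t] G := (hUm.sub (hY.mono (𝔽.mono bot_le) le_rfl)).sub (S.measurable_sI hr t)
  have hF : MemLp F 2 Pm := (S.memLp_sT hr hrn).sub (S.memLp_sI hr hrn t)
  have hVsq : ∀ ω, ‖V ω‖ₑ ^ 2 ≤ ENNReal.ofReal (Real.exp (-(γ * t)) / γ) *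
      ∫⁻ s : Time T in Set.Ioi t, ENNReal.ofReal (Real.exp (γ * s)) * ‖D.drv g Pm X q s ω‖ₑ ^ 2 := fun ω => by
    have hms : Measurable fun s => D.drv g Pm X q s ω := measurable_section_left hm ω
    have e1 : ∀ s : Time T, ‖D.drv g Pm X q s ω‖ₑ = ENNReal.ofReal (Real.exp (-(γ * s) / 2)) *
        (ENNReal.ofReal (Real.exp (γ * s / 2)) * ‖D.drv g Pm X q s ω‖ₑ) := fun s => by
      rw [← mul_assoc, ← ENNReal.ofReal_mul (Real.exp_pos _).le, ← Real.exp_add,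
        show -(γ * (s : ℝ)) / 2 + γ * s / 2 = 0 by ring]
      simp
    have e2 : ∀ a : ℝ, ENNReal.ofReal (Real.exp (a / 2)) ^ 2 = ENNReal.ofReal (Real.exp a) := fun a => by
      rw [← ENNReal.ofReal_pow (Real.exp_pos _).le, ← Real.exp_nat_mul]
      congr 2; push_cast; ring
    refine (pow_le_pow_left₀ zero_le (enorm_integral_le_lintegral_enorm _) 2).trans ?_
    rw [lintegral_congr e1]
    refine (lintegral_mul_sq_le (Measurable.aemeasurable (by fun_prop))
      (Measurable.aemeasurable (Measurable.mul (by fun_prop) hms.enorm))).trans ?_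
    simp only [Pi.mul_apply, mul_pow, e2]
    exact mul_le_mul' (lintegral_exp_neg_Ioi_le hγ t) le_rfl
  have hVm : Measurable V := (hm.stronglyMeasurable.integral_prod_left'
    (μ := volume.restrict (Set.Ioi t))).measurable
  have hbound : ∫⁻ ω, ‖V ω‖ₑ ^ 2 ∂Pm ≤ ENNReal.ofReal (Real.exp (-(γ * t)) / γ) *
      ((2 * c + 2 * c ^ 4 : NNReal) *
        ∫⁻ s : Time T in Set.Ioi t, ENNReal.ofReal (Real.exp (γ * s)) * msq g Pm X q s) := by
    refine (lintegral_mono hVsq).trans ?_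
    rw [lintegral_const_mul' _ _ ENNReal.ofReal_ne_top]
    refine mul_le_mul' le_rfl ?_
    rw [lintegral_lintegral_swap (f := fun ω (s : Time T) =>
      ENNReal.ofReal (Real.exp (γ * s)) * ‖D.drv g Pm X q s ω‖ₑ ^ 2)
      (Measurable.aemeasurable (Measurable.mul (by fun_prop) ((hm.comp measurable_swap).enorm.pow_const 2))),
      ← lintegral_const_mul' _ _ ENNReal.coe_ne_top]
    refine lintegral_mono fun s => ?_
    rw [lintegral_const_mul' _ _ ENNReal.ofReal_ne_top, mul_left_comm]
    exact mul_le_mul' le_rfl (S.lintegral_drv_sq_le B hq s)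
  have hVL : MemLp V 2 Pm := by
    refine ⟨hVm.aestronglyMeasurable, ?_⟩
    rw [eLpNorm_two_eq]
    refine ENNReal.rpow_lt_top_of_nonneg (by norm_num) (ne_top_of_le_ne_top ?_ hbound)
    refine ENNReal.mul_ne_top ENNReal.ofReal_ne_top (ENNReal.mul_ne_top ENNReal.coe_ne_top
      (ne_top_of_le_ne_top ?_ (setLIntegral_le_lintegral _ _)))
    -- `wsq` carries the exponent `2γs`, so the weight `exp(γs)` belongs to the parameter `γ/2`.
    have h1 := S.wsq_le_nsq hq (γ := γ / 2) (by positivity)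
    rw [wsq, show 2 * (γ / 2) = γ by ring] at h1
    exact ne_top_of_le_ne_top (ENNReal.mul_ne_top ENNReal.ofReal_ne_top hn) h1
  have hdec : F =ᵐ[Pm] V + G := by
    filter_upwards [h, S.integrable_drv B hq hn] with ω h1 h2
    have h3 := integral_add_compl (measurableSet_Iic (a := t)) h2
    rw [Set.compl_Iic] at h3
    simp only [F, G, V, U, Pi.add_apply, h1]
    rw [← h3]; ring
  have hGL : MemLp G 2 Pm := (hF.sub hVL).ae_eq (by
    filter_upwards [hdec] with ω hω
    rw [Pi.sub_apply, hω]; simp)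
  have e : ∫⁻ s in Set.Ioi t, msq g Pm X r s = ∫⁻ ω, ‖F ω‖ₑ ^ 2 ∂Pm := by
    have hp : Pred 𝔽 fun s ω j => if t < s then r s ω j else 0 := fun j =>
      Measurable.ite (measurable_fst_predictable (𝔽 := 𝔽) measurableSet_Ioi) (hr j)
        (@measurable_const _ _ _ 𝔽.predictable 0)
    have h1 := S.lintegral_sT_sq hp (ne_top_of_le_ne_top hrn (nsq_mono fun s ω j => by
      split_ifs <;> simp))
    rw [S.nsq_eq hp] at h1
    calc _ = ∫⁻ s, msq g Pm X (fun s ω j => if t < s then r s ω j else 0) s := by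
          rw [← lintegral_indicator measurableSet_Ioi]
          refine lintegral_congr fun s => ?_
          by_cases hs : t < s <;> simp [msq, hs]
      _ = _ := h1.symm
      _ = _ := by
          refine lintegral_congr_ae ?_
          filter_upwards [S.ae_integrable_cm hr hrn] with ω hω
          rw [sT_Ioi (φ := fun z : Time T × ℕ => r z.1 ω z.2) hω]
  rw [e]
  exact (lintegral_sq_le_of_orthogonal hVL hF hGL hdec
    (S.integral_sT_sub_sI_mul hr hrn t hGm hGL)).trans hbound

/-- The map which sends an integrand to the integrand of the solution of the equation with that driver
is a contraction for a weighted norm. -/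
theorem exists_wsq_le : ∃ γ : ℝ, 0 < γ ∧ ∀ q r : Time T → Ω → ℕ → ℝ, Pred 𝔽 q → nsq g Pm X q ≠ ∞ →
    Pred 𝔽 r → nsq g Pm X r ≠ ∞ → ∀ Y : Ω → ℝ, Measurable[𝔽 ⊥] Y →
    (∀ᵐ ω ∂Pm, sT g (X ω) (fun z => r z.1 ω z.2) = (∫ s, D.drv g Pm X q s ω) - Y ω) →
    wsq g Pm X γ r ≤ 4⁻¹ * wsq g Pm X γ q := by
  set K : NNReal := 2 * c + 2 * c ^ 4
  -- `weighted_le` gives the factor `3K/γ`, which is at most `1/4` for this `γ`; the summand `1`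
  -- keeps `γ` positive when `K = 0`.
  have hγ : (0 : ℝ) < 12 * K + 1 := by positivity
  refine ⟨12 * K + 1, hγ, fun q r hq hn hr hrn Y hY h => ?_⟩
  refine (weighted_le (S.measurable_msq hq) (S.measurable_msq hr) hγ
    (S.lintegral_Ioi_msq_le B hq hn hr hrn hY h hγ)).trans (mul_le_mul' ?_ le_rfl)
  rw [show (3 : ℝ≥0∞) = ENNReal.ofReal 3 by simp, show ((K : NNReal) : ℝ≥0∞) = ENNReal.ofReal K by simp,
    ← ENNReal.ofReal_mul (by norm_num), ← ENNReal.ofReal_mul (by positivity),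
    show (4 : ℝ≥0∞) = ENNReal.ofReal 4 by simp, ← ENNReal.ofReal_inv_of_pos (by norm_num)]
  refine ENNReal.ofReal_le_ofReal ?_
  rw [← div_eq_mul_inv, div_le_iff₀ hγ]
  have := K.2
  linarith

end ChainSetup
end MFChain
end

/-! ### Hilbert space formulation and the Neumann series -/

noncomputable section

namespace MFChain
variable {T : ℝ} [Fact (0 ≤ T)] {Ω : Type*} [mΩ : MeasurableSpace Ω]

section MarkSpace

variable {g : ℕ → ℕ → ℝ} {Pm : Measure Ω} {𝔽 : Filtration (Time T) mΩ} {X : Ω → ChainPath T}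

theorem predictable_prod_le : 𝔽.predictable.prod (⊤ : MeasurableSpace ℕ) ≤
    (Prod.instMeasurableSpace : MeasurableSpace ((Time T × Ω) × ℕ)) :=
  sup_le_sup (MeasurableSpace.comap_mono predictable_le) le_rfl

/-- The measure `dP g_{x(s⁻) j} ds` on the predictable sets. -/
def markMeasure (g : ℕ → ℕ → ℝ) (Pm : Measure Ω) (𝔽 : Filtration (Time T) mΩ) (X : Ω → ChainPath T) :
    @Measure ((Time T × Ω) × ℕ) (𝔽.predictable.prod ⊤) :=
  ((((volume : Measure (Time T)).prod Pm).prod Measure.count).withDensity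
    fun z => rt g ((X z.1.2).left z.1.1) z.2).trim predictable_prod_le

theorem pred_iff {E : Type*} [MeasurableSpace E] {q : Time T → Ω → ℕ → E} : Pred 𝔽 q ↔
    Measurable[𝔽.predictable.prod ⊤] fun z : (Time T × Ω) × ℕ => q z.1.1 z.1.2 z.2 :=
  ⟨fun h => measurable_from_prod_countable_left (m := 𝔽.predictable) (mβ := ⊤) h,
    fun h j => h.comp (@measurable_prodMk_right _ _ 𝔽.predictable ⊤ j)⟩

variable (S : ChainSetup g Pm 𝔽 X) {q r : Time T → Ω → ℕ → ℝ} [IsProbabilityMeasure Pm]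
include S

theorem ChainSetup.measurable_rt : Measurable fun z : (Time T × Ω) × ℕ =>
    rt g ((X z.1.2).left z.1.1) z.2 :=
  (Measurable.of_discrete (f := fun p : ℕ × ℕ => rt g p.1 p.2)).comp
    (((S.measurable_left.mono predictable_le le_rfl).comp measurable_fst).prodMk measurable_snd)

theorem ChainSetup.lintegral_markMeasure {f : Time T → Ω → ℕ → ℝ≥0∞} (hf : Pred 𝔽 f) :
    ∫⁻ z, f z.1.1 z.1.2 z.2 ∂markMeasure g Pm 𝔽 X =
      ∫⁻ ω, (∫⁻ z, f z.1 ω z.2 ∂cm g (X ω)) ∂Pm := by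
  have hf1 := pred_iff.1 hf
  have hf2 := hf1.mono predictable_prod_le le_rfl
  have hr := S.measurable_rt
  have hm : Measurable fun z : Time T × Ω => ∫⁻ j, f z.1 z.2 j ∂rate g ((X z.2).left z.1) :=
    (S.measurable_rate_integral hf).mono predictable_le le_rfl
  rw [markMeasure, lintegral_trim _ hf1, lintegral_withDensity_eq_lintegral_mul _ hr hf2,
    lintegral_prod _ (hr.mul hf2).aemeasurable]
  simp only [Pi.mul_apply, lintegral_count]
  have e : ∀ ω, ∫⁻ z, f z.1 ω z.2 ∂cm g (X ω) = ∫⁻ s, ∫⁻ j, f s ω j ∂rate g ((X ω).left s) :=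
    fun ω => lintegral_cm g (X ω) (S.measurable_mark hf ω)
  simp only [e, ← lintegral_rate]
  rw [lintegral_prod_symm _ hm.aemeasurable]

theorem ChainSetup.lintegral_markMeasure_sq (hq : Pred 𝔽 q) :
    ∫⁻ z, ‖q z.1.1 z.1.2 z.2‖ₑ ^ 2 ∂markMeasure g Pm 𝔽 X = nsq g Pm X q :=
  S.lintegral_markMeasure (f := fun s ω j => ‖q s ω j‖ₑ ^ 2) hq.enorm_sq

theorem ChainSetup.memLp_mark (hq : Pred 𝔽 q) (hn : nsq g Pm X q ≠ ∞) :
    MemLp (fun z : (Time T × Ω) × ℕ => q z.1.1 z.1.2 z.2) 2 (markMeasure g Pm 𝔽 X) := by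
  refine ⟨(pred_iff.1 hq).aestronglyMeasurable, ?_⟩
  rw [eLpNorm_two_eq, S.lintegral_markMeasure_sq hq]
  exact ENNReal.rpow_lt_top_of_nonneg (by norm_num) hn

omit S [IsProbabilityMeasure Pm] in
-- The measure lives on the predictable σ-algebra itself, so representatives of `L²` classes are
-- predictable. Limits and adjoints taken in this Hilbert space therefore yield genuine integrands.
theorem pred_coe (f : Lp ℝ 2 (markMeasure g Pm 𝔽 X)) : Pred 𝔽 fun s ω j => f ((s, ω), j) :=
  pred_iff.2 (Lp.stronglyMeasurable f).measurable

omit S [IsProbabilityMeasure Pm] in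
theorem enorm_lp_sq {α : Type*} {m : MeasurableSpace α} {μ : Measure α} (f : Lp ℝ 2 μ) :
    ‖f‖ₑ ^ 2 = ∫⁻ a, ‖f a‖ₑ ^ 2 ∂μ := by
  rw [Lp.enorm_def, eLpNorm_two_eq, ← ENNReal.rpow_natCast, ← ENNReal.rpow_mul]
  norm_num

theorem ChainSetup.enorm_sq_eq_nsq (f : Lp ℝ 2 (markMeasure g Pm 𝔽 X)) :
    ‖f‖ₑ ^ 2 = nsq g Pm X fun s ω j => f ((s, ω), j) := by
  rw [enorm_lp_sq, ← S.lintegral_markMeasure_sq (pred_coe f)]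

theorem ChainSetup.nsq_coe_ne_top (f : Lp ℝ 2 (markMeasure g Pm 𝔽 X)) :
    nsq g Pm X (fun s ω j => f ((s, ω), j)) ≠ ∞ := by
  rw [← S.enorm_sq_eq_nsq]
  simp

theorem ChainSetup.nsq_sub_eq_zero (hq : Pred 𝔽 q) (hr : Pred 𝔽 r)
    (h : (fun z : (Time T × Ω) × ℕ => q z.1.1 z.1.2 z.2) =ᵐ[markMeasure g Pm 𝔽 X]
      fun z => r z.1.1 z.1.2 z.2) : nsq g Pm X (fun s ω j => q s ω j - r s ω j) = 0 := by
  rw [← S.lintegral_markMeasure_sq (hq.sub hr),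
    lintegral_eq_zero_iff (pred_iff.1 (hq.sub hr).enorm_sq)]
  filter_upwards [h] with z hz
  simp [hz]

/-- Functionals of integrands as continuous linear maps. -/
theorem ChainSetup.exists_clm {F : (Time T → Ω → ℕ → ℝ) → Ω → ℝ} {C : NNReal}
    (hm : ∀ q, Pred 𝔽 q → nsq g Pm X q ≠ ∞ → Measurable (F q))
    (hC : ∀ q, Pred 𝔽 q → nsq g Pm X q ≠ ∞ → ∫⁻ ω, ‖F q ω‖ₑ ^ 2 ∂Pm ≤ C * nsq g Pm X q)
    (hadd : ∀ q r, Pred 𝔽 q → nsq g Pm X q ≠ ∞ → Pred 𝔽 r → nsq g Pm X r ≠ ∞ →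
      ∀ᵐ ω ∂Pm, F (fun s ω j => q s ω j + r s ω j) ω = F q ω + F r ω)
    (hmul : ∀ (a : ℝ) q ω, F (fun s ω j => a * q s ω j) ω = a * F q ω) :
    ∃ Λ : Lp ℝ 2 (markMeasure g Pm 𝔽 X) →L[ℝ] Lp ℝ 2 Pm,
      (∀ f, Λ f =ᵐ[Pm] F fun s ω j => f ((s, ω), j)) ∧
      ∀ q (hq : Pred 𝔽 q) (hn : nsq g Pm X q ≠ ∞), Λ ((S.memLp_mark hq hn).toLp _) =ᵐ[Pm] F q := by
  have hL : ∀ q, Pred 𝔽 q → nsq g Pm X q ≠ ∞ → MemLp (F q) 2 Pm := fun q hq hn => by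
    refine ⟨(hm q hq hn).aestronglyMeasurable, ?_⟩
    rw [eLpNorm_two_eq]
    exact ENNReal.rpow_lt_top_of_nonneg (by norm_num)
      (ne_top_of_le_ne_top (ENNReal.mul_ne_top ENNReal.coe_ne_top hn) (hC q hq hn))
  -- `F` depends only on the `L²` class: the difference of two representatives has norm zero, so its
  -- image vanishes by the bound, and additivity concludes.
  have hcongr : ∀ q r, Pred 𝔽 q → nsq g Pm X q ≠ ∞ → Pred 𝔽 r → nsq g Pm X r ≠ ∞ →
      (fun z : (Time T × Ω) × ℕ => q z.1.1 z.1.2 z.2) =ᵐ[markMeasure g Pm 𝔽 X]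
        (fun z => r z.1.1 z.1.2 z.2) → F q =ᵐ[Pm] F r := by
    intro q r hq hqn hr hrn h
    have h0 := S.nsq_sub_eq_zero hq hr h
    have h0' : nsq g Pm X (fun s ω j => q s ω j - r s ω j) ≠ ∞ := by rw [h0]; simp
    have h1 := hadd (fun s ω j => q s ω j - r s ω j) r (hq.sub hr) h0' hr hrn
    simp only [sub_add_cancel] at h1
    have h2 := hC _ (hq.sub hr) h0'
    rw [h0, mul_zero, nonpos_iff_eq_zero,
      lintegral_eq_zero_iff ((hm _ (hq.sub hr) h0').enorm.pow_const 2)] at h2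
    filter_upwards [h1, h2] with ω h1 h2
    rw [h1]
    simpa using h2
  have hR := fun f : Lp ℝ 2 (markMeasure g Pm 𝔽 X) => S.nsq_coe_ne_top f
  have hsum : ∀ {q r : Time T → Ω → ℕ → ℝ}, Pred 𝔽 q → nsq g Pm X q ≠ ∞ → Pred 𝔽 r →
      nsq g Pm X r ≠ ∞ → nsq g Pm X (fun s ω j => q s ω j + r s ω j) ≠ ∞ := by
    intro q r hq hqn hr hrn
    rw [← S.lintegral_markMeasure_sq (hq.add hr)]
    have := ((S.memLp_mark hq hqn).add (S.memLp_mark hr hrn)).2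
    rw [eLpNorm_two_eq] at this
    intro hi
    erw [hi] at this
    simp at this
  let Λ₀ : Lp ℝ 2 (markMeasure g Pm 𝔽 X) →ₗ[ℝ] Lp ℝ 2 Pm :=
    { toFun := fun f => (hL _ (pred_coe f) (hR f)).toLp _
      map_add' := fun f h => by
        apply Lp.ext
        refine ((hL _ (pred_coe (f + h)) (hR (f + h))).coeFn_toLp).trans ?_
        have h1 := hcongr _ _ (pred_coe (f + h)) (hR (f + h)) ((pred_coe f).add (pred_coe h))
          (hsum (pred_coe f) (hR f) (pred_coe h) (hR h)) (Lp.coeFn_add f h)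
        filter_upwards [h1, hadd _ _ (pred_coe f) (hR f) (pred_coe h) (hR h),
          (hL _ (pred_coe f) (hR f)).coeFn_toLp, (hL _ (pred_coe h) (hR h)).coeFn_toLp,
          Lp.coeFn_add ((hL _ (pred_coe f) (hR f)).toLp _) ((hL _ (pred_coe h) (hR h)).toLp _)]
          with ω h1 h2 h3 h4 h5
        rw [h1, h2, h5, Pi.add_apply, h3, h4]
      map_smul' := fun a f => by
        apply Lp.ext
        refine ((hL _ (pred_coe (a • f)) (hR (a • f))).coeFn_toLp).trans ?_
        have h1 := hcongr _ _ (pred_coe (a • f)) (hR (a • f)) ((pred_coe f).const_mul a)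
          (nsq_const_mul_ne_top a (hR f)) (Lp.coeFn_smul a f)
        filter_upwards [h1, (hL _ (pred_coe f) (hR f)).coeFn_toLp,
          Lp.coeFn_smul a ((hL _ (pred_coe f) (hR f)).toLp _)] with ω h1 h3 h5
        rw [h1, hmul, RingHom.id_apply, h5, Pi.smul_apply, h3, smul_eq_mul] }
  have hb : ∀ f, ‖Λ₀ f‖ ≤ (NNReal.sqrt C : ℝ) * ‖f‖ := by
    intro f
    have h1 : ‖Λ₀ f‖ₑ ^ 2 ≤ C * ‖f‖ₑ ^ 2 := by
      rw [enorm_lp_sq, S.enorm_sq_eq_nsq]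
      refine le_trans (le_of_eq (lintegral_congr_ae ?_)) (hC _ (pred_coe f) (hR f))
      filter_upwards [(hL _ (pred_coe f) (hR f)).coeFn_toLp] with ω hω
      change ‖((hL _ (pred_coe f) (hR f)).toLp _ : Ω → ℝ) ω‖ₑ ^ 2 = _
      rw [hω]
    have h2 : ‖Λ₀ f‖₊ ^ 2 ≤ (NNReal.sqrt C * ‖f‖₊) ^ 2 := by
      rw [mul_pow, NNReal.sq_sqrt]
      rw [enorm_eq_nnnorm, enorm_eq_nnnorm] at h1
      exact_mod_cast h1
    exact NNReal.coe_le_coe.2 ((pow_le_pow_iff_left₀ zero_le zero_le (by norm_num)).1 h2)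
  refine ⟨Λ₀.mkContinuous _ hb, fun f => (hL _ (pred_coe f) (hR f)).coeFn_toLp, fun q hq hn => ?_⟩
  exact ((hL _ (pred_coe _) (hR _)).coeFn_toLp).trans (hcongr _ _ (pred_coe _) (hR _) hq hn
    (MemLp.coeFn_toLp _))

end MarkSpace


namespace ChainSetup

variable {g : ℕ → ℕ → ℝ} {Pm : Measure Ω} {𝔽 : Filtration (Time T) mΩ} {X : Ω → ChainPath T}
  (S : ChainSetup g Pm 𝔽 X) [IsProbabilityMeasure Pm]
include S

/-- The stochastic integral as an isometry. -/
theorem exists_isometry : ∃ J : Lp ℝ 2 (markMeasure g Pm 𝔽 X) →ₗᵢ[ℝ] Lp ℝ 2 Pm,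
    (∀ f, J f =ᵐ[Pm] fun ω => sT g (X ω) fun z => f ((z.1, ω), z.2)) ∧
      ∀ q (hq : Pred 𝔽 q) (hn : nsq g Pm X q ≠ ∞),
        J ((S.memLp_mark hq hn).toLp _) =ᵐ[Pm] fun ω => sT g (X ω) fun z => q z.1 ω z.2 := by
  obtain ⟨Λ, h1, h2⟩ := S.exists_clm (F := fun q ω => sT g (X ω) fun z => q z.1 ω z.2) (C := 1)
    (fun q hq _ => S.measurable_sT hq) (fun q hq hn => by rw [S.lintegral_sT_sq hq hn]; simp)
    (fun q r hq hqn hr hrn => by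
      filter_upwards [S.ae_integrable_cm hq hqn, S.ae_integrable_cm hr hrn] with ω h1 h2
      exact sT_add h1 h2) fun a q ω => sT_const_mul a
  refine ⟨⟨Λ, fun f => ?_⟩, h1, h2⟩
  have h3 : ‖Λ f‖ₑ ^ 2 = ‖f‖ₑ ^ 2 := by
    rw [enorm_lp_sq, S.enorm_sq_eq_nsq, ← S.lintegral_sT_sq (pred_coe f) (S.nsq_coe_ne_top f)]
    refine lintegral_congr_ae ?_
    filter_upwards [h1 f] with ω hω
    rw [hω]
  have h4 : ‖Λ f‖ₑ = ‖f‖ₑ := by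
    rw [← ENNReal.rpow_two, ← ENNReal.rpow_two] at h3
    exact ENNReal.rpow_left_injective (by norm_num) h3
  change ‖Λ f‖ = ‖f‖
  rw [← toReal_enorm, h4, toReal_enorm]

omit S [IsProbabilityMeasure Pm] in
theorem inner_lp_eq (a b : Lp ℝ 2 Pm) : inner ℝ a b = ∫ ω, a ω * b ω ∂Pm := by
  rw [L2.inner_def]
  refine integral_congr_ae (Eventually.of_forall fun ω => ?_)
  simp [mul_comm]

/-- `J J*` is the orthogonal projection onto the range of the isometry `J`. With `Y = E[ζ | 𝔽 ⊥]`,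
the variable `ζ - Y - J J* ζ` is orthogonal to `𝔽 ⊥`, since stochastic integrals have mean zero
given `𝔽 ⊥`, and to the range of `J`, to which `Y` is itself orthogonal. Hence it vanishes by
`ae_eq_zero_of_orthogonal`. -/
theorem exists_representation {J : Lp ℝ 2 (markMeasure g Pm 𝔽 X) →ₗᵢ[ℝ] Lp ℝ 2 Pm}
    (hJ1 : ∀ f, J f =ᵐ[Pm] fun ω => sT g (X ω) fun z => f ((z.1, ω), z.2))
    (hJ2 : ∀ q (hq : Pred 𝔽 q) (hn : nsq g Pm X q ≠ ∞),
      J ((S.memLp_mark hq hn).toLp _) =ᵐ[Pm] fun ω => sT g (X ω) fun z => q z.1 ω z.2)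
    (ζ : Lp ℝ 2 Pm) : ∃ Y : Ω → ℝ, Measurable[𝔽 ⊥] Y ∧
      ∀ᵐ ω ∂Pm, J (J.toContinuousLinearMap.adjoint ζ) ω = ζ ω - Y ω := by
  set f := J.toContinuousLinearMap.adjoint ζ
  have hζ : MemLp ζ 2 Pm := Lp.memLp ζ
  have hY2 : MemLp (Pm[ζ|𝔽 ⊥]) 2 Pm := hζ.condExp one_le_two
  have hYm : Measurable[𝔽 ⊥] (Pm[ζ|𝔽 ⊥]) := stronglyMeasurable_condExp.measurable
  refine ⟨Pm[ζ|𝔽 ⊥], hYm, ?_⟩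
  have hf2 : MemLp (J f) 2 Pm := Lp.memLp _
  have hz := S.ae_eq_zero_of_orthogonal (Z := fun ω => ζ ω - (Pm[ζ|𝔽 ⊥]) ω - J f ω)
    ((hζ.sub hY2).sub hf2) (fun A hA => ?_) fun q hq hn => ?_
  · filter_upwards [hz] with ω hω
    have : ζ ω - (Pm[ζ|𝔽 ⊥]) ω - J f ω = 0 := hω
    linarith
  · have hζi : Integrable ζ Pm := hζ.integrable (by norm_num)
    rw [integral_sub (f := fun ω => ζ ω - (Pm[ζ|𝔽 ⊥]) ω)
      (hζi.sub (hY2.integrable (by norm_num))).integrableOn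
      (hf2.integrable (by norm_num)).integrableOn, integral_sub hζi.integrableOn
      (hY2.integrable (by norm_num)).integrableOn, setIntegral_condExp (𝔽.le ⊥) hζi hA, sub_self,
      setIntegral_congr_ae (𝔽.le _ _ hA) ((hJ1 f).mono fun ω h _ => h), ← S.setIntegral_sI (pred_coe f) (S.nsq_coe_ne_top f) ⊥ hA]
    simp [sI_bot]
  · set R := (S.memLp_mark hq hn).toLp _
    have hR := hJ2 q hq hn
    have hR2 : MemLp (J R) 2 Pm := Lp.memLp _
    have e1 : ∫ ω, ζ ω * J R ω ∂Pm = ∫ ω, J f ω * J R ω ∂Pm := by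
      have h1 : inner ℝ ζ (J R) = inner ℝ (J f) (J R) := by
        rw [J.inner_map_map]
        exact (ContinuousLinearMap.adjoint_inner_left J.toContinuousLinearMap R ζ).symm
      rwa [inner_lp_eq, inner_lp_eq] at h1
    have e2 : ∫ ω, (Pm[ζ|𝔽 ⊥]) ω * J R ω ∂Pm = 0 := by
      refine (integral_congr_ae ?_).trans (S.integral_sT_sub_sI_mul hq hn ⊥ hYm hY2)
      filter_upwards [hR] with ω hω
      rw [hω, sI_bot]; ring
    have hi : ∀ {f h : Ω → ℝ}, MemLp f 2 Pm → MemLp h 2 Pm → Integrable (fun ω => f ω * h ω) Pm :=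
      fun hf hh => MemLp.integrable_mul (p := 2) (q := 2) hf hh
    calc _ = ∫ ω, (ζ ω * J R ω - (Pm[ζ|𝔽 ⊥]) ω * J R ω - J f ω * J R ω) ∂Pm := by
          refine integral_congr_ae ?_
          filter_upwards [hR] with ω hω
          rw [hω]; ring
      _ = 0 := by
          rw [integral_sub (f := fun ω => ζ ω * J R ω - (Pm[ζ|𝔽 ⊥]) ω * J R ω)
            ((hi hζ hR2).sub (hi hY2 hR2)) (hi hf2 hR2),
            integral_sub (hi hζ hR2) (hi hY2 hR2), e1, e2]
          ring

variable {D : Coeffs T Ω} {c : NNReal} (B : D.Bounded g Pm 𝔽 X c)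
include B

/-- The integrated equation `∫ q dM = Ξ - Y + ∫ driver` has a solution. -/
theorem exists_integrand {Ξ : Ω → ℝ} (hΞ : MemLp Ξ 2 Pm) : ∃ (q : Time T → Ω → ℕ → ℝ) (Y : Ω → ℝ),
    Pred 𝔽 q ∧ nsq g Pm X q ≠ ∞ ∧ Measurable[𝔽 ⊥] Y ∧
      ∀ᵐ ω ∂Pm, sT g (X ω) (fun z => q z.1 ω z.2) = Ξ ω + (∫ s, D.drv g Pm X q s ω) - Y ω := by
  obtain ⟨J, hJ1, hJ2⟩ := S.exists_isometry
  obtain ⟨Λ, hΛ, -⟩ := S.exists_clm (F := fun q ω => ∫ s, D.drv g Pm X q s ω)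
    (C := (volume (Set.univ : Set (Time T))).toNNReal * (2 * c + 2 * c ^ 4))
    (fun q hq _ => (((S.measurable_drv B hq).mono predictable_le
      le_rfl).stronglyMeasurable.integral_prod_left').measurable)
    (fun q hq _ => by
      refine (S.lintegral_integral_drv_sq_le B hq).trans (le_of_eq ?_)
      rw [ENNReal.coe_mul, mul_assoc, ENNReal.coe_toNNReal (measure_ne_top _ _)])
    (fun q r hq hqn hr hrn => S.integral_drv_add B hq hr hqn hrn)
    fun a q ω => by simp only [drv_const_mul, integral_const_mul]
  have hrep := S.exists_representation hJ1 hJ2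
  obtain ⟨γ, hγ, hcon⟩ := S.exists_wsq_le B
  -- Applying `J*` turns the equation into `f = J* Ξ + Φ f`. By the representation, `J (Φ f)` equals
  -- `Λ f` up to an `𝔽 ⊥`-measurable variable, which is the situation of the contraction estimate.
  set Φ := J.toContinuousLinearMap.adjoint ∘L Λ
  set rep : Lp ℝ 2 (markMeasure g Pm 𝔽 X) → Time T → Ω → ℕ → ℝ := fun f s ω j => f ((s, ω), j)
  have hΦ : ∀ f, wsq g Pm X γ (rep (Φ f)) ≤ 4⁻¹ * wsq g Pm X γ (rep f) := by
    intro f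
    obtain ⟨Y, hY, h⟩ := hrep (Λ f)
    refine hcon _ _ (pred_coe f) (S.nsq_coe_ne_top f) (pred_coe _) (S.nsq_coe_ne_top _) Y hY ?_
    filter_upwards [h, hJ1 (Φ f), hΛ f] with ω h1 h2 h3
    rw [← h2, ← h3]
    exact h1
  set q₀ := J.toContinuousLinearMap.adjoint (hΞ.toLp Ξ)
  have hpow : ∀ n : ℕ, wsq g Pm X γ (rep ((Φ ^ n) q₀)) ≤ 4⁻¹ ^ n * wsq g Pm X γ (rep q₀) := by
    intro n
    induction n with
    | zero => simp
    | succ n ih =>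
      rw [pow_succ' Φ, mul_apply_eq_comp, pow_succ', mul_assoc]
      exact (hΦ _).trans (mul_le_mul' le_rfl ih)
  have hW : wsq g Pm X γ (rep q₀) ≠ ∞ := ne_top_of_le_ne_top
    (ENNReal.mul_ne_top ENNReal.ofReal_ne_top (S.nsq_coe_ne_top q₀)) (S.wsq_le_nsq (pred_coe q₀) hγ.le)
  set W := wsq g Pm X γ (rep q₀)
  -- `wsq` is a squared norm and dominates the squared norm of the Hilbert space, so contraction by
  -- `1/4` gives geometric decay with ratio `1/2` in norm and the Neumann series converges.
  have hnorm : ∀ n : ℕ, ‖(Φ ^ n) q₀‖ ≤ (1 / 2) ^ n * √W.toReal := by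
    intro n
    have h1 : ‖(Φ ^ n) q₀‖ₑ ^ 2 ≤ 4⁻¹ ^ n * W := by
      rw [S.enorm_sq_eq_nsq]
      exact (S.nsq_le_wsq (pred_coe _) hγ.le).trans (hpow n)
    have h2 := ENNReal.toReal_mono (ENNReal.mul_ne_top (by simp) hW) h1
    simp only [ENNReal.toReal_pow, ENNReal.toReal_mul, toReal_enorm, ENNReal.toReal_inv,
      ENNReal.toReal_ofNat] at h2
    refine (pow_le_pow_iff_left₀ (norm_nonneg _) (by positivity) (by norm_num : 2 ≠ 0)).1 (h2.trans (le_of_eq ?_))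
    rw [mul_pow, Real.sq_sqrt ENNReal.toReal_nonneg, ← pow_mul, mul_comm n, pow_mul]
    norm_num
  have hsum : Summable fun n => (Φ ^ n) q₀ := Summable.of_norm_bounded
    ((summable_geometric_of_lt_one (by norm_num) (by norm_num)).mul_right _) hnorm
  set f := ∑' n, (Φ ^ n) q₀
  have hf : f = J.toContinuousLinearMap.adjoint (hΞ.toLp Ξ + Λ f) := by
    have h1 : f = q₀ + Φ f := by
      calc f = (Φ ^ 0) q₀ + ∑' n, (Φ ^ (n + 1)) q₀ := hsum.tsum_eq_zero_add
        _ = q₀ + Φ f := by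
          rw [Φ.map_tsum hsum]
          simp [pow_succ']
    rw [map_add]
    exact h1
  -- The stochastic part of `Ξ + Λ f` in the representation is `J f`, because `f = J*(Ξ + Λ f)`;
  -- this is the integrated equation.
  obtain ⟨Y, hY, h⟩ := hrep (hΞ.toLp Ξ + Λ f)
  rw [← hf] at h
  refine ⟨rep f, Y, pred_coe f, S.nsq_coe_ne_top f, hY, ?_⟩
  filter_upwards [h, hJ1 f, hΛ f, Lp.coeFn_add (hΞ.toLp Ξ) (Λ f), hΞ.coeFn_toLp] with ω h1 h2 h3 h4 h5
  rw [← h2, h1, h4, Pi.add_apply, h5, h3]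

/-- Two solutions of the integrated equation have the same integrand. -/
theorem nsq_sub_eq_zero_of_eq {q r : Time T → Ω → ℕ → ℝ} {Ξ Y Z : Ω → ℝ}
    (hq : Pred 𝔽 q) (hqn : nsq g Pm X q ≠ ∞)
    (hr : Pred 𝔽 r) (hrn : nsq g Pm X r ≠ ∞) (hY : Measurable[𝔽 ⊥] Y) (hZ : Measurable[𝔽 ⊥] Z)
    (h1 : ∀ᵐ ω ∂Pm, sT g (X ω) (fun z => q z.1 ω z.2) = Ξ ω + (∫ s, D.drv g Pm X q s ω) - Y ω)
    (h2 : ∀ᵐ ω ∂Pm, sT g (X ω) (fun z => r z.1 ω z.2) = Ξ ω + (∫ s, D.drv g Pm X r s ω) - Z ω) :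
    nsq g Pm X (fun s ω j => q s ω j - r s ω j) = 0 := by
  obtain ⟨γ, hγ, hcon⟩ := S.exists_wsq_le B
  have hd := hq.sub hr
  have hdn : nsq g Pm X (fun s ω j => q s ω j - r s ω j) ≠ ∞ := by
    rw [← S.lintegral_markMeasure_sq hd]
    have := ((S.memLp_mark hq hqn).sub (S.memLp_mark hr hrn)).2
    rw [eLpNorm_two_eq] at this
    intro hi
    erw [hi] at this
    simp at this
  have hadd := S.integral_drv_add B hd hr hdn hrn
  simp only [sub_add_cancel] at hadd
  -- `Ξ` cancels in the difference of the two equations, so the difference is its own image under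
  -- the solution map. Its finite weighted norm is at most a quarter of itself.
  have h := hcon _ _ hd hdn hd hdn (fun ω => Y ω - Z ω) (hY.sub hZ) (by
    filter_upwards [h1, h2, hadd, S.ae_integrable_cm hq hqn, S.ae_integrable_cm hr hrn]
      with ω h1 h2 h3 h4 h5
    rw [sT_sub h4 h5, h1, h2, h3]; ring)
  have hW : wsq g Pm X γ (fun s ω j => q s ω j - r s ω j) ≠ ∞ := ne_top_of_le_ne_top
    (ENNReal.mul_ne_top ENNReal.ofReal_ne_top hdn) (S.wsq_le_nsq hd hγ.le)
  have h0 : wsq g Pm X γ (fun s ω j => q s ω j - r s ω j) = 0 := by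
    by_contra hne
    refine absurd h (not_le.2 ?_)
    calc _ < 1 * wsq g Pm X γ (fun s ω j => q s ω j - r s ω j) :=
          ENNReal.mul_lt_mul_left hne hW (by norm_num)
      _ = _ := one_mul _
  exact nonpos_iff_eq_zero.1 ((S.nsq_le_wsq hd hγ.le).trans h0.le)

end ChainSetup
end MFChain
end

/-! ### Existence and uniqueness for the backward equation -/

noncomputable section

namespace MFChain
variable {T : ℝ} [Fact (0 ≤ T)] {Ω : Type*} [mΩ : MeasurableSpace Ω]

theorem setIntegral_Ioi_bot (f : Time T → ℝ) : ∫ s in Set.Ioi (⊥ : Time T), f s = ∫ s, f s := by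
  have h : Set.Ioi (⊥ : Time T) =ᵐ[volume] Set.Ici ⊥ := Ioi_ae_eq_Ici
  rw [setIntegral_congr_set h, Set.Ici_bot, setIntegral_univ]

theorem setIntegral_Ioi_eq_sub {f : Time T → ℝ} (hf : Integrable f) (t : Time T) :
    ∫ s in Set.Ioi t, f s = (∫ s, f s) - ∫ s in Set.Iic t, f s := by
  have h3 := integral_add_compl (measurableSet_Iic (a := t)) hf
  rw [Set.compl_Iic] at h3
  linarith

namespace ChainSetup

variable {g : ℕ → ℕ → ℝ} {Pm : Measure Ω} {𝔽 : Filtration (Time T) mΩ} {X : Ω → ChainPath T}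
  (S : ChainSetup g Pm 𝔽 X) [IsProbabilityMeasure Pm] {q r : Time T → Ω → ℕ → ℝ}
include S

/-- The compensator formula for the squared difference carries the equality from compensator-almost
every point to the jumps, hence to the pathwise sums over jump times. -/
theorem integral_sub_eq (hq : Pred 𝔽 q) (hr : Pred 𝔽 r)
    (h0 : nsq g Pm X (fun s ω j => q s ω j - r s ω j) = 0) : ∀ᵐ ω ∂Pm,
      (∀ᵐ z ∂cm g (X ω), q z.1 ω z.2 = r z.1 ω z.2) ∧ ∀ᵐ z ∂jm (X ω), q z.1 ω z.2 = r z.1 ω z.2 := by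
  have hd := hq.sub hr
  have h1 : ∫⁻ ω, (∫⁻ z, ‖q z.1 ω z.2 - r z.1 ω z.2‖ₑ ^ 2 ∂jm (X ω)) ∂Pm = 0 :=
    (S.lintegral_lintegral_jm (f := fun s ω j => ‖q s ω j - r s ω j‖ₑ ^ 2) hd.enorm_sq).trans h0
  rw [lintegral_eq_zero_iff (S.measurable_lintegral_jm
    (f := fun s ω j => ‖q s ω j - r s ω j‖ₑ ^ 2) hd.enorm_sq)] at h1
  rw [nsq, lintegral_eq_zero_iff (S.measurable_lintegral_cm
    (f := fun s ω j => ‖q s ω j - r s ω j‖ₑ ^ 2) hd.enorm_sq)] at h0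
  filter_upwards [h0, h1] with ω h2 h3
  have hm : Measurable fun z : Time T × ℕ => ‖q z.1 ω z.2 - r z.1 ω z.2‖ₑ ^ 2 :=
    S.measurable_mark (f := fun s ω j => ‖q s ω j - r s ω j‖ₑ ^ 2) hd.enorm_sq ω
  constructor
  · filter_upwards [(lintegral_eq_zero_iff hm).1 h2] with z hz
    simpa [sub_eq_zero] using hz
  · filter_upwards [(lintegral_eq_zero_iff hm).1 h3] with z hz
    simpa [sub_eq_zero] using hz

variable {D : Coeffs T Ω} {c : NNReal} (B : D.Bounded g Pm 𝔽 X c)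
include B

/-- Existence for the backward equation with driver `drv q + b` and terminal value `ξ`. -/
theorem exists_backward {ξ : Ω → ℝ} (hξ : MemLp ξ 2 Pm) {b : Time T → Ω → ℝ} (hb : Prog 𝔽 b)
    {M : NNReal} (hbM : ∀ s ω, ‖b s ω‖ₑ ≤ M) :
    ∃ (q : Time T → Ω → ℕ → ℝ) (p : Time T → Ω → ℝ), Pred 𝔽 q ∧ nsq g Pm X q ≠ ∞ ∧
      (∀ t, Measurable[𝔽 t] (p t)) ∧
      (∀ ω t, ContinuousWithinAt (fun s => p s ω) (Set.Ici t) t ∧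
        ∃ a : ℝ, Tendsto (fun s => p s ω) (𝓝[<] t) (𝓝 a)) ∧
      ∫⁻ ω, (⨆ t, ‖p t ω‖ₑ) ∂Pm < ∞ ∧
      (∀ᵐ ω ∂Pm, Integrable fun s => D.drv g Pm X q s ω + b s ω) ∧
      ∀ᵐ ω ∂Pm, ∀ t, p t ω = ξ ω + (∫ s in Set.Ioi t, (D.drv g Pm X q s ω + b s ω)) -
        (sT g (X ω) (fun z => q z.1 ω z.2) - sI g (X ω) (fun z => q z.1 ω z.2) t) := by
  classical
  have hbm : ∀ ω, Integrable fun s => b s ω := fun ω => by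
    refine ⟨(measurable_section_left hb.measurable ω).aestronglyMeasurable, ?_⟩
    exact (lintegral_mono fun s => hbM s ω).trans_lt (by
      rw [lintegral_const]; exact ENNReal.mul_lt_top ENNReal.coe_lt_top (measure_lt_top _ _))
  have hBm : Measurable fun ω => ∫ s, b s ω :=
    (hb.measurable.stronglyMeasurable.integral_prod_left' (μ := volume)).measurable
  have hB2 : MemLp (fun ω => ∫ s, b s ω) 2 Pm := by
    refine MemLp.of_bound hBm.aestronglyMeasurable (M * volume.real (Set.univ : Set (Time T)))
      (Eventually.of_forall fun ω => ?_)
    have h1 := norm_setIntegral_le_of_norm_le_const (s := Set.univ) (f := fun s => b s ω) (C := M)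
      (measure_lt_top volume _) fun s _ => by
        have := hbM s ω
        rw [enorm_eq_nnnorm] at this
        exact_mod_cast this
    simpa using h1
  -- At time `0` the inhomogeneity only enters through its integral over the whole interval, so it
  -- is added to the terminal value.
  obtain ⟨q, Y, hq, hn, hY, hY1⟩ := S.exists_integrand B (hξ.add hB2)
  have hdp := S.measurable_drv B hq
  have hdm : Measurable fun z : Time T × Ω => D.drv g Pm X q z.1 z.2 := hdp.mono predictable_le le_rfl
  have hdi := S.integrable_drv B hq hn
  have hci := S.ae_integrable_cm hq hn
  -- Where these pathwise integrals converge `p` is càdlàg. The complement is null, hence belongs to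
  -- `𝔽 ⊥`, so putting `p = 0` there keeps `p` adapted and makes every path càdlàg.
  set good : Set Ω := {ω | Integrable (fun z : Time T × ℕ => q z.1 ω z.2) (cm g (X ω)) ∧
    Integrable fun s => D.drv g Pm X q s ω + b s ω}
  have hai : ∀ᵐ ω ∂Pm, Integrable fun s => D.drv g Pm X q s ω + b s ω := by
    filter_upwards [hdi] with ω h2 using h2.add (hbm ω)
  have hgood : ∀ᵐ ω ∂Pm, ω ∈ good := by
    filter_upwards [hci, hai] with ω h1 h2 using ⟨h1, h2⟩
  have hgm : ∀ t, MeasurableSet[𝔽 t] good := fun t => by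
    have := 𝔽.mono (bot_le : ⊥ ≤ t) _ (S.null goodᶜ hgood)
    simpa using @MeasurableSet.compl _ _ (𝔽 t) this
  -- `p` is defined forwards from `p(0) = Y`, which makes adaptedness evident. The integrated
  -- equation, which determines `Y`, turns this into the backward form with the right terminal
  -- value.
  set p : Time T → Ω → ℝ := fun t ω => if ω ∈ good then
    Y ω - (∫ s in Set.Iic t, (D.drv g Pm X q s ω + b s ω)) + sI g (X ω) (fun z => q z.1 ω z.2) t else 0
  have hap : Prog 𝔽 fun s ω => D.drv g Pm X q s ω + b s ω := fun t =>
    Measurable.add (Prog.of_predictable hdp t) (hb t)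
  refine ⟨q, p, hq, hn, fun t => ?_, fun ω t => ?_, ?_, hai, ?_⟩
  · exact Measurable.ite (hgm t) (((hY.mono (𝔽.mono bot_le) le_rfl).sub
      (hap.measurable_setIntegral t)).add (S.measurable_sI hq t)) measurable_const
  · by_cases hω : ω ∈ good
    · have h1 := continuousWithinAt_setIntegral measurable_id hω.2 t
      have h2 := tendsto_setIntegral_left measurable_id hω.2 t
      simp only [p, hω, if_true]
      exact ⟨(continuousWithinAt_const.sub h1).add (continuousWithinAt_sI hω.1 t),
        _, (tendsto_const_nhds.sub h2).add (tendsto_sI_left hω.1 t)⟩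
    · simp only [p, hω, if_false]
      exact ⟨continuousWithinAt_const, 0, tendsto_const_nhds⟩
  · have hY2 : MemLp Y 2 Pm := by
      have h1 : MemLp (fun ω => ∫ s, D.drv g Pm X q s ω) 2 Pm := by
        refine ⟨(hdm.stronglyMeasurable.integral_prod_left' (μ := volume)).aestronglyMeasurable, ?_⟩
        rw [eLpNorm_two_eq]
        exact ENNReal.rpow_lt_top_of_nonneg (by norm_num) (ne_top_of_le_ne_top
          (ENNReal.mul_ne_top (measure_ne_top _ _) (ENNReal.mul_ne_top ENNReal.coe_ne_top hn))
          (S.lintegral_integral_drv_sq_le B hq))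
      refine (((hξ.add hB2).add h1).sub (S.memLp_sT hq hn)).ae_eq ?_
      filter_upwards [hY1] with ω hω
      simp only [Pi.sub_apply, Pi.add_apply] at hω ⊢
      rw [hω]; ring
    have ham : Measurable fun ω => ∫⁻ s, ‖D.drv g Pm X q s ω + b s ω‖ₑ :=
      (hdm.add hb.measurable).enorm.lintegral_prod_left'
    have hY1' : ∫⁻ ω, ‖Y ω‖ₑ ∂Pm < ∞ := (hY2.integrable (by norm_num)).2
    have ha1 : ∫⁻ ω, (∫⁻ s, ‖D.drv g Pm X q s ω + b s ω‖ₑ) ∂Pm < ∞ := by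
      have hd1 : ∫⁻ ω, (∫⁻ s, ‖D.drv g Pm X q s ω‖ₑ) ∂Pm < ∞ := by
        have h2 : (∫⁻ z : Ω × Time T, ‖D.drv g Pm X q z.2 z.1‖ₑ ∂(Pm.prod volume)) ^ 2 < ∞ := by
          refine (lintegral_sq_le (hdm.comp measurable_swap).enorm.aemeasurable).trans_lt ?_
          rw [lintegral_prod _ ((hdm.comp measurable_swap).enorm.pow_const 2).aemeasurable]
          exact ENNReal.mul_lt_top (measure_lt_top _ _) ((S.lintegral_lintegral_drv_sq_le B hq).trans_lt
            (ENNReal.mul_lt_top ENNReal.coe_lt_top hn.lt_top))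
        rw [lintegral_prod (fun z : Ω × Time T => ‖D.drv g Pm X q z.2 z.1‖ₑ)
          (hdm.comp measurable_swap).enorm.aemeasurable] at h2
        exact lt_of_not_ge fun h => by
          rw [top_le_iff.1 h] at h2; simp at h2
      refine (lintegral_mono fun ω => lintegral_mono fun s => enorm_add_le _ _).trans_lt ?_
      have e : ∀ ω, ∫⁻ s, (‖D.drv g Pm X q s ω‖ₑ + ‖b s ω‖ₑ) =
          (∫⁻ s, ‖D.drv g Pm X q s ω‖ₑ) + ∫⁻ s, ‖b s ω‖ₑ := fun ω =>
        lintegral_add_right _ (measurable_section_left hb.measurable ω).enorm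
      simp only [e]
      rw [lintegral_add_left (hdm.enorm.lintegral_prod_left')]
      refine ENNReal.add_lt_top.2 ⟨hd1, ?_⟩
      refine (lintegral_mono fun ω => lintegral_mono fun s => hbM s ω).trans_lt ?_
      simp only [lintegral_const, measure_univ, mul_one]
      exact ENNReal.mul_lt_top ENNReal.coe_lt_top (measure_lt_top _ _)
    calc _ ≤ ∫⁻ ω, (‖Y ω‖ₑ + ((∫⁻ s, ‖D.drv g Pm X q s ω + b s ω‖ₑ) +
          ⨆ t, ‖sI g (X ω) (fun z => q z.1 ω z.2) t‖ₑ)) ∂Pm := by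
          refine lintegral_mono fun ω => iSup_le fun t => ?_
          simp only [p]
          split_ifs
          · refine (enorm_add_le _ _).trans ?_
            rw [← add_assoc]
            refine add_le_add ((enorm_sub_le).trans (add_le_add le_rfl ?_))
              (le_iSup (fun t => ‖sI g (X ω) (fun z => q z.1 ω z.2) t‖ₑ) t)
            exact (enorm_integral_le_lintegral_enorm _).trans (setLIntegral_le_lintegral _ _)
          · simp
      _ < ∞ := by
          rw [lintegral_add_left (hY.mono (𝔽.le ⊥) le_rfl).enorm, lintegral_add_left ham]
          exact ENNReal.add_lt_top.2 ⟨hY1', ENNReal.add_lt_top.2 ⟨ha1, S.lintegral_iSup_sI hq hn⟩⟩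
  · filter_upwards [hgood, hY1, hdi] with ω h1 h2 h3 t
    simp only [p, h1, if_true]
    rw [setIntegral_Ioi_eq_sub h1.2, integral_add h3 (hbm ω), h2, Pi.add_apply]
    ring

/-- Uniqueness for the backward equation. -/
theorem backward_unique {ξ : Ω → ℝ} {b p p' : Time T → Ω → ℝ}
    (hq : Pred 𝔽 q) (hqn : nsq g Pm X q ≠ ∞) (hr : Pred 𝔽 r) (hrn : nsq g Pm X r ≠ ∞)
    (hp : Measurable[𝔽 ⊥] (p ⊥)) (hp' : Measurable[𝔽 ⊥] (p' ⊥))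
    (hi : ∀ᵐ ω ∂Pm, Integrable fun s => D.drv g Pm X q s ω + b s ω)
    (h : ∀ᵐ ω ∂Pm, ∀ t, p t ω = ξ ω + (∫ s in Set.Ioi t, (D.drv g Pm X q s ω + b s ω)) -
        (sT g (X ω) (fun z => q z.1 ω z.2) - sI g (X ω) (fun z => q z.1 ω z.2) t))
    (h' : ∀ᵐ ω ∂Pm, ∀ t, p' t ω = ξ ω + (∫ s in Set.Ioi t, (D.drv g Pm X r s ω + b s ω)) -
        (sT g (X ω) (fun z => r z.1 ω z.2) - sI g (X ω) (fun z => r z.1 ω z.2) t)) :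
    nsq g Pm X (fun s ω j => q s ω j - r s ω j) = 0 ∧ ∀ᵐ ω ∂Pm, ∀ t, p t ω = p' t ω := by
  have hdq := S.integrable_drv B hq hqn
  have hdr := S.integrable_drv B hr hrn
  have hb : ∀ᵐ ω ∂Pm, Integrable fun s => b s ω := by
    filter_upwards [hi, hdq] with ω h1 h2
    exact (h1.sub h2).congr (Eventually.of_forall fun s => by simp)
  have h0 : nsq g Pm X (fun s ω j => q s ω j - r s ω j) = 0 := by
    -- At `t = 0` each equation becomes the integrated one, with the `𝔽 ⊥`-measurable variables `p
    -- ⊥` and `p' ⊥` in the role of `Y`.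
    refine S.nsq_sub_eq_zero_of_eq B (Ξ := fun ω => ξ ω + ∫ s, b s ω) hq hqn hr hrn hp hp' ?_ ?_
    · filter_upwards [h, hdq, hb] with ω h1 h2 h3
      rw [h1 ⊥, setIntegral_Ioi_bot, integral_add h2 h3, sI_bot]; ring
    · filter_upwards [h', hdr, hb] with ω h1 h2 h3
      rw [h1 ⊥, setIntegral_Ioi_bot, integral_add h2 h3, sI_bot]; ring
  refine ⟨h0, ?_⟩
  have hd := hq.sub hr
  have hdn : nsq g Pm X (fun s ω j => q s ω j - r s ω j) ≠ ∞ := by rw [h0]; simp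
  have hms := (S.measurable_drv B hd).mono predictable_le le_rfl
  have hmq := (S.measurable_drv B hq).mono predictable_le le_rfl
  have hmr := (S.measurable_drv B hr).mono predictable_le le_rfl
  -- Vanishing of the integrand difference at `x(s⁻)` for almost every path does not settle the
  -- mean-field term pointwise; the `L²` bound of the driver of the difference covers both terms at
  -- once.
  have h1 : ∀ᵐ s, ∀ᵐ ω ∂Pm, D.drv g Pm X q s ω = D.drv g Pm X r s ω := by
    have hz := S.nsq_eq hd
    rw [h0] at hz
    filter_upwards [S.msq_lt_top hr hrn, (lintegral_eq_zero_iff (S.measurable_msq hd)).1 hz.symm]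
      with s h2 h3
    have h4 := S.drv_add B hd hr (by rw [h3]; simp) h2
    have h5 := S.lintegral_drv_sq_le B hd s
    rw [h3, Pi.zero_apply, mul_zero, nonpos_iff_eq_zero, lintegral_eq_zero_iff
      ((measurable_section hms s).enorm.pow_const 2)] at h5
    simp only [sub_add_cancel] at h4
    filter_upwards [h4, h5] with ω h4 h5
    have h6 : D.drv g Pm X (fun s ω j => q s ω j - r s ω j) s ω = 0 := by simpa using h5
    rw [h4, h6, zero_add]
  replace h1 := (Measure.ae_ae_comm (p := fun s ω => D.drv g Pm X q s ω = D.drv g Pm X r s ω)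
    (measurableSet_eq_fun hmq hmr)).1 h1
  filter_upwards [h, h', h1, S.integral_sub_eq hq hr h0] with ω h2 h3 h4 h5 t
  have e1 : sT g (X ω) (fun z => q z.1 ω z.2) = sT g (X ω) (fun z => r z.1 ω z.2) := by
    rw [sT, sT, integral_congr_ae h5.1, integral_congr_ae h5.2]
  have e2 : sI g (X ω) (fun z => q z.1 ω z.2) t = sI g (X ω) (fun z => r z.1 ω z.2) t := by
    rw [sI, sI, integral_congr_ae (ae_restrict_of_ae h5.1), integral_congr_ae (ae_restrict_of_ae h5.2)]
  have e3 : ∫ s in Set.Ioi t, (D.drv g Pm X q s ω + b s ω) =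
      ∫ s in Set.Ioi t, (D.drv g Pm X r s ω + b s ω) := by
    refine integral_congr_ae (ae_restrict_of_ae ?_)
    filter_upwards [h4] with s hs
    rw [hs]
  rw [h2, h3, e1, e2, e3]

end ChainSetup
end MFChain
end

/-! ### Càdlàg processes and the `L²` bound of the density -/

noncomputable section

namespace MFChain
variable {T : ℝ} [Fact (0 ≤ T)] {Ω : Type*} [mΩ : MeasurableSpace Ω]

/-- A right-continuous function with left limits. -/
def Cadlag (f : Time T → ℝ) : Prop :=
  ∀ t, ContinuousWithinAt f (Set.Ici t) t ∧ ∃ a : ℝ, Tendsto f (𝓝[<] t) (𝓝 a)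

section Path

variable {f : Time T → ℝ} (hf : Cadlag f)
include hf

theorem Cadlag.tendsto_leftLim (t : Time T) : Tendsto f (𝓝[<] t) (𝓝 (Function.leftLim f t)) :=
  tendsto_leftLim_of_tendsto (hf t).2

omit hf in
theorem leftLim_bot (f : Time T → ℝ) : Function.leftLim f ⊥ = f ⊥ := leftLim_eq_of_isBot isBot_bot

theorem Cadlag.tendsto_gridL (s : Time T) :
    Tendsto (fun n => f (gridL n s)) atTop (𝓝 (Function.leftLim f s)) := by
  rcases eq_bot_or_bot_lt s with rfl | hs
  · simp only [gridL_bot, leftLim_bot]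
    exact tendsto_const_nhds
  · exact (hf.tendsto_leftLim s).comp (MFChain.tendsto_gridL hs)

theorem Cadlag.tendsto_gridR (s : Time T) :
    Tendsto (fun n => f (gridR n s)) atTop (𝓝 (f s)) :=
  (hf s).1.tendsto.comp (MFChain.tendsto_gridR s)

theorem Cadlag.bounded : ∃ C : ℝ, ∀ t, |f t| ≤ C := by
  have key : ∀ t : Time T, ∃ V ∈ 𝓝 t, ∃ C : ℝ, ∀ s ∈ V, |f s| ≤ C := by
    intro t
    obtain ⟨h1, a, h2⟩ := hf t
    have e1 : ∀ᶠ s in 𝓝[<] t, |f s| ≤ |a| + 1 :=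
      (h2.abs.eventually_lt_const (lt_add_one _)).mono fun s hs => hs.le
    have e2 : ∀ᶠ s in 𝓝[≥] t, |f s| ≤ |f t| + 1 :=
      (h1.abs.tendsto.eventually_lt_const (lt_add_one _)).mono fun s hs => hs.le
    have e3 : ∀ᶠ s in 𝓝 t, |f s| ≤ max (|a| + 1) (|f t| + 1) := by
      rw [← nhdsLT_sup_nhdsGE, eventually_sup]
      exact ⟨e1.mono fun s hs => hs.trans (le_max_left _ _), e2.mono fun s hs => hs.trans (le_max_right _ _)⟩
    exact ⟨_, e3, _, fun s hs => hs⟩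
  choose V hV C hC using key
  obtain ⟨F, -, hF⟩ := isCompact_univ.elim_nhds_subcover V fun t _ => hV t
  refine ⟨∑ t ∈ F, |C t|, fun s => ?_⟩
  obtain ⟨t, ht, hst⟩ := Set.mem_iUnion₂.1 (hF (Set.mem_univ s))
  exact ((hC t s hst).trans (le_abs_self _)).trans
    (Finset.single_le_sum (f := fun t => |C t|) (fun _ _ => abs_nonneg _) ht)

theorem Cadlag.le_of_grid {C : ℝ} {s : Time T} (h : ∀ k m, gridPt k m < s → |f (gridPt k m)| ≤ C)
    {r : Time T} (hr : r < s) : |f r| ≤ C := by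
  refine le_of_tendsto (hf.tendsto_gridR r).abs ?_
  have : ∀ᶠ u in 𝓝[≥] r, u < s := mem_nhdsWithin_of_mem_nhds (Iio_mem_nhds hr)
  filter_upwards [(MFChain.tendsto_gridR r).eventually this] with n hn
  exact h _ _ hn

end Path

/-- `|L| ≤ n` up to (and excluding) time `s`. -/
def boundedUntil (L : Time T → Ω → ℝ) (n : ℕ) (s : Time T) (ω : Ω) : Prop :=
  -- Time `0` is always included, because the left limit at `0` is by convention `L(0)`.
  ∀ r, (r = ⊥ ∨ r < s) → |L r ω| ≤ n

open Classical in
/-- The indicator of `boundedUntil`. -/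
def cut (L : Time T → Ω → ℝ) (n : ℕ) (s : Time T) (ω : Ω) : ℝ :=
  if boundedUntil L n s ω then 1 else 0

section Adapted

variable {𝔽 : Filtration (Time T) mΩ} {L : Time T → Ω → ℝ} (hL : ∀ t, Measurable[𝔽 t] (L t))
  (hc : ∀ ω, Cadlag fun t => L t ω)
include hL hc

theorem measurable_leftLim : Measurable[𝔽.predictable]
    fun z : Time T × Ω => Function.leftLim (fun r => L r z.2) z.1 := by
  have h : ∀ n, Measurable[𝔽.predictable] fun z : Time T × Ω => L (gridL n z.1) z.2 := fun n =>
    measurable_gridL_predictable (Z := L) hL n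
  let _ : MeasurableSpace (Time T × Ω) := 𝔽.predictable
  exact measurable_of_tendsto_metrizable h (tendsto_pi_nhds.2 fun z => (hc z.2).tendsto_gridL z.1)

theorem measurable_cadlag : Measurable fun z : Time T × Ω => L z.1 z.2 := by
  have h : ∀ n, Measurable fun z : Time T × Ω => L (gridR n z.1) z.2 := by
    intro n
    have h1 : Measurable fun p : ℕ × Ω => L (gridPt n p.1) p.2 :=
      measurable_from_prod_countable_right fun k => (hL (gridPt n k)).mono (𝔽.le _) le_rfl
    have h2 : Measurable fun s : Time T => ⌊2 ^ n * (s : ℝ)⌋₊ + 1 :=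
      (Nat.measurable_floor.comp (measurable_subtype_coe.const_mul (2 ^ n))).add_const 1
    have h3 : Measurable fun z : Time T × Ω => (⌊2 ^ n * (z.1 : ℝ)⌋₊ + 1, z.2) :=
      (h2.comp measurable_fst).prodMk measurable_snd
    exact Measurable.comp (g := fun p : ℕ × Ω => L (gridPt n p.1) p.2) h1 h3
  exact measurable_of_tendsto_metrizable h (tendsto_pi_nhds.2 fun z => (hc z.2).tendsto_gridR z.1)

/-- By right continuity the bound on `[0, s)` may be tested at the grid points before `s`, and an
adapted variable used only after its own time is predictable. -/
theorem measurable_cut (n : ℕ) : Measurable[𝔽.predictable] fun z : Time T × Ω => cut L n z.1 z.2 := by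
  classical
  have e : {z : Time T × Ω | boundedUntil L n z.1 z.2} =
      {z | |L ⊥ z.2| ≤ n} ∩ ⋂ k, ⋂ m, {z | |if gridPt k m < z.1 then L (gridPt k m) z.2 else 0| ≤ n} := by
    ext ⟨s, ω⟩
    simp only [boundedUntil, Set.mem_ofPred_eq, Set.mem_inter_iff, Set.mem_iInter]
    constructor
    · refine fun h => ⟨h ⊥ (Or.inl rfl), fun k m => ?_⟩
      split_ifs with hs
      · exact h _ (Or.inr hs)
      · simp
    · rintro ⟨h0, h⟩ r (rfl | hr)
      · exact h0
      · refine (hc ω).le_of_grid (fun k m hkm => ?_) hr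
        have := h k m
        rwa [if_pos hkm] at this
  have hbot : Measurable[𝔽.predictable] fun z : Time T × Ω => L ⊥ z.2 :=
    measurable_gridL_predictable (Z := fun _ => L ⊥) (fun t => (hL ⊥).mono (𝔽.mono bot_le) le_rfl) 0
  refine Measurable.ite ?_ measurable_const measurable_const
  rw [e]
  let _ : MeasurableSpace (Time T × Ω) := 𝔽.predictable
  have habs : Measurable fun x : ℝ => |x| := measurable_norm
  exact (measurableSet_le (habs.comp hbot) measurable_const).inter
    (MeasurableSet.iInter fun k => MeasurableSet.iInter fun m =>
      measurableSet_le (habs.comp (measurable_Ioi_predictable (hL _))) measurable_const)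

end Adapted

theorem cut_of_le {L : Time T → Ω → ℝ} {n : ℕ} {r s : Time T} (hrs : r ≤ s) {ω : Ω}
    (h : boundedUntil L n s ω) : boundedUntil L n r ω := fun u hu =>
  h u (hu.imp_right fun h => h.trans_le hrs)

theorem abs_cut_mul_leftLim_le {L : Time T → Ω → ℝ} (hc : ∀ ω, Cadlag fun t => L t ω) (n : ℕ)
    (s : Time T) (ω : Ω) : |cut L n s ω * Function.leftLim (fun r => L r ω) s| ≤ n := by
  by_cases h : boundedUntil L n s ω
  · rw [cut, if_pos h, one_mul]
    refine le_of_tendsto ((hc ω).tendsto_gridL s).abs (Eventually.of_forall fun k => ?_)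
    rcases eq_bot_or_bot_lt s with rfl | hs
    · rw [gridL_bot]; exact h _ (Or.inl rfl)
    · exact h _ (Or.inr (gridL_lt hs))
  · simp [cut, h]

namespace ChainSetup

variable {g : ℕ → ℕ → ℝ} {Pm : Measure Ω} {𝔽 : Filtration (Time T) mΩ} {X : Ω → ChainPath T}
  (S : ChainSetup g Pm 𝔽 X) [IsProbabilityMeasure Pm] {L : Time T → Ω → ℝ}
  {ℓ : Time T → Ω → ℕ → ℝ} {c : NNReal}
include S

/-- Solutions of the linear equation `dL = L₋ ℓ dM` are bounded in `L²`. -/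
theorem lintegral_density_sq_le (hL : ∀ t, Measurable[𝔽 t] (L t)) (hc : ∀ ω, Cadlag fun t => L t ω)
    (hℓ : Pred 𝔽 ℓ) (hℓc : ∀ s ω, ∫⁻ j, ‖ℓ s ω j‖ₑ ^ 2 ∂rate g ((X ω).left s) ≤ c)
    (heq : ∀ᵐ ω ∂Pm, ∀ t, L t ω = 1 +
      sI g (X ω) (fun z => Function.leftLim (fun r => L r ω) z.1 * ℓ z.1 ω z.2) t) :
    ∃ C : NNReal, ∀ t, ∫⁻ ω, ‖L t ω‖ₑ ^ 2 ∂Pm ≤ C := by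
  classical
  set m : Time T → Ω → ℝ := fun s ω => Function.leftLim (fun r => L r ω) s
  -- The integrand of the density equation, switched off once `|L|` has exceeded `n`. It is square
  -- integrable, so the isometry applies before any moment of `L` is known; the predictable factor
  -- `cut` does the work of a localizing stopping time.
  set q : ℕ → Time T → Ω → ℕ → ℝ := fun n s ω j => cut L n s ω * m s ω * ℓ s ω j
  set y : ℕ → Time T → ℝ≥0∞ := fun n s => ∫⁻ ω, ‖cut L n s ω * m s ω‖ₑ ^ 2 ∂Pm
  have hcm : ∀ n, Measurable[𝔽.predictable] fun z : Time T × Ω => cut L n z.1 z.2 * m z.1 z.2 :=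
    fun n => Measurable.mul (measurable_cut hL hc n) (measurable_leftLim hL hc)
  have hq : ∀ n, Pred 𝔽 (q n) := fun n j => Measurable.mul (hcm n) (hℓ j)
  have hyn : ∀ n s, y n s ≤ (n : ℝ≥0∞) ^ 2 := fun n s => by
    calc y n s ≤ ∫⁻ ω, (n : ℝ≥0∞) ^ 2 ∂Pm := by
          refine lintegral_mono fun ω => pow_le_pow_left₀ zero_le ?_ 2
          rw [← ofReal_norm, Real.norm_eq_abs, ← ENNReal.ofReal_natCast]
          exact ENNReal.ofReal_le_ofReal (abs_cut_mul_leftLim_le hc n s ω)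
      _ = _ := by simp
  have hms : ∀ n s, msq g Pm X (q n) s ≤ c * y n s := fun n s => by
    rw [← lintegral_const_mul' _ _ ENNReal.coe_ne_top]
    refine lintegral_mono fun ω => ?_
    simp only [q, enorm_mul _ (ℓ s ω _), mul_pow]
    rw [lintegral_const_mul' _ _ (ENNReal.pow_ne_top enorm_ne_top), mul_comm]
    exact mul_le_mul' (hℓc s ω) le_rfl
  have hqn : ∀ n, nsq g Pm X (q n) ≠ ∞ := fun n => by
    rw [S.nsq_eq (hq n)]
    refine ne_top_of_le_ne_top ?_ (lintegral_mono fun s => (hms n s).trans (mul_le_mul' le_rfl (hyn n s)))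
    rw [lintegral_const]
    exact ENNReal.mul_ne_top (ENNReal.mul_ne_top ENNReal.coe_ne_top (by simp)) (measure_ne_top _ _)
  have hsI : ∀ n r, ∫⁻ ω, ‖sI g (X ω) (fun z => q n z.1 ω z.2) r‖ₑ ^ 2 ∂Pm ≤
      c * ∫⁻ s in Set.Iic r, y n s := fun n r => by
    have hp := Pred.Iic (hq n) r
    have h1 := S.lintegral_sT_sq hp (ne_top_of_le_ne_top (hqn n) (nsq_mono fun s ω j => by
      split_ifs <;> simp))
    simp only [sT_Iic (φ := fun z : Time T × ℕ => q n z.1 _ z.2)] at h1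
    rw [h1, S.nsq_eq hp, ← lintegral_indicator measurableSet_Iic,
      ← lintegral_const_mul' _ _ ENNReal.coe_ne_top]
    refine lintegral_mono fun s => ?_
    by_cases hs : s ≤ r
    · simpa [msq, hs] using hms n s
    · simp [msq, hs]
  -- Where `|L| ≤ n` before `r`, the truncated integrand agrees with the true one on `[0, r]`, so
  -- `L(r)` is `1` plus the truncated integral. Elsewhere the left side is zero.
  have hz : ∀ n r, ∫⁻ ω, ‖cut L n r ω * L r ω‖ₑ ^ 2 ∂Pm ≤ 2 + 2 * (c * ∫⁻ s in Set.Iic r, y n s) := by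
    intro n r
    calc _ ≤ ∫⁻ ω, (2 + 2 * ‖sI g (X ω) (fun z => q n z.1 ω z.2) r‖ₑ ^ 2) ∂Pm := by
          refine lintegral_mono_ae ?_
          filter_upwards [heq] with ω hω
          by_cases h : boundedUntil L n r ω
          · have e : sI g (X ω) (fun z => m z.1 ω * ℓ z.1 ω z.2) r =
                sI g (X ω) (fun z => q n z.1 ω z.2) r := by
              have hset : ∀ z ∈ Set.Iic r ×ˢ (Set.univ : Set ℕ),
                  m z.1 ω * ℓ z.1 ω z.2 = q n z.1 ω z.2 := fun z hz => by
                simp [q, cut, cut_of_le (Set.mem_prod.1 hz).1 h]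
              rw [sI, sI, setIntegral_congr_fun (measurableSet_Iic.prod .univ) hset,
                setIntegral_congr_fun (measurableSet_Iic.prod .univ) hset]
            rw [cut, if_pos h, one_mul, hω r, e]
            simpa using enorm_add_sq_le 1 (sI g (X ω) (fun z => q n z.1 ω z.2) r)
          · simp [cut, h]
      _ = 2 + 2 * ∫⁻ ω, ‖sI g (X ω) (fun z => q n z.1 ω z.2) r‖ₑ ^ 2 ∂Pm := by
          rw [lintegral_add_left measurable_const, lintegral_const_mul' _ _ (by simp)]
          simp
      _ ≤ _ := add_le_add le_rfl (mul_le_mul' le_rfl (hsI n r))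
  have hcutm : ∀ n (r : Time T), Measurable fun ω => cut L n r ω * L r ω := fun n r =>
    (((measurable_cut hL hc n).mono predictable_le le_rfl).comp measurable_prodMk_left).mul
      ((hL r).mono (𝔽.le r) le_rfl)
  -- Fatou's lemma along grid points approaching `t` from the left passes from `L` to its left
  -- limit. The summand `1` in the constant ensures the positivity required by `gronwall`.
  have hgr : ∀ n t, y n t ≤ 2 + ENNReal.ofReal (2 * c + 1) * ∫⁻ s in Set.Iic t, y n s := by
    intro n t
    calc y n t ≤ ∫⁻ ω, liminf (fun k => ‖cut L n (gridL k t) ω * L (gridL k t) ω‖ₑ ^ 2) atTop ∂Pm := by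
          refine lintegral_mono fun ω => ?_
          by_cases h : boundedUntil L n t ω
          · have h1 : Tendsto (fun k => ‖cut L n (gridL k t) ω * L (gridL k t) ω‖ₑ ^ 2) atTop
                (𝓝 (‖cut L n t ω * m t ω‖ₑ ^ 2)) := by
              have h2 : ∀ k, boundedUntil L n (gridL k t) ω := fun k => by
                rcases eq_bot_or_bot_lt t with rfl | ht
                · rwa [gridL_bot]
                · exact cut_of_le (gridL_lt ht).le h
              simp only [cut, h, h2, if_true, one_mul]
              exact ((ENNReal.continuous_pow 2).tendsto _).comp ((hc ω).tendsto_gridL t).enorm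
            exact h1.liminf_eq.ge
          · simp [cut, h]
      _ ≤ liminf (fun k => ∫⁻ ω, ‖cut L n (gridL k t) ω * L (gridL k t) ω‖ₑ ^ 2 ∂Pm) atTop :=
          lintegral_liminf_le fun k => (hcutm n _).enorm.pow_const 2
      _ ≤ liminf (fun _ : ℕ => 2 + ENNReal.ofReal (2 * c + 1) * ∫⁻ s in Set.Iic t, y n s) atTop := by
          refine liminf_le_liminf (Eventually.of_forall fun k => (hz n _).trans (add_le_add le_rfl ?_))
          rw [← mul_assoc]
          refine mul_le_mul' ?_ (lintegral_mono_set (Set.Iic_subset_Iic.2 ?_))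
          · rw [show (2 : ℝ≥0∞) = ENNReal.ofReal 2 by simp, ENNReal.coe_nnreal_eq,
              ← ENNReal.ofReal_mul (by norm_num)]
            exact ENNReal.ofReal_le_ofReal (by linarith)
          · rcases eq_bot_or_bot_lt t with rfl | ht
            · rw [gridL_bot]
            · exact (gridL_lt ht).le
      _ = _ := by simp
  -- The Gronwall bound with constant term `2`. It is independent of `n`; the bound `n²` was needed
  -- for finiteness only.
  set C₁ : ℝ≥0∞ := ENNReal.ofReal (Real.exp (2 * (2 * c + 1) * T)) * (2 * 2)
  have hC₁ : C₁ ≠ ∞ := ENNReal.mul_ne_top ENNReal.ofReal_ne_top (by norm_num)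
  have hy1 : ∀ n t, y n t ≤ C₁ := fun n t =>
    gronwall (B := (n : ℝ≥0∞) ^ 2) (by simp) (hyn n) (by positivity) (hgr n) t
  set C₂ : ℝ≥0∞ := 2 + 2 * (c * (C₁ * volume (Set.univ : Set (Time T))))
  have hC₂ : C₂ ≠ ∞ := ENNReal.add_ne_top.2 ⟨by norm_num, ENNReal.mul_ne_top (by norm_num)
    (ENNReal.mul_ne_top ENNReal.coe_ne_top (ENNReal.mul_ne_top hC₁ (measure_ne_top _ _)))⟩
  refine ⟨C₂.toNNReal, fun t => ?_⟩
  rw [ENNReal.coe_toNNReal hC₂]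
  calc _ ≤ ∫⁻ ω, liminf (fun n => ‖cut L n t ω * L t ω‖ₑ ^ 2) atTop ∂Pm := by
        refine lintegral_mono fun ω => ?_
        obtain ⟨C, hC⟩ := (hc ω).bounded
        obtain ⟨N, hN⟩ := exists_nat_ge C
        have h1 : Tendsto (fun n => ‖cut L n t ω * L t ω‖ₑ ^ 2) atTop (𝓝 (‖L t ω‖ₑ ^ 2)) := by
          refine tendsto_const_nhds.congr' ?_
          filter_upwards [eventually_ge_atTop N] with n hn
          have : boundedUntil L n t ω := fun r _ => (hC r).trans (hN.trans (by exact_mod_cast hn))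
          simp [cut, this]
        exact h1.liminf_eq.ge
    _ ≤ liminf (fun n => ∫⁻ ω, ‖cut L n t ω * L t ω‖ₑ ^ 2 ∂Pm) atTop :=
        lintegral_liminf_le fun n => (hcutm n _).enorm.pow_const 2
    _ ≤ liminf (fun _ : ℕ => C₂) atTop := by
        refine liminf_le_liminf (Eventually.of_forall fun n => (hz n t).trans (add_le_add le_rfl
          (mul_le_mul' le_rfl (mul_le_mul' le_rfl ?_))))
        refine (setLIntegral_le_lintegral _ _).trans ((lintegral_mono (hy1 n)).trans ?_)
        rw [lintegral_const]
    _ = C₂ := by simp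

end ChainSetup
end MFChain
end

noncomputable section

namespace MFChain
variable {T : ℝ} [hT : Fact (0 ≤ T)]

/-! ### The martingale problem -/

theorem generator_ind {g : ℕ → ℕ → ℝ} (hg : IsQMatrix g) (j i : ℕ) : generator g (ind j) i = g i j := by
  unfold generator
  by_cases hij : i = j
  · subst hij
    rw [hg.diag, ← tsum_neg]
    refine tsum_congr fun k => ?_
    by_cases hk : k = i <;> simp [ind, hk]
  · rw [tsum_eq_single j]
    · simp [ind, hij, Ne.symm hij]
    · intro k hk
      simp [ind, hk, hij]

theorem ChainPath.measurable_val_time (x : ChainPath T) : Measurable x.val := by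
  refine measurable_of_tendsto_metrizable (f := fun n s => x.val (gridR n s)) (fun n => ?_)
    (tendsto_pi_nhds.2 fun s => (x.right_cts s).tendsto.comp (tendsto_gridR s))
  have h2 : Measurable fun s : Time T => ⌊2 ^ n * (s : ℝ)⌋₊ + 1 :=
    (Nat.measurable_floor.comp (measurable_subtype_coe.const_mul (2 ^ n))).add_const 1
  exact (Measurable.of_discrete (f := fun k : ℕ => x.val (gridPt n k))).comp h2

theorem ChainPath.integrable_val (x : ChainPath T) (a : ℕ → ℝ) : Integrable fun s => a (x.val s) := by
  obtain ⟨N, hN⟩ := x.bddAbove_range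
  refine ⟨((Measurable.of_discrete (f := a)).comp x.measurable_val_time).aestronglyMeasurable, ?_⟩
  refine HasFiniteIntegral.of_bounded (C := ∑ k ∈ Finset.range (N + 1), |a k|)
    (Eventually.of_forall fun s => ?_)
  exact Finset.single_le_sum (f := fun k => |a k|) (fun _ _ => abs_nonneg _)
    (Finset.mem_range.2 (Nat.lt_succ_of_le (hN s)))

/-- The Dynkin process of an indicator function stopped at `σ`, in terms of the jump rates. -/
theorem integral_abs_le_sub_dynkin {g : ℕ → ℕ → ℝ} (hg : IsQMatrix g) (j : ℕ) (x : ChainPath T)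
    (t : Time T) : ∫ s in Set.Ioc ⊥ t, |g (x.val s) j| ≤ 1 + 2 * |g j j| * T - dynkin g (ind j) t x := by
  -- The rate into `j` is negative only from `j` itself, where adding `2 |g j j|` exceeds its
  -- absolute value. Hence the absolute rate is controlled by the signed one, which the Dynkin
  -- process contains.
  have h1 : ∀ s, |g (x.val s) j| ≤ g (x.val s) j + 2 * |g j j| := fun s => by
    by_cases h : x.val s = j
    · rw [h]; linarith [neg_abs_le (g j j)]
    · rw [abs_of_pos (hg.pos _ _ h)]; linarith [abs_nonneg (g j j)]
  have hi := (x.integrable_val fun i => g i j).integrableOn (s := Set.Ioc ⊥ t)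
  have hia := (x.integrable_val fun i => |g i j|).integrableOn (s := Set.Ioc ⊥ t)
  have h2 : ∫ s in Set.Ioc ⊥ t, |g (x.val s) j| ≤ ∫ s in Set.Ioc ⊥ t, (g (x.val s) j + 2 * |g j j|) :=
    integral_mono hia (hi.add (integrable_const _)) h1
  rw [integral_add hi (integrable_const _), setIntegral_const, smul_eq_mul] at h2
  have h3 : volume.real (Set.Ioc ⊥ t) ≤ T := by
    refine (measureReal_mono (Set.subset_univ _)).trans ?_
    rw [Measure.real, Time.volume_apply MeasurableSet.univ, Set.image_univ, Subtype.range_coe,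
      Real.volume_Icc, sub_zero, ENNReal.toReal_ofReal hT.out]
  have h4 : ind j (x.val t) - ind j (x.val ⊥) ≤ 1 := by
    unfold ind; split_ifs <;> norm_num
  simp only [dynkin, generator_ind hg]
  nlinarith [mul_le_mul_of_nonneg_right h3 (abs_nonneg (g j j))]

/-- The Dynkin process at all times is dominated by an affine function of its terminal value.
Integrability at the final time therefore dominates the stopped processes as well. -/
theorem abs_dynkin_le {g : ℕ → ℕ → ℝ} (hg : IsQMatrix g) (j : ℕ) (x : ChainPath T)
    (t : Time T) : |dynkin g (ind j) t x| ≤ 2 + 2 * |g j j| * T - dynkin g (ind j) ⊤ x := by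
  have h1 := integral_abs_le_sub_dynkin hg j x ⊤
  have hi := (x.integrable_val fun i => |g i j|).integrableOn (s := Set.Ioc ⊥ ⊤)
  have h2 : |∫ s in Set.Ioc ⊥ t, g (x.val s) j| ≤ ∫ s in Set.Ioc ⊥ ⊤, |g (x.val s) j| :=
    (abs_integral_le_integral_abs).trans (setIntegral_mono_set hi
      (Eventually.of_forall fun _ => abs_nonneg _)
      (Set.Ioc_subset_Ioc_right le_top).eventuallyLE)
  have h4 : |ind j (x.val t) - ind j (x.val ⊥)| ≤ 1 := by
    unfold ind; split_ifs <;> norm_num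
  have h5 : |dynkin g (ind j) t x| ≤ |ind j (x.val t) - ind j (x.val ⊥)| +
      |∫ s in Set.Ioc ⊥ t, g (x.val s) j| := by
    simp only [dynkin, generator_ind hg]
    exact abs_sub _ _
  linarith

theorem dynkin_sub {g : ℕ → ℕ → ℝ} (hg : IsQMatrix g) (j : ℕ) (x : ChainPath T) {s t : Time T}
    (hst : s ≤ t) : dynkin g (ind j) t x - dynkin g (ind j) s x =
      ind j (x.val t) - ind j (x.val s) - ∫ r in Set.Ioc s t, g (x.left r) j := by
  have hi := x.integrable_val fun i => g i j
  have h1 : ∫ r in Set.Ioc s t, g (x.left r) j = ∫ r in Set.Ioc s t, g (x.val r) j :=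
    integral_congr_ae (ae_restrict_of_ae (x.ae_left_eq.mono fun r hr => by simp only [hr]))
  have h2 : ∫ r in Set.Ioc ⊥ t, g (x.val r) j =
      (∫ r in Set.Ioc ⊥ s, g (x.val r) j) + ∫ r in Set.Ioc s t, g (x.val r) j := by
    rw [← Set.Ioc_union_Ioc_eq_Ioc bot_le hst]
    exact setIntegral_union (Set.Ioc_disjoint_Ioc_of_le le_rfl) measurableSet_Ioc
      hi.integrableOn hi.integrableOn
  simp only [dynkin, generator_ind hg, h1, h2]
  ring

section Raw

variable {g : ℕ → ℕ → ℝ} (hg : IsQMatrix g) {ξ : Measure ℕ} {P : Measure (ChainPath T)}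
  [IsProbabilityMeasure P] (hP : IsMarkovChain g ξ P)
include hg hP

/-- The Dynkin processes of indicator functions are dominated martingales. -/
theorem martingale_dynkin (j : ℕ) :
    Integrable (fun ω => dynkin g (ind j) (⊤ : Time T) ω) P ∧
    (∀ t, Integrable (fun ω => dynkin g (ind j) t ω) P) ∧
    ∀ s t, s ≤ t → ∀ A, MeasurableSet[rawFiltration T s] A →
      ∫ ω in A, dynkin g (ind j) t ω ∂P = ∫ ω in A, dynkin g (ind j) s ω ∂P := by
  classical
  obtain ⟨τ, hτ, hM⟩ := hP.martingale (ind j) fun i => by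
    refine summable_of_ne_finset_zero (s := {j}) fun k hk => ?_
    rw [Finset.mem_singleton] at hk
    simp [ind, hk]
  set Y : ℕ → Time T → ChainPath T → ℝ := fun n =>
    stoppedProcess (fun i ↦ {ω | ⊥ < τ n ω}.indicator (dynkin g (ind j) i)) (τ n)
  -- The time set has a greatest element, so a localizing time that exceeds it takes the value `⊤`.
  -- Along almost every path the localization is thus eventually absent.
  have htop : ∀ᵐ ω ∂P, ∀ᶠ n in atTop, τ n ω = ⊤ := by
    filter_upwards [hτ.tendsto_top] with ω hω
    have : Set.Ioi (((⊤ : Time T)) : WithTop (Time T)) ∈ 𝓝 (⊤ : WithTop (Time T)) :=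
      Ioi_mem_nhds (WithTop.coe_lt_top _)
    filter_upwards [hω this] with n hn
    by_contra h
    obtain ⟨a, ha⟩ := WithTop.ne_top_iff_exists.1 h
    have h2 : (((⊤ : Time T)) : WithTop (Time T)) < τ n ω := hn
    rw [← ha, WithTop.coe_lt_coe] at h2
    exact not_top_lt h2
  have hY : ∀ n t ω, Y n t ω = 0 ∨ ∃ σ, Y n t ω = dynkin g (ind j) σ ω := fun n t ω => by
    by_cases h : ⊥ < τ n ω
    · right
      exact ⟨_, by simp [Y, stoppedProcess, h]; rfl⟩
    · left
      simp [Y, stoppedProcess, h]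
  have hYe : ∀ᵐ ω ∂P, ∀ t, ∀ᶠ n in atTop, Y n t ω = dynkin g (ind j) t ω := by
    filter_upwards [htop] with ω hω t
    filter_upwards [hω] with n hn
    have hb : (⊥ : WithTop (Time T)) < ⊤ := bot_lt_top
    simp [Y, stoppedProcess, hn, WithTop.untopA]
  have hYt : ∀ t, ∀ᵐ ω ∂P, Tendsto (fun n => Y n t ω) atTop (𝓝 (dynkin g (ind j) t ω)) := fun t => by
    filter_upwards [hYe] with ω hω
    exact tendsto_const_nhds.congr' ((hω t).mono fun n hn => hn.symm)
  -- `C` minus the Dynkin process is nonnegative. The localized processes have mean zero, so Fatou's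
  -- lemma gives integrability without further assumption; domination by the terminal value then
  -- carries the martingale property to the limit.
  set C : ℝ := 1 + 2 * |g j j| * T
  have hC0 : 0 ≤ C := by have := hT.out; positivity
  have hpos : ∀ t ω, 0 ≤ C - dynkin g (ind j) t ω := fun t ω =>
    (integral_nonneg fun _ => abs_nonneg _).trans (integral_abs_le_sub_dynkin hg j ω t)
  have hYpos : ∀ n t ω, 0 ≤ C - Y n t ω := fun n t ω => by
    rcases hY n t ω with h | ⟨σ, h⟩
    · rw [h]; linarith
    · rw [h]; exact hpos σ ω
  have hYi : ∀ n t, Integrable (Y n t) P := fun n t => (hM n).integrable t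
  have hY0 : ∀ n t, ∫ ω, Y n t ω ∂P = 0 := fun n t => by
    have h1 := (hM n).setIntegral_eq (bot_le : ⊥ ≤ t) (@MeasurableSet.univ _ (rawFiltration T ⊥))
    rw [setIntegral_univ, setIntegral_univ] at h1
    rw [← h1]
    refine integral_eq_zero_of_ae (Eventually.of_forall fun ω => ?_)
    have : (min (((⊥ : Time T)) : WithTop (Time T)) (τ n ω)).untopA = ⊥ := by
      rw [WithTop.coe_bot, min_eq_left bot_le, ← WithTop.coe_bot]
      rfl
    simp only [stoppedProcess, this, Pi.zero_apply]
    rw [Set.indicator_apply]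
    split_ifs
    · simp [dynkin]
    · rfl
  have hsm : ∀ t, AEStronglyMeasurable (fun ω => dynkin g (ind j) t ω) P := fun t =>
    aestronglyMeasurable_of_tendsto_ae atTop (fun n => (hYi n t).aestronglyMeasurable) (hYt t)
  have hI : ∀ t, Integrable (fun ω => dynkin g (ind j) t ω) P := by
    intro t
    have h1 : Integrable (fun ω => C - dynkin g (ind j) t ω) P := by
      refine ⟨aestronglyMeasurable_const.sub (hsm t), ?_⟩
      rw [hasFiniteIntegral_iff_ofReal (Eventually.of_forall (hpos t))]
      calc _ ≤ ∫⁻ ω, liminf (fun n => ENNReal.ofReal (C - Y n t ω)) atTop ∂P := by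
            refine lintegral_mono_ae ?_
            filter_upwards [hYt t] with ω hω
            exact ((ENNReal.continuous_ofReal.tendsto _).comp (tendsto_const_nhds.sub hω)).liminf_eq.ge
        _ ≤ liminf (fun n => ∫⁻ ω, ENNReal.ofReal (C - Y n t ω) ∂P) atTop :=
            lintegral_liminf_le' fun n =>
              ((aestronglyMeasurable_const.sub (hYi n t).aestronglyMeasurable).aemeasurable).ennreal_ofReal
        _ = liminf (fun _ : ℕ => ENNReal.ofReal C) atTop := by
            congr 1
            ext n
            have hi : Integrable (fun ω => C - Y n t ω) P := (integrable_const C).sub (hYi n t)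
            rw [← ofReal_integral_eq_lintegral_ofReal hi (Eventually.of_forall (hYpos n t)),
              integral_sub (integrable_const C) (hYi n t), hY0]
            simp
        _ < ∞ := by simp
    exact ((integrable_const C).sub h1).congr (Eventually.of_forall fun ω => by simp)
  refine ⟨hI ⊤, hI, fun s t hst A hA => ?_⟩
  have hlim : ∀ r, Tendsto (fun n => ∫ ω in A, Y n r ω ∂P) atTop
      (𝓝 (∫ ω in A, dynkin g (ind j) r ω ∂P)) := by
    intro r
    refine tendsto_integral_of_dominated_convergence (fun ω => 1 + C - dynkin g (ind j) ⊤ ω)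
      (fun n => (hYi n r).aestronglyMeasurable.restrict) ?_ (fun n => Eventually.of_forall fun ω => ?_)
      (ae_restrict_of_ae (hYt r))
    · exact ((integrable_const _).sub (hI ⊤)).integrableOn
    · have h1 : 0 ≤ 1 + C - dynkin g (ind j) ⊤ ω := by linarith [hpos ⊤ ω]
      rcases hY n r ω with h | ⟨σ, h⟩
      · rw [h]; simpa using h1
      · rw [h, Real.norm_eq_abs]
        have := abs_dynkin_le hg j ω σ
        simp only [C]; linarith
  refine tendsto_nhds_unique (hlim t) ((hlim s).congr fun n => ?_)
  exact (hM n).setIntegral_eq hst hA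

end Raw

/-! ### Completion -/

section Completion

variable {α : Type*} {mα : MeasurableSpace α} {μ : Measure α}

/-- The identity map from a space with the completed σ-field. -/
def ofNull (μ : Measure α) : NullMeasurableSpace α μ → α := id

theorem measurePreserving_completion : MeasurePreserving (ofNull μ) μ.completion μ := by
  have hm : Measurable (ofNull μ) := fun s hs => hs.nullMeasurableSet
  refine ⟨hm, Measure.ext fun s hs => ?_⟩
  rw [Measure.map_apply hm hs]
  rfl

/-- A function measurable for the completed σ-field, with values in a countably generated space,
agrees almost everywhere with a measurable one. Almost everywhere measurability is therefore the
same before and after completion. -/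
theorem aemeasurable_completion_iff {β : Type*} [MeasurableSpace β]
    [MeasurableSpace.CountablyGenerated β] [Nonempty β] {f : α → β} :
    AEMeasurable (f ∘ ofNull μ) μ.completion ↔ AEMeasurable f μ := by
  constructor
  · rintro ⟨h, hm, he⟩
    have h1 : NullMeasurable (fun a : α => h a) μ := fun s hs => hm hs
    have h2 : f =ᵐ[μ] fun a => h a := he
    exact h1.aemeasurable.congr h2.symm
  · intro h
    exact h.comp_quasiMeasurePreserving measurePreserving_completion.quasiMeasurePreserving

theorem lintegral_completion {f : α → ℝ≥0∞} (hf : AEMeasurable (f ∘ ofNull μ) μ.completion) :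
    ∫⁻ a, f (ofNull μ a) ∂μ.completion = ∫⁻ a, f a ∂μ := by
  have h := aemeasurable_completion_iff.1 hf
  rw [← (measurePreserving_completion (μ := μ)).map_eq] at h
  have h2 := lintegral_map' h measurePreserving_completion.measurable.aemeasurable
  rw [measurePreserving_completion.map_eq] at h2
  exact h2.symm

theorem aestronglyMeasurable_completion_iff {f : α → ℝ} :
    AEStronglyMeasurable (f ∘ ofNull μ) μ.completion ↔ AEStronglyMeasurable f μ :=
  aestronglyMeasurable_iff_aemeasurable.trans
    (aemeasurable_completion_iff.trans aestronglyMeasurable_iff_aemeasurable.symm)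

theorem integral_completion (f : α → ℝ) : ∫ a, f (ofNull μ a) ∂μ.completion = ∫ a, f a ∂μ := by
  by_cases hf : AEStronglyMeasurable f μ
  · have h := hf
    rw [← (measurePreserving_completion (μ := μ)).map_eq] at h
    have h2 := integral_map measurePreserving_completion.measurable.aemeasurable h
    rw [measurePreserving_completion.map_eq] at h2
    exact h2.symm
  -- Non-measurable functions have the default integral `0` for both measures, so no hypothesis on
  -- `f` is needed.
  · exact (integral_non_aestronglyMeasurable fun h =>
      hf (aestronglyMeasurable_completion_iff.1 h)).trans (integral_non_aestronglyMeasurable hf).symm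

theorem integrable_completion_iff {f : α → ℝ} :
    Integrable (f ∘ ofNull μ) μ.completion ↔ Integrable f μ := by
  refine (and_congr_right fun h => ?_).trans (and_congr_left fun _ => aestronglyMeasurable_completion_iff)
  have h2 := lintegral_completion (f := fun a => ‖f a‖ₑ) h.enorm
  change ∫⁻ a, ‖f (ofNull μ a)‖ₑ ∂μ.completion < ∞ ↔ ∫⁻ a, ‖f a‖ₑ ∂μ < ∞
  rw [h2]

instance [IsProbabilityMeasure μ] : IsProbabilityMeasure μ.completion :=
  ⟨measure_univ (μ := μ)⟩

theorem setIntegral_completion_eq {f : α → ℝ} {A : Set (NullMeasurableSpace α μ)} {B : Set α}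
    (hB : MeasurableSet B) (h : A =ᵐ[μ.completion] ofNull μ ⁻¹' B) :
    ∫ a in A, f (ofNull μ a) ∂μ.completion = ∫ a in B, f a ∂μ := by
  rw [setIntegral_congr_set h, ← integral_indicator hB,
    ← integral_completion (μ := μ) (B.indicator f),
    ← integral_indicator (measurePreserving_completion.measurable hB)]
  rfl

end Completion

/-- The path space with the completed σ-field. -/
abbrev CPath (P : Measure (ChainPath T)) : Type := NullMeasurableSpace (ChainPath T) P

/-- The completed filtration on `CPath P`. -/
def cF (P : Measure (ChainPath T)) :
    Filtration (Time T) (inferInstance : MeasurableSpace (CPath P)) := completedFiltration P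

/-- The coordinate process on `CPath P`. -/
def cX (P : Measure (ChainPath T)) : CPath P → ChainPath T := ofNull P

/-- Completion is part of the setting because `𝔽` consists of σ-fields larger than those of the raw
path space. An event of the completed filtration differs from a raw event by a null set, so the
martingale property for raw events suffices. -/
theorem chainSetup {g : ℕ → ℕ → ℝ} (hg : IsQMatrix g) {ξ : Measure ℕ} {P : Measure (ChainPath T)}
    [IsProbabilityMeasure P] (hP : IsMarkovChain g ξ P) :
    ChainSetup g P.completion (cF P) (cX P) where
  qmat := hg
  adapted t := by
    have h : Measurable[rawFiltration T t] fun ω : ChainPath T => ω.val t :=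
      (comap_measurable _).mono (le_iSup₂_of_le t le_rfl le_rfl) le_rfl
    exact fun s hs => ⟨_, h hs, EventuallyEq.rfl⟩
  null A hA := by
    have h : P A = 0 := hA
    exact ⟨∅, @MeasurableSet.empty _ (rawFiltration T ⊥), ae_eq_empty.2 h⟩
  occ j := by
    have hi := (martingale_dynkin hg hP j).1
    set C : ℝ := 1 + 2 * |g j j| * T
    have h0 : Integrable (fun ω : ChainPath T => C - dynkin g (ind j) ⊤ ω) P :=
      (integrable_const C).sub hi
    have h1 := integrable_completion_iff.2 h0
    refine ne_top_of_le_ne_top h1.2.ne (lintegral_mono fun ω => ?_)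
    have h2 := integral_abs_le_sub_dynkin hg j ω ⊤
    have h3 : Set.Ioc (⊥ : Time T) ⊤ =ᵐ[volume] Set.univ := by
      have : Set.Ioi (⊥ : Time T) =ᵐ[volume] Set.Ici ⊥ := Ioi_ae_eq_Ici
      rwa [Set.Ici_bot, ← Set.Ioc_top] at this
    have h4 := ChainPath.integrable_val ω fun i => g i j
    rw [setIntegral_congr_set h3, setIntegral_univ] at h2
    calc _ = ∫⁻ s, ‖g (ChainPath.val ω s) j‖ₑ :=
          lintegral_congr_ae ((ChainPath.ae_left_eq ω).mono fun s hs => by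
            change ‖g (ChainPath.left ω s) j‖ₑ = _
            rw [hs])
      _ = ENNReal.ofReal (∫ s, |g (ChainPath.val ω s) j|) := by
          rw [ofReal_integral_eq_lintegral_ofReal h4.abs (Eventually.of_forall fun _ => abs_nonneg _)]
          simp only [← Real.enorm_eq_ofReal_abs]
      _ ≤ ENNReal.ofReal (C - dynkin g (ind j) ⊤ ω) := ENNReal.ofReal_le_ofReal h2
      _ ≤ _ := by
          rw [Real.enorm_eq_ofReal_abs]
          exact ENNReal.ofReal_le_ofReal (le_abs_self _)
  mart j s t hst A hA := by
    obtain ⟨A', hA', he⟩ := hA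
    obtain ⟨-, hi, hm⟩ := martingale_dynkin hg hP j
    have hind : ∀ r, Integrable (fun ω : ChainPath T => ind j (ω.val r)) P := fun r => by
      have hm : Measurable fun ω : ChainPath T => ω.val r :=
        (comap_measurable _).mono (le_iSup_of_le r le_rfl) le_rfl
      refine Integrable.of_bound ((Measurable.of_discrete (f := ind j)).comp hm).aestronglyMeasurable 1
        (Eventually.of_forall fun ω => ?_)
      unfold ind; split_ifs <;> simp
    have h1 := hm s t hst A' hA'
    have h2 : ∀ ω : ChainPath T, ∫ r in Set.Ioc s t, g (ω.left r) j = ind j (ω.val t) - ind j (ω.val s) -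
        (dynkin g (ind j) t ω - dynkin g (ind j) s ω) := fun ω => by
      rw [dynkin_sub hg j ω hst]; ring
    have h3 := setIntegral_completion_eq (f := fun ω : ChainPath T => ind j (ω.val t) - ind j (ω.val s))
      ((rawFiltration T).le _ _ hA') he
    have h4 := setIntegral_completion_eq (f := fun ω : ChainPath T => ∫ r in Set.Ioc s t, g (ω.left r) j)
      ((rawFiltration T).le _ _ hA') he
    refine h3.trans (Eq.trans ?_ h4.symm)
    simp only [h2]
    rw [integral_sub (f := fun ω : ChainPath T => ind j (ω.val t) - ind j (ω.val s))
      (g := fun ω : ChainPath T => dynkin g (ind j) t ω - dynkin g (ind j) s ω)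
      ((hind t).sub (hind s)).integrableOn ((hi t).sub (hi s)).integrableOn,
      integral_sub (hi t).integrableOn (hi s).integrableOn, h1, sub_self, sub_zero]
  gen A hA := by
    obtain ⟨B, hB, he⟩ := hA
    exact ⟨B, ⟨B, hB, rfl⟩, he⟩

end MFChain
end

/-! ### Composite coefficients; from sums over states to integrals -/

noncomputable section

namespace MFChain
variable {T : ℝ} [Fact (0 ≤ T)] {Ω : Type*} [mΩ : MeasurableSpace Ω]

section Generic

variable {α : Type*} [MeasurableSpace α] {F : ℝ → α → ℝ} {m : α → ℝ}

/-- A Carathéodory argument: measurability for each fixed `y` and continuity in `y` give joint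
measurability, after which a measurable `m` may be substituted. -/
theorem measurable_comp_of_differentiable (hF : ∀ y, Measurable (F y))
    (hd : ∀ a, Differentiable ℝ fun y => F y a) (hm : Measurable m) :
    Measurable fun a => F (m a) a :=
  (measurable_uncurry_of_continuous_of_measurable (u := F) (fun a => (hd a).continuous) hF).comp
    (hm.prodMk measurable_id)

/-- The derivative is the limit of difference quotients with increments `1/(n+1)`, each of which is
a measurable composite. -/
theorem measurable_deriv_comp_of_differentiable (hF : ∀ y, Measurable (F y))
    (hd : ∀ a, Differentiable ℝ fun y => F y a) (hm : Measurable m) :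
    Measurable fun a => deriv (fun y => F y a) (m a) := by
  refine measurable_of_tendsto_metrizable
    (f := fun (n : ℕ) a => ((n : ℝ) + 1) * (F (m a + ((n : ℝ) + 1)⁻¹) a - F (m a) a)) (fun n => ?_)
    (tendsto_pi_nhds.2 fun a => ?_)
  · exact ((measurable_comp_of_differentiable hF hd (hm.add_const _)).sub
      (measurable_comp_of_differentiable hF hd hm)).const_mul _
  · have h := hasDerivAt_iff_tendsto_slope_zero.1 (hd a (m a)).hasDerivAt
    have h2 : Tendsto (fun n : ℕ => ((n : ℝ) + 1)⁻¹) atTop (𝓝[≠] 0) := by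
      refine tendsto_nhdsWithin_iff.2 ⟨?_, Eventually.of_forall fun n => ?_⟩
      · simpa [one_div] using tendsto_one_div_add_atTop_nhds_zero_nat (𝕜 := ℝ)
      · have : (0 : ℝ) < (n : ℝ) + 1 := by positivity
        simp [this.ne']
    simpa [Function.comp_def] using h.comp h2

end Generic

section Rate

variable {g : ℕ → ℕ → ℝ} (hg : IsQMatrix g)
include hg

theorem gNormSq_eq (a : ℕ → ℕ → ℝ) (i : ℕ) :
    gNormSq g a i = ∫⁻ j, ‖a i j‖ₑ ^ 2 ∂rate g i := by
  rw [gNormSq, lintegral_rate]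
  refine tsum_congr fun j => ?_
  rw [rt]
  split_ifs with h
  · simp
  · rw [ENNReal.ofReal_mul (sq_nonneg _), mul_comm, ← sq_abs, ENNReal.ofReal_pow (abs_nonneg _),
      Real.enorm_eq_ofReal_abs]

theorem gInner_eq (a b : ℕ → ℕ → ℝ) (i : ℕ) :
    gInner g a b i = ∫ j, a i j * b i j ∂rate g i := (integral_rate hg i _).symm

theorem lintegral_enorm_rate (f : ℕ → ℝ) (i : ℕ) :
    ∑' j, (if j = i then 0 else ‖f j * g i j‖ₑ) = ∫⁻ j, ‖f j‖ₑ ∂rate g i := by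
  rw [lintegral_rate]
  refine tsum_congr fun j => ?_
  rw [rt]
  split_ifs with h
  · simp
  · rw [enorm_mul, mul_comm, Real.enorm_of_nonneg (hg.pos i j (Ne.symm h)).le]

/-- Only the row of `q` at the state `x(s⁻)` is seen by the integral, so `q` acts as a marked
process. Integrability against the compensator lets its integral be written as a time integral of
sums over the target states. -/
theorem stochInt_eq {q : ℕ → ℕ → Time T → ChainPath T → ℝ} {x : ChainPath T}
    (hq : Integrable (fun z : Time T × ℕ => q (x.left z.1) z.2 z.1 x) (cm g x)) (t : Time T) :
    stochInt g q t x = sI g x (fun z => q (x.left z.1) z.2 z.1 x) t := by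
  classical
  have h1 : Set.Ioc ⊥ t =ᵐ[volume] Set.Iic t := by
    have : Set.Ioc (⊥ : Time T) t =ᵐ[volume] Set.Icc ⊥ t := Ioc_ae_eq_Icc
    rwa [Set.Icc_bot] at this
  rw [stochInt, sI, setIntegral_jm x _ measurableSet_Iic, (integral_cm x hq).2.2 _ measurableSet_Iic,
    setIntegral_congr_set h1]
  simp only [integral_rate hg]
  congr 1
  have e : ∀ s : Time T, s ∈ (jumps x).filter (· ∈ Set.Iic t) ↔ s ≤ t ∧ s ∈ jumpTimes x := fun s => by
    rw [Finset.mem_filter, mem_jumps, and_comm]; rfl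
  rw [← finsum_mem_coe_finset]
  refine finsum_congr fun s => finsum_congr_Prop ?_ fun _ => rfl
  rw [Finset.mem_coe, e]

end Rate

theorem Ioc_finalTime (t : Time T) : Set.Ioc t (ControlModel.finalTime T) = Set.Ioi t := Set.Ioc_top

/-- Selecting one of countably many predictable processes by the predictable index `x(s⁻)` gives a
predictable process. -/
theorem Pred.of_family {g : ℕ → ℕ → ℝ} {Pm : Measure Ω} {𝔽 : Filtration (Time T) mΩ}
    {X : Ω → ChainPath T} (S : ChainSetup g Pm 𝔽 X) {E : Type*} [MeasurableSpace E]
    {q : ℕ → ℕ → Time T → Ω → E}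
    (hq : ∀ i j, Measurable[𝔽.predictable] fun z : Time T × Ω => q i j z.1 z.2) :
    Pred 𝔽 fun s ω j => q ((X ω).left s) j s ω := by
  intro j
  have h1 : Measurable[(⊤ : MeasurableSpace ℕ).prod 𝔽.predictable]
      fun p : ℕ × (Time T × Ω) => q p.1 j p.2.1 p.2.2 :=
    measurable_from_prod_countable_right (mβ := 𝔽.predictable) fun i => hq i j
  have h2 : @Measurable _ _ 𝔽.predictable ((⊤ : MeasurableSpace ℕ).prod 𝔽.predictable)
      fun z : Time T × Ω => ((X z.2).left z.1, z) :=
    @Measurable.prodMk _ 𝔽.predictable _ _ ⊤ 𝔽.predictable _ _ S.measurable_left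
      (@measurable_id _ 𝔽.predictable)
  exact h1.comp h2

theorem Prog.of_progressive {𝔽 : Filtration (Time T) mΩ} {a : Time T → Ω → ℝ}
    (ha : IsStronglyProgressive 𝔽 a) : Prog 𝔽 a := by
  intro t
  have h := (ha t).measurable
  have h1 : Measurable[(inferInstance : MeasurableSpace (Time T)).prod (𝔽 t)]
      fun z : Time T × Ω => (⟨min z.1 t, Set.mem_Iic.2 (min_le_right _ _)⟩ : Set.Iic t) :=
    ((measurable_id.min measurable_const).comp (@measurable_fst _ _ _ (𝔽 t))).subtype_mk
  have h2 : @Measurable _ _ ((inferInstance : MeasurableSpace (Time T)).prod (𝔽 t))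
      ((inferInstance : MeasurableSpace (Set.Iic t)).prod (𝔽 t)) fun z : Time T × Ω =>
        ((⟨min z.1 t, Set.mem_Iic.2 (min_le_right _ _)⟩ : Set.Iic t), z.2) :=
    @Measurable.prodMk _ ((inferInstance : MeasurableSpace (Time T)).prod (𝔽 t)) _ _ _ (𝔽 t) _ _ h1
      (@measurable_snd _ _ _ (𝔽 t))
  exact h.comp h2

end MFChain
end

/-! ### The coefficients of the control problem -/

noncomputable section

namespace MFChain
variable {T : ℝ} [Fact (0 ≤ T)] {Ω : Type*} [mΩ : MeasurableSpace Ω]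

theorem Cadlag.mul {f h : Time T → ℝ} (hf : Cadlag f) (hh : Cadlag h) : Cadlag fun t => f t * h t := by
  intro t
  obtain ⟨h1, a, h2⟩ := hf t
  obtain ⟨h3, b, h4⟩ := hh t
  exact ⟨h1.mul h3, a * b, h2.mul h4⟩

theorem ChainPath.cadlag_comp (x : ChainPath T) (k : ℕ → ℝ) : Cadlag fun t => k (x.val t) := by
  intro t
  have hk : Continuous k := continuous_of_discreteTopology
  obtain ⟨i, hi⟩ := x.left_lim t
  exact ⟨hk.continuousAt.comp_continuousWithinAt (x.right_cts t), k i, (hk.tendsto i).comp hi⟩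

theorem enorm_le_of_abs_le {a C : ℝ} (h : |a| ≤ C) : ‖a‖ₑ ≤ (C.toNNReal : ℝ≥0∞) := by
  rw [Real.enorm_eq_ofReal_abs]
  exact ENNReal.ofReal_le_ofReal h

namespace ControlModel

variable {d : ℕ}

/-- The coefficients of the adjoint equation, on the completed path space. -/
def coeffs (D : ControlModel T d) (P : Measure (ChainPath T)) (u : Time T → ChainPath T → Ctrl d)
    (L : Time T → ChainPath T → ℝ) : Coeffs T (CPath P) where
  ℓ s ω j := D.ellBar P u L ((cX P ω).left s) j s (cX P ω)
  ℓy s ω j := D.ellYBar P u L ((cX P ω).left s) j s (cX P ω)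
  L s ω := L s (cX P ω)
  κ := D.κ

/-- The marked process `(s, j) ↦ q_{x(s⁻) j}(s)`. -/
def mark (P : Measure (ChainPath T)) (q : ℕ → ℕ → Time T → ChainPath T → ℝ) (s : Time T) (ω : CPath P)
    (j : ℕ) : ℝ := q ((cX P ω).left s) j s (cX P ω)

/-- The part of the driver of the adjoint equation which does not depend on `q`. -/
def offset (D : ControlModel T d) (P : Measure (ChainPath T)) (u : Time T → ChainPath T → Ctrl d)
    (L : Time T → ChainPath T → ℝ) (s : Time T) (ω : CPath P) : ℝ :=
  -D.fBar P u L s (cX P ω) -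
    D.κf ((cX P ω).left s) * ∫ η, L s η * D.fYBar P u L s η ∂P

variable {D : ControlModel T d} {ξ : Measure ℕ} {P : Measure (ChainPath T)} [IsProbabilityMeasure P]
  {u : Time T → ChainPath T → Ctrl d} {L : Time T → ChainPath T → ℝ}

namespace IsAdmissiblePair

variable (hadm : D.IsAdmissiblePair P u L)
include hadm

theorem measurable_L (t : Time T) : Measurable[cF P t] fun ω : CPath P => L t (cX P ω) :=
  (hadm.L_adapted t).measurable

theorem cadlag_L (ω : CPath P) : Cadlag fun t => L t (cX P ω) := hadm.L_cadlag (cX P ω)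

theorem measurable_L_joint : Measurable fun z : Time T × CPath P => L z.1 (cX P z.2) :=
  measurable_cadlag (L := fun t ω => L t (cX P ω)) hadm.measurable_L hadm.cadlag_L

/-- The integrand is càdlàg and adapted, hence jointly measurable, and Fubini applies on the
completed space. No continuity of the mean in time is needed. -/
theorem measurable_mean (hg : IsQMatrix D.g) (hP : IsMarkovChain D.g ξ P) (k : ℕ → ℝ) :
    Measurable (mean P L k) := by
  have S := chainSetup hg hP
  have h1 : Measurable fun z : Time T × CPath P => L z.1 (cX P z.2) * k ((cX P z.2).val z.1) :=
    measurable_cadlag (L := fun t ω => L t (cX P ω) * k ((cX P ω).val t)) (𝔽 := cF P)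
      (fun t => Measurable.mul (hadm.measurable_L t)
        ((Measurable.of_discrete (f := k)).comp (S.adapted t)))
      fun ω => (hadm.cadlag_L ω).mul ((cX P ω).cadlag_comp k)
  have h2 := (h1.stronglyMeasurable.integral_prod_right' (ν := P.completion)).measurable
  convert h2 using 2 with t
  exact (integral_completion fun ω : ChainPath T => L t ω * k (ω.val t)).symm

variable (hg : IsQMatrix D.g) (hP : IsMarkovChain D.g ξ P) (hA1 : D.A1)
include hg hP hA1

/-- The mean is a deterministic measurable function of time, hence predictable. Admissibility gives
predictability for each fixed `ȳ`; differentiability in `ȳ` allows the substitution. -/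
theorem measurable_ellBar (i j : ℕ) : Measurable[(cF P).predictable]
    fun z : Time T × CPath P => D.ellBar P u L i j z.1 (cX P z.2) := by
  by_cases hij : i = j
  · simp only [ellBar, ell, if_pos hij]
    exact @measurable_const _ _ _ (cF P).predictable _
  have hm := (hadm.measurable_mean hg hP D.κ).comp (measurable_fst_predictable (𝔽 := cF P))
  let _ : MeasurableSpace (Time T × CPath P) := (cF P).predictable
  refine measurable_comp_of_differentiable
    (F := fun y (z : Time T × CPath P) => D.ell i j z.1 (cX P z.2) y (u z.1 (cX P z.2)))
    (fun y => ?_) (fun z => hA1.diff i j _ _ _ (hadm.u_mem _ _)) hm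
  simp only [ell, if_neg hij]
  exact ((hadm.lam_pred i j hij y).measurable.div_const _).sub_const _

theorem measurable_ellYBar (i j : ℕ) : Measurable[(cF P).predictable]
    fun z : Time T × CPath P => D.ellYBar P u L i j z.1 (cX P z.2) := by
  by_cases hij : i = j
  · simp only [ellYBar, ellY, ell, if_pos hij, deriv_const]
    exact @measurable_const _ _ _ (cF P).predictable _
  have hm := (hadm.measurable_mean hg hP D.κ).comp (measurable_fst_predictable (𝔽 := cF P))
  let _ : MeasurableSpace (Time T × CPath P) := (cF P).predictable
  refine measurable_deriv_comp_of_differentiable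
    (F := fun y (z : Time T × CPath P) => D.ell i j z.1 (cX P z.2) y (u z.1 (cX P z.2)))
    (fun y => ?_) (fun z => hA1.diff i j _ _ _ (hadm.u_mem _ _)) hm
  simp only [ell, if_neg hij]
  exact ((hadm.lam_pred i j hij y).measurable.div_const _).sub_const _

/-- The bounds on `ℓ` and `ℓ_ȳ` come from `A1`. The `L²` bound on `L` is not assumed: it follows
from the density equation, rewritten with `sI`. -/
theorem exists_bounded (hκ : ∃ C : ℝ, ∀ k, |D.κ k| ≤ C) :
    ∃ c : NNReal, (D.coeffs P u L).Bounded D.g P.completion (cF P) (cX P) c := by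
  have S := chainSetup hg hP
  obtain ⟨C1, h1⟩ := hA1.bdd_ell
  obtain ⟨C2, h2⟩ := hA1.bdd_ellY
  obtain ⟨C3, h3⟩ := hκ
  have hp1 : Pred (cF P) (D.coeffs P u L).ℓ := Pred.of_family S
    (q := fun i j s ω => D.ellBar P u L i j s (cX P ω)) (hadm.measurable_ellBar hg hP hA1)
  have hp2 : Pred (cF P) (D.coeffs P u L).ℓy := Pred.of_family S
    (q := fun i j s ω => D.ellYBar P u L i j s (cX P ω)) (hadm.measurable_ellYBar hg hP hA1)
  have h1' : ∀ s ω, ∫⁻ j, ‖(D.coeffs P u L).ℓ s ω j‖ₑ ^ 2 ∂rate D.g ((cX P ω).left s) ≤ C1.toNNReal :=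
    fun s ω => (gNormSq_eq hg (fun i j => D.ellBar P u L i j s (cX P ω)) _).symm.trans_le
      (h1 s (cX P ω) _ _ (hadm.u_mem s (cX P ω)))
  have h2' : ∀ s ω, ∫⁻ j, ‖(D.coeffs P u L).ℓy s ω j‖ₑ ^ 2 ∂rate D.g ((cX P ω).left s) ≤ C2.toNNReal :=
    fun s ω => (gNormSq_eq hg (fun i j => D.ellYBar P u L i j s (cX P ω)) _).symm.trans_le
      (h2 s (cX P ω) _ _ (hadm.u_mem s (cX P ω)))
  have heq : ∀ᵐ ω ∂P.completion, ∀ t, L t (cX P ω) = 1 + sI D.g (cX P ω) (fun z =>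
      Function.leftLim (fun r => L r (cX P ω)) z.1 * (D.coeffs P u L).ℓ z.1 ω z.2) t := by
    have h : ∀ᵐ ω ∂P.completion, ∀ t, L t (cX P ω) = 1 + stochInt D.g
      (fun i j s x => Function.leftLim (fun r => L r x) s * D.ellBar P u L i j s x) t (cX P ω) :=
        hadm.L_eq
    filter_upwards [h] with ω hω t
    rw [hω t, stochInt_eq hg]
    · rfl
    -- On a fixed path `L(s⁻)` is bounded, and `ℓ` is square integrable against the finite
    -- compensator, so their product is integrable and `stochInt_eq` applies.
    have := S.finite_cm ω
    obtain ⟨K, hK⟩ := (hadm.cadlag_L ω).bounded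
    have hl : ∀ s, |Function.leftLim (fun r => L r (cX P ω)) s| ≤ K := fun s =>
      le_of_tendsto ((hadm.cadlag_L ω).tendsto_gridL s).abs (Eventually.of_forall fun n => hK _)
    have hm1 := S.measurable_mark hp1 ω
    have hm2 : Measurable fun z : Time T × ℕ => Function.leftLim (fun r => L r (cX P ω)) z.1 :=
      (measurable_section_left ((measurable_leftLim (L := fun t ω => L t (cX P ω)) (𝔽 := cF P)
        hadm.measurable_L hadm.cadlag_L).mono predictable_le le_rfl) ω).comp measurable_fst
    have hi : Integrable (fun z : Time T × ℕ => (D.coeffs P u L).ℓ z.1 ω z.2) (cm D.g (cX P ω)) := by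
      have : MemLp (fun z : Time T × ℕ => (D.coeffs P u L).ℓ z.1 ω z.2) 2 (cm D.g (cX P ω)) := by
        refine ⟨hm1.aestronglyMeasurable, ?_⟩
        rw [eLpNorm_two_eq, lintegral_cm _ _ (hm1.enorm.pow_const 2)]
        refine ENNReal.rpow_lt_top_of_nonneg (by norm_num) (ne_top_of_le_ne_top ?_
          (lintegral_mono fun s => h1' s ω))
        rw [lintegral_const]
        exact ENNReal.mul_ne_top (by simp) (measure_ne_top _ _)
      exact this.integrable (by norm_num)
    exact hi.bdd_mul hm2.aestronglyMeasurable (Eventually.of_forall fun z => hl z.1)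
  obtain ⟨C4, h4⟩ := S.lintegral_density_sq_le (L := fun t ω => L t (cX P ω)) hadm.measurable_L
    hadm.cadlag_L hp1 h1' heq
  refine ⟨C1.toNNReal + C2.toNNReal + C3.toNNReal + C4, hp1, hp2, fun s ω => (h1' s ω).trans ?_,
    fun s ω => (h2' s ω).trans ?_, hadm.measurable_L_joint, fun s => (h4 s).trans ?_,
    fun k => (enorm_le_of_abs_le (h3 k)).trans ?_⟩
  all_goals
    rw [ENNReal.coe_le_coe]
    rw [← NNReal.coe_le_coe]
    push_cast
    linarith [NNReal.coe_nonneg C1.toNNReal, NNReal.coe_nonneg C2.toNNReal,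
      NNReal.coe_nonneg C3.toNNReal, NNReal.coe_nonneg C4]

end IsAdmissiblePair

end ControlModel
end MFChain
end

/-! ### The inhomogeneity and the terminal value -/

noncomputable section

namespace MFChain
variable {T : ℝ} [Fact (0 ≤ T)] {Ω : Type*} [mΩ : MeasurableSpace Ω]

namespace ControlModel

variable {d : ℕ} {D : ControlModel T d} {ξ : Measure ℕ} {P : Measure (ChainPath T)}
  [IsProbabilityMeasure P] {u : Time T → ChainPath T → Ctrl d} {L : Time T → ChainPath T → ℝ}

namespace IsAdmissiblePair

variable (hadm : D.IsAdmissiblePair P u L) (hg : IsQMatrix D.g) (hP : IsMarkovChain D.g ξ P)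
  (hA2 : D.A2)
include hadm hg hP

/-- From `|L| ≤ 1 + L²`, the mean of `|L|` is at most `1 + c`. No measurability of `f` is needed,
since only upper bounds for integrals are used. -/
theorem integral_density_mul_le {c : NNReal} (B : (D.coeffs P u L).Bounded D.g P.completion (cF P) (cX P) c)
    {f : ChainPath T → ℝ} {C : ℝ} (hf : ∀ ω, |f ω| ≤ C) (t : Time T) :
    |∫ η, L t η * f η ∂P| ≤ (1 + c) * C := by
  have hC : 0 ≤ C := (abs_nonneg _).trans (hf (Classical.choice (P.nonempty_of_neZero)))
  have hm : Measurable fun ω : CPath P => L t (cX P ω) :=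
    (hadm.measurable_L t).mono ((cF P).le t) le_rfl
  have h1 : ∫⁻ ω, ‖L t (cX P ω)‖ₑ ∂P.completion ≤ (1 + c : NNReal) := by
    calc _ ≤ ∫⁻ ω, (1 + ‖L t (cX P ω)‖ₑ ^ 2) ∂P.completion := by
          refine lintegral_mono fun ω => ?_
          rcases le_total ‖L t (cX P ω)‖ₑ 1 with h | h
          · exact h.trans le_self_add
          · refine le_trans ?_ le_add_self
            calc _ = ‖L t (cX P ω)‖ₑ * 1 := (mul_one _).symm
              _ ≤ ‖L t (cX P ω)‖ₑ * ‖L t (cX P ω)‖ₑ := mul_le_mul' le_rfl h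
              _ = _ := (sq _).symm
      _ ≤ _ := by
          rw [lintegral_add_left measurable_const, lintegral_const, measure_univ, mul_one]
          push_cast
          exact add_le_add le_rfl (B.L_le t)
  rw [← integral_completion (μ := P) fun η => L t η * f η]
  have h2 : ‖∫ ω, L t (ofNull P ω) * f (ofNull P ω) ∂P.completion‖ₑ ≤
      ENNReal.ofReal ((1 + c) * C) := by
    refine (enorm_integral_le_lintegral_enorm _).trans ?_
    calc _ ≤ ∫⁻ ω, ‖L t (cX P ω)‖ₑ * (C.toNNReal : ℝ≥0∞) ∂P.completion := by
          refine lintegral_mono fun ω => ?_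
          rw [enorm_mul]
          exact mul_le_mul' le_rfl (enorm_le_of_abs_le (hf _))
      _ ≤ (1 + c : NNReal) * C.toNNReal := by
          rw [lintegral_mul_const' _ _ ENNReal.coe_ne_top]
          exact mul_le_mul' h1 le_rfl
      _ = _ := by
          rw [ENNReal.ofReal_mul (by positivity)]
          congr 1
          rw [← ENNReal.ofReal_coe_nnreal]
          simp
  rw [Real.enorm_eq_ofReal_abs] at h2
  exact (ENNReal.ofReal_le_ofReal_iff (by positivity)).1 h2

include hA2

theorem measurable_min_fBar (y : ℝ) (t : Time T) :
    Measurable[(inferInstance : MeasurableSpace (Time T)).prod (cF P t)]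
      fun z : Time T × CPath P => D.f (min z.1 t) (cX P z.2) y (u (min z.1 t) (cX P z.2)) :=
  Prog.of_progressive (𝔽 := cF P) (a := fun s ω => D.f s (cX P ω) y (u s (cX P ω))) (hadm.f_prog y) t

theorem measurable_min_mean (t : Time T) :
    Measurable[(inferInstance : MeasurableSpace (Time T)).prod (cF P t)]
      fun z : Time T × CPath P => mean P L D.κf (min z.1 t) :=
  ((hadm.measurable_mean hg hP D.κf).comp (measurable_id.min measurable_const)).comp
    (@measurable_fst _ _ _ (cF P t))

theorem prog_fBar : Prog (cF P) fun s ω => D.fBar P u L s (cX P ω) := by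
  intro t
  have hm := hadm.measurable_min_mean hg hP hA2 t
  have hf := fun y => hadm.measurable_min_fBar hg hP hA2 y t
  let _ : MeasurableSpace (Time T × CPath P) := (inferInstance : MeasurableSpace (Time T)).prod (cF P t)
  exact measurable_comp_of_differentiable
    (F := fun y (z : Time T × CPath P) => D.f (min z.1 t) (cX P z.2) y (u (min z.1 t) (cX P z.2)))
    hf (fun z => hA2.diff_f _ _ _ (hadm.u_mem _ _)) hm

theorem prog_fYBar : Prog (cF P) fun s ω => D.fYBar P u L s (cX P ω) := by
  intro t
  have hm := hadm.measurable_min_mean hg hP hA2 t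
  have hf := fun y => hadm.measurable_min_fBar hg hP hA2 y t
  let _ : MeasurableSpace (Time T × CPath P) := (inferInstance : MeasurableSpace (Time T)).prod (cF P t)
  exact measurable_deriv_comp_of_differentiable
    (F := fun y (z : Time T × CPath P) => D.f (min z.1 t) (cX P z.2) y (u (min z.1 t) (cX P z.2)))
    hf (fun z => hA2.diff_f _ _ _ (hadm.u_mem _ _)) hm

theorem prog_offset : Prog (cF P) (D.offset P u L) := by
  have S := chainSetup hg hP
  have h1 : Measurable fun t => ∫ η, L t η * D.fYBar P u L t η ∂P := by
    have h2 := ((hadm.measurable_L_joint.mul (hadm.prog_fYBar hg hP hA2).measurable).stronglyMeasurable.integral_prod_right'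
      (ν := P.completion)).measurable
    convert h2 using 2 with t
    exact (integral_completion fun η : ChainPath T => L t η * D.fYBar P u L t η).symm
  have h2 : Prog (cF P) fun s ω => D.κf ((cX P ω).left s) * ∫ η, L s η * D.fYBar P u L s η ∂P :=
    Prog.of_predictable (Measurable.mul ((Measurable.of_discrete (f := D.κf)).comp S.measurable_left)
      (h1.comp measurable_fst_predictable))
  intro t
  exact Measurable.sub (Measurable.neg (hadm.prog_fBar hg hP hA2 t)) (h2 t)

theorem exists_offset_le {c : NNReal}
    (B : (D.coeffs P u L).Bounded D.g P.completion (cF P) (cX P) c) :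
    ∃ M : NNReal, ∀ s ω, ‖D.offset P u L s ω‖ₑ ≤ M := by
  obtain ⟨C1, h1⟩ := hA2.bdd_f
  obtain ⟨C2, h2⟩ := hA2.bdd_fY
  obtain ⟨C3, h3⟩ := hA2.bdd_κf
  refine ⟨(C1 + C3 * ((1 + c) * C2)).toNNReal, fun s ω => enorm_le_of_abs_le ?_⟩
  refine (abs_sub _ _).trans (add_le_add ?_ ?_)
  · rw [abs_neg]; exact h1 _ _ _ _ (hadm.u_mem _ _)
  · rw [abs_mul]
    have h4 := hadm.integral_density_mul_le hg hP B
      (f := fun η => D.fYBar P u L s η) (fun η => h2 _ _ _ _ (hadm.u_mem _ _)) s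
    exact mul_le_mul (h3 _) h4 (abs_nonneg _) ((abs_nonneg _).trans (h3 0))

theorem memLp_terminal {c : NNReal}
    (B : (D.coeffs P u L).Bounded D.g P.completion (cF P) (cX P) c) :
    MemLp (fun ω => D.terminal P L (cX P ω)) 2 P.completion := by
  have S := chainSetup hg hP
  obtain ⟨C1, h1⟩ := hA2.bdd_h
  obtain ⟨C2, h2⟩ := hA2.bdd_hY
  obtain ⟨C3, h3⟩ := hA2.bdd_κh
  set K := ∫ η, L (finalTime T) η *
        D.hY (η.val (finalTime T)) (mean P L D.κh (finalTime T)) ∂P with hK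
  have h4 : |K| ≤ (1 + c) * C2 := hadm.integral_density_mul_le hg hP B
      (f := fun η => D.hY (η.val (finalTime T)) (mean P L D.κh (finalTime T))) (fun η => h2 _ _) _
  have hm : Measurable fun ω : CPath P => D.terminal P L (cX P ω) :=
    (Measurable.of_discrete (f := fun k : ℕ => -D.h k (mean P L D.κh (finalTime T)) -
      D.κh k * K)).comp (S.measurable_val (finalTime T))
  refine MemLp.of_bound hm.aestronglyMeasurable (C1 + C3 * ((1 + c) * C2))
    (Eventually.of_forall fun ω => ?_)
  refine (abs_sub _ _).trans (add_le_add ?_ ?_)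
  · rw [abs_neg]; exact h1 _ _
  · rw [abs_mul]
    exact mul_le_mul (h3 _) h4 (abs_nonneg _) ((abs_nonneg _).trans (h3 0))

end IsAdmissiblePair

theorem mf_mark (hg : IsQMatrix D.g) (q : ℕ → ℕ → Time T → ChainPath T → ℝ) (s : Time T) :
    (D.coeffs P u L).mf D.g P.completion (cX P) (mark P q) s = ∫ η, L s η *
        gInner D.g (fun i j => D.ellYBar P u L i j s η) (fun i j => q i j s η) (η.left s) ∂P := by
  simp only [gInner_eq hg]
  exact integral_completion fun η : ChainPath T => L s η *
    ∫ j, D.ellYBar P u L (η.left s) j s η * q (η.left s) j s η ∂rate D.g (η.left s)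

/-- The two sides differ only in whether `κ` and `κ_f` are evaluated at `x(s)` or at `x(s⁻)`, which
agree outside the jump times. -/
theorem driver_eq (hg : IsQMatrix D.g) (q : ℕ → ℕ → Time T → ChainPath T → ℝ) {s : Time T}
    {ω : CPath P} (hs : (cX P ω).left s = (cX P ω).val s) : D.driver P u L q s (cX P ω) =
      (D.coeffs P u L).drv D.g P.completion (cX P) (mark P q) s ω + D.offset P u L s ω := by
  rw [driver, Coeffs.drv, mf_mark hg, offset, gInner_eq hg, ← hs]
  change _ = _ + D.κ ((cX P ω).left s) * _ + _
  simp only [coeffs, mark]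
  ring

theorem driver_ae_eq (hg : IsQMatrix D.g) (q : ℕ → ℕ → Time T → ChainPath T → ℝ) (ω : CPath P) :
    ∀ᵐ s, D.driver P u L q s (cX P ω) =
      (D.coeffs P u L).drv D.g P.completion (cX P) (mark P q) s ω + D.offset P u L s ω :=
  (cX P ω).ae_left_eq.mono fun _ hs => driver_eq hg q hs

end ControlModel
end MFChain
end

/-! ### The adjoint equation on the path space -/

noncomputable section

namespace MFChain
variable {T : ℝ} [Fact (0 ≤ T)] {Ω : Type*} [mΩ : MeasurableSpace Ω]

theorem ChainPath.measurable_left_prod :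
    Measurable fun z : Time T × ChainPath T => z.2.left z.1 := by
  refine measurable_of_tendsto_metrizable (f := fun n z => z.2.val (gridL n z.1)) (fun n => ?_)
    (tendsto_pi_nhds.2 fun z => tendsto_const_nhds.congr'
      ((z.2.tendsto_val_gridL z.1).mono fun _ h => h.symm))
  refine (measurable_gridL_predictable (𝔽 := rawFiltration T) (Z := fun t ω => ω.val t)
    (fun t => ?_) n).mono predictable_le le_rfl
  exact (comap_measurable fun ω : ChainPath T => ω.val t).mono (le_iSup₂_of_le t le_rfl le_rfl) le_rfl

/-- The product of a σ-field with a completed one lies inside the completion of the product. This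
bridges predictable processes, measurable for the completed path space, and statements about the
uncompleted product measure. -/
theorem nullMeasurableSet_of_completion {α β : Type*} [MeasurableSpace α] [MeasurableSpace β]
    {μ : Measure α} {ν : Measure β} [SFinite ν] {N : Set (α × NullMeasurableSpace β ν)}
    (hN : MeasurableSet N) :
    NullMeasurableSet (α := α × β) {z | (z.1, (z.2 : NullMeasurableSpace β ν)) ∈ N} (μ.prod ν) := by
  have h1 : Measurable fun z : NullMeasurableSpace (α × β) (μ.prod ν) => (ofNull _ z).1 :=
    fun s hs => (measurable_fst hs).nullMeasurableSet
  let π : NullMeasurableSpace (α × β) (μ.prod ν) → NullMeasurableSpace β ν := fun z => (ofNull _ z).2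
  have h2 : Measurable π := fun s hs => by
    have h : NullMeasurableSet (α := β) s ν := hs
    exact h.preimage Measure.quasiMeasurePreserving_snd
  exact (Measurable.prodMk h1 h2) hN

/-- A property depending measurably on a completed space, which holds almost everywhere on almost
all sections, holds almost everywhere on the product. -/
theorem ae_prod_of_completion {α β : Type*} [MeasurableSpace α] [MeasurableSpace β]
    {μ : Measure α} {ν : Measure β} [SFinite ν] {p : α → β → Prop}
    (hp : MeasurableSet {z : α × NullMeasurableSpace β ν | ¬ p z.1 (ofNull ν z.2)})
    (h : ∀ᵐ a ∂μ, ∀ᵐ b ∂ν, p a b) : ∀ᵐ z ∂μ.prod ν, p z.1 z.2 := by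
  -- The exceptional set contains a measurable set for the uncompleted product with the same
  -- measure. Its sections are almost all null, so Tonelli's theorem applies.
  obtain ⟨N, hsub, hm, he⟩ :=
    (nullMeasurableSet_of_completion (μ := μ) hp).exists_measurable_subset_ae_eq
  have h0 : μ.prod ν N = 0 := by
    rw [Measure.measure_prod_null hm]
    filter_upwards [h] with a ha
    exact measure_mono_null (fun b hb => hsub hb) ha
  have h1 := measure_congr he
  rw [h0] at h1
  exact h1.symm

namespace ControlModel

variable {d : ℕ} {D : ControlModel T d} {ξ : Measure ℕ} {P : Measure (ChainPath T)}
  [IsProbabilityMeasure P] {u : Time T → ChainPath T → Ctrl d} {L : Time T → ChainPath T → ℝ}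

theorem pred_mark (hg : IsQMatrix D.g) (hP : IsMarkovChain D.g ξ P)
    {q : ℕ → ℕ → Time T → ChainPath T → ℝ}
    (hq : ∀ i j, IsStronglyPredictable (completedFiltration P) (q i j)) : Pred (cF P) (mark P q) :=
  Pred.of_family (chainSetup hg hP) (q := fun i j s ω => q i j s (cX P ω)) fun i j => (hq i j).measurable

theorem lintegral_gNormSq (hg : IsQMatrix D.g) (hP : IsMarkovChain D.g ξ P)
    {q : ℕ → ℕ → Time T → ChainPath T → ℝ} (hq : Pred (cF P) (mark P q)) (ω : CPath P) :
    ∫⁻ s, gNormSq D.g (fun i j => q i j s (cX P ω)) ((cX P ω).left s) =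
      ∫⁻ z, ‖mark P q z.1 ω z.2‖ₑ ^ 2 ∂cm D.g (cX P ω) := by
  rw [lintegral_cm _ _ (((chainSetup hg hP).measurable_mark hq ω).enorm.pow_const 2)]
  simp only [gNormSq_eq hg]
  rfl

theorem lintegral_comp (hg : IsQMatrix D.g) (hP : IsMarkovChain D.g ξ P)
    {q : ℕ → ℕ → Time T → ChainPath T → ℝ} (hq : Pred (cF P) (mark P q)) (ω : CPath P) :
    ∫⁻ s : Time T, ∑' j, (if j = (cX P ω).left s then 0 else
      ‖q ((cX P ω).left s) j s (cX P ω) * D.g ((cX P ω).left s) j‖ₑ) =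
      ∫⁻ z, ‖mark P q z.1 ω z.2‖ₑ ∂cm D.g (cX P ω) := by
  rw [lintegral_cm _ _ ((chainSetup hg hP).measurable_mark hq ω).enorm]
  simp only [lintegral_enorm_rate hg]
  rfl

theorem ae_equation_rhs_eq (hg : IsQMatrix D.g) (hP : IsMarkovChain D.g ξ P)
    {q : ℕ → ℕ → Time T → ChainPath T → ℝ} (hq : Pred (cF P) (mark P q))
    (hn : nsq D.g P.completion (cX P) (mark P q) ≠ ∞) : ∀ᵐ ω ∂P.completion, ∀ t,
      D.terminal P L (cX P ω) + (∫ s in Set.Ioc t (finalTime T), D.driver P u L q s (cX P ω))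
        - (stochInt D.g q (finalTime T) (cX P ω) - stochInt D.g q t (cX P ω)) =
      D.terminal P L (cX P ω) + (∫ s in Set.Ioi t,
        ((D.coeffs P u L).drv D.g P.completion (cX P) (mark P q) s ω + D.offset P u L s ω)) -
      (sT D.g (cX P ω) (fun z => mark P q z.1 ω z.2) -
        sI D.g (cX P ω) (fun z => mark P q z.1 ω z.2) t) := by
  filter_upwards [(chainSetup hg hP).ae_integrable_cm hq hn] with ω h2 t
  rw [stochInt_eq hg h2, stochInt_eq hg h2, Ioc_finalTime,
    integral_congr_ae (ae_restrict_of_ae (driver_ae_eq hg q ω)), ← sI_top]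
  rfl

namespace IsAdmissiblePair

variable (hadm : D.IsAdmissiblePair P u L) (hg : IsQMatrix D.g) (hP : IsMarkovChain D.g ξ P)
  (hA1 : D.A1) (hA2 : D.A2) (hκ : ∃ C : ℝ, ∀ k, |D.κ k| ≤ C)
include hadm hg hP hA1 hA2 hκ

theorem exists_isAdjointSolution : ∃ (p : Time T → ChainPath T → ℝ)
    (q : ℕ → ℕ → Time T → ChainPath T → ℝ), D.IsAdjointSolution P u L p q := by
  have S := chainSetup hg hP
  obtain ⟨c, B⟩ := hadm.exists_bounded hg hP hA1 hκ
  obtain ⟨M, hM⟩ := hadm.exists_offset_le hg hP hA2 B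
  obtain ⟨q, p, hq, hn, hp, hc, hs, hi, he⟩ := S.exists_backward B
    (hadm.memLp_terminal hg hP hA2 B) (hadm.prog_offset hg hP hA2) hM
  -- The equation uses only the row `x(s⁻)`, so the same marked process may serve as every row.
  set q' : ℕ → ℕ → Time T → ChainPath T → ℝ := fun _ j s x => q s x j with hq'
  have hmark : mark P q' = q := rfl
  refine ⟨fun t x => p t x, q', ?_, fun x => hc x, fun i j => ?_, ?_, ?_, ?_, ?_, ?_⟩
  · exact fun t => (hp t).stronglyMeasurable
  · exact (hq j).stronglyMeasurable
  · have hN : Measurable fun ω : CPath P =>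
        ∫⁻ s, gNormSq D.g (fun i j => q' i j s (cX P ω)) ((cX P ω).left s) := by
      simp only [lintegral_gNormSq hg hP (q := q') hq]
      exact S.measurable_lintegral_cm (f := fun s ω j => ‖q s ω j‖ₑ ^ 2) hq.enorm_sq
    -- The supremum over all times comes without measurability, so the passage from the completed
    -- space uses the inequality for images of measures, valid for arbitrary functions.
    have h1 := lintegral_map_le (μ := P.completion) (fun ω : ChainPath T => (⨆ t, ‖p t ω‖ₑ) +
      ∫⁻ s, gNormSq D.g (fun i j => q' i j s ω) (ω.left s)) (ofNull P)
    rw [measurePreserving_completion.map_eq] at h1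
    refine h1.trans_lt ?_
    have h2 : ∫⁻ ω : CPath P, ((⨆ t, ‖p t ω‖ₑ) +
        ∫⁻ s, gNormSq D.g (fun i j => q' i j s (cX P ω)) ((cX P ω).left s)) ∂P.completion < ∞ := by
      rw [lintegral_add_right _ hN]
      refine ENNReal.add_lt_top.2 ⟨hs, ?_⟩
      simp only [lintegral_gNormSq hg hP (q := q') hq]
      exact hn.lt_top
    exact h2
  · filter_upwards [S.msq_lt_top hq hn] with s hs
    have h1 := S.integrable_mf B hq hs
    have h2 := (integrable_completion_iff (μ := P)
      (f := fun η : ChainPath T => L s η * ∫ j, D.ellYBar P u L (η.left s) j s η *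
        q' (η.left s) j s η ∂rate D.g (η.left s))).1 h1
    simp only [gInner_eq hg]
    exact h2
  · have h : ∀ᵐ ω ∂P.completion, Integrable fun t => D.driver P u L q' t (cX P ω) := by
      filter_upwards [hi] with ω hω
      exact hω.congr ((driver_ae_eq hg q' ω).mono fun s hs => hs.symm)
    exact h
  · have h : ∀ᵐ ω ∂P.completion, ∫⁻ s : Time T, ∑' j, (if j = (cX P ω).left s then 0 else
        ‖q' ((cX P ω).left s) j s (cX P ω) * D.g ((cX P ω).left s) j‖ₑ) < ∞ := by
      filter_upwards [S.ae_integrable_cm hq hn] with ω hω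
      rw [lintegral_comp hg hP (q := q') hq]
      exact hω.2
    exact h
  · have h : ∀ᵐ ω ∂P.completion, ∀ t, p t ω = D.terminal P L (cX P ω)
        + (∫ s in Set.Ioc t (finalTime T), D.driver P u L q' s (cX P ω))
        - (stochInt D.g q' (finalTime T) (cX P ω) - stochInt D.g q' t (cX P ω)) := by
      filter_upwards [he, ae_equation_rhs_eq (D := D) (u := u) (L := L) hg hP (q := q') hq hn]
        with ω h1 h2 t
      exact (h1 t).trans (h2 t).symm
    exact h

omit hadm hA1 hA2 hκ in
theorem nsq_mark_ne_top {p : Time T → ChainPath T → ℝ} {q : ℕ → ℕ → Time T → ChainPath T → ℝ}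
    (h : D.IsAdjointSolution P u L p q) : nsq D.g P.completion (cX P) (mark P q) ≠ ∞ := by
  have S := chainSetup hg hP
  have hq := pred_mark hg hP h.q_pred
  have hm : Measurable fun ω : CPath P =>
      ∫⁻ s, gNormSq D.g (fun i j => q i j s (cX P ω)) ((cX P ω).left s) := by
    simp only [lintegral_gNormSq hg hP hq]
    exact S.measurable_lintegral_cm (f := fun s ω j => ‖mark P q s ω j‖ₑ ^ 2) hq.enorm_sq
  have h1 := lintegral_completion (μ := P)
    (f := fun ω : ChainPath T => ∫⁻ s, gNormSq D.g (fun i j => q i j s ω) (ω.left s)) hm.aemeasurable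
  have h2 : nsq D.g P.completion (cX P) (mark P q) =
      ∫⁻ ω, ∫⁻ s, gNormSq D.g (fun i j => q i j s ω) (ω.left s) ∂volume ∂P := by
    rw [← h1, nsq]
    exact lintegral_congr fun ω => (lintegral_gNormSq hg hP hq ω).symm
  rw [h2]
  exact ne_top_of_le_ne_top h.estimate.ne (lintegral_mono fun ω => le_add_self)

omit hadm hA1 hA2 hκ in
theorem backward_equation {p : Time T → ChainPath T → ℝ} {q : ℕ → ℕ → Time T → ChainPath T → ℝ}
    (h : D.IsAdjointSolution P u L p q) : ∀ᵐ ω ∂P.completion, ∀ t, p t (cX P ω) =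
      D.terminal P L (cX P ω) + (∫ s in Set.Ioi t,
        ((D.coeffs P u L).drv D.g P.completion (cX P) (mark P q) s ω + D.offset P u L s ω)) -
      (sT D.g (cX P ω) (fun z => mark P q z.1 ω z.2) -
        sI D.g (cX P ω) (fun z => mark P q z.1 ω z.2) t) := by
  have S := chainSetup hg hP
  have he : ∀ᵐ ω ∂P.completion, ∀ t, p t (cX P ω) = D.terminal P L (cX P ω)
      + (∫ s in Set.Ioc t (finalTime T), D.driver P u L q s (cX P ω))
      - (stochInt D.g q (finalTime T) (cX P ω) - stochInt D.g q t (cX P ω)) := h.equation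
  filter_upwards [he, ae_equation_rhs_eq (D := D) (u := u) (L := L) hg hP (pred_mark hg hP h.q_pred)
    (nsq_mark_ne_top hg hP h)] with ω h1 h2 t
  exact (h1 t).trans (h2 t)

theorem isAdjointSolution_unique {p p' : Time T → ChainPath T → ℝ}
    {q q' : ℕ → ℕ → Time T → ChainPath T → ℝ}
    (h : D.IsAdjointSolution P u L p q) (h' : D.IsAdjointSolution P u L p' q') :
    (∀ᵐ ω ∂P, ∀ t, p t ω = p' t ω) ∧
      ∀ i j, i ≠ j → ∀ᵐ z ∂(jumpMeasure D.g P i j), q i j z.1 z.2 = q' i j z.1 z.2 := by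
  have S := chainSetup hg hP
  obtain ⟨c, B⟩ := hadm.exists_bounded hg hP hA1 hκ
  have hq := pred_mark hg hP h.q_pred
  have hq' := pred_mark hg hP h'.q_pred
  have hi : ∀ᵐ ω ∂P.completion, Integrable fun t => D.driver P u L q t (cX P ω) :=
    h.driver_integrable
  obtain ⟨h0, h1⟩ := S.backward_unique B (p := fun t ω => p t (cX P ω))
    (p' := fun t ω => p' t (cX P ω)) hq (nsq_mark_ne_top hg hP h) hq' (nsq_mark_ne_top hg hP h')
    (h.p_adapted ⊥).measurable (h'.p_adapted ⊥).measurable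
    (hi.mono fun ω hω => hω.congr (driver_ae_eq hg q ω))
    (backward_equation hg hP h) (backward_equation hg hP h')
  refine ⟨h1, fun i j hij => ?_⟩
  have hm : Measurable fun z : Time T × ChainPath T =>
      if z.2.left z.1 = i then ENNReal.ofReal (D.g i j) else 0 :=
    Measurable.ite (ChainPath.measurable_left_prod (measurableSet_singleton i)) measurable_const
      measurable_const
  rw [jumpMeasure, ae_withDensity_iff hm]
  have h2 := S.nsq_eq (hq.sub hq')
  rw [h0] at h2
  have h3 := (lintegral_eq_zero_iff (S.measurable_msq (hq.sub hq'))).1 h2.symm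
  have hd : Measurable fun z : Time T × CPath P => q i j z.1 (cX P z.2) :=
    Measurable.mono (ma := (cF P).predictable) (h.q_pred i j).measurable predictable_le le_rfl
  have hd' : Measurable fun z : Time T × CPath P => q' i j z.1 (cX P z.2) :=
    Measurable.mono (ma := (cF P).predictable) (h'.q_pred i j).measurable predictable_le le_rfl
  -- For almost every `s` the difference vanishes almost surely in norm at `x(s⁻)`. On the event
  -- `x(s⁻) = i` the term `j` of the sum is multiplied by `g_ij > 0`, so `q_ij` and `q'_ij` agree
  -- there; `ae_prod_of_completion` then gives the statement on the product.
  have key : ∀ᵐ z ∂(volume : Measure (Time T)).prod P,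
      z.2.left z.1 = i → q i j z.1 z.2 = q' i j z.1 z.2 := by
    refine ae_prod_of_completion (μ := volume) (ν := P)
      (p := fun s x => x.left s = i → q i j s x = q' i j s x) ?_ ?_
    · have h4 : MeasurableSet {z : Time T × CPath P | (cX P z.2).left z.1 = i ∧
          q i j z.1 (cX P z.2) ≠ q' i j z.1 (cX P z.2)} :=
        (S.measurable_left_joint (measurableSet_singleton i)).inter
          (measurableSet_eq_fun hd hd').compl
      simp only [Classical.not_imp]
      exact h4
    · filter_upwards [h3] with s hs
      have h5 : ∀ᵐ ω ∂P.completion,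
          (cX P ω).left s = i → q i j s (cX P ω) = q' i j s (cX P ω) := by
        have h6 := (lintegral_eq_zero_iff
          ((S.measurable_rate_sq (hq.sub hq')).comp measurable_prodMk_left)).1 hs
        filter_upwards [h6] with ω hω hl
        have h7 : ∑' k, rt D.g ((cX P ω).left s) k *
            ‖mark P q s ω k - mark P q' s ω k‖ₑ ^ 2 = 0 := (lintegral_rate _ _ _).symm.trans hω
        have h8 := ENNReal.tsum_eq_zero.1 h7 j
        rw [hl, rt, if_neg (Ne.symm hij)] at h8
        rcases mul_eq_zero.1 h8 with h9 | h9
        · exact absurd (ENNReal.ofReal_eq_zero.1 h9) (not_le.2 (hg.pos i j hij))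
        · have h10 := enorm_eq_zero.1 (pow_eq_zero_iff two_ne_zero |>.1 h9)
          simpa only [mark, hl, sub_eq_zero] using h10
      exact h5
  filter_upwards [key] with z hz hne
  refine hz ?_
  by_contra hl
  exact hne (if_neg hl)

end IsAdmissiblePair
end ControlModel
end MFChain
end

theorem proposition3p1 {T : ℝ} [Fact (0 ≤ T)] {d : ℕ} (D : MFChain.ControlModel T d)
    (hg : MFChain.IsQMatrix D.g)
    (ξ : Measure ℕ) [IsProbabilityMeasure ξ]
    (P : Measure (MFChain.ChainPath T)) [IsProbabilityMeasure P]
    (hP : MFChain.IsMarkovChain D.g ξ P)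
    (u : MFChain.Time T → MFChain.ChainPath T → MFChain.Ctrl d)
    (L : MFChain.Time T → MFChain.ChainPath T → ℝ)
    (hadm : D.IsAdmissiblePair P u L)
    (hA1 : D.A1) (hA2 : D.A2) (hκ : ∃ C : ℝ, ∀ k, |D.κ k| ≤ C) :
    (∃ (p : MFChain.Time T → MFChain.ChainPath T → ℝ)
       (q : ℕ → ℕ → MFChain.Time T → MFChain.ChainPath T → ℝ),
      D.IsAdjointSolution P u L p q) ∧
    (∀ (p p' : MFChain.Time T → MFChain.ChainPath T → ℝ)
       (q q' : ℕ → ℕ → MFChain.Time T → MFChain.ChainPath T → ℝ),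
      D.IsAdjointSolution P u L p q → D.IsAdjointSolution P u L p' q' →
      (∀ᵐ ω ∂P, ∀ t, p t ω = p' t ω) ∧
      ∀ i j, i ≠ j → ∀ᵐ z ∂(MFChain.jumpMeasure D.g P i j), q i j z.1 z.2 = q' i j z.1 z.2) := 
  ⟨hadm.exists_isAdjointSolution hg hP hA1 hA2 hκ, fun _ _ _ _ h h' =>
    hadm.isAdjointSolution_unique hg hP hA1 hA2 hκ h h'⟩
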